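/- Let $n\ge 1$ and write $\mathbb{R}^{n+1}_+=\{(\lambda,x):\lambda>0,\ x\in\mathbb{R}^n\}$ and $\mathbb{R}^{n+2}_+=\mathbb{R}^{n+1}_+\times\mathbb{R}$, with points $(\lambda,x,t)$. Let $A=A(\lambda,x,t)$ be a measurable function on $\mathbb{R}^{n+2}_+$ with values in the complex $(n+1)\times(n+1)$ matrices such that, for some constants $0<\kappa,M<\infty$, all $(\lambda,x,t)\in\mathbb{R}^{n+2}_+$ and all $\xi,\zeta\in\mathbb{C}^{n+1}$, $$\kappa|\xi|^2\le \operatorname{Re}\big(A(\lambda,x,t)\xi\cdot\overline{\xi}\big),\qquad |A(\lambda,x,t)\xi\cdot\zeta|\le M|\xi||\zeta| .$$ *Definitions.* For a Schwartz function $\phi$ on $\mathbb{R}$ let $D_t^{1/2}\phi$ be given by the Fourier multiplier $|\tau|^{1/2}$. The space $\dot H^{1/2}(\mathbb{R})$ consists of all $v\in L^2_{loc}(\mathbb{R})\cap\mathcal{S}'(\mathbb{R})$ such that $v\,D_t^{1/2}\phi\in L^1(\mathbb{R})$ for every Schwartz function $\phi$ and such that there is $g\in L^2(\mathbb{R})$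 with $\int v\,\overline{D_t^{1/2}\phi}\,dt=\int g\,\overline{\phi}\,dt$ for all such $\phi$; then $D_t^{1/2}v:=g$. The Hilbert transform $H_t$ is the operator on $L^2(\mathbb{R})$ with Fourier multiplier $i\,\mathrm{sgn}(\tau)$. The space $\dot H^{1/2}(\mathbb{R};L^2_{loc}(\mathbb{R}^{n+1}_+))$ consists of all $u\in L^2_{loc}(\mathbb{R}^{n+2}_+)$ such that $u(\lambda,x,\cdot)\in\dot H^{1/2}(\mathbb{R})$ for almost every $(\lambda,x)\in\mathbb{R}^{n+1}_+$ and $\iint_K\int_{\mathbb{R}}|D_t^{1/2}u|^2\,dt\,dx\,d\lambda<\infty$ for every compact $K\subset\mathbb{R}^{n+1}_+$. A *reinforced weak solution* of $$\partial_t u-\operatorname{div}_{\lambda,x}A\nabla_{\lambda,x}u=0\quad\text{on }\mathbb{R}^{n+2}_+$$ is a complex valued function $u\in\dot H^{1/2}(\mathbb{R};L^2_{loc}(\mathbb{R}^{n+1}_+))\cap L^2_{loc}(\mathbb{R};W^{1,2}_{loc}(\mathbb{R}^{n+1}_+))$ such that for all $\phi\in C_0^\infty(\mathbb{R}^{n+2}_+)$,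 $$\int_0^\infty\iint_{\mathbb{R}^{n+1}}A\nabla_{\lambda,x}u\cdot\overline{\nabla_{\lambda,x}\phi}+H_tD_t^{1/2}u\cdot\overline{D_t^{1/2}\phi}\;dx\,dt\,d\lambda=0 .$$ **Theorem.** There is a constant $C$, depending only on $n$, $\kappa$ and $M$, such that for every such $A$, every reinforced weak solution $u$, all $\lambda>0$, $x\in\mathbb{R}^n$, $t\in\mathbb{R}$ and all $0<r<\lambda/8$, $$\bigg(\operatorname{avg}_{\Lambda\times Q\times I}\big(|\nabla_{\lambda,x}u|^2+|H_tD_t^{1/2}u|^2+|D_t^{1/2}u|^2\big)\bigg)^{1/2}\le C\sum_{k\in\mathbb{Z}}\frac{1}{1+|k|^{3/2}}\;\operatorname{avg}_{8\Lambda\times 8Q\times I_k}\big(|\nabla_{\lambda,x}u|+|H_tD_t^{1/2}u|+|D_t^{1/2}u|\big),$$ where $\operatorname{avg}_E$ denotes the mean value over $E$ with respect to Lebesgue measure in $(\mu,y,s)$, $\Lambda=(\lambda-r,\lambda+r)$, $Q=B(x,r)$, $I=(t-r^2,t+r^2]$, $8\Lambda=(\lambda-8r,\lambda+8r)$, $8Q=B(x,8r)$,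 and $I_k=2kr^2+I$ $(k\in\mathbb{Z})$ are the disjoint translates of $I$ covering $\mathbb{R}$. -/

import Mathlib

open MeasureTheory Set
open scoped ENNReal NNReal ContDiff FourierTransform SchwartzMap Matrix ComplexConjugate

noncomputable section

namespace ParabolicRH

/-! ### Geometry -/

/-- Points `(λ, x, t)` with `λ ∈ ℝ`, `x ∈ ℝⁿ`, `t ∈ ℝ`. -/
abbrev Pt (n : ℕ) : Type := ℝ × EuclideanSpace ℝ (Fin n) × ℝ

/-- The open half-space of all `X = (λ, x)` with `λ > 0`. -/
def spatialHalfSpace (n : ℕ) : Set (ℝ × EuclideanSpace ℝ (Fin n)) := {X | 0 < X.1}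

/-- The open parabolic half-space of all `(λ, x, t)` with `λ > 0`. -/
def halfSpace (n : ℕ) : Set (Pt n) := {p | 0 < p.1}

/-- The set `(λ - ρ, λ + ρ) × B(x, ρ) × J`. -/
def parabolicCylinder {n : ℕ} (lam : ℝ) (x : EuclideanSpace ℝ (Fin n)) (ρ : ℝ) (J : Set ℝ) : Set (Pt n) :=
  Ioo (lam - ρ) (lam + ρ) ×ˢ Metric.ball x ρ ×ˢ J

/-- The translate `I_k = k ℓ(I) + I` of the interval `I = (t - r², t + r²]`, where
`ℓ(I) = 2 r²` is the length of `I`. -/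
def timeInterval (t r : ℝ) (k : ℤ) : Set ℝ :=
  Ioc (k * (2 * r ^ 2) + (t - r ^ 2)) (k * (2 * r ^ 2) + (t + r ^ 2))

/-! ### The coefficients -/

/-- `A` is measurable on the half-space and uniformly elliptic with constants `κ` and `M`:
`κ |ξ|² ≤ Re (A ξ · conj ξ)` and `|A ξ · ζ| ≤ M |ξ| |ζ|` at each point, for all
complex vectors `ξ`, `ζ`. The index `0` belongs to the variable `λ`. -/
structure IsElliptic {n : ℕ} (A : Pt n → Matrix (Fin (n + 1)) (Fin (n + 1)) ℂ) (κ M : ℝ) :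
    Prop where
  measurable : ∀ i j, AEMeasurable (fun p => A p i j) (volume.restrict (halfSpace n))
  lower : ∀ p ∈ halfSpace n, ∀ ξ : EuclideanSpace ℂ (Fin (n + 1)),
    κ * ‖ξ‖ ^ 2 ≤ ((A p *ᵥ ξ.ofLp) ⬝ᵥ star ξ.ofLp).re
  upper : ∀ p ∈ halfSpace n, ∀ ξ ζ : EuclideanSpace ℂ (Fin (n + 1)),
    ‖(A p *ᵥ ξ.ofLp) ⬝ᵥ ζ.ofLp‖ ≤ M * ‖ξ‖ * ‖ζ‖

/-! ### Test functions and weak gradients -/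

/-- `φ ∈ C₀^∞` of the open half-space (complex valued, extended by zero). -/
structure IsTestFunction {n : ℕ} (φ : Pt n → ℂ) : Prop where
  smooth : ContDiff ℝ ∞ φ
  compactSupport : HasCompactSupport φ
  support_subset : tsupport φ ⊆ halfSpace n

/-- The coordinate directions of the variables `(λ, x₁, …, xₙ)`, numbered `0, …, n`. -/
def spaceDir {n : ℕ} (i : Fin (n + 1)) : Pt n :=
  Fin.cases (1, 0, 0) (fun j => (0, EuclideanSpace.single j 1, 0)) i

/-- The classical gradient in the variables `(λ, x)`. -/
def spaceGrad {n : ℕ} (φ : Pt n → ℂ) (p : Pt n) : EuclideanSpace ℂ (Fin (n + 1)) :=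
  WithLp.toLp 2 fun i => fderiv ℝ φ p (spaceDir i)

/-- `f ∈ L²_loc(Ω)`: square integrable on every compact subset of the open set `Ω`. -/
def MemL2Loc {X F : Type*} [TopologicalSpace X] [MeasureSpace X] [NormedAddCommGroup F]
    (f : X → F) (Ω : Set X) : Prop :=
  ∀ K ⊆ Ω, IsCompact K → MemLp f 2 (volume.restrict K)

/-- `u ∈ L²_loc(ℝ; W^{1,2}_loc)` on the half-space, and `G` is its weak gradient in the
variables `(λ, x)`. -/
structure IsWeakGradient {n : ℕ} (u : Pt n → ℂ) (G : Pt n → EuclideanSpace ℂ (Fin (n + 1))) :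
    Prop where
  memL2Loc : MemL2Loc u (halfSpace n)
  memL2Loc_grad : MemL2Loc G (halfSpace n)
  integral_eq : ∀ φ : Pt n → ℂ, IsTestFunction φ → ∀ i : Fin (n + 1),
    ∫ p in halfSpace n, u p * fderiv ℝ φ p (spaceDir i) = - ∫ p in halfSpace n, G p i * φ p

/-! ### The half-order derivative and the Hilbert transform on the real line -/

/-- The half-order derivative of a Schwartz function `φ`, given by the Fourier multiplier
`|τ|^{1/2}`. Mathlib's Fourier transform has the kernel `exp (-2πi t ξ)`, so that `τ = 2πξ`. -/
def halfDeriv (φ : ℝ → ℂ) : ℝ → ℂ :=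
  𝓕⁻ (fun ξ : ℝ => (Real.sqrt |2 * Real.pi * ξ| : ℂ) * 𝓕 φ ξ)

/-- `v` lies in the homogeneous Sobolev space `Ḣ^{1/2}(ℝ)` and `g ∈ L²(ℝ)` is its half-order
derivative: `v` is locally square integrable and a tempered distribution, `v · D^{1/2} φ` is
integrable, and `∫ v · conj (D^{1/2} φ) = ∫ g · conj φ`, for all Schwartz functions `φ`. -/
structure IsHalfDeriv (v g : ℝ → ℂ) : Prop where
  memL2Loc : MemL2Loc v univ
  tempered : ∃ T : 𝓢'(ℝ, ℂ), ∀ φ : 𝓢(ℝ, ℂ), HasCompactSupport φ → T φ = ∫ s, v s * φ s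
  integrable : ∀ φ : 𝓢(ℝ, ℂ), Integrable fun s => v s * halfDeriv φ s
  memL2 : MemLp g 2
  integral_eq : ∀ φ : 𝓢(ℝ, ℂ), ∫ s, v s * conj (halfDeriv φ s) = ∫ s, g s * conj (φ s)

/-- `g, h ∈ L²(ℝ)` and `h` is the Hilbert transform of `g`, given by the Fourier multiplier
`i sgn τ`, where the Fourier transform is that of `L²(ℝ)`. With this sign the operator
`D^{1/2} H D^{1/2}` has the multiplier `i τ`, that is, it is the derivative. -/
def IsHilbertTransform (g h : ℝ → ℂ) : Prop :=
  ∃ (hg : MemLp g 2) (hh : MemLp h 2),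
    ∀ᵐ ξ : ℝ, (𝓕 (hh.toLp h) : Lp ℂ 2 (volume : Measure ℝ)) ξ =
      Complex.I * ((SignType.sign ξ : ℝ) : ℂ) *
        (𝓕 (hg.toLp g) : Lp ℂ 2 (volume : Measure ℝ)) ξ

/-! ### Half-order time derivatives of functions on the half-space -/

/-- The half-order derivative of a test function in the variable `t`. -/
def timeHalfDeriv {n : ℕ} (φ : Pt n → ℂ) (p : Pt n) : ℂ :=
  halfDeriv (fun s => φ (p.1, p.2.1, s)) p.2.2

/-- `u ∈ Ḣ^{1/2}(ℝ; L²_loc)` on the half-space, and `g` is (a jointly measurable version of) the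
half-order derivative of `u` in `t`: it is taken in `t` for almost every `(λ, x)`, and `g` is
square integrable on `K × ℝ` for every compact set `K` of points `(λ, x)` with `λ > 0`. -/
structure IsTimeHalfDeriv {n : ℕ} (u g : Pt n → ℂ) : Prop where
  memL2Loc : MemL2Loc u (halfSpace n)
  slices : ∀ᵐ X ∂(volume.restrict (spatialHalfSpace n)),
    IsHalfDeriv (fun s => u (X.1, X.2, s)) (fun s => g (X.1, X.2, s))
  memL2 : ∀ K ⊆ spatialHalfSpace n, IsCompact K →
    MemLp g 2 (volume.restrict {p : Pt n | (p.1, p.2.1) ∈ K})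

/-- `h` is (a jointly measurable version of) the Hilbert transform of `g` in `t`. -/
structure IsTimeHilbertTransform {n : ℕ} (g h : Pt n → ℂ) : Prop where
  measurable : AEStronglyMeasurable h (volume.restrict (halfSpace n))
  slices : ∀ᵐ X ∂(volume.restrict (spatialHalfSpace n)),
    IsHilbertTransform (fun s => g (X.1, X.2, s)) (fun s => h (X.1, X.2, s))

/-! ### Reinforced weak solutions -/

/-- `u` is a reinforced weak solution of `∂ₜ u - div A ∇ u = 0` on the half-space, with
`G = ∇ u` (the gradient in `(λ, x)`), `g = D_t^{1/2} u` and `h = H_t D_t^{1/2} u`. The functions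
`G`, `g` and `h` are determined by `u` up to null sets. -/
structure IsReinforcedWeakSolution {n : ℕ} (A : Pt n → Matrix (Fin (n + 1)) (Fin (n + 1)) ℂ)
    (u : Pt n → ℂ) (G : Pt n → EuclideanSpace ℂ (Fin (n + 1))) (g h : Pt n → ℂ) : Prop where
  grad : IsWeakGradient u G
  half : IsTimeHalfDeriv u g
  hilbert : IsTimeHilbertTransform g h
  equation : ∀ φ : Pt n → ℂ, IsTestFunction φ →
    ∫ p in halfSpace n, ((A p *ᵥ (G p).ofLp) ⬝ᵥ star (spaceGrad φ p).ofLp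
      + h p * conj (timeHalfDeriv φ p)) = 0

end ParabolicRH

end

open ParabolicRH

/-! Both halves of the estimate come from comparing a solution with its own parabolic mollification.
The gradient `G` and the flux `F`, the product of `A` with the gradient, are kept as separate
functions tied to the solution only by the linear relations ∂ᵢu = Gᵢ and ∂ₜu = ∑ ∂ᵢFᵢ. These survive
mollification although `A` is merely measurable, so the difference u - u_δ satisfies relations of
the same form and a local energy identity. No averages over time slices have to be compared.

Gradient. By the energy inequality, ∇u in L² on a small ball is controlled by G_δ, F_δ and u - u_δ
on a larger one. The functions G_δ, F_δ are bounded pointwise by L¹ means of G. The difference u -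
u_δ is O(δ) in L² in terms of G and F (`exists_lintegral_sub_mollify_sq_le`): the derivative of a
mollification in its scale is an average of G and F, once the time derivative is replaced by the
divergence and integrated by parts. For small δ this term is absorbed, an iteration over radii
removes the remainder, and an L¹ mean is left (`exists_gradient_reverse_holder`).

Half-order derivative. With g = D^{1/2}u and h = HD^{1/2}u, the combinations q = c·g ∓ s·h, for
positive constants c and s, are dual to one-sided difference operators with kernel s^(-3/2)
(`IsHalfDeriv.integral_mul_fracDiff`). Hence pairing q - q_{1/2} with a local test function ψ
amounts to pairing z = u - u_{1/2} with the fractional difference of ψ. Near the support of ψ, a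
cutoff of z has a half-order energy in time bounded through the equation by Fourier transform in t.
Far away in time the fractional difference decays like |t|^(-3/2), while z over a time slab is
bounded by the L¹ mean of the gradient near that slab. This produces the weighted sum over the
translates of I. Together with the L¹ mean of q, which controls q_{1/2}, it gives
`exists_fractional_reverse_holder`.

The definitions test D^{1/2} only against Schwartz functions, a class not preserved by H or D^{1/2}.
The needed dualities, among them D^{1/2}HD^{1/2} = ∂ₜ, follow by cutting off low and high
frequencies and passing to the limit with dominating functions uniform in the cutoff
(`IsHalfDeriv.integral_hilbert_eq`). Parabolic rescaling to r = 1 finishes the proof. -/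

noncomputable section
namespace ParabolicRH
open Filter Topology Metric

set_option linter.unusedSectionVars false
set_option linter.unusedVariables false

/-! ### Parabolic dilations and their Jacobian. -/

section Dilation

variable {E : Type*} [NormedAddCommGroup E] [NormedSpace ℝ E]

/-- The parabolic dilation `(Y, s) ↦ (a Y, a² s)`. -/
def dil (a : ℝ) : E × ℝ →L[ℝ] E × ℝ :=
  (a • ContinuousLinearMap.id ℝ E).prodMap (a ^ 2 • ContinuousLinearMap.id ℝ ℝ)

@[simp] lemma dil_apply (a : ℝ) (q : E × ℝ) : dil a q = (a • q.1, a ^ 2 * q.2) := by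
  rfl

lemma dil_inv_dil {a : ℝ} (ha : a ≠ 0) (q : E × ℝ) : dil a⁻¹ (dil a q) = q := by
  ext <;> simp [smul_smul, ha]

lemma dil_dil_inv {a : ℝ} (ha : a ≠ 0) (q : E × ℝ) : dil a (dil a⁻¹ q) = q := by
  ext <;> simp [smul_smul, ha]

lemma norm_dil_le {a : ℝ} (ha : 0 ≤ a) (ha1 : a ≤ 1) (q : E × ℝ) : ‖dil a q‖ ≤ a * ‖q‖ := by
  rw [dil_apply, Prod.norm_mk, norm_smul, norm_mul, Real.norm_of_nonneg ha,
    Real.norm_of_nonneg (sq_nonneg a)]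
  refine max_le (by gcongr; exact norm_fst_le q) ?_
  have : a ^ 2 ≤ a := by nlinarith
  exact mul_le_mul this (norm_snd_le q) (norm_nonneg _) ha

lemma norm_dil_le_of_mem {a : ℝ} (ha : 0 ≤ a) (ha1 : a ≤ 1) {q : E × ℝ}
    (hq : q ∈ closedBall (0 : E × ℝ) 1) : ‖dil a q‖ ≤ a :=
  (norm_dil_le ha ha1 q).trans (mul_le_of_le_one_right ha (by simpa using hq))

lemma continuous_dil_uncurry : Continuous fun x : ℝ × (E × ℝ) => dil x.1 x.2 := by
  simp only [dil_apply]; fun_prop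

/-- The continuous linear equivalence given by a dilation. -/
def dilEquiv (a : ℝ) (ha : a ≠ 0) : (E × ℝ) ≃L[ℝ] (E × ℝ) :=
  ContinuousLinearEquiv.equivOfInverse (dil a) (dil a⁻¹) (dil_inv_dil ha) (dil_dil_inv ha)

variable [FiniteDimensional ℝ E]

/-- The homogeneous dimension. -/
def homDim (E : Type*) [NormedAddCommGroup E] [NormedSpace ℝ E] : ℕ := Module.finrank ℝ E + 2

lemma det_dil (a : ℝ) : LinearMap.det ((dil a : E × ℝ →L[ℝ] E × ℝ) : E × ℝ →ₗ[ℝ] E × ℝ)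
    = a ^ homDim E := by
  have : ((dil a : E × ℝ →L[ℝ] E × ℝ) : E × ℝ →ₗ[ℝ] E × ℝ)
      = (a • LinearMap.id : E →ₗ[ℝ] E).prodMap (a ^ 2 • LinearMap.id) := by
    ext <;> simp
  rw [this, LinearMap.det_prodMap]
  simp [homDim, pow_add]

variable [MeasureSpace E] [BorelSpace E] [(volume : Measure E).IsAddHaarMeasure]

instance : (volume : Measure (E × ℝ)).IsAddHaarMeasure :=
  inferInstanceAs ((volume : Measure E).prod (volume : Measure ℝ)).IsAddHaarMeasure

lemma map_dil {a : ℝ} (ha : 0 < a) :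
    Measure.map (dil a) (volume : Measure (E × ℝ)) =
      ENNReal.ofReal ((a ^ homDim E)⁻¹) • (volume : Measure (E × ℝ)) := by
  have h := Measure.map_linearMap_addHaar_eq_smul_addHaar (volume : Measure (E × ℝ))
    (f := ((dil a : E × ℝ →L[ℝ] E × ℝ) : E × ℝ →ₗ[ℝ] E × ℝ)) (by rw [det_dil]; positivity)
  rw [det_dil, abs_of_pos (by positivity)] at h
  exact h

lemma measurableEmbedding_dil {a : ℝ} (ha : a ≠ 0) :
    MeasurableEmbedding (dil a : E × ℝ →L[ℝ] E × ℝ) :=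
  (dilEquiv a ha).toHomeomorph.measurableEmbedding

lemma integral_comp_dil {F : Type*} [NormedAddCommGroup F] [NormedSpace ℝ F] {a : ℝ} (ha : 0 < a)
    (f : E × ℝ → F) : ∫ q, f (dil a q) = (a ^ homDim E)⁻¹ • ∫ q, f q := by
  rw [← (measurableEmbedding_dil ha.ne').integral_map, map_dil ha, integral_smul_measure,
    ENNReal.toReal_ofReal (by positivity)]

/-- Needed to make (p, q) ↦ f (p - dil a q) measurable when f is only almost everywhere strongly
measurable. -/
lemma quasiMeasurePreserving_sub_dil (a : ℝ) :
    Measure.QuasiMeasurePreserving (fun x : (E × ℝ) × (E × ℝ) => x.1 - dil a x.2)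
      (volume.prod volume) volume :=
  QuasiMeasurePreserving.prod_of_left (by fun_prop)
    (ae_of_all _ fun q => (measurePreserving_sub_right volume (dil a q)).quasiMeasurePreserving)

end Dilation

/-! ### Parabolic mollification and its derivatives. -/

section Mollify

variable {E : Type*} [NormedAddCommGroup E] [NormedSpace ℝ E] [FiniteDimensional ℝ E]
  [MeasureSpace E] [BorelSpace E] [(volume : Measure E).IsAddHaarMeasure]
  {F : Type*} [NormedAddCommGroup F] [NormedSpace ℝ F]

/-- A fixed bump at the origin of `E × ℝ`. -/
def profileBump (E : Type*) [NormedAddCommGroup E] : ContDiffBump (0 : E × ℝ) where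
  rIn := 1 / 2
  rOut := 1
  rIn_pos := by norm_num
  rIn_lt_rOut := by norm_num

/-- The normalized smooth profile, supported in the unit ball of `E × ℝ`. -/
def profile (E : Type*) [NormedAddCommGroup E] [NormedSpace ℝ E] [FiniteDimensional ℝ E]
    [MeasureSpace E] : E × ℝ → ℝ :=
  (profileBump E).normed volume

lemma profile_nonneg (q : E × ℝ) : 0 ≤ profile E q := (profileBump E).nonneg_normed q

lemma contDiff_profile : ContDiff ℝ ∞ (profile E) := (profileBump E).contDiff_normed

lemma integral_profile : ∫ q, profile E q = 1 := (profileBump E).integral_normed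

lemma tsupport_profile : tsupport (profile E) = closedBall 0 1 :=
  (profileBump E).tsupport_normed_eq

lemma hasCompactSupport_profile : HasCompactSupport (profile E) :=
  (profileBump E).hasCompactSupport_normed

lemma integrable_profile : Integrable (profile E) := (profileBump E).integrable_normed

/-- The average of translated dilates of `f` with a weight `κ`. -/
def dilAvg (κ : E × ℝ → ℝ) (a : ℝ) (f : E × ℝ → F) (p : E × ℝ) : F :=
  ∫ q, κ q • f (p - dil a q)

/-- The parabolic mollification at scale `a`. -/
def mollify (a : ℝ) (f : E × ℝ → F) (p : E × ℝ) : F := dilAvg (profile E) a f p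

/-- The rescaled weight: `dilAvg κ a` is the convolution with `rescale κ a`. -/
def rescale (κ : E × ℝ → ℝ) (a : ℝ) (q : E × ℝ) : ℝ := (a ^ homDim E)⁻¹ * κ (dil a⁻¹ q)

/-- Both forms are used: with the scale inside the argument of f one can differentiate in `a`, and
as a convolution the average is smooth in the point. -/
lemma dilAvg_eq_convolution (κ : E × ℝ → ℝ) {a : ℝ} (ha : 0 < a) (f : E × ℝ → F) :
    dilAvg κ a f = convolution (rescale κ a) f (ContinuousLinearMap.lsmul ℝ ℝ) volume := by
  ext p
  rw [convolution_def, dilAvg]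
  have h := integral_comp_dil (inv_pos.2 ha) fun q : E × ℝ => κ q • f (p - dil a q)
  simp only [dil_dil_inv ha.ne'] at h
  have hpos : (0 : ℝ) < a ^ homDim E := by positivity
  simp only [rescale, ContinuousLinearMap.lsmul_apply, mul_smul, integral_smul, h]
  rw [inv_pow, inv_inv, smul_smul, inv_mul_cancel₀ hpos.ne', one_smul]

lemma contDiff_rescale {κ : E × ℝ → ℝ} (hκ : ContDiff ℝ ∞ κ) (a : ℝ) :
    ContDiff ℝ ∞ (rescale κ a) :=
  contDiff_const.mul (hκ.comp (dil (E := E) a⁻¹).contDiff)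

lemma tsupport_rescale_subset {κ : E × ℝ → ℝ} (hκ : tsupport κ ⊆ closedBall 0 1) {a : ℝ}
    (ha : 0 < a) (ha1 : a ≤ 1) : tsupport (rescale κ a) ⊆ closedBall 0 a := by
  refine closure_minimal (fun q hq => ?_) isClosed_closedBall
  have hq' : dil a⁻¹ q ∈ closedBall (0 : E × ℝ) 1 := by
    refine hκ (subset_tsupport _ ?_)
    rw [Function.mem_support] at hq ⊢
    exact right_ne_zero_of_mul hq
  have := norm_dil_le_of_mem ha.le ha1 hq'
  rw [dil_dil_inv ha.ne'] at this
  simpa using this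

lemma hasCompactSupport_rescale {κ : E × ℝ → ℝ} (hκ : tsupport κ ⊆ closedBall 0 1) {a : ℝ}
    (ha : 0 < a) (ha1 : a ≤ 1) : HasCompactSupport (rescale κ a) :=
  (isCompact_closedBall (0 : E × ℝ) a).of_isClosed_subset (isClosed_tsupport _)
    (tsupport_rescale_subset hκ ha ha1)

lemma contDiff_mollify [CompleteSpace F] {a : ℝ} (ha : 0 < a) (ha1 : a ≤ 1) {f : E × ℝ → F}
    (hf : LocallyIntegrable f) : ContDiff ℝ ∞ (mollify a f) := by
  have : mollify a f = dilAvg (profile E) a f := rfl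
  rw [this, dilAvg_eq_convolution _ ha]
  exact (hasCompactSupport_rescale tsupport_profile.le ha ha1).contDiff_convolution_left _
    (contDiff_rescale contDiff_profile a) hf

/-- The profile translated and dilated, as a function of the integration variable. -/
def mollKernel (a : ℝ) (p q : E × ℝ) : ℝ := rescale (profile E) a (p - q)

lemma mollify_eq_integral {a : ℝ} (ha : 0 < a) (f : E × ℝ → F) (p : E × ℝ) :
    mollify a f p = ∫ q, mollKernel a p q • f q := by
  change dilAvg (profile E) a f p = _
  rw [dilAvg_eq_convolution _ ha, convolution_eq_swap]
  rfl

lemma contDiff_mollKernel (a : ℝ) (p : E × ℝ) : ContDiff ℝ ∞ (mollKernel (E := E) a p) :=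
  (contDiff_rescale contDiff_profile a).comp (contDiff_const.sub contDiff_id)

lemma tsupport_mollKernel_subset {a : ℝ} (ha : 0 < a) (ha1 : a ≤ 1) (p : E × ℝ) :
    tsupport (mollKernel a p) ⊆ closedBall p a := by
  refine closure_minimal (fun q hq => ?_) isClosed_closedBall
  have : p - q ∈ closedBall (0 : E × ℝ) a :=
    tsupport_rescale_subset tsupport_profile.le ha ha1 (subset_tsupport _ hq)
  rwa [mem_closedBall_zero_iff, ← dist_eq_norm, dist_comm] at this

lemma fderiv_mollKernel (a : ℝ) (p q v : E × ℝ) :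
    fderiv ℝ (mollKernel a p) q v = - fderiv ℝ (rescale (profile E) a) (p - q) v := by
  have h1 : HasFDerivAt (rescale (profile E) a) (fderiv ℝ (rescale (profile E) a) (p - q)) (p - q) :=
    ((contDiff_rescale contDiff_profile a).differentiable (by simp) _).hasFDerivAt
  have h2 : HasFDerivAt (fun q : E × ℝ => p - q) (-ContinuousLinearMap.id ℝ (E × ℝ)) q :=
    (hasFDerivAt_id q).const_sub p
  have := (h1.comp q h2).fderiv
  change fderiv ℝ (rescale (profile E) a ∘ fun q => p - q) q v = _
  rw [this]; simp

/-- The derivative is put on the kernel as a function of the integration variable, whence the sign.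
In this form `mollKernel a p` can serve as the test function in a weak formulation. -/
lemma fderiv_mollify [CompleteSpace F] {a : ℝ} (ha : 0 < a) (ha1 : a ≤ 1) {f : E × ℝ → F}
    (hf : LocallyIntegrable f) (p v : E × ℝ) :
    fderiv ℝ (mollify a f) p v = - ∫ q, fderiv ℝ (mollKernel a p) q v • f q := by
  have hk := hasCompactSupport_rescale (E := E) tsupport_profile.le ha ha1
  have hc := contDiff_rescale (contDiff_profile (E := E)) a
  have := (hk.hasFDerivAt_convolution_left (ContinuousLinearMap.lsmul ℝ ℝ)
    (hc.of_le (by simp)) hf p).fderiv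
  have e : mollify a f = dilAvg (profile E) a f := rfl
  rw [e, dilAvg_eq_convolution _ ha, this, convolution_eq_swap]
  have hint : Integrable (fun q => (ContinuousLinearMap.precompL (E × ℝ)
      (ContinuousLinearMap.lsmul ℝ ℝ : ℝ →L[ℝ] F →L[ℝ] F))
      (fderiv ℝ (rescale (profile E) a) (p - q)) (f q)) := by
    have := ((hk.fderiv ℝ).convolutionExists_left ((ContinuousLinearMap.precompL (E × ℝ)
      (ContinuousLinearMap.lsmul ℝ ℝ : ℝ →L[ℝ] F →L[ℝ] F)))
      (hc.continuous_fderiv (by simp)) hf p)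
    exact (ConvolutionExistsAt.integrable_swap this)
  rw [ContinuousLinearMap.integral_apply hint, ← integral_neg]
  refine integral_congr_ae (ae_of_all _ fun q => ?_)
  simp [fderiv_mollKernel, ContinuousLinearMap.precompL_apply]

end Mollify

/-! ### Cauchy-Schwarz inequalities for the lower integral. -/

lemma lintegral_mul_sq_le {α : Type*} [MeasurableSpace α] (μ : Measure α) {f g : α → ℝ≥0∞}
    (hf : AEMeasurable f μ) (hg : AEMeasurable g μ) :
    (∫⁻ x, f x * g x ∂μ) ^ 2 ≤ (∫⁻ x, f x ^ 2 ∂μ) * ∫⁻ x, g x ^ 2 ∂μ := by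
  have h := ENNReal.lintegral_mul_le_Lp_mul_Lq μ (p := 2) (q := 2) (by constructor <;> norm_num) hf hg
  simp only [Pi.mul_apply, ENNReal.rpow_two] at h
  refine (pow_le_pow_left' h 2).trans ?_
  rw [mul_pow, ← ENNReal.rpow_natCast, ← ENNReal.rpow_natCast, ← ENNReal.rpow_mul,
    ← ENNReal.rpow_mul]
  norm_num

/-- Cauchy-Schwarz for the factorization w f = w^(1/2) · (w^(1/2) f). -/
lemma lintegral_mul_sq_le_weighted {α : Type*} [MeasurableSpace α] (μ : Measure α)
    {w f : α → ℝ≥0∞} (hw : AEMeasurable w μ) (hf : AEMeasurable f μ) :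
    (∫⁻ x, w x * f x ∂μ) ^ 2 ≤ (∫⁻ x, w x ∂μ) * ∫⁻ x, w x * f x ^ 2 ∂μ := by
  have h := lintegral_mul_sq_le μ (f := fun x => w x ^ (1 / 2 : ℝ))
    (g := fun x => w x ^ (1 / 2 : ℝ) * f x) (hw.pow_const _) ((hw.pow_const _).mul hf)
  have e : ∀ x, w x ^ (1 / 2 : ℝ) * w x ^ (1 / 2 : ℝ) = w x := fun x => by
    rw [← ENNReal.rpow_add_of_nonneg _ _ (by norm_num) (by norm_num)]; norm_num
  have e2 : ∀ x, (w x ^ (1 / 2 : ℝ)) ^ 2 = w x := fun x => by rw [sq, e]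
  simpa only [← mul_assoc, e, mul_pow, e2] using h

lemma lintegral_sq_le {α : Type*} [MeasurableSpace α] (μ : Measure α) {f : α → ℝ≥0∞}
    (hf : AEMeasurable f μ) : (∫⁻ x, f x ∂μ) ^ 2 ≤ μ univ * ∫⁻ x, f x ^ 2 ∂μ := by
  simpa using lintegral_mul_sq_le_weighted μ (w := fun _ => 1) aemeasurable_const hf

/-! ### L² bounds and convergence of mollifications; mollified weak solutions. -/

section Mollify

variable {E : Type*} [NormedAddCommGroup E] [NormedSpace ℝ E] [FiniteDimensional ℝ E]
  [MeasureSpace E] [BorelSpace E] [(volume : Measure E).IsAddHaarMeasure]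
  {F : Type*} [NormedAddCommGroup F] [NormedSpace ℝ F]

lemma setLIntegral_sub_le {S S' : Set (E × ℝ)} (c : E × ℝ) (h : ∀ p ∈ S, p - c ∈ S')
    (φ : E × ℝ → ℝ≥0∞) : ∫⁻ p in S, φ (p - c) ≤ ∫⁻ p in S', φ p := by
  have hm : MeasurePreserving (fun p : E × ℝ => p - c) volume volume :=
    measurePreserving_sub_right volume c
  rw [← hm.setLIntegral_comp_preimage_emb (measurableEmbedding_subRight c) φ S']
  exact lintegral_mono_set h

lemma aestronglyMeasurable_comp_sub_dil {f : E × ℝ → F} (hf : AEStronglyMeasurable f) (a : ℝ)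
    (S : Set (E × ℝ)) :
    AEStronglyMeasurable (fun x : (E × ℝ) × (E × ℝ) => f (x.1 - dil a x.2))
      (((volume : Measure (E × ℝ)).restrict S).prod volume) :=
  (hf.comp_quasiMeasurePreserving (quasiMeasurePreserving_sub_dil a)).mono_ac
    (by
    rw [← Measure.restrict_univ (μ := (volume : Measure (E × ℝ))), Measure.restrict_restrict_of_subset
      (subset_univ S), Measure.prod_restrict, Measure.restrict_univ]
    exact Measure.absolutelyContinuous_of_le Measure.restrict_le_self)

/-- A weighted average of translated dilates is bounded on `L²`. -/
lemma lintegral_dilAvg_sq_le {κ : E × ℝ → ℝ} (hκ : Continuous κ) {a : ℝ} {S S' : Set (E × ℝ)}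
    (h : ∀ p ∈ S, ∀ q ∈ tsupport κ, p - dil a q ∈ S') {f : E × ℝ → F}
    (hf : AEStronglyMeasurable f) :
    ∫⁻ p in S, ‖dilAvg κ a f p‖ₑ ^ 2 ≤ (∫⁻ q, ‖κ q‖ₑ) ^ 2 * ∫⁻ p in S', ‖f p‖ₑ ^ 2 := by
  have hmeas := aestronglyMeasurable_comp_sub_dil hf a S
  have hm2 : ∀ᵐ p ∂(volume.restrict S), AEStronglyMeasurable (fun q => f (p - dil a q)) volume :=
    hmeas.prodMk_left
  calc ∫⁻ p in S, ‖dilAvg κ a f p‖ₑ ^ 2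
      ≤ ∫⁻ p in S, (∫⁻ q, ‖κ q‖ₑ) * ∫⁻ q, ‖κ q‖ₑ * ‖f (p - dil a q)‖ₑ ^ 2 := by
        refine lintegral_mono_ae (hm2.mono fun p hp => ?_)
        refine (pow_le_pow_left' (enorm_integral_le_lintegral_enorm _) 2).trans ?_
        simp only [enorm_smul]
        exact lintegral_mul_sq_le_weighted _ hκ.enorm.measurable.aemeasurable hp.enorm
    _ ≤ (∫⁻ q, ‖κ q‖ₑ) * ∫⁻ q, ∫⁻ p in S, ‖κ q‖ₑ * ‖f (p - dil a q)‖ₑ ^ 2 := by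
        rw [lintegral_const_mul'', lintegral_lintegral_swap]
        · exact (hκ.enorm.measurable.aemeasurable.comp_snd).mul (hmeas.enorm.pow_const 2)
        · exact ((hκ.enorm.measurable.aemeasurable.comp_snd).mul
            (hmeas.enorm.pow_const 2)).lintegral_prod_right'
    _ ≤ (∫⁻ q, ‖κ q‖ₑ) * ∫⁻ q, ‖κ q‖ₑ * ∫⁻ p in S', ‖f p‖ₑ ^ 2 := by
        gcongr with q
        rw [lintegral_const_mul' _ _ enorm_ne_top]
        by_cases hq : q ∈ tsupport κ
        · refine mul_le_mul_right ?_ _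
          exact setLIntegral_sub_le (dil a q) (fun p hp => h p hp q hq) fun p => ‖f p‖ₑ ^ 2
        · simp [image_eq_zero_of_notMem_tsupport hq]
    _ = _ := by
        rw [lintegral_mul_const _ hκ.enorm.measurable, sq, mul_assoc]

lemma lintegral_enorm_profile : ∫⁻ q, ‖profile E q‖ₑ = 1 := by
  rw [← ofReal_integral_norm_eq_lintegral_enorm integrable_profile]
  simp [Real.norm_of_nonneg (profile_nonneg _), integral_profile]

/-- `S'` contains the `a`-neighbourhood of `S`. -/
def Nbhd (a : ℝ) (S S' : Set (E × ℝ)) : Prop := ∀ p ∈ S, closedBall p a ⊆ S'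

lemma Nbhd.subset {a : ℝ} {S S' : Set (E × ℝ)} (h : Nbhd a S S') (ha : 0 ≤ a) : S ⊆ S' :=
  fun p hp => h p hp (mem_closedBall_self ha)

lemma Nbhd.mono {a a' : ℝ} {S S' : Set (E × ℝ)} (h : Nbhd a S S') (ha : a' ≤ a) : Nbhd a' S S' :=
  fun p hp => (closedBall_subset_closedBall ha).trans (h p hp)

lemma Nbhd.sub_dil_mem {a : ℝ} {S S' : Set (E × ℝ)} (h : Nbhd a S S') (ha : 0 ≤ a) (ha1 : a ≤ 1)
    {p q : E × ℝ} (hp : p ∈ S) (hq : q ∈ closedBall (0 : E × ℝ) 1) : p - dil a q ∈ S' := by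
  refine h p hp ?_
  rw [mem_closedBall, dist_eq_norm, sub_sub_cancel_left, norm_neg]
  exact norm_dil_le_of_mem ha ha1 hq

lemma lintegral_mollify_sq_le {a : ℝ} (ha : 0 ≤ a) (ha1 : a ≤ 1) {S S' : Set (E × ℝ)}
    (h : Nbhd a S S') {f : E × ℝ → F} (hf : AEStronglyMeasurable f) :
    ∫⁻ p in S, ‖mollify a f p‖ₑ ^ 2 ≤ ∫⁻ p in S', ‖f p‖ₑ ^ 2 := by
  have := lintegral_dilAvg_sq_le contDiff_profile.continuous (a := a) (S := S) (S' := S')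
    (fun p hp q hq => h.sub_dil_mem ha ha1 hp (tsupport_profile.le hq)) hf
  simpa [lintegral_enorm_profile, mollify] using this

/-- The mollification at scale `a` is bounded pointwise by local `L¹` norms. -/
lemma exists_enorm_mollify_le (E : Type*) [NormedAddCommGroup E] [NormedSpace ℝ E]
    [FiniteDimensional ℝ E] [MeasureSpace E] [BorelSpace E]
    [(volume : Measure E).IsAddHaarMeasure] :
    ∃ C : ℝ, 0 < C ∧ ∀ {F : Type} [NormedAddCommGroup F] [NormedSpace ℝ F] {a : ℝ}, 0 < a → a ≤ 1 →
      ∀ (f : E × ℝ → F) (p : E × ℝ), ‖mollify a f p‖ₑ ≤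
        ENNReal.ofReal (C * (a ^ homDim E)⁻¹) * ∫⁻ q in closedBall p a, ‖f q‖ₑ := by
  obtain ⟨C, hC⟩ := hasCompactSupport_profile.exists_bound_of_continuous
    (contDiff_profile (E := E)).continuous
  refine ⟨max C 1, by positivity, fun {F} _ _ {a} ha ha1 f p => ?_⟩
  rw [mollify_eq_integral ha, ← lintegral_const_mul' _ _ ENNReal.ofReal_ne_top,
    ← lintegral_indicator isClosed_closedBall.measurableSet]
  refine (enorm_integral_le_lintegral_enorm _).trans (lintegral_mono fun q => ?_)
  by_cases hq : q ∈ closedBall p a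
  · rw [indicator_of_mem hq, enorm_smul]
    gcongr
    rw [← ofReal_norm]
    refine ENNReal.ofReal_le_ofReal ?_
    rw [mollKernel, rescale, norm_mul, norm_inv, norm_pow, Real.norm_of_nonneg ha.le, mul_comm]
    gcongr
    exact (hC _).trans (le_max_left _ _)
  · rw [indicator_of_notMem hq, image_eq_zero_of_notMem_tsupport
      (fun h => hq (tsupport_mollKernel_subset ha ha1 p h))]
    simp

lemma mollify_congr_of_eqOn {a : ℝ} (ha : 0 < a) (ha1 : a ≤ 1) {S S' : Set (E × ℝ)}
    (h : Nbhd a S S') {f g : E × ℝ → F} (hfg : EqOn f g S') {p : E × ℝ} (hp : p ∈ S) :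
    mollify a f p = mollify a g p := by
  refine integral_congr_ae (ae_of_all _ fun q => ?_)
  by_cases hq : q ∈ tsupport (profile E)
  · simp only [hfg (h.sub_dil_mem ha.le ha1 hp (tsupport_profile.le hq))]
  · simp [image_eq_zero_of_notMem_tsupport hq]

lemma integrable_mollify_integrand {a : ℝ} (ha : 0 < a) (ha1 : a ≤ 1) {f : E × ℝ → F}
    (hf : LocallyIntegrable f) (p : E × ℝ) :
    Integrable fun q => profile E q • f (p - dil a q) := by
  have h1 : Integrable fun q : E × ℝ => rescale (profile E) a q • f (p - q) :=
    (hasCompactSupport_rescale (E := E) tsupport_profile.le ha ha1).convolutionExists_left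
      (ContinuousLinearMap.lsmul ℝ ℝ) (contDiff_rescale contDiff_profile a).continuous hf p
  have h2 : Integrable ((fun q : E × ℝ => rescale (profile E) a q • f (p - q)) ∘ dil a) := by
    rw [← (measurableEmbedding_dil ha.ne').integrable_map_iff, map_dil ha]
    exact h1.smul_measure ENNReal.ofReal_ne_top
  have h3 := h2.smul (a ^ homDim E)
  refine h3.congr (ae_of_all _ fun q => ?_)
  have hpos : (0 : ℝ) < a ^ homDim E := by positivity
  simp only [Pi.smul_apply, Function.comp_apply, rescale, dil_inv_dil ha.ne', smul_smul,
    ← mul_assoc, mul_inv_cancel₀ hpos.ne', one_mul]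

lemma mollify_sub {a : ℝ} (ha : 0 < a) (ha1 : a ≤ 1) {f g : E × ℝ → F}
    (hf : LocallyIntegrable f) (hg : LocallyIntegrable g) (p : E × ℝ) :
    mollify a (f - g) p = mollify a f p - mollify a g p := by
  simp only [mollify, dilAvg, Pi.sub_apply, smul_sub]
  exact integral_sub (integrable_mollify_integrand ha ha1 hf p)
    (integrable_mollify_integrand ha ha1 hg p)

lemma eLpNorm_two_sq {α : Type*} [MeasurableSpace α] {μ : Measure α} (f : α → F) :
    eLpNorm f 2 μ ^ 2 = ∫⁻ x, ‖f x‖ₑ ^ 2 ∂μ := by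
  have := eLpNorm_nnreal_pow_eq_lintegral (f := f) (μ := μ) (p := 2) (by norm_num)
  simpa using this

/-- The case of the dense class: the difference is at most ε everywhere by uniform continuity, and
it vanishes off the 1-neighbourhood of the support because a ≤ 1. -/
lemma lintegral_mollify_sub_sq_le_of_uniform {a ε δ : ℝ} (ha : 0 < a) (ha1 : a ≤ 1) (haδ : a < δ)
    {g : E × ℝ → F} [CompleteSpace F] (hg : Continuous g) (hgc : HasCompactSupport g)
    (hδ : ∀ p q, dist p q < δ → dist (g p) (g q) < ε) :
    ∫⁻ p, ‖mollify a g p - g p‖ₑ ^ 2 ≤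
      ENNReal.ofReal ε ^ 2 * volume (cthickening 1 (tsupport g)) := by
  have hgi : LocallyIntegrable g := hg.locallyIntegrable
  rw [← setLIntegral_const, ← lintegral_indicator isClosed_cthickening.measurableSet]
  refine lintegral_mono fun p => ?_
  have hb : ∀ q ∈ tsupport (profile E), dist (p - dil a q) p ≤ a := fun q hq => by
    rw [dist_eq_norm, sub_sub_cancel_left, norm_neg]
    exact norm_dil_le_of_mem ha.le ha1 (tsupport_profile.le hq)
  by_cases hp : p ∈ cthickening 1 (tsupport g)
  · rw [indicator_of_mem hp]
    gcongr
    have e : mollify a g p - g p = ∫ q, profile E q • (g (p - dil a q) - g p) := by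
      simp only [smul_sub]
      rw [integral_sub (integrable_mollify_integrand ha ha1 hgi p)
        (integrable_profile.smul_const _), integral_smul_const, integral_profile, one_smul]
      rfl
    rw [e]
    refine (enorm_integral_le_lintegral_enorm _).trans ?_
    calc ∫⁻ q, ‖profile E q • (g (p - dil a q) - g p)‖ₑ
        ≤ ∫⁻ q, ‖profile E q‖ₑ * ENNReal.ofReal ε := by
          refine lintegral_mono fun q => ?_
          by_cases hq : q ∈ tsupport (profile E)
          · rw [enorm_smul]
            refine mul_le_mul_right ?_ _
            rw [← ofReal_norm, ← dist_eq_norm]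
            exact ENNReal.ofReal_le_ofReal (hδ _ _ ((hb q hq).trans_lt haδ)).le
          · simp [image_eq_zero_of_notMem_tsupport hq]
      _ = ENNReal.ofReal ε := by
          rw [lintegral_mul_const _ contDiff_profile.continuous.enorm.measurable,
            lintegral_enorm_profile, one_mul]
  · rw [indicator_of_notMem hp]
    have h0 : g p = 0 := image_eq_zero_of_notMem_tsupport
      fun h => hp (self_subset_cthickening _ h)
    have h1 : mollify a g p = 0 := by
      refine integral_eq_zero_of_ae (ae_of_all _ fun q => ?_)
      by_cases hq : q ∈ tsupport (profile E)
      · have : g (p - dil a q) = 0 := image_eq_zero_of_notMem_tsupport fun h =>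
          hp (mem_cthickening_of_dist_le _ _ _ _ h (by
            rw [dist_comm]; exact (hb q hq).trans ha1))
        simp only [this, smul_zero, Pi.zero_apply]
      · simp [image_eq_zero_of_notMem_tsupport hq]
    simp [h0, h1]

/-- Mollifications converge in `L²`. -/
lemma tendsto_lintegral_mollify_sub_sq [CompleteSpace F] {f : E × ℝ → F} (hf : MemLp f 2) :
    Tendsto (fun a => ∫⁻ p, ‖mollify a f p - f p‖ₑ ^ 2) (𝓝[>] 0) (𝓝 0) := by
  suffices h : Tendsto (fun a => eLpNorm (fun p => mollify a f p - f p) 2 volume) (𝓝[>] 0) (𝓝 0) by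
    have := (ENNReal.continuous_pow 2).continuousAt.tendsto.comp h
    simpa [Function.comp_def, eLpNorm_two_sq] using this
  rw [ENNReal.tendsto_nhds_zero]
  intro ε hε
  have hε3 : 0 < ε / 3 := ENNReal.div_pos hε.ne' (by norm_num)
  obtain ⟨g, hgc, hfg, hg, hgm⟩ := hf.exists_hasCompactSupport_eLpNorm_sub_le (by norm_num) hε3.ne'
  have hfi : LocallyIntegrable f := hf.locallyIntegrable (by norm_num)
  have hgi : LocallyIntegrable g := hg.locallyIntegrable
  set V := volume (cthickening 1 (tsupport g)) with hV
  have hVfin : V ≠ ⊤ := (hgc.isCompact.cthickening).measure_lt_top.ne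
  obtain ⟨η, hη, hηV⟩ : ∃ η : ℝ, 0 < η ∧ ENNReal.ofReal η ^ 2 * V ≤ (ε / 3) ^ 2 := by
    have h1 : Tendsto (fun η : ℝ => ENNReal.ofReal η ^ 2 * V) (𝓝[>] 0) (𝓝 (0 ^ 2 * V)) := by
      refine ENNReal.Tendsto.mul_const ?_ (Or.inr hVfin)
      have : Tendsto (fun η : ℝ => ENNReal.ofReal η) (𝓝[>] 0) (𝓝 0) := by
        have := (ENNReal.continuous_ofReal.tendsto 0).mono_left (nhdsWithin_le_nhds (s := Ioi 0))
        simpa using this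
      exact (ENNReal.continuous_pow 2).continuousAt.tendsto.comp this
    have h2 : (0 : ℝ≥0∞) ^ 2 * V < (ε / 3) ^ 2 := by
      simp only [ne_eq, OfNat.ofNat_ne_zero, not_false_eq_true, zero_pow, zero_mul]
      exact ENNReal.pow_pos hε3 2
    obtain ⟨η, h3, h4⟩ := ((h1.eventually_lt_const h2).and self_mem_nhdsWithin).exists
    exact ⟨η, h4, h3.le⟩
  obtain ⟨δ, hδ, hδ'⟩ := Metric.uniformContinuous_iff.1
    (hgc.uniformContinuous_of_continuous hg) η hη
  filter_upwards [Ioo_mem_nhdsGT (lt_min hδ one_pos)] with a ⟨ha, ha2⟩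
  have ha1 : a ≤ 1 := (ha2.trans_le (min_le_right _ _)).le
  have hgm2 : eLpNorm (fun p => mollify a g p - g p) 2 volume ≤ ε / 3 := by
    rw [← ENNReal.pow_le_pow_left_iff two_ne_zero, eLpNorm_two_sq]
    exact (lintegral_mollify_sub_sq_le_of_uniform ha ha1 (ha2.trans_le (min_le_left _ _)) hg hgc
      fun p q h => hδ' h).trans hηV
  have hfgm : eLpNorm (mollify a (f - g)) 2 volume ≤ ε / 3 := by
    refine le_trans ?_ hfg
    rw [← ENNReal.pow_le_pow_left_iff two_ne_zero, eLpNorm_two_sq, eLpNorm_two_sq]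
    have := lintegral_mollify_sq_le ha.le ha1 (S := univ) (S' := univ)
      (fun _ _ => subset_univ _) (hf.sub hgm).aestronglyMeasurable
    simpa using this
  have hc := (contDiff_mollify ha ha1 (hfi.sub hgi)).continuous
  have hc2 := (contDiff_mollify ha ha1 hgi).continuous
  have e : (fun p => mollify a f p - f p)
      = (mollify a (f - g) + fun p => mollify a g p - g p) - (f - g) := by
    ext p
    simp only [Pi.sub_apply, Pi.add_apply, mollify_sub ha ha1 hfi hgi]
    abel
  rw [e]
  calc _ ≤ (ε / 3 + ε / 3) + ε / 3 := by
        refine (eLpNorm_sub_le (hc.aestronglyMeasurable.add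
          (hc2.sub hg).aestronglyMeasurable) (hf.sub hgm).aestronglyMeasurable (by norm_num)).trans ?_
        gcongr
        exact (eLpNorm_add_le hc.aestronglyMeasurable
          (hc2.sub hg).aestronglyMeasurable (by norm_num)).trans (add_le_add hfgm hgm2)
    _ = ε := by rw [ENNReal.add_thirds]

lemma MemL2Loc.locallyIntegrable {f : E × ℝ → F} (hf : MemL2Loc f univ) :
    LocallyIntegrable f := by
  rw [locallyIntegrable_iff]
  intro K hK
  have : IsFiniteMeasure (volume.restrict K) := ⟨by simpa using hK.measure_lt_top⟩
  exact (hf K (subset_univ _) hK).integrable (by norm_num)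

lemma MemL2Loc.aestronglyMeasurable {f : E × ℝ → F} (hf : MemL2Loc f univ) :
    AEStronglyMeasurable f := hf.locallyIntegrable.aestronglyMeasurable

lemma MemL2Loc.lintegral_lt_top {f : E × ℝ → F} (hf : MemL2Loc f univ) {S : Set (E × ℝ)}
    (hS : Bornology.IsBounded S) : ∫⁻ p in S, ‖f p‖ₑ ^ 2 < ⊤ := by
  refine (lintegral_mono_set subset_closure).trans_lt ?_
  rw [← eLpNorm_two_sq]
  exact ENNReal.pow_lt_top (hf _ (subset_univ _) hS.isCompact_closure).eLpNorm_lt_top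

/-- Mollifications converge in `L²` on bounded sets. -/
lemma MemL2Loc.tendsto_mollify [CompleteSpace F] {f : E × ℝ → F} (hf : MemL2Loc f univ)
    {S : Set (E × ℝ)} (hS : Bornology.IsBounded S) :
    Tendsto (fun a => ∫⁻ p in S, ‖mollify a f p - f p‖ₑ ^ 2) (𝓝[>] 0) (𝓝 0) := by
  -- At scales at most 1 the mollification on S sees f only on K, so f can be truncated to a
  -- function in L² of the whole space.
  set K := cthickening 1 (closure S)
  have hK : IsCompact K := hS.isCompact_closure.cthickening
  have hn : Nbhd 1 (closure S) K := fun p hp => closedBall_subset_cthickening hp 1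
  have hm : MemLp (K.indicator f) 2 := (memLp_indicator_iff_restrict hK.measurableSet).2
    (hf K (subset_univ _) hK)
  refine tendsto_of_tendsto_of_tendsto_of_le_of_le' tendsto_const_nhds
    (tendsto_lintegral_mollify_sub_sq hm) (Eventually.of_forall fun _ => zero_le) ?_
  filter_upwards [Ioc_mem_nhdsGT one_pos] with a ⟨ha, ha1⟩
  calc _ ≤ ∫⁻ p in closure S, ‖mollify a f p - f p‖ₑ ^ 2 := lintegral_mono_set subset_closure
    _ = ∫⁻ p in closure S, ‖mollify a (K.indicator f) p - K.indicator f p‖ₑ ^ 2 := by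
        refine setLIntegral_congr_fun isClosed_closure.measurableSet fun p hp => ?_
        have e : EqOn f (K.indicator f) K := fun q hq => (indicator_of_mem hq f).symm
        simp only [mollify_congr_of_eqOn ha ha1 (hn.mono ha1) e hp, ← e (hn.subset zero_le_one hp)]
    _ ≤ _ := setLIntegral_le_lintegral _ _

lemma _root_.Continuous.memL2Loc {f : E × ℝ → F} (hf : Continuous f) : MemL2Loc f univ :=
    fun K _ hK => by
  obtain ⟨C, hC⟩ := hK.exists_bound_of_continuousOn hf.continuousOn
  have : IsFiniteMeasure (volume.restrict K) := ⟨by simpa using hK.measure_lt_top⟩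
  exact MemLp.of_bound hf.aestronglyMeasurable C
    ((ae_restrict_iff' hK.measurableSet).2 (ae_of_all _ hC))

lemma MemL2Loc.mollify [CompleteSpace F] {f : E × ℝ → F} (hf : MemL2Loc f univ) {a : ℝ}
    (ha : 0 < a) (ha1 : a ≤ 1) : MemL2Loc (mollify a f) univ :=
  (contDiff_mollify ha ha1 hf.locallyIntegrable).continuous.memL2Loc

/-- `u` is a weak solution of `∂ₜ u = ∑ ∂ᵢ Fᵢ` with weak gradient `G` on the open set `Ω`, where
the derivatives are taken in the directions `eᵢ` of `E`. -/
structure WeakSol {ι : Type*} [Fintype ι] (e : ι → E) (Ω : Set (E × ℝ)) (u : E × ℝ → ℂ)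
    (F G : ι → E × ℝ → ℂ) : Prop where
  memL2 : MemL2Loc u univ
  memL2_flux : ∀ i, MemL2Loc (F i) univ
  memL2_grad : ∀ i, MemL2Loc (G i) univ
  grad : ∀ φ : E × ℝ → ℝ, ContDiff ℝ ∞ φ → HasCompactSupport φ → tsupport φ ⊆ Ω → ∀ i,
    ∫ p, fderiv ℝ φ p (e i, 0) • u p = - ∫ p, φ p • G i p
  eqn : ∀ φ : E × ℝ → ℝ, ContDiff ℝ ∞ φ → HasCompactSupport φ → tsupport φ ⊆ Ω →
    ∫ p, fderiv ℝ φ p (0, 1) • u p = ∑ i, ∫ p, fderiv ℝ φ p (e i, 0) • F i p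

section WeakSol

variable {ι : Type*} [Fintype ι] {e : ι → E} {Ω : Set (E × ℝ)} {u : E × ℝ → ℂ}
    {F G : ι → E × ℝ → ℂ}

lemma hasCompactSupport_mollKernel {a : ℝ} (ha : 0 < a) (ha1 : a ≤ 1) (p : E × ℝ) :
    HasCompactSupport (mollKernel a p) :=
  (isCompact_closedBall p a).of_isClosed_subset (isClosed_tsupport _)
    (tsupport_mollKernel_subset ha ha1 p)

/-- The kernel centred at p is an admissible test function as soon as its supporting ball lies in Ω.
-/
lemma WeakSol.fderiv_mollify_space (h : WeakSol e Ω u F G) {a : ℝ} (ha : 0 < a) (ha1 : a ≤ 1)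
    {p : E × ℝ} (hp : closedBall p a ⊆ Ω) (i : ι) :
    fderiv ℝ (ParabolicRH.mollify a u) p (e i, 0) = ParabolicRH.mollify a (G i) p := by
  rw [fderiv_mollify ha ha1 h.memL2.locallyIntegrable, h.grad _ (contDiff_mollKernel a p)
    (hasCompactSupport_mollKernel ha ha1 p) ((tsupport_mollKernel_subset ha ha1 p).trans hp), neg_neg,
    mollify_eq_integral ha]

lemma WeakSol.fderiv_mollify_time (h : WeakSol e Ω u F G) {a : ℝ} (ha : 0 < a) (ha1 : a ≤ 1)
    {p : E × ℝ} (hp : closedBall p a ⊆ Ω) :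
    fderiv ℝ (ParabolicRH.mollify a u) p (0, 1)
      = ∑ i, fderiv ℝ (ParabolicRH.mollify a (F i)) p (e i, 0) := by
  rw [fderiv_mollify ha ha1 h.memL2.locallyIntegrable, h.eqn _ (contDiff_mollKernel a p)
    (hasCompactSupport_mollKernel ha ha1 p) ((tsupport_mollKernel_subset ha ha1 p).trans hp),
    ← Finset.sum_neg_distrib]
  exact Finset.sum_congr rfl fun i _ => (fderiv_mollify ha ha1
    (h.memL2_flux i).locallyIntegrable _ _).symm

end WeakSol

end Mollify

/-- Cauchy-Schwarz for the counting measure. -/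
lemma sum_sq_le_card_mul {ι : Type*} [Fintype ι] (f : ι → ℝ≥0∞) :
    (∑ i, f i) ^ 2 ≤ Fintype.card ι * ∑ i, f i ^ 2 := by
  let : MeasurableSpace ι := ⊤
  have := lintegral_sq_le (Measure.count (α := ι)) (f := f) (measurable_of_finite f).aemeasurable
  simpa [lintegral_count, tsum_fintype, Measure.count_apply] using this

/-! ### Smooth solutions and the distance to their mollifications. -/

section SmoothSol

variable {E : Type*} [NormedAddCommGroup E] [NormedSpace ℝ E] [FiniteDimensional ℝ E]
  [MeasureSpace E] [BorelSpace E] [(volume : Measure E).IsAddHaarMeasure]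
  {F : Type*} [NormedAddCommGroup F] [NormedSpace ℝ F]
  {ι : Type*} [Fintype ι]

/-- Smooth functions `v`, `F i`, `G i` with `∂ᵢ v = Gᵢ` and `∂ₜ v = ∑ ∂ᵢ Fᵢ` on the set `Ω`. -/
structure SmoothSol (e : ι → E) (Ω : Set (E × ℝ)) (v : E × ℝ → ℂ) (F G : ι → E × ℝ → ℂ) :
    Prop where
  smooth : ContDiff ℝ ∞ v
  smooth_flux : ∀ i, ContDiff ℝ ∞ (F i)
  smooth_grad : ∀ i, ContDiff ℝ ∞ (G i)
  grad : ∀ p ∈ Ω, ∀ i, fderiv ℝ v p (e i, 0) = G i p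
  eqn : ∀ p ∈ Ω, fderiv ℝ v p (0, 1) = ∑ i, fderiv ℝ (F i) p (e i, 0)

lemma SmoothSol.mono {e : ι → E} {Ω Ω' : Set (E × ℝ)} {v : E × ℝ → ℂ} {F G : ι → E × ℝ → ℂ}
    (h : SmoothSol e Ω v F G) (hΩ : Ω' ⊆ Ω) : SmoothSol e Ω' v F G :=
  ⟨h.smooth, h.smooth_flux, h.smooth_grad, fun p hp => h.grad p (hΩ hp),
    fun p hp => h.eqn p (hΩ hp)⟩

lemma WeakSol.smoothSol {e : ι → E} {Ω Ω' : Set (E × ℝ)} {u : E × ℝ → ℂ} {F G : ι → E × ℝ → ℂ}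
    (h : WeakSol e Ω u F G) {a : ℝ} (ha : 0 < a) (ha1 : a ≤ 1) (hΩ : Nbhd a Ω' Ω) :
    SmoothSol e Ω' (mollify a u) (fun i => mollify a (F i)) (fun i => mollify a (G i)) where
  smooth := contDiff_mollify ha ha1 h.memL2.locallyIntegrable
  smooth_flux i := contDiff_mollify ha ha1 (h.memL2_flux i).locallyIntegrable
  smooth_grad i := contDiff_mollify ha ha1 (h.memL2_grad i).locallyIntegrable
  grad p hp i := h.fderiv_mollify_space ha ha1 (hΩ p hp) i
  eqn p hp := h.fderiv_mollify_time ha ha1 (hΩ p hp)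

lemma fderiv_mollify_of_contDiff [CompleteSpace F] {a : ℝ} (ha : 0 < a) (ha1 : a ≤ 1)
    {f : E × ℝ → F} (hf : ContDiff ℝ ∞ f) (p v : E × ℝ) :
    fderiv ℝ (mollify a f) p v = mollify a (fun q => fderiv ℝ f q v) p := by
  have hk := contDiff_mollKernel a p
  have hc := hasCompactSupport_mollKernel ha ha1 p
  have hf' : Continuous fun q => fderiv ℝ f q v :=
    (hf.continuous_fderiv (by simp)).clm_apply continuous_const
  have hk' : Continuous fun q => fderiv ℝ (mollKernel a p) q v :=
    (hk.continuous_fderiv (by simp)).clm_apply continuous_const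
  have hc' : HasCompactSupport fun q => fderiv ℝ (mollKernel a p) q v :=
    (hc.fderiv_apply (𝕜 := ℝ) v)
  rw [fderiv_mollify ha ha1 hf.continuous.locallyIntegrable, mollify_eq_integral ha,
    integral_smul_fderiv_eq_neg_fderiv_smul_of_integrable]
  · exact (hk'.smul hf.continuous).integrable_of_hasCompactSupport hc'.smul_right
  · exact (hk.continuous.smul hf').integrable_of_hasCompactSupport hc.smul_right
  · exact (hk.continuous.smul hf.continuous).integrable_of_hasCompactSupport hc.smul_right
  · exact fun x _ => hk.differentiable (by simp) x
  · exact fun x _ => hf.differentiable (by simp) x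

/-- No relation between F and G enters the structure, so its equations have constant coefficients
and commute with mollification. Ellipticity would not survive here, and it is not required. -/
lemma SmoothSol.mollify {e : ι → E} {Ω Ω' : Set (E × ℝ)} {v : E × ℝ → ℂ} {F G : ι → E × ℝ → ℂ}
    (h : SmoothSol e Ω v F G) {a : ℝ} (ha : 0 < a) (ha1 : a ≤ 1) (hΩ : Nbhd a Ω' Ω) :
    SmoothSol e Ω' (mollify a v) (fun i => mollify a (F i)) (fun i => mollify a (G i)) where
  smooth := contDiff_mollify ha ha1 h.smooth.continuous.locallyIntegrable
  smooth_flux i := contDiff_mollify ha ha1 (h.smooth_flux i).continuous.locallyIntegrable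
  smooth_grad i := contDiff_mollify ha ha1 (h.smooth_grad i).continuous.locallyIntegrable
  grad p hp i := by
    rw [fderiv_mollify_of_contDiff ha ha1 h.smooth]
    exact mollify_congr_of_eqOn ha ha1 hΩ (fun q hq => h.grad q hq i) hp
  eqn p hp := by
    rw [fderiv_mollify_of_contDiff ha ha1 h.smooth]
    simp only [fderiv_mollify_of_contDiff ha ha1 (h.smooth_flux _)]
    rw [mollify_congr_of_eqOn ha ha1 hΩ (fun q hq => h.eqn q hq) hp]
    simp only [ParabolicRH.mollify, dilAvg, Finset.smul_sum]
    refine integral_finsetSum _ fun i _ => ?_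
    exact integrable_mollify_integrand ha ha1 ((h.smooth_flux i).continuous_fderiv (by simp)
      |>.clm_apply continuous_const).locallyIntegrable p

lemma SmoothSol.sub {e : ι → E} {Ω : Set (E × ℝ)} {v v' : E × ℝ → ℂ} {F G F' G' : ι → E × ℝ → ℂ}
    (h : SmoothSol e Ω v F G) (h' : SmoothSol e Ω v' F' G') :
    SmoothSol e Ω (fun p => v p - v' p) (fun i p => F i p - F' i p)
      (fun i p => G i p - G' i p) where
  smooth := h.smooth.sub h'.smooth
  smooth_flux i := (h.smooth_flux i).sub (h'.smooth_flux i)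
  smooth_grad i := (h.smooth_grad i).sub (h'.smooth_grad i)
  grad p hp i := by
    rw [fderiv_fun_sub (h.smooth.differentiable (by simp) p)
      (h'.smooth.differentiable (by simp) p), ← h.grad p hp i, ← h'.grad p hp i]; rfl
  eqn p hp := by
    have := fun i => fderiv_fun_sub ((h.smooth_flux i).differentiable (by simp) p)
      ((h'.smooth_flux i).differentiable (by simp) p)
    simp only [this]
    rw [fderiv_fun_sub (h.smooth.differentiable (by simp) p)
      (h'.smooth.differentiable (by simp) p), sub_apply, h.eqn p hp,
      h'.eqn p hp, ← Finset.sum_sub_distrib]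
    rfl

/-- The weights that represent the derivative of the mollification in the scale. -/
def gradWeight (ℓ : ι → E →L[ℝ] ℝ) (i : ι) (q : E × ℝ) : ℝ := profile E q * ℓ i q.1

/-- The weights that represent the derivative of the mollification in the scale. -/
def fluxWeight (e : ι → E) (i : ι) (q : E × ℝ) : ℝ :=
  2 * q.2 * fderiv ℝ (profile E) q (e i, 0)

lemma continuous_gradWeight (ℓ : ι → E →L[ℝ] ℝ) (i : ι) : Continuous (gradWeight ℓ i) :=
  contDiff_profile.continuous.mul ((ℓ i).continuous.comp continuous_fst)

lemma continuous_fluxWeight (e : ι → E) (i : ι) : Continuous (fluxWeight e i) :=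
  (continuous_const.mul continuous_snd).mul
    ((contDiff_profile.continuous_fderiv (by simp)).clm_apply continuous_const)

lemma tsupport_gradWeight (ℓ : ι → E →L[ℝ] ℝ) (i : ι) :
    tsupport (gradWeight ℓ i) ⊆ closedBall 0 1 :=
  (tsupport_mul_subset_left).trans tsupport_profile.le

lemma tsupport_fluxWeight (e : ι → E) (i : ι) : tsupport (fluxWeight e i) ⊆ closedBall 0 1 :=
  (tsupport_mul_subset_right).trans ((tsupport_fderiv_apply_subset ℝ _).trans tsupport_profile.le)

lemma hasCompactSupport_of_tsupport_subset_closedBall {f : E × ℝ → F} {p : E × ℝ} {r : ℝ}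
    (h : tsupport f ⊆ closedBall p r) : HasCompactSupport f :=
  (isCompact_closedBall p r).of_isClosed_subset (isClosed_tsupport _) h

lemma integrable_dilAvg_integrand {κ : E × ℝ → ℝ} (hκ : Continuous κ)
    (hs : tsupport κ ⊆ closedBall 0 1) {f : E × ℝ → F} (hf : Continuous f) (a : ℝ) (p : E × ℝ) :
    Integrable fun q => κ q • f (p - dil a q) :=
  (hκ.smul (hf.comp (by fun_prop))).integrable_of_hasCompactSupport
    (hasCompactSupport_of_tsupport_subset_closedBall hs).smul_right

/-- A spatial q-derivative of f (p - dil a q) carries a factor -a. The factor 2a from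
differentiating a² q.2 in the scale therefore pays exactly for moving the derivative to the profile,
and no negative power of a remains. -/
lemma integral_flux_eq (e : ι → E) {f : E × ℝ → ℂ} (hf : ContDiff ℝ ∞ f) (a : ℝ) (p : E × ℝ)
    (i : ι) : ∫ q, (profile E q * (2 * a * q.2)) • fderiv ℝ f (p - dil a q) (e i, 0)
      = dilAvg (fluxWeight e i) a f p := by
  have hk := contDiff_profile (E := E)
  have hκ : ContDiff ℝ ∞ fun q : E × ℝ => profile E q * (2 * q.2) :=
    hk.mul (contDiff_const.mul contDiff_snd)
  have hκc : HasCompactSupport fun q : E × ℝ => profile E q * (2 * q.2) :=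
    hasCompactSupport_profile.mul_right
  have hg : ContDiff ℝ ∞ fun q : E × ℝ => f (p - dil a q) :=
    hf.comp (contDiff_const.sub (dil (E := E) a).contDiff)
  have hg' : ∀ q, fderiv ℝ (fun q : E × ℝ => f (p - dil a q)) q (e i, 0)
      = - (a • fderiv ℝ f (p - dil a q) (e i, 0)) := fun q => by
    have h1 : HasFDerivAt (fun q : E × ℝ => p - dil a q) (-(dil a)) q :=
      (dil a).hasFDerivAt.const_sub p
    have h2 := ((hf.differentiable (by simp) (p - dil a q)).hasFDerivAt.comp q h1).fderiv
    change fderiv ℝ (f ∘ fun q : E × ℝ => p - dil a q) q _ = _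
    rw [h2, ContinuousLinearMap.comp_apply, neg_apply, map_neg, ← map_smul]
    simp
  have hκ' : ∀ q, fderiv ℝ (fun q : E × ℝ => profile E q * (2 * q.2)) q (e i, 0)
      = fluxWeight e i q := fun q => by
    have h1 : HasFDerivAt (fun q : E × ℝ => 2 * q.2) ((2 : ℝ) • ContinuousLinearMap.snd ℝ E ℝ) q :=
      (ContinuousLinearMap.snd ℝ E ℝ).hasFDerivAt.const_mul 2
    have h2 := ((hk.differentiable (by simp) q).hasFDerivAt.mul h1).fderiv
    change fderiv ℝ (profile E * fun q : E × ℝ => 2 * q.2) q _ = _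
    rw [h2]
    simp [fluxWeight]
  have key := integral_smul_fderiv_eq_neg_fderiv_smul_of_integrable (μ := volume)
    (f := fun q : E × ℝ => profile E q * (2 * q.2)) (g := fun q : E × ℝ => f (p - dil a q))
    (v := (e i, 0)) ?_ ?_ ?_ (fun x _ => hκ.differentiable (by simp) x)
    (fun x _ => hg.differentiable (by simp) x)
  · simp only [hg', hκ', smul_neg, integral_neg, neg_inj] at key
    rw [dilAvg, ← key]
    refine integral_congr_ae (ae_of_all _ fun q => ?_)
    simp only [smul_smul]
    ring_nf
  · simp only [hκ']
    exact integrable_dilAvg_integrand (continuous_fluxWeight e i) (tsupport_fluxWeight e i)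
      hf.continuous a p
  · exact (hκ.continuous.smul ((hg.continuous_fderiv (by simp)).clm_apply
      continuous_const)).integrable_of_hasCompactSupport hκc.smul_right
  · exact (hκ.continuous.smul hg.continuous).integrable_of_hasCompactSupport hκc.smul_right

/-- The derivative in the scale `a` of the mollification. -/
def scaleDeriv (e : ι → E) (ℓ : ι → E →L[ℝ] ℝ) (F G : ι → E × ℝ → ℂ) (a : ℝ) (p : E × ℝ) : ℂ :=
  ∑ i, (dilAvg (gradWeight ℓ i) a (G i) p + dilAvg (fluxWeight e i) a (F i) p)

/-- The fundamental theorem of calculus along a ↦ v (p - dil a q) from a = 0 to a = δ, averaged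
against the profile and followed by Fubini. -/
lemma SmoothSol.sub_mollify_eq {e : ι → E} {ℓ : ι → E →L[ℝ] ℝ} (hℓ : ∀ Y, ∑ i, ℓ i Y • e i = Y)
    {Ω : Set (E × ℝ)} {v : E × ℝ → ℂ} {F G : ι → E × ℝ → ℂ} (h : SmoothSol e Ω v F G)
    {δ : ℝ} (hδ : 0 < δ) (hδ1 : δ ≤ 1) {p : E × ℝ} (hp : closedBall p δ ⊆ Ω) :
    v p - ParabolicRH.mollify δ v p = ∫ a in Ioc 0 δ, scaleDeriv e ℓ F G a p := by
  have hk := contDiff_profile (E := E)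
  have hv' : Continuous (fderiv ℝ v) := h.smooth.continuous_fderiv (by simp)
  have hdil : Continuous fun x : (E × ℝ) × ℝ => p - dil x.2 x.1 :=
    continuous_const.sub (continuous_dil_uncurry.comp (continuous_snd.prodMk continuous_fst))
  have hH : Continuous fun x : (E × ℝ) × ℝ =>
      profile E x.1 • fderiv ℝ v (p - dil x.2 x.1) (x.1.1, 2 * x.2 * x.1.2) := by
    refine (hk.continuous.comp continuous_fst).smul ((hv'.comp hdil).clm_apply ?_)
    fun_prop
  have hder : ∀ (q : E × ℝ) (a : ℝ), HasDerivAt (fun a => v (p - dil a q))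
      (- fderiv ℝ v (p - dil a q) (q.1, 2 * a * q.2)) a := fun q a => by
    have h1 : HasDerivAt (fun a : ℝ => p - dil a q) (-(q.1, 2 * a * q.2)) a := by
      simp only [dil_apply]
      refine HasDerivAt.const_sub p (HasDerivAt.prodMk ?_ ?_)
      · simpa using (hasDerivAt_id a).smul_const q.1
      · simpa using (hasDerivAt_pow 2 a).mul_const q.2
    have h2 := (h.smooth.differentiable (by simp) (p - dil a q)).hasFDerivAt.comp_hasDerivAt a h1
    rw [map_neg] at h2
    exact h2
  have hftc : ∀ q : E × ℝ, v p - v (p - dil δ q)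
      = ∫ a in Ioc 0 δ, fderiv ℝ v (p - dil a q) (q.1, 2 * a * q.2) := fun q => by
    have hc : Continuous fun a => - fderiv ℝ v (p - dil a q) (q.1, 2 * a * q.2) := by
      refine ((hv'.comp (hdil.comp (continuous_const.prodMk continuous_id))).clm_apply ?_).neg
      fun_prop
    have := intervalIntegral.integral_eq_sub_of_hasDerivAt (a := 0) (b := δ)
      (fun a _ => hder q a) (hc.intervalIntegrable _ _)
    rw [intervalIntegral.integral_of_le hδ.le, integral_neg] at this
    rw [← neg_sub, ← neg_eq_iff_eq_neg.2 this.symm]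
    have h0 : dil 0 q = 0 := by simp
    rw [h0, sub_zero]
  have hint : Integrable (fun x : (E × ℝ) × ℝ =>
      profile E x.1 • fderiv ℝ v (p - dil x.2 x.1) (x.1.1, 2 * x.2 * x.1.2))
      ((volume : Measure (E × ℝ)).prod (volume.restrict (Ioc 0 δ))) := by
    have hK : IsCompact ((closedBall (0 : E × ℝ) 1) ×ˢ Icc (0 : ℝ) δ) :=
      (isCompact_closedBall _ _).prod isCompact_Icc
    have h1 := (hH.continuousOn.integrableOn_compact (μ := volume.prod volume) hK).mono_set
      (prod_mono_right (s := closedBall (0 : E × ℝ) 1) Ioc_subset_Icc_self)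
    rw [IntegrableOn, ← Measure.prod_restrict] at h1
    have h2 : IntegrableOn (fun x : (E × ℝ) × ℝ =>
        profile E x.1 • fderiv ℝ v (p - dil x.2 x.1) (x.1.1, 2 * x.2 * x.1.2))
        ((closedBall (0 : E × ℝ) 1) ×ˢ univ)
        ((volume : Measure (E × ℝ)).prod (volume.restrict (Ioc 0 δ))) := by
      rw [IntegrableOn, ← Measure.prod_restrict, Measure.restrict_univ]
      exact h1
    refine h2.integrable_of_forall_notMem_eq_zero fun x hx => ?_
    have : x.1 ∉ tsupport (profile E) := fun hx' => hx ⟨tsupport_profile.le hx', mem_univ _⟩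
    simp only [image_eq_zero_of_notMem_tsupport this, zero_smul]
  calc v p - ParabolicRH.mollify δ v p
      = ∫ q, profile E q • (v p - v (p - dil δ q)) := by
        simp only [smul_sub]
        rw [integral_sub (integrable_profile.smul_const _)
          (integrable_mollify_integrand hδ hδ1 h.smooth.continuous.locallyIntegrable p),
          integral_smul_const, integral_profile, one_smul]
        rfl
    _ = ∫ q, ∫ a in Ioc 0 δ,
          profile E q • fderiv ℝ v (p - dil a q) (q.1, 2 * a * q.2) := by
        simp only [hftc, integral_smul]
    _ = ∫ a in Ioc 0 δ, ∫ q,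
          profile E q • fderiv ℝ v (p - dil a q) (q.1, 2 * a * q.2) :=
        integral_integral_swap hint
    _ = ∫ a in Ioc 0 δ, scaleDeriv e ℓ F G a p := by
        refine setIntegral_congr_fun measurableSet_Ioc fun a ha => ?_
        -- The velocity (q.1, 2 a q.2) is split into space and time directions. The spatial
        -- derivatives of v become the Gᵢ, and the time derivative is replaced by the divergence of
        -- the flux.
        have hpt : ∀ q : E × ℝ, profile E q • fderiv ℝ v (p - dil a q) (q.1, 2 * a * q.2)
            = ∑ i, (gradWeight ℓ i q • G i (p - dil a q)
              + (profile E q * (2 * a * q.2)) • fderiv ℝ (F i) (p - dil a q) (e i, 0)) := by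
          intro q
          by_cases hq : q ∈ tsupport (profile E)
          · have hmem : p - dil a q ∈ Ω := by
              refine hp ?_
              rw [mem_closedBall, dist_eq_norm, sub_sub_cancel_left, norm_neg]
              exact (norm_dil_le_of_mem ha.1.le (ha.2.trans hδ1) (tsupport_profile.le hq)).trans ha.2
            have hdec : ((q.1, 2 * a * q.2) : E × ℝ)
                = ∑ i, ℓ i q.1 • ((e i, 0) : E × ℝ) + (2 * a * q.2) • (0, 1) := by
              have h1 : ∑ i, ℓ i q.1 • ((e i, 0) : E × ℝ) = (q.1, 0) := by
                rw [Prod.ext_iff]; simp [Prod.fst_sum, Prod.snd_sum, hℓ]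
              rw [h1]; simp
            rw [hdec, map_add, map_sum, map_smul, h.eqn _ hmem]
            simp only [map_smul, h.grad _ hmem, smul_add, Finset.smul_sum, smul_smul,
              Finset.sum_add_distrib, gradWeight]
          · simp [image_eq_zero_of_notMem_tsupport hq, gradWeight]
        simp only [hpt, scaleDeriv]
        have hi1 : ∀ i, Integrable fun q => gradWeight ℓ i q • G i (p - dil a q) := fun i =>
          integrable_dilAvg_integrand (continuous_gradWeight ℓ i) (tsupport_gradWeight ℓ i)
            (h.smooth_grad i).continuous a p
        have hi2 : ∀ i, Integrable fun q : E × ℝ =>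
            (profile E q * (2 * a * q.2)) • fderiv ℝ (F i) (p - dil a q) (e i, 0) := fun i =>
          integrable_dilAvg_integrand (κ := fun q : E × ℝ => profile E q * (2 * a * q.2))
            (hk.continuous.mul (by fun_prop))
            (tsupport_mul_subset_left.trans tsupport_profile.le)
            (((h.smooth_flux i).continuous_fderiv (by simp)).clm_apply continuous_const) a p
        have hi12 : ∀ i, Integrable fun q => gradWeight ℓ i q • G i (p - dil a q)
            + (profile E q * (2 * a * q.2)) • fderiv ℝ (F i) (p - dil a q) (e i, 0) :=
          fun i => (hi1 i).add (hi2 i)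
        rw [integral_finsetSum _ fun i _ => hi12 i]
        refine Finset.sum_congr rfl fun i _ => ?_
        rw [integral_add (hi1 i) (hi2 i), integral_flux_eq e (h.smooth_flux i)]
        rfl

lemma measurable_dilAvg {κ : E × ℝ → ℝ} (hκ : Continuous κ) {f : E × ℝ → ℂ} (hf : Continuous f) :
    Measurable fun x : (E × ℝ) × ℝ => dilAvg κ x.2 f x.1 := by
  have : Continuous fun y : ((E × ℝ) × ℝ) × (E × ℝ) => κ y.2 • f (y.1.1 - dil y.1.2 y.2) := by
    refine (hκ.comp continuous_snd).smul (hf.comp ?_)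
    exact (continuous_fst.comp continuous_fst).sub (continuous_dil_uncurry.comp
      ((continuous_snd.comp continuous_fst).prodMk continuous_snd))
  exact (this.stronglyMeasurable.integral_prod_right (ν := volume)).measurable

/-- The difference of a smooth solution and its mollification is small in `L²`. -/
theorem exists_lintegral_sub_mollify_sq_le (e : ι → E) (ℓ : ι → E →L[ℝ] ℝ)
    (hℓ : ∀ Y, ∑ i, ℓ i Y • e i = Y) :
    ∃ C : ℝ≥0, ∀ {S S' : Set (E × ℝ)} {v : E × ℝ → ℂ} {F G : ι → E × ℝ → ℂ} {δ : ℝ},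
      0 < δ → δ ≤ 1 → MeasurableSet S → Nbhd δ S S' → SmoothSol e S' v F G →
      ∫⁻ p in S, ‖v p - mollify δ v p‖ₑ ^ 2 ≤
        C * ENNReal.ofReal δ ^ 2 * ∑ i, ∫⁻ p in S', (‖G i p‖ₑ ^ 2 + ‖F i p‖ₑ ^ 2) := by
  have hfin : ∀ {κ : E × ℝ → ℝ}, Continuous κ → tsupport κ ⊆ closedBall 0 1 →
      (∫⁻ q, ‖κ q‖ₑ) ≠ ⊤ := fun hκ hs => (hκ.integrable_of_hasCompactSupport
        (hasCompactSupport_of_tsupport_subset_closedBall hs)).2.ne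
  set A : ℝ≥0∞ := ∑ i, ((∫⁻ q, ‖gradWeight ℓ i q‖ₑ) ^ 2 + (∫⁻ q, ‖fluxWeight e i q‖ₑ) ^ 2) with hA
  have hAfin : A ≠ ⊤ := by
    refine ENNReal.sum_ne_top.2 fun i _ => ENNReal.add_ne_top.2 ⟨?_, ?_⟩
    · exact ENNReal.pow_ne_top (hfin (continuous_gradWeight ℓ i) (tsupport_gradWeight ℓ i))
    · exact ENNReal.pow_ne_top (hfin (continuous_fluxWeight e i) (tsupport_fluxWeight e i))
  refine ⟨Fintype.card ι * 2 * A.toNNReal, fun {S S' v F G δ} hδ hδ1 hS hn h => ?_⟩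
  push_cast
  rw [ENNReal.coe_toNNReal hAfin]
  have hmG : ∀ i, Measurable fun x : (E × ℝ) × ℝ => dilAvg (gradWeight ℓ i) x.2 (G i) x.1 :=
    fun i => measurable_dilAvg (continuous_gradWeight ℓ i) (h.smooth_grad i).continuous
  have hmF : ∀ i, Measurable fun x : (E × ℝ) × ℝ => dilAvg (fluxWeight e i) x.2 (F i) x.1 :=
    fun i => measurable_dilAvg (continuous_fluxWeight e i) (h.smooth_flux i).continuous
  have hm : Measurable fun x : (E × ℝ) × ℝ => scaleDeriv e ℓ F G x.2 x.1 :=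
    Finset.measurable_sum _ fun i _ => (hmG i).add (hmF i)
  set B := ∑ i, ∫⁻ p in S', (‖G i p‖ₑ ^ 2 + ‖F i p‖ₑ ^ 2) with hB
  -- The bound is uniform in the scale. Cauchy-Schwarz over the interval (0, δ] and the integration
  -- in a then contribute one factor δ each.
  have hscale : ∀ a ∈ Ioc 0 δ, ∫⁻ p in S, ‖scaleDeriv e ℓ F G a p‖ₑ ^ 2
      ≤ Fintype.card ι * 2 * A * B := by
    intro a ha
    have hn' : Nbhd a S S' := hn.mono ha.2
    have hb : ∀ {κ : E × ℝ → ℝ}, Continuous κ → tsupport κ ⊆ closedBall 0 1 →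
        ∀ {f : E × ℝ → ℂ}, Continuous f →
        ∫⁻ p in S, ‖dilAvg κ a f p‖ₑ ^ 2 ≤ (∫⁻ q, ‖κ q‖ₑ) ^ 2 * ∫⁻ p in S', ‖f p‖ₑ ^ 2 :=
      fun hκ hs f hf => lintegral_dilAvg_sq_le hκ
        (fun p hp q hq => hn'.sub_dil_mem ha.1.le (ha.2.trans hδ1) hp (hs hq))
        hf.aestronglyMeasurable
    calc ∫⁻ p in S, ‖scaleDeriv e ℓ F G a p‖ₑ ^ 2
        ≤ ∫⁻ p in S, Fintype.card ι * ∑ i, 2 * (‖dilAvg (gradWeight ℓ i) a (G i) p‖ₑ ^ 2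
            + ‖dilAvg (fluxWeight e i) a (F i) p‖ₑ ^ 2) := by
          refine lintegral_mono fun p => ?_
          refine (pow_le_pow_left' (enorm_sum_le _ _) 2).trans
            ((sum_sq_le_card_mul _).trans ?_)
          gcongr with i
          refine (pow_le_pow_left' (enorm_add_le _ _) 2).trans ?_
          have := sum_sq_le_card_mul (ι := Fin 2) ![‖dilAvg (gradWeight ℓ i) a (G i) p‖ₑ,
            ‖dilAvg (fluxWeight e i) a (F i) p‖ₑ]
          simpa using this
      _ = Fintype.card ι * ∑ i, 2 * ((∫⁻ p in S, ‖dilAvg (gradWeight ℓ i) a (G i) p‖ₑ ^ 2)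
            + ∫⁻ p in S, ‖dilAvg (fluxWeight e i) a (F i) p‖ₑ ^ 2) := by
          have h1 : ∀ i, Measurable fun p => ‖dilAvg (gradWeight ℓ i) a (G i) p‖ₑ ^ 2 := fun i =>
            (((hmG i).comp (measurable_id.prodMk measurable_const)).enorm).pow_const 2
          have h2 : ∀ i, Measurable fun p => ‖dilAvg (fluxWeight e i) a (F i) p‖ₑ ^ 2 := fun i =>
            (((hmF i).comp (measurable_id.prodMk measurable_const)).enorm).pow_const 2
          have h12 : ∀ i, Measurable fun p => ‖dilAvg (gradWeight ℓ i) a (G i) p‖ₑ ^ 2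
              + ‖dilAvg (fluxWeight e i) a (F i) p‖ₑ ^ 2 := fun i => (h1 i).add (h2 i)
          rw [lintegral_const_mul _ (Finset.measurable_sum _ fun i _ => (h12 i).const_mul _),
            lintegral_finsetSum _ fun i _ => (h12 i).const_mul _]
          simp only [lintegral_const_mul _ (h12 _), lintegral_add_left (h1 _)]
      _ ≤ Fintype.card ι * ∑ i, 2 * (A * ∫⁻ p in S', (‖G i p‖ₑ ^ 2 + ‖F i p‖ₑ ^ 2)) := by
          gcongr with i
          have hAi : (∫⁻ q, ‖gradWeight ℓ i q‖ₑ) ^ 2 + (∫⁻ q, ‖fluxWeight e i q‖ₑ) ^ 2 ≤ A :=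
            Finset.single_le_sum (f := fun i => (∫⁻ q, ‖gradWeight ℓ i q‖ₑ) ^ 2
              + (∫⁻ q, ‖fluxWeight e i q‖ₑ) ^ 2) (fun _ _ => zero_le) (Finset.mem_univ i)
          rw [lintegral_add_left ((h.smooth_grad i).continuous.enorm.measurable.pow_const 2), mul_add]
          refine add_le_add
            ((hb (continuous_gradWeight ℓ i) (tsupport_gradWeight ℓ i)
              (h.smooth_grad i).continuous).trans ?_)
            ((hb (continuous_fluxWeight e i) (tsupport_fluxWeight e i)
              (h.smooth_flux i).continuous).trans ?_)
          · exact mul_le_mul_left (le_self_add.trans hAi) _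
          · exact mul_le_mul_left (le_add_self.trans hAi) _
      _ = _ := by
          rw [← Finset.mul_sum, ← Finset.mul_sum]
          ring
  calc ∫⁻ p in S, ‖v p - ParabolicRH.mollify δ v p‖ₑ ^ 2
      ≤ ∫⁻ p in S, ENNReal.ofReal δ * ∫⁻ a in Ioc 0 δ, ‖scaleDeriv e ℓ F G a p‖ₑ ^ 2 := by
        refine setLIntegral_mono' hS fun p hp => ?_
        rw [h.sub_mollify_eq hℓ hδ hδ1 (hn p hp)]
        refine (pow_le_pow_left' (enorm_integral_le_lintegral_enorm _) 2).trans ?_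
        have := lintegral_sq_le (volume.restrict (Ioc 0 δ))
          (f := fun a => ‖scaleDeriv e ℓ F G a p‖ₑ)
          (hm.comp (measurable_const.prodMk measurable_id)).enorm.aemeasurable
        simpa using this
    _ = ENNReal.ofReal δ * ∫⁻ a in Ioc 0 δ, ∫⁻ p in S, ‖scaleDeriv e ℓ F G a p‖ₑ ^ 2 := by
        rw [lintegral_const_mul' _ _ ENNReal.ofReal_ne_top, lintegral_lintegral_swap]
        exact (hm.enorm.pow_const 2).aemeasurable
    _ ≤ ENNReal.ofReal δ * ∫⁻ a in Ioc 0 δ, Fintype.card ι * 2 * A * B := by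
        exact mul_le_mul_right (setLIntegral_mono' measurableSet_Ioc hscale) _
    _ = _ := by
        rw [setLIntegral_const, Real.volume_Ioc, sub_zero]
        ring

end SmoothSol

/-! ### Local energy identity and energy inequality. -/

section Energy

variable {E : Type*} [NormedAddCommGroup E] [NormedSpace ℝ E] [FiniteDimensional ℝ E]
  [MeasureSpace E] [BorelSpace E] [(volume : Measure E).IsAddHaarMeasure]
  {ι : Type*} [Fintype ι]

lemma integral_fderiv_apply_eq_zero {F : Type*} [NormedAddCommGroup F] [NormedSpace ℝ F]
    {Φ : E × ℝ → F} (hΦ : ContDiff ℝ 1 Φ)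
    (hc : HasCompactSupport Φ) (w : E × ℝ) : ∫ p, fderiv ℝ Φ p w = 0 := by
  have h := integral_smul_fderiv_eq_neg_fderiv_smul_of_integrable (μ := (volume : Measure (E × ℝ)))
    (f := fun _ => (1 : ℝ)) (g := Φ) (v := w) ?_ ?_ ?_ (fun x _ => by fun_prop)
    (fun x _ => hΦ.differentiable one_ne_zero x)
  · simpa using h
  · simp
  · simpa using ((hΦ.continuous_fderiv one_ne_zero).clm_apply
      continuous_const).integrable_of_hasCompactSupport (hc.fderiv_apply (𝕜 := ℝ) w)
  · simpa using hΦ.continuous.integrable_of_hasCompactSupport hc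

lemma fderiv_sq_mul_inner {η : E × ℝ → ℝ} {a b : E × ℝ → ℂ} (hη : ContDiff ℝ ∞ η)
    (ha : ContDiff ℝ ∞ a) (hb : ContDiff ℝ ∞ b) (p w : E × ℝ) :
    fderiv ℝ (fun p => η p ^ 2 * inner ℝ (a p) (b p)) p w =
      2 * (η p * fderiv ℝ η p w * inner ℝ (a p) (b p)) +
        η p ^ 2 * (inner ℝ (a p) (fderiv ℝ b p w) + inner ℝ (fderiv ℝ a p w) (b p)) := by
  have hη' := hη.differentiable (by simp) p
  have ha' := ha.differentiable (by simp) p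
  have hb' := hb.differentiable (by simp) p
  rw [fderiv_fun_mul (hη'.fun_pow 2) (ha'.inner ℝ hb')]
  simp only [add_apply, smul_apply, fderiv_inner_apply ℝ ha' hb', smul_eq_mul]
  rw [fderiv_fun_pow 2 hη']
  simp
  ring

/-- The local energy identity. -/
lemma SmoothSol.energy_identity {e : ι → E} {Ω : Set (E × ℝ)} {z : E × ℝ → ℂ}
    {f g : ι → E × ℝ → ℂ} (h : SmoothSol e Ω z f g) {η : E × ℝ → ℝ} (hη : ContDiff ℝ ∞ η)
    (hc : HasCompactSupport η) (hs : tsupport η ⊆ Ω) :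
    ∫ p, η p ^ 2 * ∑ i, inner ℝ (g i p) (f i p) =
      ∫ p, (η p * fderiv ℝ η p (0, 1) * ‖z p‖ ^ 2
        - ∑ i, 2 * (η p * fderiv ℝ η p (e i, 0) * inner ℝ (z p) (f i p))) := by
  have hc2 : HasCompactSupport fun p => η p ^ 2 := by
    simp only [sq]; exact hc.mul_right
  have hsm : ∀ {a b : E × ℝ → ℂ}, ContDiff ℝ ∞ a → ContDiff ℝ ∞ b →
      ContDiff ℝ 1 fun p => η p ^ 2 * inner ℝ (a p) (b p) := fun ha hb =>
    ((hη.pow 2).mul (ha.inner ℝ hb)).of_le (by simp)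
  have h0 := integral_fderiv_apply_eq_zero (hsm h.smooth h.smooth) hc2.mul_right (0, 1)
  have hi := fun i => integral_fderiv_apply_eq_zero (hsm h.smooth (h.smooth_flux i))
    hc2.mul_right (e i, 0)
  have hint : ∀ {a b : E × ℝ → ℂ} (w : E × ℝ), ContDiff ℝ ∞ a → ContDiff ℝ ∞ b →
      Integrable fun p => fderiv ℝ (fun p => η p ^ 2 * inner ℝ (a p) (b p)) p w := fun w ha hb =>
    (((hsm ha hb).continuous_fderiv one_ne_zero).clm_apply
      continuous_const).integrable_of_hasCompactSupport (hc2.mul_right.fderiv_apply (𝕜 := ℝ) w)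
  have hη' : ∀ w, Continuous fun p => fderiv ℝ η p w := fun w =>
    (hη.continuous_fderiv (by simp)).clm_apply continuous_const
  have hI1 : Integrable fun p => η p ^ 2 * ∑ i, inner ℝ (g i p) (f i p) := by
    refine Continuous.integrable_of_hasCompactSupport ?_ hc2.mul_right
    exact (hη.continuous.pow 2).mul (continuous_finsetSum _ fun i _ =>
      (h.smooth_grad i).continuous.inner (h.smooth_flux i).continuous)
  have hI2 : Integrable fun p => (η p * fderiv ℝ η p (0, 1) * ‖z p‖ ^ 2
        - ∑ i, 2 * (η p * fderiv ℝ η p (e i, 0) * inner ℝ (z p) (f i p))) := by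
    refine Continuous.integrable_of_hasCompactSupport ?_ ?_
    · refine ((hη.continuous.mul (hη' _)).mul (h.smooth.continuous.norm.pow 2)).sub
        (continuous_finsetSum _ fun i _ => continuous_const.mul
          ((hη.continuous.mul (hη' _)).mul (h.smooth.continuous.inner (h.smooth_flux i).continuous)))
    · refine hc.mono fun p hp => ?_
      contrapose! hp
      simp only [Function.mem_support, not_not] at hp ⊢
      simp [hp]
  rw [← sub_eq_zero, ← integral_sub hI1 hI2]
  -- The difference of the integrands is a divergence in space and time, so its integral vanishes.
  have hpt : ∀ p, η p ^ 2 * ∑ i, inner ℝ (g i p) (f i p) - (η p * fderiv ℝ η p (0, 1) * ‖z p‖ ^ 2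
        - ∑ i, 2 * (η p * fderiv ℝ η p (e i, 0) * inner ℝ (z p) (f i p)))
      = ∑ i, fderiv ℝ (fun p => η p ^ 2 * inner ℝ (z p) (f i p)) p (e i, 0)
        - 2⁻¹ * fderiv ℝ (fun p => η p ^ 2 * inner ℝ (z p) (z p)) p (0, 1) := by
    intro p
    simp only [fderiv_sq_mul_inner hη h.smooth h.smooth,
      fderiv_sq_mul_inner hη h.smooth (h.smooth_flux _)]
    by_cases hp : p ∈ tsupport η
    · simp only [h.grad p (hs hp), h.eqn p (hs hp), real_inner_self_eq_norm_sq, mul_add,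
        Finset.sum_add_distrib, sum_inner, inner_sum, Finset.mul_sum]
      have : ∀ i, inner ℝ (fderiv ℝ (f i) p (e i, 0)) (z p)
          = inner ℝ (z p) (fderiv ℝ (f i) p (e i, 0)) := fun i => real_inner_comm _ _
      simp only [this]
      have e2 : ∀ x : ℝ, 2⁻¹ * (2 * x) = x := fun x => by ring
      simp only [← Finset.mul_sum]
      ring
    · simp [image_eq_zero_of_notMem_tsupport hp]
  simp only [hpt]
  rw [integral_sub (integrable_finsetSum _ fun i _ => hint _ h.smooth (h.smooth_flux i))
    ((hint _ h.smooth h.smooth).const_mul _), integral_finsetSum _ fun i _ =>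
    hint _ h.smooth (h.smooth_flux i), integral_const_mul, h0]
  simp only [hi, Finset.sum_const_zero, mul_zero, sub_zero]

/-- Young's inequality, with a constant that is not sharp. -/
lemma inner_le_of_pos {a b : ℂ} {s : ℝ} (hs : 0 < s) :
    inner ℝ a b ≤ s * ‖a‖ ^ 2 + s⁻¹ * ‖b‖ ^ 2 := by
  refine (real_inner_le_norm a b).trans ?_
  have h1 : s * s⁻¹ = 1 := mul_inv_cancel₀ hs.ne'
  have h2 : 0 < s⁻¹ := inv_pos.2 hs
  have : 0 ≤ s * (‖a‖ - s⁻¹ * ‖b‖ / 2) ^ 2 := by positivity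
  nlinarith [norm_nonneg a, norm_nonneg b, mul_nonneg h2.le (sq_nonneg ‖b‖)]

/-- The energy inequality for the difference of two smooth solutions. -/
lemma SmoothSol.energy_le {e : ι → E} {Ω : Set (E × ℝ)} {v v' : E × ℝ → ℂ}
    {F G F' G' : ι → E × ℝ → ℂ} (h : SmoothSol e Ω v F G) (h' : SmoothSol e Ω v' F' G')
    {η : E × ℝ → ℝ} (hη : ContDiff ℝ ∞ η) (hc : HasCompactSupport η) (hs : tsupport η ⊆ Ω)
    (hη0 : ∀ p, 0 ≤ η p) (hη1 : ∀ p, η p ≤ 1) {L : ℝ} (hL : ∀ p, |fderiv ℝ η p (0, 1)| ≤ L)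
    (hL' : ∀ p i, |fderiv ℝ η p (e i, 0)| ≤ L) {s : ℝ} (hs0 : 0 < s) (hs1 : s ≤ 1) :
    ∫ p, η p ^ 2 * ∑ i, inner ℝ (G i p) (F i p) ≤
      3 * s * (∫ p, η p ^ 2 * ∑ i, (‖F i p‖ ^ 2 + ‖G i p‖ ^ 2)) +
      4 * s⁻¹ * (∫ p in tsupport η, ∑ i, (‖F' i p‖ ^ 2 + ‖G' i p‖ ^ 2)) +
      (L + 4 * Fintype.card ι * L ^ 2 * s⁻¹) * ∫ p in tsupport η, ‖v p - v' p‖ ^ 2 := by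
  have hsub := h.sub h'
  have key := hsub.energy_identity hη hc hs
  have hc2 : HasCompactSupport fun p => η p ^ 2 := by
    simp only [sq]; exact hc.mul_right
  have hcF := fun i => (h.smooth_flux i).continuous
  have hcG := fun i => (h.smooth_grad i).continuous
  have hcF' := fun i => (h'.smooth_flux i).continuous
  have hcG' := fun i => (h'.smooth_grad i).continuous
  have hcv := h.smooth.continuous
  have hcv' := h'.smooth.continuous
  have hηc := hη.continuous
  have hη' : ∀ w, Continuous fun p => fderiv ℝ η p w := fun w =>
    (hη.continuous_fderiv (by simp)).clm_apply continuous_const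
  have hint : ∀ {w : E × ℝ → ℝ}, Continuous w → Integrable fun p => η p ^ 2 * w p := fun hw =>
    ((hηc.pow 2).mul hw).integrable_of_hasCompactSupport hc2.mul_right
  have hK : ∀ {w : E × ℝ → ℝ}, Continuous w → IntegrableOn w (tsupport η) := fun hw =>
    hw.continuousOn.integrableOn_compact hc.isCompact
  have hK' : ∀ {w : E × ℝ → ℝ}, Continuous w → Integrable ((tsupport η).indicator w) := fun hw =>
    (integrable_indicator_iff (isClosed_tsupport η).measurableSet).2 (hK hw)
  have hw1 : Continuous fun p => ∑ i, (‖F i p‖ ^ 2 + ‖G i p‖ ^ 2) := by fun_prop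
  have hw2 : Continuous fun p => ∑ i, (‖F' i p‖ ^ 2 + ‖G' i p‖ ^ 2) := by fun_prop
  have hw3 : Continuous fun p => ‖v p - v' p‖ ^ 2 := by fun_prop
  have hI0 : Continuous fun p => ∑ i, inner ℝ (G i p) (F i p) :=
    continuous_finsetSum _ fun i _ => (hcG i).inner (hcF i)
  have hI1 : Integrable fun p => η p ^ 2 * ∑ i, inner ℝ (G i p - G' i p) (F i p - F' i p) :=
    hint (continuous_finsetSum _ fun i _ => ((hcG i).sub (hcG' i)).inner ((hcF i).sub (hcF' i)))
  have hI2 : Integrable fun p => (η p * fderiv ℝ η p (0, 1) * ‖v p - v' p‖ ^ 2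
        - ∑ i, 2 * (η p * fderiv ℝ η p (e i, 0) * inner ℝ (v p - v' p) (F i p - F' i p))) := by
    refine Continuous.integrable_of_hasCompactSupport ?_ ?_
    · refine ((hηc.mul (hη' _)).mul hw3).sub (continuous_finsetSum _ fun i _ => continuous_const.mul
        ((hηc.mul (hη' _)).mul ((hcv.sub hcv').inner ((hcF i).sub (hcF' i)))))
    · refine hc.mono fun p hp => ?_
      contrapose! hp
      simp only [Function.mem_support, not_not] at hp ⊢
      simp [hp]
  have hRHS : Integrable fun p => (η p * fderiv ℝ η p (0, 1) * ‖v p - v' p‖ ^ 2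
        - ∑ i, 2 * (η p * fderiv ℝ η p (e i, 0) * inner ℝ (v p - v' p) (F i p - F' i p)))
        + η p ^ 2 * (∑ i, inner ℝ (G i p) (F i p) -
          ∑ i, inner ℝ (G i p - G' i p) (F i p - F' i p)) :=
    hI2.add (hint (hI0.sub (continuous_finsetSum _ fun i _ =>
      ((hcG i).sub (hcG' i)).inner ((hcF i).sub (hcF' i)))))
  have hL0 : 0 ≤ L := (abs_nonneg _).trans (hL 0)
  have hsi : 1 ≤ s⁻¹ := (one_le_inv₀ hs0).2 hs1
  calc ∫ p, η p ^ 2 * ∑ i, inner ℝ (G i p) (F i p)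
      = ∫ p, ((η p * fderiv ℝ η p (0, 1) * ‖v p - v' p‖ ^ 2
        - ∑ i, 2 * (η p * fderiv ℝ η p (e i, 0) * inner ℝ (v p - v' p) (F i p - F' i p)))
        + η p ^ 2 * (∑ i, inner ℝ (G i p) (F i p) -
          ∑ i, inner ℝ (G i p - G' i p) (F i p - F' i p))) := by
        have hI3 : Integrable fun p => η p ^ 2 * (∑ i, inner ℝ (G i p) (F i p) -
          ∑ i, inner ℝ (G i p - G' i p) (F i p - F' i p)) := by
          simp only [mul_sub]
          exact (hint hI0).sub hI1
        rw [integral_add hI2 hI3, ← key]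
        simp only [mul_sub]
        rw [integral_sub (hint hI0) hI1]
        ring
    _ ≤ ∫ p, (3 * s * (η p ^ 2 * ∑ i, (‖F i p‖ ^ 2 + ‖G i p‖ ^ 2))
        + 4 * s⁻¹ * (tsupport η).indicator (fun p => ∑ i, (‖F' i p‖ ^ 2 + ‖G' i p‖ ^ 2)) p
        + (L + 4 * Fintype.card ι * L ^ 2 * s⁻¹) *
          (tsupport η).indicator (fun p => ‖v p - v' p‖ ^ 2) p) := by
        refine integral_mono hRHS ((((hint hw1).const_mul _).add ((hK' hw2).const_mul _)).add
          ((hK' hw3).const_mul _)) fun p => ?_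
        by_cases hp : p ∈ tsupport η
        · simp only [indicator_of_mem hp]
          -- Young's inequality for every cross term, a factor s going to F and G. The constant 3 is
          -- reached by F: once against G', twice in the cutoff term. The constant 4 is reached by
          -- F': against G, against G', and twice in the cutoff term.
          have hi : ∀ i, - (2 * (η p * fderiv ℝ η p (e i, 0)
                * inner ℝ (v p - v' p) (F i p - F' i p)))
              + η p ^ 2 * (inner ℝ (G i p) (F i p) - inner ℝ (G i p - G' i p) (F i p - F' i p))
              ≤ 3 * s * (η p ^ 2 * (‖F i p‖ ^ 2 + ‖G i p‖ ^ 2))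
                + 4 * s⁻¹ * (‖F' i p‖ ^ 2 + ‖G' i p‖ ^ 2)
                + 4 * L ^ 2 * s⁻¹ * ‖v p - v' p‖ ^ 2 := by
            intro i
            set y := fderiv ℝ η p (e i, 0) with hy
            have hyL : y ^ 2 ≤ L ^ 2 := by
              rw [← sq_abs]; gcongr; exact hL' p i
            have a1 := inner_le_of_pos (a := F i p) (b := G' i p) hs0
            have a2 := inner_le_of_pos (a := G i p) (b := F' i p) hs0
            have a3 := inner_le_of_pos (a := -G' i p) (b := F' i p) one_pos
            -- The factor η is kept with F and the derivative y with v - v'. The square of F thus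
            -- appears with the weight η², as the later absorption requires.
            have a4 := inner_le_of_pos (a := ((η p : ℝ) : ℂ) * F i p)
              (b := ((-y : ℝ) : ℂ) * (v p - v' p)) hs0
            have a5 := inner_le_of_pos (a := ((η p : ℝ) : ℂ) * F' i p)
              (b := ((y : ℝ) : ℂ) * (v p - v' p)) hs0
            simp only [← Complex.real_smul, inner_smul_left, inner_smul_right, norm_smul, mul_pow,
              Real.norm_eq_abs, sq_abs, inner_neg_left, norm_neg, RCLike.conj_to_real,
              neg_sq] at a3 a4 a5
            have c1 : inner ℝ (v p - v' p) (F i p - F' i p)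
                = inner ℝ (F i p) (v p - v' p) - inner ℝ (F' i p) (v p - v' p) := by
              rw [inner_sub_right, real_inner_comm, real_inner_comm (v p - v' p) (F' i p)]
            have c2 : inner ℝ (G i p) (F i p) - inner ℝ (G i p - G' i p) (F i p - F' i p)
                = inner ℝ (F i p) (G' i p) + inner ℝ (G i p) (F' i p)
                  - inner ℝ (G' i p) (F' i p) := by
              rw [inner_sub_left, inner_sub_right, inner_sub_right,
                real_inner_comm (F i p) (G' i p)]
              ring
            rw [c1, c2]
            set X := inner ℝ (F i p) (v p - v' p)
            set X' := inner ℝ (F' i p) (v p - v' p)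
            have hη2 : η p ^ 2 ≤ 1 := pow_le_one₀ (hη0 p) (hη1 p)
            have hη20 : 0 ≤ η p ^ 2 := sq_nonneg _
            have b1 := mul_le_mul_of_nonneg_left a1 hη20
            have b2 := mul_le_mul_of_nonneg_left a2 hη20
            have b3 := mul_le_mul_of_nonneg_left a3 hη20
            have d1 : η p ^ 2 * (s⁻¹ * ‖G' i p‖ ^ 2) ≤ s⁻¹ * ‖G' i p‖ ^ 2 :=
              mul_le_of_le_one_left (by positivity) hη2
            have d2 : η p ^ 2 * (s⁻¹ * ‖F' i p‖ ^ 2) ≤ s⁻¹ * ‖F' i p‖ ^ 2 :=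
              mul_le_of_le_one_left (by positivity) hη2
            have d3 : η p ^ 2 * (1 * ‖G' i p‖ ^ 2 + 1⁻¹ * ‖F' i p‖ ^ 2)
                ≤ s⁻¹ * (‖G' i p‖ ^ 2 + ‖F' i p‖ ^ 2) := by
              rw [inv_one, one_mul, one_mul]
              exact mul_le_mul_of_nonneg_right (hη2.trans hsi) (by positivity)
            have d4 : s * (η p ^ 2 * ‖F' i p‖ ^ 2) ≤ s⁻¹ * ‖F' i p‖ ^ 2 := by
              rw [← mul_assoc]
              refine mul_le_mul_of_nonneg_right ?_ (by positivity)
              nlinarith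
            have d5 : s⁻¹ * (y ^ 2 * ‖v p - v' p‖ ^ 2) ≤ s⁻¹ * (L ^ 2 * ‖v p - v' p‖ ^ 2) := by
              gcongr
            have d6 : 0 ≤ s * (η p ^ 2 * ‖G i p‖ ^ 2) := by positivity
            have d7 : 0 ≤ s⁻¹ * ‖G' i p‖ ^ 2 := by positivity
            have k1 : -(2 * (η p * y * (X - X'))) = 2 * (-y * (η p * X)) + 2 * (y * (η p * X')) := by
              ring
            rw [k1]
            linarith
          have h0 : η p * fderiv ℝ η p (0, 1) * ‖v p - v' p‖ ^ 2 ≤ L * ‖v p - v' p‖ ^ 2 := by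
            gcongr
            calc η p * fderiv ℝ η p (0, 1) ≤ 1 * |fderiv ℝ η p (0, 1)| :=
                  (mul_le_mul_of_nonneg_left (le_abs_self _) (hη0 p)).trans
                    (mul_le_mul_of_nonneg_right (hη1 p) (abs_nonneg _))
              _ ≤ L := by rw [one_mul]; exact hL p
          have hsum := Finset.sum_le_sum fun i (_ : i ∈ Finset.univ) => hi i
          simp only [Finset.sum_add_distrib, Finset.sum_neg_distrib, ← Finset.mul_sum,
            Finset.sum_sub_distrib, Finset.sum_const, Finset.card_univ, nsmul_eq_mul] at hsum ⊢
          nlinarith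
        · simp [image_eq_zero_of_notMem_tsupport hp, indicator_of_notMem hp]
    _ = _ := by
        have j1 := (hint hw1).const_mul (3 * s)
        have j2 := (hK' hw2).const_mul (4 * s⁻¹)
        have j3 := (hK' hw3).const_mul (L + 4 * Fintype.card ι * L ^ 2 * s⁻¹)
        have j12 : Integrable fun p => 3 * s * (η p ^ 2 * ∑ i, (‖F i p‖ ^ 2 + ‖G i p‖ ^ 2))
            + 4 * s⁻¹ * (tsupport η).indicator (fun p => ∑ i, (‖F' i p‖ ^ 2 + ‖G' i p‖ ^ 2)) p :=
          j1.add j2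
        rw [integral_add j12 j3, integral_add j1 j2, integral_const_mul, integral_const_mul,
          integral_const_mul, integral_indicator (isClosed_tsupport η).measurableSet,
          integral_indicator (isClosed_tsupport η).measurableSet]

end Energy

/-! ### L¹ bounds for mollifications and quantitative cutoff functions. -/

section Cutoff

variable {E : Type*} [NormedAddCommGroup E] [NormedSpace ℝ E] [FiniteDimensional ℝ E]
  [MeasureSpace E] [BorelSpace E] [(volume : Measure E).IsAddHaarMeasure]
  {F : Type*} [NormedAddCommGroup F] [NormedSpace ℝ F]

lemma lintegral_mollify_le {a : ℝ} (ha : 0 ≤ a) (ha1 : a ≤ 1) {S S' : Set (E × ℝ)}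
    (h : Nbhd a S S') {f : E × ℝ → F} (hf : AEStronglyMeasurable f) :
    ∫⁻ p in S, ‖mollify a f p‖ₑ ≤ ∫⁻ p in S', ‖f p‖ₑ := by
  have hmeas := aestronglyMeasurable_comp_sub_dil hf a S
  have hκ := (contDiff_profile (E := E)).continuous
  calc ∫⁻ p in S, ‖mollify a f p‖ₑ
      ≤ ∫⁻ p in S, ∫⁻ q, ‖profile E q‖ₑ * ‖f (p - dil a q)‖ₑ := by
        refine lintegral_mono fun p => ?_
        refine (enorm_integral_le_lintegral_enorm _).trans ?_
        simp only [enorm_smul, le_refl]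
    _ = ∫⁻ q, ∫⁻ p in S, ‖profile E q‖ₑ * ‖f (p - dil a q)‖ₑ := by
        rw [lintegral_lintegral_swap]
        exact (hκ.enorm.measurable.aemeasurable.comp_snd).mul hmeas.enorm
    _ ≤ ∫⁻ q, ‖profile E q‖ₑ * ∫⁻ p in S', ‖f p‖ₑ := by
        refine lintegral_mono fun q => ?_
        rw [lintegral_const_mul' _ _ enorm_ne_top]
        by_cases hq : q ∈ tsupport (profile E)
        · refine mul_le_mul_right ?_ _
          exact setLIntegral_sub_le (dil a q)
            (fun p hp => h.sub_dil_mem ha ha1 hp (tsupport_profile.le hq)) fun p => ‖f p‖ₑ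
        · simp [image_eq_zero_of_notMem_tsupport hq]
    _ = _ := by
        rw [lintegral_mul_const _ hκ.enorm.measurable, lintegral_enorm_profile, one_mul]

lemma fderiv_rescale {κ : E × ℝ → ℝ} (hκ : ContDiff ℝ ∞ κ) (a : ℝ) (q w : E × ℝ) :
    fderiv ℝ (rescale κ a) q w = (a ^ homDim E)⁻¹ * fderiv ℝ κ (dil a⁻¹ q) (dil a⁻¹ w) := by
  have h1 := (hκ.differentiable (by simp) (dil a⁻¹ q)).hasFDerivAt.comp q
    (dil (E := E) a⁻¹).hasFDerivAt
  have h2 := (h1.const_mul ((a ^ homDim E)⁻¹)).fderiv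
  change fderiv ℝ (fun q => (a ^ homDim E)⁻¹ * (κ ∘ dil a⁻¹) q) q w = _
  rw [h2]; rfl

/-- For a ≤ 1 the time direction is the worst one, whence the square. -/
lemma norm_dil_inv_le {a : ℝ} (ha : 0 < a) (ha1 : a ≤ 1) (w : E × ℝ) :
    ‖dil a⁻¹ w‖ ≤ (a ^ 2)⁻¹ * ‖w‖ := by
  have hi : 1 ≤ a⁻¹ := (one_le_inv₀ ha).2 ha1
  rw [dil_apply, Prod.norm_mk, norm_smul, norm_mul, Real.norm_of_nonneg (by positivity),
    Real.norm_of_nonneg (by positivity), ← inv_pow]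
  refine max_le ?_ (by gcongr; exact norm_snd_le w)
  have : a⁻¹ ≤ a⁻¹ ^ 2 := by nlinarith
  exact mul_le_mul this (norm_fst_le w) (norm_nonneg _) (by positivity)

lemma norm_fderiv_mollify_le {a : ℝ} (ha : 0 < a) (ha1 : a ≤ 1) {f : E × ℝ → ℝ}
    (hf : LocallyIntegrable f) (hf1 : ∀ p, ‖f p‖ ≤ 1) (p w : E × ℝ) :
    ‖fderiv ℝ (mollify a f) p w‖ ≤ (∫ q, ‖fderiv ℝ (profile E) q‖) * ((a ^ 2)⁻¹ * ‖w‖) := by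
  have hk := contDiff_profile (E := E)
  have hcont : Continuous fun q => fderiv ℝ (rescale (profile E) a) q w :=
    ((contDiff_rescale hk a).continuous_fderiv (by simp)).clm_apply continuous_const
  have hcs : HasCompactSupport fun q => fderiv ℝ (rescale (profile E) a) q w :=
    (hasCompactSupport_rescale tsupport_profile.le ha ha1).fderiv_apply (𝕜 := ℝ) w
  have hint := (hcont.integrable_of_hasCompactSupport (μ := volume) hcs).norm
  have hint' : Integrable fun q => ‖fderiv ℝ (rescale (profile E) a) (p - q) w‖ :=
    hint.comp_sub_left p
  have hcc : Continuous fun q : E × ℝ => ‖fderiv ℝ (profile E) (dil a⁻¹ q)‖ :=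
    ((hk.continuous_fderiv (by simp)).comp (dil a⁻¹).continuous).norm
  have hcc' : HasCompactSupport fun q : E × ℝ => ‖fderiv ℝ (profile E) (dil a⁻¹ q)‖ :=
    ((hasCompactSupport_profile (E := E)).fderiv ℝ).norm.comp_homeomorph
      (dilEquiv a⁻¹ (inv_ne_zero ha.ne')).toHomeomorph
  rw [fderiv_mollify ha ha1 hf, norm_neg]
  calc ‖∫ q, fderiv ℝ (mollKernel a p) q w • f q‖
      ≤ ∫ q, ‖fderiv ℝ (rescale (profile E) a) (p - q) w‖ := by
        refine norm_integral_le_of_norm_le hint' (ae_of_all _ fun q => ?_)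
        rw [norm_smul, fderiv_mollKernel, norm_neg]
        exact mul_le_of_le_one_right (norm_nonneg _) (hf1 q)
    _ = ∫ q, ‖fderiv ℝ (rescale (profile E) a) q w‖ :=
        integral_sub_left_eq_self (fun q => ‖fderiv ℝ (rescale (profile E) a) q w‖) volume p
    _ ≤ ∫ q, (a ^ homDim E)⁻¹ * (‖fderiv ℝ (profile E) (dil a⁻¹ q)‖ * ((a ^ 2)⁻¹ * ‖w‖)) := by
        refine integral_mono hint
          (((hcc.integrable_of_hasCompactSupport hcc').mul_const _).const_mul _) fun q => ?_
        dsimp only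
        rw [fderiv_rescale hk, norm_mul, Real.norm_of_nonneg (by positivity)]
        gcongr
        exact (ContinuousLinearMap.le_opNorm _ _).trans
          (mul_le_mul_of_nonneg_left (norm_dil_inv_le ha ha1 w) (norm_nonneg _))
    _ = _ := by
        rw [integral_const_mul, integral_mul_const,
          integral_comp_dil (inv_pos.2 ha) fun q => ‖fderiv ℝ (profile E) q‖, smul_eq_mul,
          inv_pow, inv_inv, ← mul_assoc, inv_mul_cancel_left₀ (pow_ne_zero _ ha.ne')]

lemma mollify_eq_const {a : ℝ} (ha : 0 ≤ a) (ha1 : a ≤ 1) {f : E × ℝ → F} [CompleteSpace F]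
    {p : E × ℝ} {c : F} (h : ∀ q ∈ closedBall p a, f q = c) : mollify a f p = c := by
  calc mollify a f p = ∫ q, profile E q • c := by
        refine integral_congr_ae (ae_of_all _ fun q => ?_)
        by_cases hq : q ∈ tsupport (profile E)
        · have : p - dil a q ∈ closedBall p a := by
            rw [mem_closedBall, dist_eq_norm, sub_sub_cancel_left, norm_neg]
            exact norm_dil_le_of_mem ha ha1 (tsupport_profile.le hq)
          simp only [h _ this]
        · simp [image_eq_zero_of_notMem_tsupport hq]
    _ = c := by rw [integral_smul_const, integral_profile, one_smul]

/-- Smooth cutoff functions between balls, with derivatives controlled by the gap. -/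
lemma exists_cutoff (E : Type*) [NormedAddCommGroup E] [NormedSpace ℝ E] [FiniteDimensional ℝ E]
    [MeasureSpace E] [BorelSpace E] [(volume : Measure E).IsAddHaarMeasure] :
    ∃ C : ℝ, 1 ≤ C ∧ ∀ (p₀ : E × ℝ) (ρ d : ℝ), 0 < d → d ≤ 1 → ∃ η : E × ℝ → ℝ,
      ContDiff ℝ ∞ η ∧ (∀ p, 0 ≤ η p) ∧ (∀ p, η p ≤ 1) ∧ (∀ p ∈ ball p₀ ρ, η p = 1) ∧
      tsupport η ⊆ closedBall p₀ (ρ + 2 * (d / 8)) ∧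
      ∀ p w, |fderiv ℝ η p w| ≤ C * (d ^ 2)⁻¹ * ‖w‖ := by
  obtain ⟨I, hI⟩ : ∃ I, I = ∫ q, ‖fderiv ℝ (profile E) q‖ := ⟨_, rfl⟩
  have hI0 : 0 ≤ I := hI ▸ integral_nonneg fun _ => norm_nonneg _
  refine ⟨64 * I + 1, by linarith, fun p₀ ρ d hd hd1 => ?_⟩
  -- The cutoff is the indicator of the ball of radius ρ + a mollified at scale a. Its derivative
  -- costs a⁻² = 64 d⁻².
  obtain ⟨a, had⟩ : ∃ a, a = d / 8 := ⟨_, rfl⟩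
  have ha : 0 < a := by rw [had]; positivity
  have ha1 : a ≤ 1 := by linarith
  rw [← had]
  obtain ⟨f, hf⟩ : ∃ f : E × ℝ → ℝ, f = (closedBall p₀ (ρ + a)).indicator fun _ => 1 := ⟨_, rfl⟩
  have hfm : Measurable f := by
    rw [hf]; exact measurable_const.indicator isClosed_closedBall.measurableSet
  have hf0 : ∀ p, 0 ≤ f p := fun p => by
    rw [hf]; exact indicator_nonneg (fun _ _ => zero_le_one) p
  have hf1 : ∀ p, f p ≤ 1 := fun p => by
    rw [hf]; exact indicator_le_self' (fun _ _ => zero_le_one) p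
  have hfn : ∀ p, ‖f p‖ ≤ 1 := fun p => by rw [Real.norm_of_nonneg (hf0 p)]; exact hf1 p
  have hfi : LocallyIntegrable f := (locallyIntegrable_const (1 : ℝ)).mono hfm.aestronglyMeasurable
    (ae_of_all _ fun p => by rw [norm_one]; exact hfn p)
  refine ⟨mollify a f, contDiff_mollify ha ha1 hfi, fun p => ?_, fun p => ?_, fun p hp => ?_, ?_,
    fun p w => ?_⟩
  · exact integral_nonneg fun q => mul_nonneg (profile_nonneg q) (hf0 _)
  · calc mollify a f p ≤ ∫ q, profile E q • (1 : ℝ) := by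
          refine integral_mono (integrable_mollify_integrand ha ha1 hfi p)
            (integrable_profile.smul_const _) fun q => ?_
          exact mul_le_mul_of_nonneg_left (hf1 _) (profile_nonneg q)
      _ = 1 := by rw [integral_smul_const, integral_profile, one_smul]
  · refine mollify_eq_const ha.le ha1 fun q hq => ?_
    rw [hf, indicator_of_mem]
    exact closedBall_subset_closedBall' (by linarith [mem_ball.1 hp]) hq
  · refine closure_minimal (fun p hp => ?_) isClosed_closedBall
    by_contra hn
    refine hp (mollify_eq_const ha.le ha1 fun q hq => ?_)
    rw [hf, indicator_of_notMem]
    intro hB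
    rw [mem_closedBall] at hB hq hn
    rw [dist_comm] at hq
    linarith [dist_triangle p q p₀]
  · rw [← Real.norm_eq_abs]
    refine (norm_fderiv_mollify_le ha ha1 hfi hfn p w).trans ?_
    rw [← hI, ← mul_assoc, had, div_pow, inv_div, div_eq_mul_inv, ← mul_assoc]
    have : 0 ≤ (d ^ 2)⁻¹ := by positivity
    gcongr
    linarith

end Cutoff

/-! ### Absorption by iteration over radii. -/

/-- The standard iteration lemma for absorbing a term on a slightly larger set. -/
lemma exists_iteration_bound (N : ℕ) : ∃ C : ℝ, 0 < C ∧ ∀ (f : ℝ → ℝ) (A B : ℝ), 0 ≤ A →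
    (∀ ρ ∈ Icc (4 : ℝ) 5, f ρ ≤ B) →
    (∀ ρ ρ' : ℝ, 4 ≤ ρ → ρ < ρ' → ρ' ≤ 5 → f ρ ≤ 1 / 2 * f ρ' + A * ((ρ' - ρ) ^ N)⁻¹) →
    f 4 ≤ C * A := by
  -- The radii will be 5 - l^k, with gaps l^k (1 - l). The error at step k grows at most like
  -- (3/2)^k and is multiplied by (1/2)^k, which gives a geometric series of ratio 3/4.
  obtain ⟨l, hl0, hl1, hlN⟩ : ∃ l : ℝ, 0 < l ∧ l < 1 ∧ (l ^ N)⁻¹ ≤ 3 / 2 := by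
    have hc : ContinuousAt (fun l : ℝ => (l ^ N)⁻¹) 1 :=
      (continuousAt_id.pow N).inv₀ (by simp)
    have h1 : ∀ᶠ l in 𝓝[<] (1 : ℝ), (l ^ N)⁻¹ < 3 / 2 := by
      refine (hc.tendsto.mono_left nhdsWithin_le_nhds).eventually_lt_const ?_
      norm_num
    obtain ⟨l, h2, h3, h4⟩ := (h1.and (Ioo_mem_nhdsLT (zero_lt_one (α := ℝ)))).exists
    exact ⟨l, h3, h4, h2.le⟩
  set K := ((1 - l) ^ N)⁻¹ with hK
  have hK0 : 0 < K := by have : 0 < 1 - l := by linarith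
                         positivity
  refine ⟨4 * K, by positivity, fun f A B hA hB h => ?_⟩
  -- The factor 4 is the sum of the geometric series, and 5 - l^0 = 4 starts the induction.
  have key : ∀ k : ℕ, f 4 ≤ (1 / 2) ^ k * f (5 - l ^ k) + 4 * K * A * (1 - (3 / 4) ^ k) := by
    intro k
    induction k with
    | zero => norm_num
    | succ k ih =>
      have hlk : 0 < l ^ k := by positivity
      have hlk1 : l ^ k ≤ 1 := pow_le_one₀ hl0.le hl1.le
      have hgap : (5 - l ^ (k + 1)) - (5 - l ^ k) = l ^ k * (1 - l) := by ring
      have h1 := h (5 - l ^ k) (5 - l ^ (k + 1)) (by linarith)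
        (by nlinarith [pow_succ l k]) (by linarith [pow_pos hl0 (k + 1)])
      rw [hgap, mul_pow, mul_inv, ← pow_mul, mul_comm k N, pow_mul, ← inv_pow] at h1
      have h2 : (l ^ N)⁻¹ ^ k ≤ (3 / 2) ^ k := by gcongr
      have h3 : (1 / 2 : ℝ) ^ k * (3 / 2) ^ k = (3 / 4) ^ k := by rw [← mul_pow]; norm_num
      calc f 4 ≤ _ := ih
        _ ≤ (1 / 2) ^ k * (1 / 2 * f (5 - l ^ (k + 1)) + A * ((3 / 2) ^ k * K))
            + 4 * K * A * (1 - (3 / 4) ^ k) := by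
            gcongr
            refine h1.trans ?_
            gcongr
        _ = (1 / 2) ^ (k + 1) * f (5 - l ^ (k + 1)) + (A * K * ((1 / 2 : ℝ) ^ k * (3 / 2) ^ k)
            + 4 * K * A * (1 - (3 / 4) ^ k)) := by ring
        _ = _ := by rw [h3]; ring
  have hlim : Tendsto (fun k : ℕ => (1 / 2 : ℝ) ^ k * B + 4 * K * A * (1 - (3 / 4) ^ k)) atTop
      (𝓝 (0 * B + 4 * K * A * (1 - 0))) :=
    ((tendsto_pow_atTop_nhds_zero_of_lt_one (by norm_num) (by norm_num)).mul_const B).add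
      ((tendsto_const_nhds.sub (tendsto_pow_atTop_nhds_zero_of_lt_one (by norm_num)
        (by norm_num))).const_mul _)
  have := ge_of_tendsto' hlim fun k => (key k).trans (by
    gcongr
    refine hB _ ⟨?_, ?_⟩
    · linarith [pow_le_one₀ (n := k) hl0.le hl1.le]
    · linarith [pow_pos hl0 k])
  simpa using this

/-! ### Passing to the limit in localized quadratic expressions. -/

section Limit

variable {E : Type*} [NormedAddCommGroup E] [NormedSpace ℝ E] [FiniteDimensional ℝ E]
  [MeasureSpace E] [BorelSpace E] [(volume : Measure E).IsAddHaarMeasure]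

lemma integrable_sq_mul_inner {η : E × ℝ → ℝ} (hη : Continuous η) (hc : HasCompactSupport η)
    (hη1 : ∀ p, η p ^ 2 ≤ 1) {f g : E × ℝ → ℂ} (hf : MemL2Loc f univ) (hg : MemL2Loc g univ) :
    Integrable fun p => η p ^ 2 * inner ℝ (g p) (f p) := by
  have hK := hc.isCompact
  have h1 : Integrable (fun p => inner ℝ (g p) (f p)) (volume.restrict (tsupport η)) := by
    have := (hg _ (subset_univ _) hK).norm.integrable_mul (hf _ (subset_univ _) hK).norm
    refine this.mono' (hg.aestronglyMeasurable.inner hf.aestronglyMeasurable).restrict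
      (ae_of_all _ fun p => norm_inner_le_norm _ _)
  have h2 : IntegrableOn (fun p => η p ^ 2 * inner ℝ (g p) (f p)) (tsupport η) :=
    h1.mono (((hη.pow 2).aestronglyMeasurable.mul
      (hg.aestronglyMeasurable.inner hf.aestronglyMeasurable)).restrict)
      (ae_of_all _ fun p => by
        rw [norm_mul, Real.norm_of_nonneg (sq_nonneg _)]
        exact mul_le_of_le_one_left (norm_nonneg _) (hη1 p))
  refine h2.integrable_of_forall_notMem_eq_zero fun p hp => ?_
  simp [image_eq_zero_of_notMem_tsupport hp]

/-- The difference of the products is expanded bilinearly. Each piece contains a factor tending to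
zero in L² of the support of η, and Cauchy-Schwarz applies. -/
lemma tendsto_integral_sq_mul_inner {η : E × ℝ → ℝ} (hη : Continuous η) (hc : HasCompactSupport η)
    (hη1 : ∀ p, η p ^ 2 ≤ 1) {f g : E × ℝ → ℂ} (hf : MemL2Loc f univ) (hg : MemL2Loc g univ) :
    Tendsto (fun ε => ∫ p, η p ^ 2 * inner ℝ (mollify ε g p) (mollify ε f p)) (𝓝[>] 0)
      (𝓝 (∫ p, η p ^ 2 * inner ℝ (g p) (f p))) := by
  set K := tsupport η
  have hKb : Bornology.IsBounded K := hc.isCompact.isBounded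
  have hKm : MeasurableSet K := (isClosed_tsupport η).measurableSet
  rw [tendsto_iff_edist_tendsto_0]
  set N : (E × ℝ → ℂ) → ℝ≥0∞ := fun w => (∫⁻ p in K, ‖w p‖ₑ ^ 2) ^ (1 / 2 : ℝ) with hN
  have hNtop : ∀ {w}, MemL2Loc w univ → N w ≠ ⊤ := fun hw =>
    ENNReal.rpow_ne_top_of_nonneg (by norm_num) (hw.lintegral_lt_top hKb).ne
  have hNt : ∀ {w}, MemL2Loc w univ →
      Tendsto (fun ε => N fun p => mollify ε w p - w p) (𝓝[>] 0) (𝓝 0) := fun hw => by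
    have := ((ENNReal.continuous_rpow_const (y := (1 / 2 : ℝ))).tendsto 0).comp
      (hw.tendsto_mollify hKb)
    rw [ENNReal.zero_rpow_of_pos (by norm_num)] at this
    exact this
  have hCS : ∀ {w w' : E × ℝ → ℂ}, AEStronglyMeasurable w → AEStronglyMeasurable w' →
      ∫⁻ p in K, ‖w p‖ₑ * ‖w' p‖ₑ ≤ N w * N w' := fun hw hw' => by
    have := ENNReal.lintegral_mul_le_Lp_mul_Lq (volume.restrict K) (p := 2) (q := 2)
      (by constructor <;> norm_num) hw.restrict.enorm hw'.restrict.enorm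
    simp only [ENNReal.rpow_two] at this
    exact this
  have hlim : Tendsto (fun ε => (N fun p => mollify ε g p - g p) * (N fun p => mollify ε f p - f p)
      + (N fun p => mollify ε g p - g p) * N f + N g * N fun p => mollify ε f p - f p) (𝓝[>] 0)
      (𝓝 (0 * 0 + 0 * N f + N g * 0)) :=
    ((ENNReal.Tendsto.mul (hNt hg) (by simp) (hNt hf) (by simp)).add
      (ENNReal.Tendsto.mul_const (hNt hg) (by simp [hNtop hf]))).add
      (ENNReal.Tendsto.const_mul (hNt hf) (by simp [hNtop hg]))
  simp only [mul_zero, zero_mul, add_zero] at hlim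
  refine tendsto_of_tendsto_of_tendsto_of_le_of_le' tendsto_const_nhds hlim
    (Eventually.of_forall fun _ => zero_le) ?_
  filter_upwards [Ioc_mem_nhdsGT one_pos] with ε ⟨hε, hε1⟩
  have hfε := hf.mollify hε hε1
  have hgε := hg.mollify hε hε1
  have hdf := (hfε.aestronglyMeasurable.sub hf.aestronglyMeasurable)
  have hdg := (hgε.aestronglyMeasurable.sub hg.aestronglyMeasurable)
  rw [edist_eq_enorm_sub, ← integral_sub (integrable_sq_mul_inner hη hc hη1 hfε hgε)
    (integrable_sq_mul_inner hη hc hη1 hf hg)]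
  refine (enorm_integral_le_lintegral_enorm _).trans ?_
  calc ∫⁻ p, ‖η p ^ 2 * inner ℝ (mollify ε g p) (mollify ε f p) - η p ^ 2 * inner ℝ (g p) (f p)‖ₑ
      ≤ ∫⁻ p, K.indicator (fun p => ‖mollify ε g p - g p‖ₑ * ‖mollify ε f p - f p‖ₑ
        + ‖mollify ε g p - g p‖ₑ * ‖f p‖ₑ + ‖g p‖ₑ * ‖mollify ε f p - f p‖ₑ) p := by
        refine lintegral_mono fun p => ?_
        by_cases hp : p ∈ K
        · rw [indicator_of_mem hp, ← mul_sub, enorm_mul]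
          have h1 : ‖η p ^ 2‖ₑ ≤ 1 := by
            rw [← ofReal_norm, Real.norm_of_nonneg (sq_nonneg _)]
            exact ENNReal.ofReal_le_one.2 (hη1 p)
          have e1 : inner ℝ (mollify ε g p) (mollify ε f p) - inner ℝ (g p) (f p)
              = inner ℝ (mollify ε g p - g p) (mollify ε f p - f p)
                + inner ℝ (mollify ε g p - g p) (f p)
                + inner ℝ (g p) (mollify ε f p - f p) := by
            simp only [inner_sub_left, inner_sub_right]; ring
          rw [e1]
          refine (mul_le_of_le_one_left zero_le h1).trans ?_
          refine (enorm_add_le _ _).trans (add_le_add ((enorm_add_le _ _).trans (add_le_add ?_ ?_)) ?_)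
          all_goals
            rw [← enorm_mul, ← ofReal_norm, ← ofReal_norm]
            refine ENNReal.ofReal_le_ofReal ?_
            rw [norm_mul]
            exact norm_inner_le_norm _ _
        · have : η p = 0 := image_eq_zero_of_notMem_tsupport hp
          simp [this]
    _ ≤ _ := by
        rw [lintegral_indicator hKm, lintegral_add_left', lintegral_add_left']
        · exact add_le_add (add_le_add (hCS hdg hdf) (hCS hdg hf.aestronglyMeasurable))
            (hCS hg.aestronglyMeasurable hdf)
        · exact (hdg.restrict.enorm).mul hdf.restrict.enorm
        · exact ((hdg.restrict.enorm).mul hdf.restrict.enorm).add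
            (hdg.restrict.enorm.mul hf.aestronglyMeasurable.restrict.enorm)

end Limit

/-! ### Reverse Hölder inequality for the spatial gradient. -/

section Step

variable {E : Type*} [NormedAddCommGroup E] [NormedSpace ℝ E] [FiniteDimensional ℝ E]
  [MeasureSpace E] [BorelSpace E] [(volume : Measure E).IsAddHaarMeasure]
  {ι : Type*} [Fintype ι]

/-- A weak solution whose flux is given by bounded elliptic coefficients, in terms of the
resulting pointwise inequalities. -/
structure EllipticSol (e : ι → E) (Ω : Set (E × ℝ)) (κ M : ℝ) (u : E × ℝ → ℂ)
    (F G : ι → E × ℝ → ℂ) : Prop extends WeakSol e Ω u F G where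
  lower : ∀ p, κ * ∑ i, ‖G i p‖ ^ 2 ≤ ∑ i, inner ℝ (G i p) (F i p)
  upper : ∀ p, ∑ i, ‖F i p‖ ^ 2 ≤ M ^ 2 * ∑ i, ‖G i p‖ ^ 2

lemma norm_le_of_sum_sq_le {f g : ι → ℂ} {M : ℝ} (hM : 0 ≤ M)
    (h : ∑ i, ‖f i‖ ^ 2 ≤ M ^ 2 * ∑ i, ‖g i‖ ^ 2) (i : ι) : ‖f i‖ ≤ M * ∑ j, ‖g j‖ := by
  have h0 : 0 ≤ ∑ j, ‖g j‖ := Finset.sum_nonneg fun _ _ => norm_nonneg _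
  refine le_of_sq_le_sq ?_ (by positivity)
  calc ‖f i‖ ^ 2 ≤ ∑ i, ‖f i‖ ^ 2 :=
        Finset.single_le_sum (f := fun i => ‖f i‖ ^ 2) (fun _ _ => sq_nonneg _) (Finset.mem_univ i)
    _ ≤ M ^ 2 * ∑ i, ‖g i‖ ^ 2 := h
    _ ≤ M ^ 2 * (∑ i, ‖g i‖) ^ 2 := by
        gcongr
        exact Finset.sum_sq_le_sq_sum_of_nonneg fun _ _ => norm_nonneg _
    _ = _ := by ring

lemma MemL2Loc.integrableOn_sq {f : E × ℝ → ℂ} (hf : MemL2Loc f univ) {S : Set (E × ℝ)}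
    (hS : Bornology.IsBounded S) : IntegrableOn (fun p => ‖f p‖ ^ 2) S := by
  refine ⟨(hf.aestronglyMeasurable.norm.pow 2).restrict, ?_⟩
  rw [hasFiniteIntegral_iff_enorm]
  simpa [enorm_pow] using hf.lintegral_lt_top hS

lemma MemL2Loc.integrableOn {f : E × ℝ → ℂ} (hf : MemL2Loc f univ) {S : Set (E × ℝ)}
    (hS : Bornology.IsBounded S) : IntegrableOn f S :=
  (hf.locallyIntegrable.integrableOn_isCompact hS.isCompact_closure).mono_set subset_closure

lemma MemL2Loc.ofReal_setIntegral_sq {f : E × ℝ → ℂ} (hf : MemL2Loc f univ) {S : Set (E × ℝ)}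
    (hS : Bornology.IsBounded S) :
    ENNReal.ofReal (∫ p in S, ‖f p‖ ^ 2) = ∫⁻ p in S, ‖f p‖ₑ ^ 2 := by
  rw [ofReal_integral_eq_lintegral_ofReal (hf.integrableOn_sq hS)
    (ae_of_all _ fun p => sq_nonneg _)]
  simp only [ENNReal.ofReal_pow (norm_nonneg _), ofReal_norm]

/-- The source of the L¹ means: the outer mollification at the fixed scale δ turns an L¹ norm into a
pointwise bound. The inner one at scale ε does not increase the L¹ norm, so the bound is uniform in
ε. -/
lemma norm_mollify_mollify_le {C : ℝ} (hC : ∀ {a : ℝ}, 0 < a → a ≤ 1 →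
      ∀ (f : E × ℝ → ℂ) (p : E × ℝ), ‖mollify a f p‖ₑ ≤
        ENNReal.ofReal (C * (a ^ homDim E)⁻¹) * ∫⁻ q in closedBall p a, ‖f q‖ₑ) (hC0 : 0 < C)
    {f : E × ℝ → ℂ} (hf : AEStronglyMeasurable f) {δ ε A : ℝ} (hδ : 0 < δ) (hδ1 : δ ≤ 1)
    (hε : 0 < ε) (hε1 : ε ≤ 1) {p : E × ℝ} {B : Set (E × ℝ)} (hB : closedBall p (δ + ε) ⊆ B)
    (hA0 : 0 ≤ A) (hA : ∫⁻ q in B, ‖f q‖ₑ ≤ ENNReal.ofReal A) :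
    ‖mollify δ (mollify ε f) p‖ ≤ C * (δ ^ homDim E)⁻¹ * A := by
  rw [← ENNReal.ofReal_le_ofReal_iff (by positivity), ENNReal.ofReal_mul (by positivity),
    ofReal_norm]
  refine (hC hδ hδ1 _ p).trans (mul_le_mul_right ?_ _)
  refine (lintegral_mollify_le hε.le hε1 (fun q hq => ?_) hf).trans hA
  exact (closedBall_subset_closedBall' (by linarith [mem_closedBall.1 hq])).trans hB

lemma setIntegral_sum_sq_le_of_norm_le {f g : ι → E × ℝ → ℂ} {S : Set (E × ℝ)} {a b V : ℝ}
    (hV : volume S ≤ ENNReal.ofReal V) (hV0 : 0 ≤ V)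
    (hf : ∀ p ∈ S, ∀ i, ‖f i p‖ ≤ a) (hg : ∀ p ∈ S, ∀ i, ‖g i p‖ ≤ b) :
    ∫ p in S, ∑ i, (‖f i p‖ ^ 2 + ‖g i p‖ ^ 2) ≤ Fintype.card ι * (a ^ 2 + b ^ 2) * V := by
  have h1 := norm_setIntegral_le_of_norm_le_const (μ := volume) (s := S)
    (f := fun p => ∑ i, (‖f i p‖ ^ 2 + ‖g i p‖ ^ 2)) (C := Fintype.card ι * (a ^ 2 + b ^ 2))
    (hV.trans_lt ENNReal.ofReal_lt_top) fun p hp => by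
      rw [Real.norm_of_nonneg (by positivity)]
      refine (Finset.sum_le_sum (g := fun _ => a ^ 2 + b ^ 2) fun i _ => ?_).trans_eq (by simp; ring)
      have := hf p hp i
      have := hg p hp i
      gcongr
  refine (le_abs_self _).trans (h1.trans ?_)
  refine mul_le_mul_of_nonneg_left ?_ (by positivity)
  exact ENNReal.toReal_le_of_le_ofReal hV0 hV

lemma setIntegral_sq_sub_mollify_le {e : ι → E} {C : ℝ≥0}
    (hC : ∀ {S S' : Set (E × ℝ)} {v : E × ℝ → ℂ} {F G : ι → E × ℝ → ℂ} {δ : ℝ},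
      0 < δ → δ ≤ 1 → MeasurableSet S → Nbhd δ S S' → SmoothSol e S' v F G →
      ∫⁻ p in S, ‖v p - mollify δ v p‖ₑ ^ 2 ≤
        C * ENNReal.ofReal δ ^ 2 * ∑ i, ∫⁻ p in S', (‖G i p‖ₑ ^ 2 + ‖F i p‖ₑ ^ 2))
    {Ω : Set (E × ℝ)} {κ M : ℝ} {u : E × ℝ → ℂ} {F G : ι → E × ℝ → ℂ}
    (h : EllipticSol e Ω κ M u F G) {ε δ : ℝ} (hε : 0 < ε) (hε1 : ε ≤ 1) (hδ : 0 < δ) (hδ1 : δ ≤ 1)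
    {S S₁ S₂ : Set (E × ℝ)} (hS : MeasurableSet S) (h1 : Nbhd δ S S₁) (h2 : Nbhd ε S₁ S₂)
    (h2Ω : S₂ ⊆ Ω) (hb : Bornology.IsBounded S₂) :
    ∫ p in S, ‖mollify ε u p - mollify δ (mollify ε u) p‖ ^ 2 ≤
      C * δ ^ 2 * ((1 + M ^ 2) * ∫ p in S₂, ∑ i, ‖G i p‖ ^ 2) := by
  have hv : SmoothSol e S₁ _ _ _ :=
    h.toWeakSol.smoothSol hε hε1 fun p hp => (h2 p hp).trans h2Ω
  have hSb : Bornology.IsBounded S := hb.subset ((h1.subset hδ.le).trans (h2.subset hε.le))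
  have hm : MemL2Loc (fun p => mollify ε u p - mollify δ (mollify ε u) p) univ :=
    (hv.smooth.sub (contDiff_mollify hδ hδ1 hv.smooth.continuous.locallyIntegrable)).continuous.memL2Loc
  have hGi := fun i => (h.memL2_grad i).integrableOn_sq hb
  have hFi := fun i => (h.memL2_flux i).integrableOn_sq hb
  have hsum : ∑ i, ((∫ p in S₂, ‖G i p‖ ^ 2) + ∫ p in S₂, ‖F i p‖ ^ 2) ≤
      (1 + M ^ 2) * ∫ p in S₂, ∑ i, ‖G i p‖ ^ 2 := by
    rw [Finset.sum_add_distrib, ← integral_finsetSum _ fun i _ => hGi i,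
      ← integral_finsetSum _ fun i _ => hFi i, add_mul, one_mul, ← integral_const_mul]
    refine add_le_add le_rfl (integral_mono (integrable_finsetSum _ fun i _ => hFi i)
      ((integrable_finsetSum _ fun i _ => hGi i).const_mul _) fun p => h.upper p)
  have hn : 0 ≤ ∫ p in S₂, ∑ i, ‖G i p‖ ^ 2 :=
    integral_nonneg fun p => Finset.sum_nonneg fun _ _ => sq_nonneg _
  rw [← ENNReal.ofReal_le_ofReal_iff (by positivity), hm.ofReal_setIntegral_sq hSb]
  refine (hC hδ hδ1 hS h1 hv).trans ?_
  rw [ENNReal.ofReal_mul (by positivity), ENNReal.ofReal_mul (by positivity),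
    ENNReal.ofReal_coe_nnreal, ENNReal.ofReal_pow hδ.le]
  refine mul_le_mul_right (le_trans ?_ (ENNReal.ofReal_le_ofReal hsum)) _
  rw [ENNReal.ofReal_sum_of_nonneg fun i _ => by positivity]
  refine Finset.sum_le_sum fun i _ => ?_
  rw [ENNReal.ofReal_add (by positivity) (by positivity),
    (h.memL2_grad i).ofReal_setIntegral_sq hb, (h.memL2_flux i).ofReal_setIntegral_sq hb,
    lintegral_add_left (((hv.smooth_grad i).continuous.enorm.measurable).pow_const 2)]
  exact add_le_add (lintegral_mollify_sq_le hε.le hε1 h2 (h.memL2_grad i).aestronglyMeasurable)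
    (lintegral_mollify_sq_le hε.le hε1 h2 (h.memL2_flux i).aestronglyMeasurable)

/-- The energy inequality in the limit of vanishing mollification. -/
lemma EllipticSol.integral_sq_mul_le {e : ι → E} {Ω : Set (E × ℝ)} {κ M : ℝ} {u : E × ℝ → ℂ}
    {F G : ι → E × ℝ → ℂ} (h : EllipticSol e Ω κ M u F G) {η : E × ℝ → ℝ} (hη : Continuous η)
    (hc : HasCompactSupport η) (hη1 : ∀ p, η p ^ 2 ≤ 1) {s R : ℝ} (hs0 : 0 ≤ s)
    (hs : 3 * s * (1 + M ^ 2) ≤ κ / 2)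
    (hR : ∀ᶠ ε in 𝓝[>] (0 : ℝ), ∫ p, η p ^ 2 * ∑ i, inner ℝ (mollify ε (G i) p) (mollify ε (F i) p) ≤
      3 * s * (∫ p, η p ^ 2 * ∑ i, (‖mollify ε (F i) p‖ ^ 2 + ‖mollify ε (G i) p‖ ^ 2)) + R) :
    κ / 2 * ∫ p, η p ^ 2 * ∑ i, ‖G i p‖ ^ 2 ≤ R := by
  have hF := h.memL2_flux
  have hG := h.memL2_grad
  have hint : ∀ {f g : ι → E × ℝ → ℂ}, (∀ i, MemL2Loc (f i) univ) → (∀ i, MemL2Loc (g i) univ) →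
      ∀ i, Integrable fun p => η p ^ 2 * inner ℝ (g i p) (f i p) := fun hf hg i =>
    integrable_sq_mul_inner hη hc hη1 (hf i) (hg i)
  have hsum : ∀ {f g : ι → E × ℝ → ℂ}, (∀ i, MemL2Loc (f i) univ) → (∀ i, MemL2Loc (g i) univ) →
      ∫ p, η p ^ 2 * ∑ i, inner ℝ (g i p) (f i p)
        = ∑ i, ∫ p, η p ^ 2 * inner ℝ (g i p) (f i p) := fun hf hg => by
    simp only [Finset.mul_sum]
    exact integral_finsetSum _ fun i _ => hint hf hg i
  have hsum2 : ∀ {f g : ι → E × ℝ → ℂ}, (∀ i, MemL2Loc (f i) univ) → (∀ i, MemL2Loc (g i) univ) →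
      ∫ p, η p ^ 2 * ∑ i, (‖f i p‖ ^ 2 + ‖g i p‖ ^ 2)
        = (∑ i, ∫ p, η p ^ 2 * inner ℝ (f i p) (f i p))
          + ∑ i, ∫ p, η p ^ 2 * inner ℝ (g i p) (g i p) := fun hf hg => by
    rw [← hsum hf hf, ← hsum hg hg, ← integral_add]
    · simp only [Finset.sum_add_distrib, mul_add, real_inner_self_eq_norm_sq]
    · simp only [Finset.mul_sum]; exact integrable_finsetSum _ fun i _ => hint hf hf i
    · simp only [Finset.mul_sum]; exact integrable_finsetSum _ fun i _ => hint hg hg i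
  have hlim : ∀ {f g : ι → E × ℝ → ℂ}, (∀ i, MemL2Loc (f i) univ) → (∀ i, MemL2Loc (g i) univ) →
      Tendsto (fun ε => ∑ i, ∫ p, η p ^ 2 * inner ℝ (mollify ε (g i) p) (mollify ε (f i) p)) (𝓝[>] 0)
        (𝓝 (∑ i, ∫ p, η p ^ 2 * inner ℝ (g i p) (f i p))) := fun hf hg =>
    tendsto_finsetSum _ fun i _ => tendsto_integral_sq_mul_inner hη hc hη1 (hf i) (hg i)
  -- The limit ε → 0 comes before the use of ellipticity: the pointwise inequalities between F and G
  -- hold for the functions themselves, not for their mollifications.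
  have key := le_of_tendsto_of_tendsto (hlim hF hG)
    ((((hlim hF hF).add (hlim hG hG)).const_mul (3 * s)).add_const R) (by
      filter_upwards [hR, Ioc_mem_nhdsGT (zero_lt_one (α := ℝ))] with ε hε ⟨hε0, hε1⟩
      rw [hsum (f := fun i => ParabolicRH.mollify ε (F i)) (g := fun i => ParabolicRH.mollify ε (G i))
          (fun i => (hF i).mollify hε0 hε1) fun i => (hG i).mollify hε0 hε1,
        hsum2 (f := fun i => ParabolicRH.mollify ε (F i)) (g := fun i => ParabolicRH.mollify ε (G i))
          (fun i => (hF i).mollify hε0 hε1) fun i => (hG i).mollify hε0 hε1] at hε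
      exact hε)
  rw [← hsum hF hG, ← hsum2 hF hG] at key
  have hiGG : Integrable fun p => η p ^ 2 * ∑ i, ‖G i p‖ ^ 2 := by
    simp only [Finset.mul_sum]
    refine integrable_finsetSum _ fun i _ => ?_
    simpa only [real_inner_self_eq_norm_sq] using hint hG hG i
  have hiFF : Integrable fun p => η p ^ 2 * ∑ i, ‖F i p‖ ^ 2 := by
    simp only [Finset.mul_sum]
    refine integrable_finsetSum _ fun i _ => ?_
    simpa only [real_inner_self_eq_norm_sq] using hint hF hF i
  -- Of the coercive term κ, one half is spent on the contribution 3 s (1 + M²), so κ/2 remains.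
  have k1 : κ * ∫ p, η p ^ 2 * ∑ i, ‖G i p‖ ^ 2 ≤ ∫ p, η p ^ 2 * ∑ i, inner ℝ (G i p) (F i p) := by
    rw [← integral_const_mul]
    refine integral_mono (hiGG.const_mul _) ?_ fun p => ?_
    · simp only [Finset.mul_sum]; exact integrable_finsetSum _ fun i _ => hint hF hG i
    · have := mul_le_mul_of_nonneg_left (h.lower p) (sq_nonneg (η p))
      dsimp only; linarith
  have k2 : ∫ p, η p ^ 2 * ∑ i, (‖F i p‖ ^ 2 + ‖G i p‖ ^ 2) ≤
      (1 + M ^ 2) * ∫ p, η p ^ 2 * ∑ i, ‖G i p‖ ^ 2 := by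
    rw [← integral_const_mul]
    refine integral_mono ?_ (hiGG.const_mul _) fun p => ?_
    · simp only [Finset.sum_add_distrib, mul_add]; exact hiFF.add hiGG
    · have := mul_le_mul_of_nonneg_left (h.upper p) (sq_nonneg (η p))
      simp only [Finset.sum_add_distrib]; linarith
  have hn : 0 ≤ ∫ p, η p ^ 2 * ∑ i, ‖G i p‖ ^ 2 := integral_nonneg fun p => by positivity
  nlinarith [mul_le_mul_of_nonneg_left k2 (by positivity : 0 ≤ 3 * s)]

set_option maxHeartbeats 1000000 in
/-- Caccioppoli type inequality comparing a solution with its own mollification. -/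
lemma exists_gradient_step (e : ι → E) (ℓ : ι → E →L[ℝ] ℝ) (hℓ : ∀ Y, ∑ i, ℓ i Y • e i = Y)
    {κ M : ℝ} (hκ : 0 < κ) (hM : 0 < M) :
    ∃ K : ℝ, 0 ≤ K ∧ ∀ {Ω : Set (E × ℝ)} {u : E × ℝ → ℂ} {F G : ι → E × ℝ → ℂ},
      EllipticSol e Ω κ M u F G → ∀ p₀ : E × ℝ, closedBall p₀ 6 ⊆ Ω → ∀ ρ ρ' : ℝ,
      4 ≤ ρ → ρ < ρ' → ρ' ≤ 5 →
      ∫ p in ball p₀ ρ, ∑ i, ‖G i p‖ ^ 2 ≤ 1 / 2 * (∫ p in ball p₀ ρ', ∑ i, ‖G i p‖ ^ 2) +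
        K * (∫ p in closedBall p₀ 6, ∑ i, ‖G i p‖) ^ 2 *
          ((ρ' - ρ) ^ (4 * homDim E))⁻¹ := by
  obtain ⟨C₁, hC₁0, hC₁⟩ := exists_enorm_mollify_le E
  obtain ⟨C₂, hC₂1, hcut⟩ := exists_cutoff E
  obtain ⟨C₃, hC₃⟩ := exists_lintegral_sub_mollify_sq_le e ℓ hℓ
  obtain ⟨V, hV⟩ : ∃ V : ℝ, V = (volume (closedBall (0 : E × ℝ) 6)).toReal := ⟨_, rfl⟩
  have hV0 : 0 ≤ V := hV ▸ ENNReal.toReal_nonneg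
  obtain ⟨c, hc⟩ : ∃ c : ℝ, c = Fintype.card ι := ⟨_, rfl⟩
  have hc0 : 0 ≤ c := hc ▸ Nat.cast_nonneg _
  obtain ⟨CL, hCL⟩ : ∃ CL : ℝ, CL = C₂ * (1 + ∑ i, ‖e i‖) := ⟨_, rfl⟩
  have hsum0 : 0 ≤ ∑ i, ‖e i‖ := Finset.sum_nonneg fun _ _ => norm_nonneg _
  have hCL0 : 0 < CL := by rw [hCL]; positivity
  obtain ⟨s, hs⟩ : ∃ s : ℝ, s = min 1 (κ / (6 * (1 + M ^ 2))) := ⟨_, rfl⟩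
  have hs0 : 0 < s := by rw [hs]; positivity
  have hs1 : s ≤ 1 := hs ▸ min_le_left _ _
  have hsκ : 3 * s * (1 + M ^ 2) ≤ κ / 2 := by
    have h1 : s ≤ κ / (6 * (1 + M ^ 2)) := hs ▸ min_le_right _ _
    rw [le_div_iff₀ (by positivity)] at h1
    linarith
  obtain ⟨K₀, hK₀⟩ : ∃ K₀ : ℝ, K₀ = CL + 4 * c * CL ^ 2 * s⁻¹ := ⟨_, rfl⟩
  have hK₀0 : 0 ≤ K₀ := by rw [hK₀]; positivity
  obtain ⟨X, hX⟩ : ∃ X : ℝ, X = K₀ * C₃ * (1 + M ^ 2) := ⟨_, rfl⟩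
  have hX0 : 0 ≤ X := by rw [hX]; positivity
  -- X b² will be the coefficient of the gradient on the larger ball. Keeping it below κ/4, half of
  -- the coercivity κ/2, yields the factor 1/2 of the iteration. The bound 1/8 makes δ at most d/8.
  obtain ⟨b, hb⟩ : ∃ b : ℝ, b = min (1 / 8) (κ / (4 * (X + 1))) := ⟨_, rfl⟩
  have hb0 : 0 < b := by rw [hb]; positivity
  have hb8 : b ≤ 1 / 8 := hb ▸ min_le_left _ _
  have hbX : X * b ^ 2 ≤ κ / 4 := by
    have h1 : b ≤ κ / (4 * (X + 1)) := hb ▸ min_le_right _ _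
    rw [le_div_iff₀ (by positivity)] at h1
    have h2 : b ^ 2 ≤ b := by nlinarith
    nlinarith
  refine ⟨2 / κ * (4 * s⁻¹ * (c * (1 + M ^ 2) * C₁ ^ 2 * ((b ^ homDim E)⁻¹) ^ 2 * V)),
    by positivity, fun {Ω u F G} h p₀ hΩ ρ ρ' hρ hρρ' hρ' => ?_⟩
  obtain ⟨d, hd⟩ : ∃ d, d = ρ' - ρ := ⟨_, rfl⟩
  have hd0 : 0 < d := by linarith
  have hd1 : d ≤ 1 := by linarith
  obtain ⟨η, hη, hη0, hη1, hηρ, hηS, hηL⟩ := hcut p₀ ρ d hd0 hd1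
  have hηc : HasCompactSupport η := hasCompactSupport_of_tsupport_subset_closedBall hηS
  -- The square of a derivative of the cutoff is of order d⁻⁴ and the squared distance to the
  -- mollification is of order δ². With this δ the powers of d cancel and b² is left.
  obtain ⟨δ, hδ⟩ : ∃ δ, δ = b * d ^ 2 := ⟨_, rfl⟩
  have hδ0 : 0 < δ := by rw [hδ]; positivity
  have hδd : δ ≤ d / 8 := by rw [hδ]; nlinarith
  have hδ1 : δ ≤ 1 := by linarith
  obtain ⟨A, hA⟩ : ∃ A, A = ∫ p in closedBall p₀ 6, ∑ i, ‖G i p‖ := ⟨_, rfl⟩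
  have hA0 : 0 ≤ A := hA ▸ integral_nonneg fun p => Finset.sum_nonneg fun _ _ => norm_nonneg _
  obtain ⟨I', hI'⟩ : ∃ I', I' = ∫ p in ball p₀ ρ', ∑ i, ‖G i p‖ ^ 2 := ⟨_, rfl⟩
  rw [← hA, ← hd, ← hI']
  have hI'0 : 0 ≤ I' := hI' ▸ integral_nonneg fun p => Finset.sum_nonneg fun _ _ => sq_nonneg _
  have hAint : IntegrableOn (fun p => ∑ i, ‖G i p‖) (closedBall p₀ 6) :=
    integrable_finsetSum _ fun i _ => ((h.memL2_grad i).integrableOn isBounded_closedBall).norm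
  have hAe : ∫⁻ p in closedBall p₀ 6, ENNReal.ofReal (∑ i, ‖G i p‖) = ENNReal.ofReal A := by
    rw [hA, ofReal_integral_eq_lintegral_ofReal hAint
      (ae_of_all _ fun p => Finset.sum_nonneg fun _ _ => norm_nonneg _)]
  have hGA : ∀ i, ∫⁻ p in closedBall p₀ 6, ‖G i p‖ₑ ≤ ENNReal.ofReal A := fun i => by
    rw [← hAe]
    refine lintegral_mono fun p => ?_
    rw [← ofReal_norm]
    exact ENNReal.ofReal_le_ofReal (Finset.single_le_sum (f := fun i => ‖G i p‖)
      (fun _ _ => norm_nonneg _) (Finset.mem_univ i))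
  have hFA : ∀ i, ∫⁻ p in closedBall p₀ 6, ‖F i p‖ₑ ≤ ENNReal.ofReal (M * A) := fun i => by
    rw [ENNReal.ofReal_mul hM.le, ← hAe, ← lintegral_const_mul' _ _ ENNReal.ofReal_ne_top]
    refine lintegral_mono fun p => ?_
    rw [← ofReal_norm, ← ENNReal.ofReal_mul hM.le]
    exact ENNReal.ofReal_le_ofReal (norm_le_of_sum_sq_le hM.le (h.upper p) i)
  -- Bookkeeping of radii in steps of d/8: two for the cutoff, one for δ, one for ε, which stays
  -- inside the ball of radius ρ' = ρ + d.
  have hn1 : Nbhd δ (tsupport η) (closedBall p₀ (ρ + 3 * (d / 8))) := fun p hp =>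
    closedBall_subset_closedBall' (by linarith [mem_closedBall.1 (hηS hp)])
  have hn2 : ∀ ε ≤ d / 8, Nbhd ε (closedBall p₀ (ρ + 3 * (d / 8))) (ball p₀ ρ') := fun ε hε p hp =>
    closedBall_subset_ball' (by linarith [mem_closedBall.1 hp])
  have hρ'6 : ball p₀ ρ' ⊆ closedBall p₀ 6 :=
    (ball_subset_ball (by linarith)).trans ball_subset_closedBall
  have hVS : volume (tsupport η) ≤ ENNReal.ofReal V := by
    rw [hV, ENNReal.ofReal_toReal measure_closedBall_lt_top.ne]
    refine (measure_mono (hηS.trans (closedBall_subset_closedBall (by linarith)))).trans_eq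
      (Measure.addHaar_closedBall_center _ _ _)
  have hLe : ∀ w : E × ℝ, ‖w‖ ≤ 1 + ∑ i, ‖e i‖ → ∀ p, |fderiv ℝ η p w| ≤ CL * (d ^ 2)⁻¹ :=
    fun w hw p => by
      refine (hηL p w).trans ?_
      rw [hCL, mul_right_comm]
      gcongr
  have hR : κ / 2 * ∫ p, η p ^ 2 * ∑ i, ‖G i p‖ ^ 2 ≤
      4 * s⁻¹ * (c * ((C₁ * (δ ^ homDim E)⁻¹ * (M * A)) ^ 2 + (C₁ * (δ ^ homDim E)⁻¹ * A) ^ 2) * V)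
        + K₀ * ((d ^ 2)⁻¹) ^ 2 * (C₃ * δ ^ 2 * ((1 + M ^ 2) * I')) := by
    refine h.integral_sq_mul_le hη.continuous hηc (fun p => pow_le_one₀ (hη0 p) (hη1 p)) hs0.le
      hsκ ?_
    filter_upwards [Ioc_mem_nhdsGT (by positivity : (0 : ℝ) < d / 8)] with ε ⟨hε0, hεd⟩
    have hε1 : ε ≤ 1 := by linarith
    have hv : SmoothSol e _ _ _ _ := h.toWeakSol.smoothSol hε0 hε1
      (Ω' := closedBall p₀ (ρ + 3 * (d / 8)))
      fun p hp => (hn2 ε hεd p hp).trans (hρ'6.trans hΩ)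
    have hv' := hv.mollify hδ0 hδ1 hn1
    have key := (hv.mono (hn1.subset hδ0.le)).energy_le hv' hη hηc subset_rfl hη0 hη1
      (L := CL * (d ^ 2)⁻¹)
      (hLe _ (by
        rw [Prod.norm_mk, norm_zero, norm_one, max_eq_right zero_le_one]; linarith))
      (fun p i => hLe _ (by
        rw [Prod.norm_mk, norm_zero, max_eq_left (norm_nonneg _)]
        exact (Finset.single_le_sum (f := fun i => ‖e i‖) (fun _ _ => norm_nonneg _)
          (Finset.mem_univ i)).trans (by linarith)) p) hs0 hs1
    have hsub : ∀ p ∈ tsupport η, closedBall p (δ + ε) ⊆ closedBall p₀ 6 := fun p hp =>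
      closedBall_subset_closedBall' (by linarith [mem_closedBall.1 (hηS hp)])
    have t2 := setIntegral_sum_sq_le_of_norm_le (S := tsupport η)
      (f := fun i => mollify δ (mollify ε (F i))) (g := fun i => mollify δ (mollify ε (G i))) hVS hV0
      (fun p hp i => norm_mollify_mollify_le hC₁ hC₁0 (h.memL2_flux i).aestronglyMeasurable hδ0 hδ1
        hε0 hε1 (hsub p hp) (by positivity) (hFA i))
      (fun p hp i => norm_mollify_mollify_le hC₁ hC₁0 (h.memL2_grad i).aestronglyMeasurable hδ0 hδ1
        hε0 hε1 (hsub p hp) hA0 (hGA i))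
    have t3 := setIntegral_sq_sub_mollify_le hC₃ h hε0 hε1 hδ0 hδ1
      (isClosed_tsupport η).measurableSet hn1 (hn2 ε hεd) (hρ'6.trans hΩ) isBounded_ball
    rw [← hI'] at t3
    -- Since d ≤ 1, the term linear in d⁻² is dominated by d⁻⁴.
    have hK : CL * (d ^ 2)⁻¹ + 4 * Fintype.card ι * (CL * (d ^ 2)⁻¹) ^ 2 * s⁻¹
        ≤ K₀ * ((d ^ 2)⁻¹) ^ 2 := by
      have h1 : 1 ≤ (d ^ 2)⁻¹ := (one_le_inv₀ (by positivity)).2 (pow_le_one₀ hd0.le hd1)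
      have h2 : (d ^ 2)⁻¹ ≤ ((d ^ 2)⁻¹) ^ 2 := le_self_pow₀ h1 two_ne_zero
      have h3 := mul_le_mul_of_nonneg_left h2 hCL0.le
      rw [hK₀, ← hc]
      linear_combination h3
    rw [← hc] at t2
    refine key.trans ?_
    rw [add_assoc]
    refine add_le_add le_rfl (add_le_add (mul_le_mul_of_nonneg_left t2 (by positivity)) ?_)
    refine mul_le_mul hK t3 (integral_nonneg fun p => sq_nonneg _) (by positivity)
  have hρη : ∫ p in ball p₀ ρ, ∑ i, ‖G i p‖ ^ 2 ≤ ∫ p, η p ^ 2 * ∑ i, ‖G i p‖ ^ 2 := by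
    rw [← integral_indicator isOpen_ball.measurableSet]
    refine integral_mono ?_ ?_ fun p => ?_
    · have hi : IntegrableOn (fun p => ∑ i, ‖G i p‖ ^ 2) (ball p₀ ρ) :=
        integrable_finsetSum _ fun i _ => (h.memL2_grad i).integrableOn_sq isBounded_ball
      exact hi.integrable_indicator isOpen_ball.measurableSet
    · simp only [Finset.mul_sum]
      refine integrable_finsetSum _ fun i _ => ?_
      simpa only [real_inner_self_eq_norm_sq] using integrable_sq_mul_inner hη.continuous hηc
        (fun p => pow_le_one₀ (hη0 p) (hη1 p)) (h.memL2_grad i) (h.memL2_grad i)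
    · by_cases hp : p ∈ ball p₀ ρ
      · rw [indicator_of_mem hp, hηρ p hp]; simp
      · rw [indicator_of_notMem hp]; positivity
  -- The pointwise bound at scale δ enters squared, which explains the exponent 4 `homDim E` of the
  -- gap.
  have hδpow : (δ ^ homDim E)⁻¹ = (b ^ homDim E)⁻¹ * (d ^ (2 * homDim E))⁻¹ := by
    rw [hδ, mul_pow, mul_inv, pow_mul]
  have hlast : K₀ * ((d ^ 2)⁻¹) ^ 2 * (C₃ * δ ^ 2 * ((1 + M ^ 2) * I')) ≤ κ / 4 * I' := by
    have : K₀ * ((d ^ 2)⁻¹) ^ 2 * (C₃ * δ ^ 2 * ((1 + M ^ 2) * I')) = X * b ^ 2 * I' := by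
      rw [hδ, hX]; field_simp
    rw [this]
    gcongr
  have h4 : (d ^ (4 * homDim E))⁻¹ = ((d ^ (2 * homDim E))⁻¹) ^ 2 := by
    rw [← inv_pow, ← inv_pow, ← pow_mul]; congr 1; ring
  have hfin : κ / 2 * ∫ p in ball p₀ ρ, ∑ i, ‖G i p‖ ^ 2 ≤ 4 * s⁻¹ * (c * (1 + M ^ 2) * C₁ ^ 2 *
      ((b ^ homDim E)⁻¹) ^ 2 * V) * A ^ 2 * (d ^ (4 * homDim E))⁻¹ + κ / 4 * I' := by
    refine (mul_le_mul_of_nonneg_left hρη (by positivity)).trans (hR.trans ?_)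
    refine add_le_add (le_of_eq ?_) hlast
    rw [hδpow, h4]; ring
  calc _ = 2 / κ * (κ / 2 * ∫ p in ball p₀ ρ, ∑ i, ‖G i p‖ ^ 2) := by field_simp
    _ ≤ _ := mul_le_mul_of_nonneg_left hfin (by positivity)
    _ = _ := by field_simp; ring

/-- Local reverse Hölder inequality for the spatial gradient of a solution. -/
theorem exists_gradient_reverse_holder (e : ι → E) (ℓ : ι → E →L[ℝ] ℝ)
    (hℓ : ∀ Y, ∑ i, ℓ i Y • e i = Y) {κ M : ℝ} (hκ : 0 < κ) (hM : 0 < M) :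
    ∃ C : ℝ≥0, ∀ {Ω : Set (E × ℝ)} {u : E × ℝ → ℂ} {F G : ι → E × ℝ → ℂ},
      EllipticSol e Ω κ M u F G → ∀ p₀ : E × ℝ, closedBall p₀ 6 ⊆ Ω →
      ∫⁻ p in ball p₀ 4, ∑ i, ‖G i p‖ₑ ^ 2 ≤ C * (∫⁻ p in closedBall p₀ 6, ∑ i, ‖G i p‖ₑ) ^ 2 := by
  obtain ⟨K, hK0, hK⟩ := exists_gradient_step e ℓ hℓ hκ hM
  obtain ⟨C, hC0, hC⟩ := exists_iteration_bound (4 * homDim E)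
  refine ⟨(C * K).toNNReal, fun {Ω u F G} h p₀ hΩ => ?_⟩
  have hn : ∀ p, 0 ≤ ∑ i, ‖G i p‖ ^ 2 := fun p => Finset.sum_nonneg fun _ _ => sq_nonneg _
  have hint : ∀ S : Set (E × ℝ), Bornology.IsBounded S →
      IntegrableOn (fun p => ∑ i, ‖G i p‖ ^ 2) S := fun S hS =>
    integrable_finsetSum _ fun i _ => (h.memL2_grad i).integrableOn_sq hS
  have hint1 : IntegrableOn (fun p => ∑ i, ‖G i p‖) (closedBall p₀ 6) :=
    integrable_finsetSum _ fun i _ => ((h.memL2_grad i).integrableOn isBounded_closedBall).norm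
  have key := hC (fun ρ => ∫ p in ball p₀ ρ, ∑ i, ‖G i p‖ ^ 2)
    (K * (∫ p in closedBall p₀ 6, ∑ i, ‖G i p‖) ^ 2) (∫ p in ball p₀ 5, ∑ i, ‖G i p‖ ^ 2)
    (by positivity)
    (fun ρ hρ => setIntegral_mono_set (hint _ isBounded_ball) (ae_of_all _ hn)
      (ball_subset_ball hρ.2).eventuallyLE)
    (fun ρ ρ' h1 h2 h3 => hK h p₀ hΩ ρ ρ' h1 h2 h3)
  have e1 : ∫⁻ p in ball p₀ 4, ∑ i, ‖G i p‖ₑ ^ 2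
      = ENNReal.ofReal (∫ p in ball p₀ 4, ∑ i, ‖G i p‖ ^ 2) := by
    rw [ofReal_integral_eq_lintegral_ofReal (hint _ isBounded_ball) (ae_of_all _ hn)]
    refine lintegral_congr fun p => ?_
    rw [ENNReal.ofReal_sum_of_nonneg fun i _ => sq_nonneg _]
    simp only [ENNReal.ofReal_pow (norm_nonneg _), ofReal_norm]
  have e2 : ∫⁻ p in closedBall p₀ 6, ∑ i, ‖G i p‖ₑ
      = ENNReal.ofReal (∫ p in closedBall p₀ 6, ∑ i, ‖G i p‖) := by
    rw [ofReal_integral_eq_lintegral_ofReal hint1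
      (ae_of_all _ fun p => Finset.sum_nonneg fun _ _ => norm_nonneg _)]
    refine lintegral_congr fun p => ?_
    rw [ENNReal.ofReal_sum_of_nonneg fun i _ => norm_nonneg _]
    simp only [ofReal_norm]
  rw [e1, e2, ← ENNReal.ofReal_pow (integral_nonneg fun p =>
    Finset.sum_nonneg fun _ _ => norm_nonneg _)]
  change _ ≤ ENNReal.ofReal (C * K) * _
  rw [← ENNReal.ofReal_mul (by positivity)]
  exact ENNReal.ofReal_le_ofReal (key.trans_eq (by ring))

end Step

/-! ### The kernel s^(-3/2) and one-sided fractional differences. -/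

section Kernel

/-- The homogeneous kernel `s ^ (-3/2)`. -/
def ker (s : ℝ) : ℝ := s ^ (-(3 / 2) : ℝ)

lemma ker_pos {s : ℝ} (hs : 0 < s) : 0 < ker s := Real.rpow_pos_of_pos hs _

lemma measurable_ker : Measurable ker := measurable_id.pow_const _

lemma ker_mul {c s : ℝ} (hc : 0 < c) (hs : 0 < s) : ker (c * s) = ker c * ker s :=
  Real.mul_rpow hc.le hs.le

lemma ker_le_ker {s s' : ℝ} (hs : 0 < s) (h : s ≤ s') : ker s' ≤ ker s :=
  Real.rpow_le_rpow_of_nonpos hs h (by norm_num)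

/-- A difference of a bounded Lipschitz function over a step s is O(min 1 s). This turns the kernel
into s^(-1/2) near zero and leaves s^(-3/2) at infinity. -/
lemma integrableOn_min_mul_ker : IntegrableOn (fun s => min 1 s * ker s) (Ioi 0) := by
  rw [← Ioc_union_Ioi_eq_Ioi zero_le_one]
  refine IntegrableOn.union ?_ ?_
  · have h : IntegrableOn (fun s : ℝ => s ^ (-(1 / 2) : ℝ)) (Ioc 0 1) := by
      have := (intervalIntegral.intervalIntegrable_rpow' (a := 0) (b := 1)
        (r := (-(1 / 2) : ℝ)) (by norm_num)).1
      exact this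
    refine h.congr_fun (fun s hs => ?_) measurableSet_Ioc
    rw [min_eq_right hs.2, ker]
    have := Real.rpow_add hs.1 1 (-(3 / 2))
    rw [Real.rpow_one] at this
    rw [← this]; norm_num
  · refine (integrableOn_Ioi_rpow_of_lt (a := (-(3 / 2) : ℝ)) (by norm_num) one_pos).congr_fun
      (fun s hs => ?_) measurableSet_Ioi
    rw [min_eq_left (le_of_lt hs), one_mul, ker]

variable {F : Type*} [NormedAddCommGroup F] [NormedSpace ℝ F]

lemma integrableOn_ker_smul {f : ℝ → F} {D : ℝ} (hf : AEStronglyMeasurable f (volume.restrict (Ioi 0)))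
    (h : ∀ s, 0 < s → ‖f s‖ ≤ D * min 1 s) : IntegrableOn (fun s => ker s • f s) (Ioi 0) := by
  refine (integrableOn_min_mul_ker.const_mul D).mono'
    (measurable_ker.aestronglyMeasurable.smul hf) ?_
  refine (ae_restrict_iff' measurableSet_Ioi).2 (ae_of_all _ fun s hs => ?_)
  rw [norm_smul, Real.norm_of_nonneg (ker_pos hs).le]
  nlinarith [mul_le_mul_of_nonneg_left (h s hs) (ker_pos hs).le]

lemma norm_integral_ker_smul_le {f : ℝ → F} {D : ℝ} (h : ∀ s, 0 < s → ‖f s‖ ≤ D * min 1 s) :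
    ‖∫ s in Ioi 0, ker s • f s‖ ≤ D * ∫ s in Ioi (0 : ℝ), min 1 s * ker s := by
  rw [← integral_const_mul]
  refine norm_integral_le_of_norm_le (integrableOn_min_mul_ker.const_mul D) ?_
  refine (ae_restrict_iff' measurableSet_Ioi).2 (ae_of_all _ fun s hs => ?_)
  rw [norm_smul, Real.norm_of_nonneg (ker_pos hs).le]
  nlinarith [mul_le_mul_of_nonneg_left (h s hs) (ker_pos hs).le]

lemma abs_one_sub_cos_le (x : ℝ) : |1 - Real.cos x| ≤ 2 * min 1 (x ^ 2) := by
  have h1 := Real.one_sub_sq_div_two_le_cos (x := x)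
  have h2 := Real.neg_one_le_cos x
  rw [abs_of_nonneg (by linarith [Real.cos_le_one x]), mul_min_of_nonneg _ _ zero_le_two]
  exact le_min (by linarith) (by nlinarith [sq_nonneg x])

lemma min_one_sq_le {x : ℝ} (hx : 0 ≤ x) : min 1 (x ^ 2) ≤ min 1 x :=
  le_min (min_le_left _ _) (by
    rcases le_total x 1 with h | h
    · exact (min_le_right _ _).trans (by nlinarith)
    · exact (min_le_left _ _).trans h)

lemma abs_sin_le_min {x : ℝ} (hx : 0 ≤ x) : |Real.sin x| ≤ 1 * min 1 x := by
  rw [one_mul]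
  exact le_min (Real.abs_sin_le_one x) ((Real.abs_sin_le_abs).trans_eq (abs_of_nonneg hx))

/-- The constant `∫₀^∞ (1 - cos s) s ^ (-3/2) ds`. -/
def cosConst : ℝ := ∫ s in Ioi (0 : ℝ), ker s • (1 - Real.cos s)

/-- The constant `∫₀^∞ sin s · s ^ (-3/2) ds`. -/
def sinConst : ℝ := ∫ s in Ioi (0 : ℝ), ker s • Real.sin s

lemma integrableOn_ker_one_sub_cos :
    IntegrableOn (fun s => ker s • (1 - Real.cos s)) (Ioi 0) :=
  integrableOn_ker_smul (D := 2) (by fun_prop) fun s hs =>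
    (abs_one_sub_cos_le s).trans (mul_le_mul_of_nonneg_left (min_one_sq_le hs.le) zero_le_two)

lemma integrableOn_ker_sin : IntegrableOn (fun s => ker s • Real.sin s) (Ioi 0) :=
  integrableOn_ker_smul (by fun_prop) fun s hs => abs_sin_le_min hs.le

lemma integral_Ioi_pos {f : ℝ → ℝ} (hf : IntegrableOn f (Ioi 0)) (h0 : ∀ s, 0 < s → 0 ≤ f s)
    (h1 : ∀ s, 0 < s → s < 1 → 0 < f s) : 0 < ∫ s in Ioi 0, f s := by
  rw [setIntegral_pos_iff_support_of_nonneg_ae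
    ((ae_restrict_iff' measurableSet_Ioi).2 (ae_of_all _ fun s hs => h0 s hs)) hf]
  refine lt_of_lt_of_le ?_ (measure_mono (fun s (hs : s ∈ Ioo (0 : ℝ) 1) =>
    ⟨(h1 s hs.1 hs.2).ne', hs.1⟩))
  simp

lemma one_sub_cos_pos {s : ℝ} (h0 : 0 < s) (h1 : s < 1) : 0 < 1 - Real.cos s := by
  have := Real.cos_lt_cos_of_nonneg_of_le_pi le_rfl (by linarith [Real.pi_gt_three]) h0
  rw [Real.cos_zero] at this
  linarith

/-- Since this constant and `sinConst` do not vanish, the two combinations dual to the forward and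
backward differences determine the half-order derivative and its Hilbert transform. -/
lemma cosConst_pos : 0 < cosConst :=
  integral_Ioi_pos integrableOn_ker_one_sub_cos
    (fun s hs => mul_nonneg (ker_pos hs).le (by linarith [Real.cos_le_one s]))
    fun s h0 h1 => mul_pos (ker_pos h0) (one_sub_cos_pos h0 h1)

lemma integrableOn_ker_div :
    IntegrableOn (fun s => ker s • ((1 - Real.cos s) / s)) (Ioi 0) := by
  refine integrableOn_ker_smul (D := 2)
    ((by fun_prop : Measurable fun s : ℝ => (1 - Real.cos s) / s).aestronglyMeasurable) fun s hs => ?_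
  rw [norm_div, Real.norm_eq_abs, Real.norm_of_nonneg hs.le, div_le_iff₀ hs]
  refine (abs_one_sub_cos_le s).trans ?_
  rw [mul_assoc]
  gcongr
  rcases le_total s 1 with h | h
  · rw [min_eq_right h, min_eq_right (by nlinarith), sq]
  · rw [min_eq_left h, one_mul]; exact (min_le_left _ _).trans h

/-- Integration by parts turns the oscillating integral into a positive one. -/
lemma sinConst_eq : sinConst = 3 / 2 * ∫ s in Ioi (0 : ℝ), ker s • ((1 - Real.cos s) / s) := by
  have hb : ∀ s, 0 ≤ s → ‖ker s * (1 - Real.cos s)‖ ≤ ker s * (2 * min 1 (s ^ 2)) := fun s hs => by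
    rw [norm_mul, Real.norm_of_nonneg (show 0 ≤ ker s from Real.rpow_nonneg hs _), Real.norm_eq_abs]
    exact mul_le_mul_of_nonneg_left (abs_one_sub_cos_le s) (Real.rpow_nonneg hs _)
  have key := integral_Ioi_of_hasDerivAt_of_tendsto (a := 0) (m := 0)
    (f := fun s => ker s * (1 - Real.cos s))
    (f' := fun s => ker s • Real.sin s - 3 / 2 * ker s • ((1 - Real.cos s) / s)) ?_ ?_ ?_ ?_
  · rw [integral_sub integrableOn_ker_sin (integrableOn_ker_div.const_mul _),
      integral_const_mul] at key
    simp only [Real.cos_zero, sub_self, mul_zero] at key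
    rw [sinConst]; linarith
  -- The boundary term at zero vanishes because 1 - cos s is quadratic, which leaves s^(1/2).
  · have : Tendsto (fun s : ℝ => 2 * s ^ (1 / 2 : ℝ)) (𝓝[Ici 0] 0) (𝓝 0) := by
      have h := ((Real.continuousAt_rpow_const 0 (1 / 2) (Or.inr (by norm_num))).const_mul
        2).tendsto.mono_left (nhdsWithin_le_nhds (s := Ici 0))
      simpa using h
    rw [ContinuousWithinAt]
    simp only [Real.cos_zero, sub_self, mul_zero]
    refine squeeze_zero_norm' ?_ this
    filter_upwards [self_mem_nhdsWithin] with s hs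
    refine (hb s hs).trans ?_
    rcases eq_or_lt_of_le (show (0 : ℝ) ≤ s from hs) with rfl | h
    · simp
    · have e : ker s * s ^ 2 = s ^ (1 / 2 : ℝ) := by
        rw [ker, ← Real.rpow_natCast, ← Real.rpow_add h]; norm_num
      rw [← e]
      nlinarith [mul_le_mul_of_nonneg_left (min_le_right 1 (s ^ 2)) (ker_pos h).le]
  · intro s hs
    have hs0 : s ≠ 0 := ne_of_gt hs
    have h1 : HasDerivAt ker (-(3 / 2) * s ^ (-(3 / 2) - 1 : ℝ)) s :=
      Real.hasDerivAt_rpow_const (Or.inl hs0)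
    have h2 := h1.mul ((Real.hasDerivAt_cos s).const_sub 1)
    refine h2.congr_deriv ?_
    rw [Real.rpow_sub_one hs0]
    simp only [smul_eq_mul, ker, neg_neg]
    ring
  · exact integrableOn_ker_sin.sub (integrableOn_ker_div.const_mul _)
  · have : Tendsto (fun s : ℝ => ker s * 2) atTop (𝓝 0) := by
      have := (tendsto_rpow_neg_atTop (show (0 : ℝ) < 3 / 2 by norm_num)).mul_const 2
      rwa [zero_mul] at this
    refine squeeze_zero_norm' ?_ this
    filter_upwards [eventually_gt_atTop 0] with s hs
    refine (hb s hs.le).trans (mul_le_mul_of_nonneg_left ?_ (ker_pos hs).le)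
    linarith [min_le_left 1 (s ^ 2)]

lemma sinConst_pos : 0 < sinConst := by
  rw [sinConst_eq]
  refine mul_pos (by norm_num) (integral_Ioi_pos integrableOn_ker_div
    (fun s hs => mul_nonneg (ker_pos hs).le (div_nonneg (by linarith [Real.cos_le_one s]) hs.le))
    fun s h0 h1 => mul_pos (ker_pos h0) (div_pos (one_sub_cos_pos h0 h1) h0))

/-- Homogeneity: the kernel contributes y^(3/2) and the substitution y⁻¹. -/
lemma integral_ker_comp_mul {f : ℝ → ℝ} {y : ℝ} (hy : 0 < y) :
    ∫ s in Ioi (0 : ℝ), ker s • f (y * s) = √y * ∫ s in Ioi (0 : ℝ), ker s • f s := by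
  have h := integral_comp_mul_left_Ioi (fun s => ker s • f s) 0 hy
  rw [mul_zero] at h
  have e : ∫ s in Ioi (0 : ℝ), ker s • f (y * s)
      = (ker y)⁻¹ * ∫ s in Ioi (0 : ℝ), ker (y * s) • f (y * s) := by
    rw [← integral_const_mul]
    refine setIntegral_congr_fun measurableSet_Ioi fun s hs => ?_
    change ker s • f (y * s) = (ker y)⁻¹ * (ker (y * s) • f (y * s))
    have := (ker_pos hy).ne'
    rw [ker_mul hy hs, smul_eq_mul, smul_eq_mul]
    field_simp
  rw [e, h, smul_eq_mul, ← mul_assoc]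
  congr 1
  rw [ker, ← Real.rpow_neg hy.le, ← Real.rpow_neg_one, ← Real.rpow_add hy, Real.sqrt_eq_rpow]
  norm_num

lemma one_sub_exp_eq (x : ℝ) : 1 - Complex.exp (-(x * Complex.I))
    = ((1 - Real.cos x : ℝ) : ℂ) + (Real.sin x : ℝ) * Complex.I := by
  rw [← neg_mul, ← Complex.ofReal_neg, Complex.exp_mul_I, ← Complex.ofReal_cos,
    ← Complex.ofReal_sin, Real.cos_neg, Real.sin_neg]
  push_cast
  ring

lemma norm_one_sub_exp_le (x : ℝ) : ‖1 - Complex.exp (-(x * Complex.I))‖ ≤ 2 * min 1 |x| := by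
  have h2 : ‖1 - Complex.exp (-(x * Complex.I))‖ ≤ |x| := by
    have := Real.norm_exp_I_mul_ofReal_sub_one_le (x := -x)
    rw [norm_sub_rev]
    rw [Real.norm_eq_abs, abs_neg] at this
    rwa [Complex.ofReal_neg, mul_neg, mul_comm] at this
  have h1 : ‖1 - Complex.exp (-(x * Complex.I))‖ ≤ 2 := by
    refine (norm_sub_le _ _).trans_eq ?_
    rw [← neg_mul, ← Complex.ofReal_neg, Complex.norm_exp_ofReal_mul_I, norm_one]
    norm_num
  rw [mul_min_of_nonneg _ _ zero_le_two]
  exact le_min (by linarith) (by linarith [abs_nonneg x])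

lemma min_one_mul_le {c s : ℝ} (hc : 0 ≤ c) (hs : 0 ≤ s) : min 1 (c * s) ≤ (1 + c) * min 1 s := by
  rcases le_total s 1 with h | h
  · rw [min_eq_right h]
    exact (min_le_right _ _).trans (by nlinarith)
  · rw [min_eq_left h]
    exact (min_le_left _ _).trans (by linarith)

/-- The Fourier multiplier of the one-sided fractional difference operators. -/
def fracSymbol (y : ℝ) : ℂ :=
  ∫ s in Ioi (0 : ℝ), ker s • (1 - Complex.exp (-((y * s : ℝ) * Complex.I)))

lemma norm_fracSymbol_integrand_le (y : ℝ) {s : ℝ} (hs : 0 < s) :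
    ‖1 - Complex.exp (-((y * s : ℝ) * Complex.I))‖ ≤ 2 * (1 + |y|) * min 1 s := by
  refine (norm_one_sub_exp_le _).trans ?_
  rw [abs_mul, abs_of_pos hs, mul_assoc]
  exact mul_le_mul_of_nonneg_left (min_one_mul_le (abs_nonneg y) hs.le) zero_le_two

lemma fracSymbol_eq (y : ℝ) : fracSymbol y =
    ((∫ s in Ioi (0 : ℝ), ker s • (1 - Real.cos (y * s)) : ℝ) : ℂ)
      + (∫ s in Ioi (0 : ℝ), ker s • Real.sin (y * s) : ℝ) * Complex.I := by
  have h1 : IntegrableOn (fun s => ker s • (1 - Real.cos (y * s))) (Ioi 0) := by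
    refine integrableOn_ker_smul (D := 2 * (1 + |y|)) (by fun_prop) fun s hs => ?_
    refine (abs_one_sub_cos_le _).trans ?_
    rw [mul_assoc, ← sq_abs, abs_mul, abs_of_pos hs]
    exact mul_le_mul_of_nonneg_left ((min_one_sq_le (by positivity)).trans
      (min_one_mul_le (abs_nonneg y) hs.le)) zero_le_two
  have h2 : IntegrableOn (fun s => ker s • Real.sin (y * s)) (Ioi 0) := by
    refine integrableOn_ker_smul (D := 1 + |y|) (by fun_prop) fun s hs => ?_
    have h := abs_sin_le_min (abs_nonneg (y * s))
    rw [one_mul, abs_mul y s, abs_of_pos hs] at h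
    refine le_trans (le_of_eq ?_) (h.trans (min_one_mul_le (abs_nonneg y) hs.le))
    rcases abs_cases y with ⟨h, -⟩ | ⟨h, -⟩ <;> simp [h]
  rw [fracSymbol, ← integral_complex_ofReal, ← integral_complex_ofReal, ← integral_mul_const,
    ← integral_add h1.ofReal (h2.ofReal.mul_const _)]
  refine integral_congr_ae (ae_of_all _ fun s => ?_)
  dsimp only
  rw [one_sub_exp_eq]
  simp only [Complex.real_smul, smul_eq_mul, Complex.ofReal_mul]
  ring

lemma fracSymbol_of_pos {y : ℝ} (hy : 0 < y) :
    fracSymbol y = √y * (cosConst + sinConst * Complex.I) := by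
  rw [fracSymbol_eq, integral_ker_comp_mul (f := fun s => 1 - Real.cos s) hy,
    integral_ker_comp_mul (f := Real.sin) hy, cosConst, sinConst]
  push_cast
  ring

lemma fracSymbol_neg (y : ℝ) : fracSymbol (-y) = conj (fracSymbol y) := by
  rw [fracSymbol_eq, fracSymbol_eq]
  simp only [neg_mul, Real.cos_neg, Real.sin_neg, smul_neg, integral_neg]
  simp

lemma fracSymbol_of_neg {y : ℝ} (hy : y < 0) :
    fracSymbol y = √(-y) * (cosConst - sinConst * Complex.I) := by
  have := fracSymbol_neg (-y)
  rw [neg_neg, fracSymbol_of_pos (neg_pos.2 hy)] at this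
  rw [this]
  simp [sub_eq_add_neg]

lemma fracSymbol_zero : fracSymbol 0 = 0 := by simp [fracSymbol]

/-- The modulus is a pure multiple of |y|^(1/2), hence the operator is controlled by exactly the
half-order energy. -/
lemma norm_fracSymbol_sq (y : ℝ) : ‖fracSymbol y‖ ^ 2 = (cosConst ^ 2 + sinConst ^ 2) * |y| := by
  have h : ∀ y > 0, ‖fracSymbol y‖ ^ 2 = (cosConst ^ 2 + sinConst ^ 2) * |y| := fun y hy => by
    rw [fracSymbol_of_pos hy, norm_mul, mul_pow, Complex.norm_real, Real.norm_eq_abs, sq_abs,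
      Real.sq_sqrt hy.le, ← Complex.normSq_eq_norm_sq, Complex.normSq_add_mul_I, abs_of_pos hy]
    ring
  rcases lt_trichotomy y 0 with hy | rfl | hy
  · have := h (-y) (neg_pos.2 hy)
    rwa [fracSymbol_neg, abs_neg, RCLike.norm_conj] at this
  · simp [fracSymbol_zero]
  · exact h y hy

/-- The one-sided fractional difference operators of order `1/2`, forwards or backwards in time
according to the sign of `σ`. -/
def fracDiff (σ : ℝ) (ψ : ℝ → ℂ) (t : ℝ) : ℂ :=
  ∫ s in Ioi (0 : ℝ), ker s • (ψ t - ψ (t - σ * s))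

/-- Fourier inversion under the integral over the step, followed by Fubini. Absolute convergence
holds since |1 - e^(-iys)| ≤ 2 (1 + |y|) min 1 s and 𝓕 ψ has an integrable first moment. -/
lemma fracDiff_eq_fourierInv (σ : ℝ) (ψ : 𝓢(ℝ, ℂ)) (t : ℝ) :
    fracDiff σ ψ t = 𝓕⁻ (fun ξ : ℝ => fracSymbol (2 * Real.pi * σ * ξ) * 𝓕 (ψ : ℝ → ℂ) ξ) t := by
  have hint : Integrable (𝓕 (ψ : ℝ → ℂ)) := by
    rw [← SchwartzMap.fourier_coe]; exact (𝓕 ψ).integrable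
  have hint1 : Integrable fun ξ : ℝ => |ξ| * ‖𝓕 (ψ : ℝ → ℂ) ξ‖ := by
    refine ((𝓕 ψ).integrable_pow_mul volume 1).congr (ae_of_all _ fun ξ => ?_)
    simp [SchwartzMap.fourier_coe]
  have hcont : Continuous (𝓕 (ψ : ℝ → ℂ)) := by
    rw [← SchwartzMap.fourier_coe]; exact (𝓕 ψ).continuous
  have hinv : ∀ t, ψ t = ∫ ξ : ℝ, Complex.exp ((2 * Real.pi * (t * ξ) : ℝ) * Complex.I) *
      𝓕 (ψ : ℝ → ℂ) ξ := fun t => by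
    have := congrFun (ψ.continuous.fourierInv_fourier_eq ψ.integrable hint) t
    rw [← this, Real.fourierInv_eq']
    rfl
  have hI : ∀ t, Integrable fun ξ : ℝ => Complex.exp ((2 * Real.pi * (t * ξ) : ℝ) * Complex.I) *
      𝓕 (ψ : ℝ → ℂ) ξ := fun t => by
    refine hint.bdd_mul (c := 1) (by fun_prop) (ae_of_all _ fun ξ => ?_)
    rw [Complex.norm_exp_ofReal_mul_I]
  have hdiff : ∀ s, ψ t - ψ (t - σ * s) = ∫ ξ : ℝ, Complex.exp ((2 * Real.pi * (t * ξ) : ℝ) * Complex.I) *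
      ((1 - Complex.exp (-((2 * Real.pi * σ * ξ * s : ℝ) * Complex.I))) * 𝓕 (ψ : ℝ → ℂ) ξ) := by
    intro s
    rw [hinv t, hinv (t - σ * s), ← integral_sub (hI _) (hI _)]
    refine integral_congr_ae (ae_of_all _ fun ξ => ?_)
    dsimp only
    have e : Complex.exp ((2 * Real.pi * ((t - σ * s) * ξ) : ℝ) * Complex.I) =
        Complex.exp ((2 * Real.pi * (t * ξ) : ℝ) * Complex.I) *
          Complex.exp (-((2 * Real.pi * σ * ξ * s : ℝ) * Complex.I)) := by
      rw [← Complex.exp_add]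
      congr 1
      push_cast; ring
    rw [e]; ring
  have hprod : Integrable (fun x : ℝ × ℝ => ker x.1 •
      (Complex.exp ((2 * Real.pi * (t * x.2) : ℝ) * Complex.I) *
      ((1 - Complex.exp (-((2 * Real.pi * σ * x.2 * x.1 : ℝ) * Complex.I))) * 𝓕 (ψ : ℝ → ℂ) x.2)))
      ((volume.restrict (Ioi 0)).prod volume) := by
    have hb : Integrable (fun x : ℝ × ℝ => (min 1 x.1 * ker x.1) *
        (2 * ((1 + 2 * Real.pi * |σ| * |x.2|) * ‖𝓕 (ψ : ℝ → ℂ) x.2‖)))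
        ((volume.restrict (Ioi 0)).prod volume) := by
      refine integrableOn_min_mul_ker.mul_prod (g := fun ξ : ℝ =>
        2 * ((1 + 2 * Real.pi * |σ| * |ξ|) * ‖𝓕 (ψ : ℝ → ℂ) ξ‖)) ?_
      simp only [add_mul, one_mul, mul_assoc]
      have := hint.norm.add (hint1.const_mul (2 * (Real.pi * |σ|)))
      refine (this.const_mul 2).congr (ae_of_all _ fun ξ => ?_)
      simp only [Pi.add_apply]; ring
    refine hb.mono' ?_ ?_
    · have hm : Measurable fun x : ℝ × ℝ =>
        (Complex.exp ((2 * Real.pi * (t * x.2) : ℝ) * Complex.I) *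
        ((1 - Complex.exp (-((2 * Real.pi * σ * x.2 * x.1 : ℝ) * Complex.I)))
          * 𝓕 (ψ : ℝ → ℂ) x.2)) := by
        have : Continuous fun x : ℝ × ℝ => 𝓕 (ψ : ℝ → ℂ) x.2 := hcont.comp continuous_snd
        refine Continuous.measurable ?_
        fun_prop
      exact ((measurable_ker.comp measurable_fst).smul hm).aestronglyMeasurable
    · have : ∀ᵐ x : ℝ × ℝ ∂((volume.restrict (Ioi 0)).prod volume), 0 < x.1 :=
        Measure.quasiMeasurePreserving_fst.ae (ae_restrict_mem measurableSet_Ioi)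
      filter_upwards [this] with x hx
      rw [norm_smul, norm_mul, norm_mul, Complex.norm_exp_ofReal_mul_I, one_mul,
        Real.norm_of_nonneg (ker_pos hx).le]
      have h1 := norm_fracSymbol_integrand_le (2 * Real.pi * σ * x.2) hx
      rw [abs_mul, abs_mul, abs_of_pos Real.two_pi_pos] at h1
      have h2 := mul_le_mul_of_nonneg_right h1 (norm_nonneg (𝓕 (ψ : ℝ → ℂ) x.2))
      have h3 := mul_le_mul_of_nonneg_left h2 (ker_pos hx).le
      exact h3.trans_eq (by ring)
  calc fracDiff σ ψ t = ∫ s in Ioi (0 : ℝ), ∫ ξ : ℝ, ker s •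
      (Complex.exp ((2 * Real.pi * (t * ξ) : ℝ) * Complex.I) *
      ((1 - Complex.exp (-((2 * Real.pi * σ * ξ * s : ℝ) * Complex.I))) * 𝓕 (ψ : ℝ → ℂ) ξ)) := by
        simp only [fracDiff, hdiff, integral_smul]
    _ = ∫ ξ : ℝ, ∫ s in Ioi (0 : ℝ), ker s • (Complex.exp ((2 * Real.pi * (t * ξ) : ℝ) * Complex.I) *
      ((1 - Complex.exp (-((2 * Real.pi * σ * ξ * s : ℝ) * Complex.I))) * 𝓕 (ψ : ℝ → ℂ) ξ)) :=
        integral_integral_swap hprod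
    _ = ∫ ξ : ℝ, Complex.exp ((2 * Real.pi * (t * ξ) : ℝ) * Complex.I) *
        (fracSymbol (2 * Real.pi * σ * ξ) * 𝓕 (ψ : ℝ → ℂ) ξ) := by
        refine integral_congr_ae (ae_of_all _ fun ξ => ?_)
        dsimp only
        rw [fracSymbol, ← integral_mul_const, ← integral_const_mul]
        refine integral_congr_ae (ae_of_all _ fun s => ?_)
        simp only [Complex.real_smul]; ring
    _ = _ := by
        rw [Real.fourierInv_eq']
        rfl

/-- The weight describing the decay of fractional differences of test functions. -/
def decay (t : ℝ) : ℝ := ker (1 + |t|)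

lemma decay_pos (t : ℝ) : 0 < decay t := ker_pos (by positivity)

lemma continuous_decay : Continuous decay :=
  (continuous_const.add continuous_abs).rpow_const fun t => Or.inl (add_pos_of_pos_of_nonneg one_pos (abs_nonneg t)).ne'

lemma decay_le_one (t : ℝ) : decay t ≤ 1 := by
  refine (ker_le_ker one_pos (by linarith [abs_nonneg t])).trans_eq ?_
  simp [ker]

/-- Off the support only the translate contributes, and it forces a step s ≥ |t| - R. For |t| ≥ R +
1/2 one has |t| - R ≥ (1 + |t|) / (2R + 3), with equality at the endpoint, so the kernel can be
taken out of the integral. -/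
lemma norm_fracDiff_le {σ : ℝ} (hσ : |σ| = 1) {ψ : ℝ → ℂ} (hc : Continuous ψ) {R : ℝ} (hR : 0 ≤ R)
    (hψ : tsupport ψ ⊆ closedBall 0 R) {t : ℝ} (ht : R + 1 / 2 ≤ |t|) :
    ‖fracDiff σ ψ t‖ ≤ ker (1 / (2 * R + 3)) * decay t * ∫ s, ‖ψ s‖ := by
  have hσ0 : σ ≠ 0 := by rintro rfl; simp at hσ
  have hi : Integrable fun s => ‖ψ s‖ := (hc.integrable_of_hasCompactSupport
    ((isCompact_closedBall 0 R).of_isClosed_subset (isClosed_tsupport _) hψ)).norm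
  have hi' : Integrable fun s => ‖ψ (t - σ * s)‖ :=
    (hi.comp_sub_left t).comp_mul_left' hσ0
  have h0 : ∀ s, R < |s| → ψ s = 0 := fun s hs => image_eq_zero_of_notMem_tsupport fun h => by
    have := mem_closedBall_zero_iff.1 (hψ h)
    rw [Real.norm_eq_abs] at this
    linarith
  have hb : ∀ s, 0 < s → ‖ker s • (ψ t - ψ (t - σ * s))‖
      ≤ ker (1 / (2 * R + 3)) * decay t * ‖ψ (t - σ * s)‖ := fun s hs => by
    rw [h0 t (by linarith), zero_sub, norm_smul, norm_neg, Real.norm_of_nonneg (ker_pos hs).le]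
    by_cases h : R < |t - σ * s|
    · simp [h0 _ h]
    · refine mul_le_mul_of_nonneg_right ?_ (norm_nonneg _)
      rw [decay, ← ker_mul (by positivity) (by positivity)]
      refine ker_le_ker (by positivity) ?_
      have h1 : |t| - s ≤ |t - σ * s| := by
        have := abs_sub_abs_le_abs_sub t (σ * s)
        rwa [abs_mul, hσ, one_mul, abs_of_pos hs] at this
      have h2 : |t| - R ≤ s := by linarith
      refine le_trans ?_ h2
      rw [one_div_mul_eq_div, div_le_iff₀ (by positivity)]
      nlinarith
  refine (norm_integral_le_of_norm_le (hi'.integrableOn.const_mul _)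
    ((ae_restrict_iff' measurableSet_Ioi).2 (ae_of_all _ hb))).trans ?_
  rw [integral_const_mul]
  refine mul_le_mul_of_nonneg_left ?_ (mul_nonneg (ker_pos (by positivity)).le (decay_pos t).le)
  refine (setIntegral_le_integral hi' (ae_of_all _ fun _ => norm_nonneg _)).trans_eq ?_
  have := Measure.integral_comp_mul_left (fun s => ‖ψ (t - s)‖) σ
  rw [this, integral_sub_left_eq_self (fun s => ‖ψ s‖) volume t, abs_inv, hσ]
  simp

end Kernel

/-! ### Fourier transform in time and the half-order energy. -/

section TimeFourier

variable {E : Type*} [NormedAddCommGroup E] [NormedSpace ℝ E] [FiniteDimensional ℝ E]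
  [MeasureSpace E] [BorelSpace E] [(volume : Measure E).IsAddHaarMeasure]
  {ι : Type*} [Fintype ι]

/-- The Fourier transform in the time variable. -/
def timeFourier (w : E × ℝ → ℂ) (τ : ℝ) (X : E) : ℂ := 𝓕 (fun t => w (X, t)) τ

lemma timeFourier_eq (w : E × ℝ → ℂ) (τ : ℝ) (X : E) : timeFourier w τ X =
    ∫ t : ℝ, Complex.exp ((-2 * Real.pi * t * τ : ℝ) * Complex.I) * w (X, t) :=
  Real.fourier_real_eq_integral_exp_smul _ _

lemma _root_.HasCompactSupport.exists_time_bound {F : Type*} [NormedAddCommGroup F]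
    {w : E × ℝ → F} (hc : HasCompactSupport w) (hw : Continuous w) :
    ∃ b : ℝ → ℝ, Integrable b ∧ ∀ X t, ‖w (X, t)‖ ≤ b t := by
  obtain ⟨C, hC⟩ := hc.exists_bound_of_continuous hw
  obtain ⟨R, hR⟩ := hc.isCompact.isBounded.subset_closedBall 0
  refine ⟨(closedBall (0 : ℝ) R).indicator fun _ => C, ?_, fun X t => ?_⟩
  · exact (integrableOn_const measure_closedBall_lt_top.ne).integrable_indicator
      isClosed_closedBall.measurableSet
  · by_cases ht : t ∈ closedBall (0 : ℝ) R
    · rw [indicator_of_mem ht]; exact hC _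
    · have hz : w (X, t) = 0 := image_eq_zero_of_notMem_tsupport fun h => ht (by
        have := hR h
        rw [mem_closedBall_zero_iff] at this ⊢
        exact (norm_snd_le (X, t)).trans this)
      rw [indicator_of_notMem ht, hz, norm_zero]

lemma continuous_timeFourier {w : E × ℝ → ℂ} (hc : HasCompactSupport w) (hw : Continuous w) :
    Continuous fun x : E × ℝ => timeFourier w x.2 x.1 := by
  obtain ⟨b, hb, hwb⟩ := hc.exists_time_bound hw
  simp only [timeFourier_eq]
  refine continuous_of_dominated (bound := b) (fun x => ?_) (fun x => ae_of_all _ fun t => ?_) hb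
    (ae_of_all _ fun t => by fun_prop)
  · exact (by fun_prop : Continuous fun t : ℝ =>
      Complex.exp ((-2 * Real.pi * t * x.2 : ℝ) * Complex.I) * w (x.1, t)).aestronglyMeasurable
  · rw [norm_mul, Complex.norm_exp_ofReal_mul_I, one_mul]
    exact hwb _ _

lemma timeFourier_eq_zero {w : E × ℝ → ℂ} {X : E} (hX : X ∉ Prod.fst '' tsupport w) (τ : ℝ) :
    timeFourier w τ X = 0 := by
  have : ∀ t, w (X, t) = 0 := fun t => image_eq_zero_of_notMem_tsupport fun h => hX ⟨_, h, rfl⟩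
  rw [timeFourier_eq]
  simp [this]

lemma hasCompactSupport_timeFourier {w : E × ℝ → ℂ} (hc : HasCompactSupport w) (τ : ℝ) :
    HasCompactSupport (timeFourier w τ) :=
  HasCompactSupport.intro (hc.isCompact.image continuous_fst) fun _ h => timeFourier_eq_zero h τ

lemma hasFDerivAt_timeFourier {w : E × ℝ → ℂ} (hc : HasCompactSupport w) (hw : ContDiff ℝ ∞ w)
    (τ : ℝ) (X : E) : HasFDerivAt (timeFourier w τ)
      (∫ t : ℝ, Complex.exp ((-2 * Real.pi * t * τ : ℝ) * Complex.I) •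
        (fderiv ℝ w (X, t)).comp (ContinuousLinearMap.inl ℝ E ℝ)) X := by
  have hcw := hw.continuous
  have hcf : Continuous (fderiv ℝ w) := hw.continuous_fderiv (by simp)
  obtain ⟨b, hb, hwb⟩ := (hc.fderiv ℝ).exists_time_bound hcf
  obtain ⟨b', hb', hwb'⟩ := hc.exists_time_bound hcw
  have hm : ∀ X, AEStronglyMeasurable fun t : ℝ =>
      Complex.exp ((-2 * Real.pi * t * τ : ℝ) * Complex.I) * w (X, t) := fun X =>
    Continuous.aestronglyMeasurable (by fun_prop)
  have e : timeFourier w τ = fun X => ∫ t : ℝ,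
      Complex.exp ((-2 * Real.pi * t * τ : ℝ) * Complex.I) * w (X, t) :=
    funext fun X => timeFourier_eq w τ X
  rw [e]
  refine hasFDerivAt_integral_of_dominated_of_fderiv_le (bound := b) univ_mem
    (F' := fun X t => Complex.exp ((-2 * Real.pi * t * τ : ℝ) * Complex.I) •
        (fderiv ℝ w (X, t)).comp (ContinuousLinearMap.inl ℝ E ℝ))
    (Eventually.of_forall hm) ?_ ?_ (ae_of_all _ fun t X _ => ?_) hb (ae_of_all _ fun t X _ => ?_)
  · refine hb'.mono' (hm X) (ae_of_all _ fun t => ?_)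
    rw [norm_mul, Complex.norm_exp_ofReal_mul_I, one_mul]
    exact hwb' _ _
  · refine Continuous.aestronglyMeasurable ?_
    have : Continuous fun t => fderiv ℝ w (X, t) := hcf.comp (by fun_prop)
    exact (by fun_prop : Continuous fun t : ℝ =>
        Complex.exp ((-2 * Real.pi * t * τ : ℝ) * Complex.I)).smul (this.clm_comp continuous_const)
  · rw [norm_smul, Complex.norm_exp_ofReal_mul_I, one_mul]
    refine (ContinuousLinearMap.opNorm_comp_le _ _).trans ?_
    refine (mul_le_of_le_one_right (norm_nonneg _) ?_).trans (hwb X t)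
    exact ContinuousLinearMap.norm_inl_le_one ℝ E ℝ
  · have h1 : HasFDerivAt (fun X : E => (X, t)) (ContinuousLinearMap.inl ℝ E ℝ) X :=
      hasFDerivAt_prodMk_left X t
    exact (((hw.differentiable (by simp) (X, t)).hasFDerivAt.comp X h1).const_mul _)

lemma fderiv_timeFourier {w : E × ℝ → ℂ} (hc : HasCompactSupport w) (hw : ContDiff ℝ ∞ w)
    (τ : ℝ) (X v : E) : fderiv ℝ (timeFourier w τ) X v =
      timeFourier (fun p => fderiv ℝ w p (v, 0)) τ X := by
  have hcf : Continuous (fderiv ℝ w) := hw.continuous_fderiv (by simp)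
  obtain ⟨b, hb, hwb⟩ := (hc.fderiv ℝ).exists_time_bound hcf
  have hint : Integrable fun t : ℝ => Complex.exp ((-2 * Real.pi * t * τ : ℝ) * Complex.I) •
        (fderiv ℝ w (X, t)).comp (ContinuousLinearMap.inl ℝ E ℝ) := by
    refine hb.mono' (Continuous.aestronglyMeasurable ?_) (ae_of_all _ fun t => ?_)
    · have : Continuous fun t => fderiv ℝ w (X, t) := hcf.comp (by fun_prop)
      exact (by fun_prop : Continuous fun t : ℝ =>
        Complex.exp ((-2 * Real.pi * t * τ : ℝ) * Complex.I)).smul (this.clm_comp continuous_const)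
    · rw [norm_smul, Complex.norm_exp_ofReal_mul_I, one_mul]
      refine (ContinuousLinearMap.opNorm_comp_le _ _).trans ?_
      refine (mul_le_of_le_one_right (norm_nonneg _) ?_).trans (hwb X t)
      exact ContinuousLinearMap.norm_inl_le_one ℝ E ℝ
  rw [(hasFDerivAt_timeFourier hc hw τ X).fderiv, ContinuousLinearMap.integral_apply hint,
    timeFourier_eq]
  rfl

/-- Time slices of test functions as Schwartz functions. -/
def timeSlice {w : E × ℝ → ℂ} (hc : HasCompactSupport w) (hw : ContDiff ℝ ∞ w) (X : E) :
    𝓢(ℝ, ℂ) :=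
  HasCompactSupport.toSchwartzMap (f := fun t => w (X, t))
    (HasCompactSupport.intro (hc.isCompact.image continuous_snd) fun t ht =>
      image_eq_zero_of_notMem_tsupport fun h => ht ⟨_, h, rfl⟩)
    (hw.comp (contDiff_prodMk_right X))

lemma timeFourier_deriv {w : E × ℝ → ℂ} (hc : HasCompactSupport w) (hw : ContDiff ℝ ∞ w)
    (τ : ℝ) (X : E) : timeFourier (fun p => fderiv ℝ w p (0, 1)) τ X =
      2 * Real.pi * Complex.I * τ * timeFourier w τ X := by
  have hd : ∀ t, HasDerivAt (fun t => w (X, t)) (fderiv ℝ w (X, t) (0, 1)) t := fun t => by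
    have h1 : HasDerivAt (fun t : ℝ => (X, t)) ((0 : E), (1 : ℝ)) t :=
      (hasDerivAt_const t X).prodMk (hasDerivAt_id t)
    exact (hw.differentiable (by simp) (X, t)).hasFDerivAt.comp_hasDerivAt t h1
  have hde : deriv (fun t => w (X, t)) = fun t => fderiv ℝ w (X, t) (0, 1) :=
    funext fun t => (hd t).deriv
  have h1 := Real.fourier_deriv (f := fun t => w (X, t)) (timeSlice hc hw X).integrable
    (fun t => (hd t).differentiableAt) (by
      rw [hde]
      exact (timeSlice (hc.fderiv_apply (𝕜 := ℝ) (0, 1))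
        ((hw.fderiv_right (m := ∞) (by simp)).clm_apply contDiff_const) X).integrable)
  have h2 := congrFun h1 τ
  rw [hde] at h2
  rw [timeFourier, h2]
  simp [timeFourier, mul_comm, mul_assoc, mul_left_comm]

lemma lintegral_timeFourier_sq {w : E × ℝ → ℂ} (hc : HasCompactSupport w) (hw : ContDiff ℝ ∞ w)
    (X : E) : ∫⁻ τ, ‖timeFourier w τ X‖ₑ ^ 2 = ∫⁻ t, ‖w (X, t)‖ₑ ^ 2 := by
  have h := SchwartzMap.integral_norm_sq_fourier (timeSlice hc hw X)
  have hs : ∀ f : 𝓢(ℝ, ℂ), ENNReal.ofReal (∫ t, ‖f t‖ ^ 2) = ∫⁻ t, ‖f t‖ₑ ^ 2 := fun f => by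
    have hi : Integrable fun t => ‖f t‖ ^ 2 := (f.memLp 2 volume).integrable_norm_pow two_ne_zero
    rw [ofReal_integral_eq_lintegral_ofReal hi (ae_of_all _ fun _ => sq_nonneg _)]
    simp only [ENNReal.ofReal_pow (norm_nonneg _), ofReal_norm]
  have h' := congrArg ENNReal.ofReal h
  rw [hs, hs] at h'
  exact h'

/-- The half-order energy of a compactly supported function whose time derivative is a divergence
plus a lower order term. -/
lemma two_pi_mul_integral_timeFourier_sq_le {e : ι → E} {w f : E × ℝ → ℂ} {Ψ : ι → E × ℝ → ℂ}
    (hwc : HasCompactSupport w) (hw : ContDiff ℝ ∞ w) (hfc : HasCompactSupport f)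
    (hf : ContDiff ℝ ∞ f) (hΨc : ∀ i, HasCompactSupport (Ψ i)) (hΨ : ∀ i, ContDiff ℝ ∞ (Ψ i))
    (heq : ∀ p, fderiv ℝ w p (0, 1) = ∑ i, fderiv ℝ (Ψ i) p (e i, 0) + f p) (τ : ℝ) :
    2 * Real.pi * |τ| * ∫ X, ‖timeFourier w τ X‖ ^ 2 ≤
      ∫ X, (∑ i, (‖timeFourier (Ψ i) τ X‖ ^ 2 + ‖timeFourier (fun p => fderiv ℝ w p (e i, 0)) τ X‖ ^ 2)
        + (‖timeFourier f τ X‖ ^ 2 + ‖timeFourier w τ X‖ ^ 2)) := by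
  have hcont : ∀ {v : E × ℝ → ℂ}, HasCompactSupport v → ContDiff ℝ ∞ v →
      Continuous (timeFourier v τ) := fun hc hv =>
    (continuous_timeFourier hc hv.continuous).comp (by fun_prop : Continuous fun X : E => (X, τ))
  have hd : ∀ {v : E × ℝ → ℂ} (y : E), ContDiff ℝ ∞ v → ContDiff ℝ ∞ fun p => fderiv ℝ v p (y, 0) :=
    fun y hv => (hv.fderiv_right (m := ∞) (by simp)).clm_apply contDiff_const
  have hdc : ∀ {v : E × ℝ → ℂ} (y : E), HasCompactSupport v →
      HasCompactSupport fun p => fderiv ℝ v p (y, 0) := fun y hv => hv.fderiv_apply (𝕜 := ℝ) (y, 0)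
  have hprod : ∀ {a b : E × ℝ → ℂ}, HasCompactSupport a → ContDiff ℝ ∞ a → HasCompactSupport b →
      ContDiff ℝ ∞ b → Integrable fun X => timeFourier a τ X * conj (timeFourier b τ X) :=
    fun hac ha hbc hb => ((hcont hac ha).mul (Complex.continuous_conj.comp
      (hcont hbc hb))).integrable_of_hasCompactSupport (hasCompactSupport_timeFourier hac τ).mul_right
  have hsq : ∀ {a : E × ℝ → ℂ}, HasCompactSupport a → ContDiff ℝ ∞ a →
      Integrable fun X => ‖timeFourier a τ X‖ ^ 2 := fun hac ha => by
    refine ((hcont hac ha).norm.pow 2).integrable_of_hasCompactSupport ?_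
    simp only [sq]
    exact (hasCompactSupport_timeFourier hac τ).norm.mul_right
  -- The equation after Fourier transform in time. The space variables remain physical, so
  -- integration by parts in X is still available.
  have hslice : ∀ X, 2 * Real.pi * Complex.I * τ * timeFourier w τ X =
      ∑ i, timeFourier (fun p => fderiv ℝ (Ψ i) p (e i, 0)) τ X + timeFourier f τ X := fun X => by
    rw [← timeFourier_deriv hwc hw]
    simp only [timeFourier_eq, heq, mul_add, Finset.mul_sum]
    have hi : ∀ {v : E × ℝ → ℂ}, HasCompactSupport v → ContDiff ℝ ∞ v → Integrable fun t : ℝ =>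
        Complex.exp ((-2 * Real.pi * t * τ : ℝ) * Complex.I) * v (X, t) := fun hc hv =>
      (timeSlice hc hv X).integrable.bdd_mul (c := 1)
        (Continuous.aestronglyMeasurable (by fun_prop)) (ae_of_all _ fun t => by
          rw [Complex.norm_exp_ofReal_mul_I])
    rw [integral_add (integrable_finsetSum _ fun i _ => hi (hdc _ (hΨc i)) (hd _ (hΨ i)))
      (hi hfc hf), integral_finsetSum _ fun i _ => hi (hdc _ (hΨc i)) (hd _ (hΨ i))]
  have hibp : ∀ i, ∫ X, timeFourier (fun p => fderiv ℝ (Ψ i) p (e i, 0)) τ X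
      * conj (timeFourier w τ X) = - ∫ X, timeFourier (Ψ i) τ X *
        conj (timeFourier (fun p => fderiv ℝ w p (e i, 0)) τ X) := fun i => by
    have hc' : ∀ X, HasFDerivAt (fun X => conj (timeFourier w τ X))
        (Complex.conjCLE.toContinuousLinearMap.comp (fderiv ℝ (timeFourier w τ) X)) X := fun X =>
      Complex.conjCLE.hasFDerivAt.comp X
        (hasFDerivAt_timeFourier hwc hw τ X).differentiableAt.hasFDerivAt
    have hce : ∀ X v, fderiv ℝ (fun X => conj (timeFourier w τ X)) X v
        = conj (timeFourier (fun p => fderiv ℝ w p (v, 0)) τ X) := fun X v => by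
      rw [(hc' X).fderiv, ← fderiv_timeFourier hwc hw]; rfl
    have key := integral_mul_fderiv_eq_neg_fderiv_mul_of_integrable (μ := (volume : Measure E))
      (f := timeFourier (Ψ i) τ) (g := fun X => conj (timeFourier w τ X)) (v := e i) ?_ ?_ ?_
      (fun X _ => (hasFDerivAt_timeFourier (hΨc i) (hΨ i) τ X).differentiableAt)
      (fun X _ => (hc' X).differentiableAt)
    · simp only [hce, fderiv_timeFourier (hΨc i) (hΨ i)] at key
      rw [key, neg_neg]
    · simp only [fderiv_timeFourier (hΨc i) (hΨ i)]
      exact hprod (hdc _ (hΨc i)) (hd _ (hΨ i)) hwc hw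
    · simp only [hce]
      exact hprod (hΨc i) (hΨ i) (hdc _ hwc) (hd _ hw)
    · exact hprod (hΨc i) (hΨ i) hwc hw
  -- Testing with the conjugate of the transform of w itself. Its modulus gives the factor |τ| for
  -- either sign of the frequency.
  have hmain : 2 * Real.pi * Complex.I * τ * ((∫ X, ‖timeFourier w τ X‖ ^ 2 : ℝ) : ℂ) =
      -(∑ i, ∫ X, timeFourier (Ψ i) τ X *
        conj (timeFourier (fun p => fderiv ℝ w p (e i, 0)) τ X))
      + ∫ X, timeFourier f τ X * conj (timeFourier w τ X) := by
    rw [← integral_complex_ofReal, ← integral_const_mul, ← Finset.sum_neg_distrib]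
    simp only [← hibp]
    rw [← integral_finsetSum _ fun i _ => hprod (hdc _ (hΨc i)) (hd _ (hΨ i)) hwc hw,
      ← integral_add (integrable_finsetSum _ fun i _ => hprod (hdc _ (hΨc i)) (hd _ (hΨ i)) hwc hw)
        (hprod hfc hf hwc hw)]
    refine integral_congr_ae (ae_of_all _ fun X => ?_)
    dsimp only
    rw [← Finset.sum_mul, ← add_mul, ← hslice X]
    push_cast
    rw [← Complex.mul_conj']
    ring
  have hnorm : 2 * Real.pi * |τ| * ∫ X, ‖timeFourier w τ X‖ ^ 2 ≤
      ∑ i, (∫ X, ‖timeFourier (Ψ i) τ X * conj (timeFourier (fun p => fderiv ℝ w p (e i, 0)) τ X)‖)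
      + ∫ X, ‖timeFourier f τ X * conj (timeFourier w τ X)‖ := by
    have h0 : 0 ≤ ∫ X, ‖timeFourier w τ X‖ ^ 2 := integral_nonneg fun _ => sq_nonneg _
    have e1 : 2 * Real.pi * |τ| * ∫ X, ‖timeFourier w τ X‖ ^ 2 =
        ‖2 * Real.pi * Complex.I * τ * ((∫ X, ‖timeFourier w τ X‖ ^ 2 : ℝ) : ℂ)‖ := by
      simp only [norm_mul, Complex.norm_I, Complex.norm_real, Complex.norm_ofNat, mul_one,
        Real.norm_eq_abs, abs_of_pos Real.pi_pos, abs_of_nonneg h0]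
    rw [e1, hmain]
    refine (norm_add_le _ _).trans (add_le_add ?_ (norm_integral_le_integral_norm _))
    rw [norm_neg]
    exact (norm_sum_le _ _).trans (Finset.sum_le_sum fun i _ => norm_integral_le_integral_norm _)
  refine hnorm.trans ?_
  have hp : ∀ a b : ℂ, ‖a * conj b‖ ≤ ‖a‖ ^ 2 + ‖b‖ ^ 2 := fun a b => by
    rw [norm_mul, RCLike.norm_conj]
    nlinarith [sq_nonneg (‖a‖ - ‖b‖), sq_nonneg ‖a‖, sq_nonneg ‖b‖]
  rw [← integral_finsetSum _ fun i _ => (hprod (hΨc i) (hΨ i) (hdc _ hwc) (hd _ hw)).norm,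
    ← integral_add (integrable_finsetSum _ fun i _ =>
      (hprod (hΨc i) (hΨ i) (hdc _ hwc) (hd _ hw)).norm) (hprod hfc hf hwc hw).norm]
  refine integral_mono ((integrable_finsetSum _ fun i _ =>
      (hprod (hΨc i) (hΨ i) (hdc _ hwc) (hd _ hw)).norm).add (hprod hfc hf hwc hw).norm) ?_ fun X => ?_
  · exact (integrable_finsetSum _ fun i _ => (hsq (hΨc i) (hΨ i)).add
      (hsq (hdc _ hwc) (hd _ hw))).add ((hsq hfc hf).add (hsq hwc hw))
  · exact add_le_add (Finset.sum_le_sum fun i _ => hp _ _) (hp _ _)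

/-- The multiplication formula after a reflection. Mere integrability is assumed because g will be a
non-smooth symbol times a Fourier transform. -/
lemma integral_mul_fourierInv {f g : ℝ → ℂ} (hf : Integrable f) (hg : Integrable g) :
    ∫ t, f t * 𝓕⁻ g t = ∫ ξ, 𝓕 f (-ξ) * g ξ := by
  have h := VectorFourier.integral_fourierIntegral_smul_eq_flip (μ := (volume : Measure ℝ))
    (ν := (volume : Measure ℝ)) (L := innerₗ ℝ) (f := g) (g := f)
    Real.continuous_fourierChar (by fun_prop) hg hf
  have h1 : ∫ ξ, 𝓕 g ξ * f (-ξ) = ∫ ξ, g ξ * 𝓕 (fun t => f (-t)) ξ := by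
    have := VectorFourier.integral_fourierIntegral_smul_eq_flip (μ := (volume : Measure ℝ))
      (ν := (volume : Measure ℝ)) (L := innerₗ ℝ) (f := g) (g := fun t => f (-t))
      Real.continuous_fourierChar (by fun_prop) hg hf.comp_neg
    rw [flip_innerₗ] at this
    exact this
  rw [← integral_neg_eq_self]
  simp only [Real.fourierInv_eq_fourier_neg, neg_neg]
  simp only [mul_comm (f _)]
  rw [h1]
  refine integral_congr_ae (ae_of_all _ fun ξ => ?_)
  dsimp only
  rw [mul_comm, ← Real.fourierInv_eq_fourier_neg, Real.fourierInv_eq_fourier_comp_neg]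

/-- The fractional difference operators acting in the time variable. -/
def timeFrac (σ : ℝ) (ψ : E × ℝ → ℂ) (p : E × ℝ) : ℂ := fracDiff σ (fun t => ψ (p.1, t)) p.2

lemma timeFrac_eq (σ : ℝ) (ψ : E × ℝ → ℂ) (p : E × ℝ) :
    timeFrac σ ψ p = ∫ s in Ioi (0 : ℝ), ker s • (ψ p - ψ (p - (0, σ * s))) := by
  simp [timeFrac, fracDiff, Prod.mk_sub_mk, Prod.sub_def]

lemma norm_fracSymbol (y : ℝ) :
    ‖fracSymbol y‖ = √((cosConst ^ 2 + sinConst ^ 2) * |y|) := by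
  rw [← norm_fracSymbol_sq, Real.sqrt_sq (norm_nonneg _)]

/-- Since √ vanishes on negative numbers, one formula covers both signs, and continuity at the
origin can be read off. -/
lemma fracSymbol_eq_sqrt (y : ℝ) : fracSymbol y =
    (√y + √(-y) : ℝ) * (cosConst : ℂ) + (√y - √(-y) : ℝ) * (sinConst * Complex.I) := by
  rcases lt_trichotomy y 0 with hy | rfl | hy
  · rw [fracSymbol_of_neg hy, Real.sqrt_eq_zero_of_nonpos hy.le]
    push_cast; ring
  · simp [fracSymbol_zero]
  · rw [fracSymbol_of_pos hy, Real.sqrt_eq_zero_of_nonpos (neg_nonpos.2 hy.le)]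
    push_cast; ring

lemma continuous_fracSymbol : Continuous fracSymbol := by
  rw [funext fracSymbol_eq_sqrt]; fun_prop

lemma integrable_fracSymbol_mul (σ : ℝ) (ψ : 𝓢(ℝ, ℂ)) :
    Integrable fun ξ : ℝ => fracSymbol (2 * Real.pi * σ * ξ) * 𝓕 (ψ : ℝ → ℂ) ξ := by
  have h0 : Integrable fun ξ => ‖𝓕 ψ ξ‖ := (𝓕 ψ).integrable.norm
  have h1 := (𝓕 ψ).integrable_pow_mul volume 1
  simp only [pow_one] at h1
  have h2 := h0.add (h1.const_mul ((cosConst ^ 2 + sinConst ^ 2) * |2 * Real.pi * σ|))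
  refine h2.mono' ((continuous_fracSymbol.comp (by fun_prop)).mul
    (by rw [← SchwartzMap.fourier_coe]; exact (𝓕 ψ).continuous)).aestronglyMeasurable
    (ae_of_all _ fun ξ => ?_)
  rw [norm_mul, norm_fracSymbol, abs_mul _ ξ, ← SchwartzMap.fourier_coe, Pi.add_apply,
    Real.norm_eq_abs, ← mul_assoc, ← mul_assoc, ← one_add_mul]
  refine mul_le_mul_of_nonneg_right ?_ (norm_nonneg _)
  rw [Real.sqrt_le_left (by positivity)]
  nlinarith [show 0 ≤ (cosConst ^ 2 + sinConst ^ 2) * |2 * Real.pi * σ| * |ξ| by positivity]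

lemma enorm_integral_slice_le {σ : ℝ} {w ψ : E × ℝ → ℂ} (hwc : HasCompactSupport w)
    (hw : ContDiff ℝ ∞ w) (hψc : HasCompactSupport ψ) (hψ : ContDiff ℝ ∞ ψ) (X : E) :
    ‖∫ t, w (X, t) * timeFrac σ ψ (X, t)‖ₑ ≤ ∫⁻ ξ, ‖timeFourier w (-ξ) X‖ₑ *
      ‖fracSymbol (2 * Real.pi * σ * ξ)‖ₑ * ‖timeFourier ψ ξ X‖ₑ := by
  have h1 : ∀ t, timeFrac σ ψ (X, t) =
      𝓕⁻ (fun ξ : ℝ => fracSymbol (2 * Real.pi * σ * ξ) * timeFourier ψ ξ X) t := fun t =>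
    fracDiff_eq_fourierInv σ (timeSlice hψc hψ X) t
  simp only [h1]
  have h2 : ∫ t, w (X, t) * 𝓕⁻ (fun ξ : ℝ => fracSymbol (2 * Real.pi * σ * ξ) * timeFourier ψ ξ X) t
      = ∫ ξ, timeFourier w (-ξ) X * (fracSymbol (2 * Real.pi * σ * ξ) * timeFourier ψ ξ X) :=
    integral_mul_fourierInv (timeSlice hwc hw X).integrable
      (integrable_fracSymbol_mul σ (timeSlice hψc hψ X))
  rw [h2]
  refine (enorm_integral_le_lintegral_enorm _).trans (lintegral_mono fun ξ => ?_)
  rw [enorm_mul, enorm_mul, ← mul_assoc]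

/-- Integrability need not be assumed: without it the left integral is zero by convention. -/
lemma enorm_integral_prod_le (f : E × ℝ → ℂ) :
    ‖∫ p, f p‖ₑ ≤ ∫⁻ X, ‖∫ t, f (X, t)‖ₑ := by
  by_cases hf : Integrable f
  · have : ∫ p, f p = ∫ X, ∫ t, f (X, t) := integral_prod f hf
    rw [this]
    exact enorm_integral_le_lintegral_enorm _
  · rw [integral_undef hf]; simp

lemma lintegral_prod_eq {f : E × ℝ → ℝ≥0∞} (hf : Measurable f) :
    ∫⁻ p, f p = ∫⁻ X, ∫⁻ t, f (X, t) := lintegral_prod f hf.aemeasurable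

lemma lintegral_timeFourier_sq' {w : E × ℝ → ℂ} (hc : HasCompactSupport w) (hw : ContDiff ℝ ∞ w) :
    ∫⁻ X, ∫⁻ τ, ‖timeFourier w τ X‖ₑ ^ 2 = ∫⁻ p, ‖w p‖ₑ ^ 2 := by
  rw [lintegral_prod_eq (hw.continuous.enorm.measurable.pow_const 2)]
  exact lintegral_congr fun X => lintegral_timeFourier_sq hc hw X

lemma lintegral_lintegral_timeFourier_sq {w : E × ℝ → ℂ} (hc : HasCompactSupport w)
    (hw : ContDiff ℝ ∞ w) :
    ∫⁻ τ, ∫⁻ X, ‖timeFourier w τ X‖ₑ ^ 2 = ∫⁻ p, ‖w p‖ₑ ^ 2 := by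
  rw [← lintegral_timeFourier_sq' hc hw, lintegral_lintegral_swap]
  have := (continuous_timeFourier hc hw.continuous).comp (continuous_swap (X := ℝ) (Y := E))
  exact (this.enorm.measurable.pow_const 2).aemeasurable

/-- The estimate at a fixed frequency integrated in τ; Plancherel in time returns each term on the
right to physical space. -/
lemma lintegral_two_pi_mul_timeFourier_sq_le {e : ι → E} {w f : E × ℝ → ℂ} {Ψ : ι → E × ℝ → ℂ}
    (hwc : HasCompactSupport w) (hw : ContDiff ℝ ∞ w) (hfc : HasCompactSupport f)
    (hf : ContDiff ℝ ∞ f) (hΨc : ∀ i, HasCompactSupport (Ψ i)) (hΨ : ∀ i, ContDiff ℝ ∞ (Ψ i))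
    (heq : ∀ p, fderiv ℝ w p (0, 1) = ∑ i, fderiv ℝ (Ψ i) p (e i, 0) + f p) :
    ∫⁻ τ : ℝ, ENNReal.ofReal (2 * Real.pi * |τ|) * ∫⁻ X, ‖timeFourier w τ X‖ₑ ^ 2 ≤
      ∑ i, ((∫⁻ p, ‖Ψ i p‖ₑ ^ 2) + ∫⁻ p, ‖fderiv ℝ w p (e i, 0)‖ₑ ^ 2)
        + ((∫⁻ p, ‖f p‖ₑ ^ 2) + ∫⁻ p, ‖w p‖ₑ ^ 2) := by
  have hd : ∀ i, ContDiff ℝ ∞ fun p => fderiv ℝ w p (e i, 0) := fun i =>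
    (hw.fderiv_right (m := ∞) (by simp)).clm_apply contDiff_const
  have hdc : ∀ i, HasCompactSupport fun p => fderiv ℝ w p (e i, 0) := fun i =>
    hwc.fderiv_apply (𝕜 := ℝ) (e i, 0)
  have hcont : ∀ {v : E × ℝ → ℂ}, HasCompactSupport v → ContDiff ℝ ∞ v → ∀ τ,
      Continuous (timeFourier v τ) := fun hc hv τ =>
    (continuous_timeFourier hc hv.continuous).comp (by fun_prop : Continuous fun X : E => (X, τ))
  have hsq : ∀ {a : E × ℝ → ℂ}, HasCompactSupport a → ContDiff ℝ ∞ a → ∀ τ,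
      Integrable fun X => ‖timeFourier a τ X‖ ^ 2 := fun hac ha τ => by
    refine ((hcont hac ha τ).norm.pow 2).integrable_of_hasCompactSupport ?_
    simp only [sq]
    exact (hasCompactSupport_timeFourier hac τ).norm.mul_right
  have hm : ∀ {v : E × ℝ → ℂ}, HasCompactSupport v → ContDiff ℝ ∞ v → ∀ τ,
      Measurable fun X => ‖timeFourier v τ X‖ₑ ^ 2 := fun hc hv τ =>
    (hcont hc hv τ).enorm.measurable.pow_const 2
  have hmτ : ∀ {v : E × ℝ → ℂ}, HasCompactSupport v → ContDiff ℝ ∞ v →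
      Measurable fun τ => ∫⁻ X, ‖timeFourier v τ X‖ₑ ^ 2 := fun {v} hc hv => by
    have := (continuous_timeFourier hc hv.continuous).enorm.measurable.pow_const 2
    exact this.lintegral_prod_left'
  have hofReal : ∀ {v : E × ℝ → ℂ}, HasCompactSupport v → ContDiff ℝ ∞ v → ∀ τ,
      ENNReal.ofReal (∫ X, ‖timeFourier v τ X‖ ^ 2) = ∫⁻ X, ‖timeFourier v τ X‖ₑ ^ 2 :=
    fun hc hv τ => by
      rw [ofReal_integral_eq_lintegral_ofReal (hsq hc hv τ) (ae_of_all _ fun _ => sq_nonneg _)]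
      simp only [ENNReal.ofReal_pow (norm_nonneg _), ofReal_norm]
  have hpt : ∀ τ : ℝ, ENNReal.ofReal (2 * Real.pi * |τ|) * ∫⁻ X, ‖timeFourier w τ X‖ₑ ^ 2 ≤
      ∑ i, ((∫⁻ X, ‖timeFourier (Ψ i) τ X‖ₑ ^ 2)
        + ∫⁻ X, ‖timeFourier (fun p => fderiv ℝ w p (e i, 0)) τ X‖ₑ ^ 2)
      + ((∫⁻ X, ‖timeFourier f τ X‖ₑ ^ 2) + ∫⁻ X, ‖timeFourier w τ X‖ₑ ^ 2) := fun τ => by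
    have h := ENNReal.ofReal_le_ofReal
      (two_pi_mul_integral_timeFourier_sq_le hwc hw hfc hf hΨc hΨ heq τ)
    rw [ENNReal.ofReal_mul (by positivity), hofReal hwc hw] at h
    refine h.trans (le_of_eq ?_)
    have i1 := fun i => hsq (hΨc i) (hΨ i) τ
    have i2 := fun i => hsq (hdc i) (hd i) τ
    have i3 : Integrable fun X => ∑ i, (‖timeFourier (Ψ i) τ X‖ ^ 2 +
        ‖timeFourier (fun p => fderiv ℝ w p (e i, 0)) τ X‖ ^ 2) :=
      integrable_finsetSum _ fun i _ => (i1 i).add (i2 i)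
    have i4 : Integrable fun X => ‖timeFourier f τ X‖ ^ 2 + ‖timeFourier w τ X‖ ^ 2 :=
      (hsq hfc hf τ).add (hsq hwc hw τ)
    have i5 : ∀ i ∈ Finset.univ, Integrable fun X => ‖timeFourier (Ψ i) τ X‖ ^ 2 +
        ‖timeFourier (fun p => fderiv ℝ w p (e i, 0)) τ X‖ ^ 2 := fun i _ => (i1 i).add (i2 i)
    rw [integral_add i3 i4, integral_add (hsq hfc hf τ) (hsq hwc hw τ), integral_finsetSum _ i5]
    have n1 : ∀ {v : E × ℝ → ℂ}, 0 ≤ ∫ X, ‖timeFourier v τ X‖ ^ 2 := fun {v} =>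
      integral_nonneg fun _ => sq_nonneg _
    have n2 : ∀ i, 0 ≤ ∫ X, (‖timeFourier (Ψ i) τ X‖ ^ 2 +
        ‖timeFourier (fun p => fderiv ℝ w p (e i, 0)) τ X‖ ^ 2) := fun i =>
      integral_nonneg fun _ => by positivity
    rw [ENNReal.ofReal_add (Finset.sum_nonneg fun i _ => n2 i) (add_nonneg n1 n1),
      ENNReal.ofReal_add n1 n1, hofReal hfc hf, hofReal hwc hw,
      ENNReal.ofReal_sum_of_nonneg fun i _ => n2 i]
    congr 1
    refine Finset.sum_congr rfl fun i _ => ?_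
    rw [integral_add (i1 i) (i2 i), ENNReal.ofReal_add n1 n1, hofReal (hΨc i) (hΨ i),
      hofReal (hdc i) (hd i)]
  refine (lintegral_mono hpt).trans (le_of_eq ?_)
  have m1 := fun i => hmτ (hΨc i) (hΨ i)
  have m2 := fun i => hmτ (hdc i) (hd i)
  have m3 : Measurable fun τ =>
      (∫⁻ X, ‖timeFourier f τ X‖ₑ ^ 2) + ∫⁻ X, ‖timeFourier w τ X‖ₑ ^ 2 :=
    (hmτ hfc hf).add (hmτ hwc hw)
  have m4 : ∀ i ∈ Finset.univ, Measurable fun τ => (∫⁻ X, ‖timeFourier (Ψ i) τ X‖ₑ ^ 2) +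
      ∫⁻ X, ‖timeFourier (fun p => fderiv ℝ w p (e i, 0)) τ X‖ₑ ^ 2 := fun i _ => (m1 i).add (m2 i)
  rw [lintegral_add_right _ m3, lintegral_add_right _ (hmτ hwc hw),
    lintegral_finsetSum _ m4, lintegral_lintegral_timeFourier_sq hfc hf,
    lintegral_lintegral_timeFourier_sq hwc hw]
  congr 1
  refine Finset.sum_congr rfl fun i _ => ?_
  rw [lintegral_add_right _ (m2 i), lintegral_lintegral_timeFourier_sq (hΨc i) (hΨ i),
    lintegral_lintegral_timeFourier_sq (hdc i) (hd i)]

/-- Pairing with the fractional differences of a test function is controlled by the half-order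
energy. -/
lemma enorm_integral_mul_timeFrac_sq_le {σ : ℝ} (hσ : |σ| = 1) {w ψ : E × ℝ → ℂ}
    (hwc : HasCompactSupport w) (hw : ContDiff ℝ ∞ w)
    (hψc : HasCompactSupport ψ) (hψ : ContDiff ℝ ∞ ψ) :
    ‖∫ p, w p * timeFrac σ ψ p‖ₑ ^ 2 ≤ ENNReal.ofReal (cosConst ^ 2 + sinConst ^ 2) *
      (∫⁻ τ : ℝ, ENNReal.ofReal (2 * Real.pi * |τ|) * ∫⁻ X, ‖timeFourier w τ X‖ₑ ^ 2) *
      ∫⁻ p, ‖ψ p‖ₑ ^ 2 := by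
  have hcw := continuous_timeFourier hwc hw.continuous
  have hcψ := continuous_timeFourier hψc hψ.continuous
  have hneg : Continuous fun x : E × ℝ => (x.1, -x.2) := by fun_prop
  have hcw' : Continuous fun x : E × ℝ => timeFourier w (-x.2) x.1 := by
    have := hcw.comp hneg
    simp only [Function.comp_def] at this
    exact this
  have hcs : Continuous fun x : E × ℝ => fracSymbol (2 * Real.pi * σ * x.2) :=
    continuous_fracSymbol.comp (by fun_prop)
  have hma : Measurable fun x : E × ℝ => ‖timeFourier w (-x.2) x.1‖ₑ
      * ‖fracSymbol (2 * Real.pi * σ * x.2)‖ₑ := hcw'.enorm.measurable.mul hcs.enorm.measurable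
  have hsym : ∀ ξ : ℝ, ‖fracSymbol (2 * Real.pi * σ * ξ)‖ₑ ^ 2 =
      ENNReal.ofReal (cosConst ^ 2 + sinConst ^ 2) * ENNReal.ofReal (2 * Real.pi * |-ξ|) := fun ξ => by
    rw [← ofReal_norm, ← ENNReal.ofReal_pow (norm_nonneg _), norm_fracSymbol_sq,
      ← ENNReal.ofReal_mul (by positivity), abs_mul, abs_mul, hσ, abs_of_pos Real.two_pi_pos,
      abs_neg, mul_one]
  have h0 : ‖∫ p, w p * timeFrac σ ψ p‖ₑ ≤ ∫⁻ X, ∫⁻ ξ, ‖timeFourier w (-ξ) X‖ₑ *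
      ‖fracSymbol (2 * Real.pi * σ * ξ)‖ₑ * ‖timeFourier ψ ξ X‖ₑ :=
    (enorm_integral_prod_le fun p => w p * timeFrac σ ψ p).trans
      (lintegral_mono fun X => enorm_integral_slice_le hwc hw hψc hψ X)
  calc ‖∫ p, w p * timeFrac σ ψ p‖ₑ ^ 2
      ≤ (∫⁻ x : E × ℝ, (‖timeFourier w (-x.2) x.1‖ₑ * ‖fracSymbol (2 * Real.pi * σ * x.2)‖ₑ)
          * ‖timeFourier ψ x.2 x.1‖ₑ) ^ 2 := by
        have h1 : Measurable fun x : E × ℝ => ‖timeFourier w (-x.2) x.1‖ₑ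
            * ‖fracSymbol (2 * Real.pi * σ * x.2)‖ₑ * ‖timeFourier ψ x.2 x.1‖ₑ :=
          hma.mul hcψ.enorm.measurable
        rw [lintegral_prod_eq h1]
        gcongr
    -- Cauchy-Schwarz gives the whole symbol to w, so only the plain L² norm of ψ is left.
    _ ≤ (∫⁻ x : E × ℝ, (‖timeFourier w (-x.2) x.1‖ₑ * ‖fracSymbol (2 * Real.pi * σ * x.2)‖ₑ) ^ 2)
        * ∫⁻ x : E × ℝ, ‖timeFourier ψ x.2 x.1‖ₑ ^ 2 :=
        lintegral_mul_sq_le _ hma.aemeasurable hcψ.enorm.measurable.aemeasurable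
    _ = _ := by
        rw [lintegral_prod_eq (hcψ.enorm.measurable.pow_const 2), lintegral_timeFourier_sq' hψc hψ,
          lintegral_prod_eq (hma.pow_const 2), lintegral_lintegral_swap
            (hma.pow_const 2).aemeasurable]
        congr 1
        rw [← lintegral_const_mul' _ _ ENNReal.ofReal_ne_top]
        -- The pairing is bilinear, so w is transformed at -ξ. The weight is even and the reflection
        -- is harmless.
        have := (Measure.measurePreserving_neg (volume : Measure ℝ)).lintegral_comp_emb
          (MeasurableEquiv.neg ℝ).measurableEmbedding
          (fun τ => ENNReal.ofReal (cosConst ^ 2 + sinConst ^ 2) *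
            (ENNReal.ofReal (2 * Real.pi * |τ|) * ∫⁻ X, ‖timeFourier w τ X‖ₑ ^ 2))
        rw [← this]
        refine lintegral_congr fun ξ => ?_
        simp only [mul_pow, hsym]
        rw [lintegral_mul_const' _ _ (ENNReal.mul_ne_top ENNReal.ofReal_ne_top
          ENNReal.ofReal_ne_top)]
        ring

end TimeFourier

/-! ### Fractional differences in time of functions on space-time. -/

section TimeFrac

variable {E : Type*} [NormedAddCommGroup E] [NormedSpace ℝ E] [FiniteDimensional ℝ E]
  [MeasureSpace E] [BorelSpace E] [(volume : Measure E).IsAddHaarMeasure]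

/-- The mean value inequality for steps s ≤ 1 and the supremum bound for s ≥ 1. -/
lemma exists_time_difference_bound {ψ : E × ℝ → ℂ} (hc : HasCompactSupport ψ)
    (hψ : ContDiff ℝ ∞ ψ) : ∃ D : ℝ, 0 ≤ D ∧ ∀ σ : ℝ, |σ| = 1 → ∀ p s, 0 < s →
      ‖ψ p - ψ (p - (0, σ * s))‖ ≤ D * min 1 s := by
  obtain ⟨C₁, h₁⟩ := hc.exists_bound_of_continuous hψ.continuous
  obtain ⟨C₂, h₂⟩ := (hc.fderiv ℝ).exists_bound_of_continuous (hψ.continuous_fderiv (by simp))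
  have hC₁ : 0 ≤ C₁ := (norm_nonneg _).trans (h₁ 0)
  have hC₂ : 0 ≤ C₂ := (norm_nonneg _).trans (h₂ 0)
  refine ⟨2 * C₁ + C₂, by positivity, fun σ hσ p s hs => ?_⟩
  rcases le_total s 1 with h | h
  · rw [min_eq_right h]
    have := convex_univ.norm_image_sub_le_of_norm_fderiv_le (𝕜 := ℝ) (f := ψ) (C := C₂)
      (x := p - (0, σ * s)) (y := p)
      (fun x _ => hψ.differentiable (by simp) x) (fun x _ => h₂ x) (mem_univ _) (mem_univ _)
    refine this.trans ?_
    rw [sub_sub_cancel, Prod.norm_mk, norm_zero, max_eq_right (norm_nonneg _), Real.norm_eq_abs,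
      abs_mul, hσ, one_mul, abs_of_pos hs]
    nlinarith
  · rw [min_eq_left h, mul_one]
    refine (norm_sub_le _ _).trans ?_
    linarith [h₁ p, h₁ (p - (0, σ * s))]

lemma continuous_timeFrac {σ : ℝ} (hσ : |σ| = 1) {ψ : E × ℝ → ℂ} (hc : HasCompactSupport ψ)
    (hψ : ContDiff ℝ ∞ ψ) : Continuous (timeFrac σ ψ) := by
  obtain ⟨D, hD, h⟩ := exists_time_difference_bound hc hψ
  have hcont := hψ.continuous
  rw [funext (timeFrac_eq σ ψ)]
  refine continuous_of_dominated (bound := fun s => D * (min 1 s * ker s)) (fun p => ?_)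
    (fun p => ?_) (integrableOn_min_mul_ker.const_mul D) (ae_of_all _ fun s => ?_)
  · exact measurable_ker.aestronglyMeasurable.smul
      (Continuous.aestronglyMeasurable (by fun_prop))
  · refine (ae_restrict_iff' measurableSet_Ioi).2 (ae_of_all _ fun s hs => ?_)
    rw [norm_smul, Real.norm_of_nonneg (ker_pos hs).le]
    nlinarith [mul_le_mul_of_nonneg_left (h σ hσ p s hs) (ker_pos hs).le]
  · exact (by fun_prop : Continuous fun p => ψ p - ψ (p - (0, σ * s))).const_smul (ker s)

lemma timeFrac_eq_zero (σ : ℝ) {ψ : E × ℝ → ℂ} {p : E × ℝ} (hp : p.1 ∉ Prod.fst '' tsupport ψ) :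
    timeFrac σ ψ p = 0 := by
  have : ∀ t, ψ (p.1, t) = 0 := fun t => image_eq_zero_of_notMem_tsupport fun h => hp ⟨_, h, rfl⟩
  simp [timeFrac, fracDiff, this]

lemma norm_timeFrac_le_of_le {σ : ℝ} (hσ : |σ| = 1) {ψ : E × ℝ → ℂ} (hψ : Continuous ψ) {R : ℝ}
    (hR : 0 ≤ R) (hs : tsupport ψ ⊆ closedBall 0 R) {X : E} {t : ℝ} (ht : R + 1 / 2 ≤ |t|) :
    ‖timeFrac σ ψ (X, t)‖ ≤ ker (1 / (2 * R + 3)) * decay t * ∫ s, ‖ψ (X, s)‖ := by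
  refine norm_fracDiff_le hσ (by fun_prop) hR ?_ ht
  refine closure_minimal (fun s hs' => ?_) isClosed_closedBall
  have h := hs (subset_tsupport ψ hs')
  rw [mem_closedBall_zero_iff] at h ⊢
  exact (norm_snd_le (X, s)).trans h

lemma decay_sub_le {s : ℝ} (hs : |s| ≤ 1) (t : ℝ) : decay (t - s) ≤ ker (1 / 2) * decay t := by
  rw [decay, decay, ← ker_mul (by norm_num) (by positivity)]
  refine ker_le_ker (by positivity) ?_
  have := abs_sub_abs_le_abs_sub t (t - s)
  rw [sub_sub_cancel] at this
  linarith [abs_nonneg (t - s)]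

/-- For large |t| this is the tail bound off the support; for the remaining times boundedness
suffices, because the weight is bounded below there. -/
lemma exists_norm_timeFrac_le {σ : ℝ} (hσ : |σ| = 1) {ψ : E × ℝ → ℂ} (hc : HasCompactSupport ψ)
    (hψ : ContDiff ℝ ∞ ψ) : ∃ C : ℝ, 0 ≤ C ∧ ∀ p, ‖timeFrac σ ψ p‖ ≤ C * decay p.2 := by
  obtain ⟨D, hD, h⟩ := exists_time_difference_bound hc hψ
  obtain ⟨b, hb, hbψ⟩ := hc.exists_time_bound hψ.continuous
  obtain ⟨R, hR⟩ := hc.isCompact.isBounded.subset_closedBall 0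
  -- The radius supplied by boundedness may be negative when the support is empty.
  have hR' : tsupport ψ ⊆ closedBall 0 |R| := hR.trans (closedBall_subset_closedBall (le_abs_self R))
  have hk : 0 < ker (1 / (2 * |R| + 3)) := ker_pos (by positivity)
  have hk2 : 0 < ker (|R| + 3 / 2) := ker_pos (by positivity)
  have hI : 0 ≤ ∫ s in Ioi (0 : ℝ), min 1 s * ker s :=
    setIntegral_nonneg measurableSet_Ioi fun s hs =>
      mul_nonneg (le_min zero_le_one (le_of_lt hs)) (ker_pos hs).le
  have hb0 : 0 ≤ ∫ s, b s := integral_nonneg fun s => (norm_nonneg _).trans (hbψ 0 s)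
  set I := ∫ s in Ioi (0 : ℝ), min 1 s * ker s
  refine ⟨ker (1 / (2 * |R| + 3)) * (∫ s, b s) + D * I * (ker (|R| + 3 / 2))⁻¹, by positivity,
    fun p => ?_⟩
  have hd := decay_pos p.2
  rcases le_total (|R| + 1 / 2) |p.2| with ht | ht
  · have h1 := norm_timeFrac_le_of_le hσ hψ.continuous (abs_nonneg R) hR' (X := p.1) ht
    have h2 : ∫ s, ‖ψ (p.1, s)‖ ≤ ∫ s, b s := integral_mono_of_nonneg
      (ae_of_all _ fun _ => norm_nonneg _) hb (ae_of_all _ fun s => hbψ _ _)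
    refine h1.trans ?_
    have h3 := mul_le_mul_of_nonneg_left h2 (mul_nonneg hk.le hd.le)
    have h4 : 0 ≤ D * I * (ker (|R| + 3 / 2))⁻¹ * decay p.2 := by positivity
    linarith
  · have h1 : ‖timeFrac σ ψ p‖ ≤ D * I := by
      rw [timeFrac_eq]
      exact norm_integral_ker_smul_le fun s hs => h σ hσ p s hs
    have h2 : 1 ≤ (ker (|R| + 3 / 2))⁻¹ * decay p.2 := by
      rw [← div_eq_inv_mul, one_le_div hk2]
      exact ker_le_ker (by positivity) (by linarith)
    have h3 := mul_le_mul_of_nonneg_left h2 (mul_nonneg hD hI)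
    have h4 : 0 ≤ ker (1 / (2 * |R| + 3)) * (∫ s, b s) * decay p.2 := by positivity
    linarith

/-- Both operators are integrals of translates, so they commute by Fubini; the bound by min 1 s
supplies the integrability. -/
lemma timeFrac_mollify {σ : ℝ} (hσ : |σ| = 1) {ψ : E × ℝ → ℂ} (hc : HasCompactSupport ψ)
    (hψ : ContDiff ℝ ∞ ψ) {a : ℝ} (ha : 0 < a) (ha1 : a ≤ 1) (p : E × ℝ) :
    timeFrac σ (mollify a ψ) p = mollify a (timeFrac σ ψ) p := by
  obtain ⟨D, hD, h⟩ := exists_time_difference_bound hc hψ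
  have hcont := hψ.continuous
  have hk := (contDiff_profile (E := E)).continuous
  have hd := (dil (E := E) a).continuous
  have hm := fun p => integrable_mollify_integrand ha ha1 hcont.locallyIntegrable p
  have hint : Integrable (fun x : ℝ × (E × ℝ) => ker x.1 • (profile E x.2 •
      (ψ (p - dil a x.2) - ψ (p - dil a x.2 - (0, σ * x.1)))))
      ((volume.restrict (Ioi 0)).prod volume) := by
    have hb : Integrable (fun x : ℝ × (E × ℝ) => (D * (min 1 x.1 * ker x.1)) * profile E x.2)
        ((volume.restrict (Ioi 0)).prod volume) :=
      (integrableOn_min_mul_ker.const_mul D).mul_prod integrable_profile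
    refine hb.mono' ?_ ?_
    · exact (measurable_ker.comp measurable_fst).aestronglyMeasurable.smul
        (Continuous.aestronglyMeasurable (by fun_prop))
    · have : ∀ᵐ x : ℝ × (E × ℝ) ∂((volume.restrict (Ioi 0)).prod volume), 0 < x.1 :=
        Measure.quasiMeasurePreserving_fst.ae (ae_restrict_mem measurableSet_Ioi)
      filter_upwards [this] with x hx
      rw [norm_smul, norm_smul, Real.norm_of_nonneg (ker_pos hx).le,
        Real.norm_of_nonneg (profile_nonneg _)]
      have h1 := mul_le_mul_of_nonneg_left (h σ hσ (p - dil a x.2) x.1 hx)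
        (mul_nonneg (ker_pos hx).le (profile_nonneg x.2))
      linarith
  have e1 : timeFrac σ (mollify a ψ) p = ∫ s in Ioi (0 : ℝ), ∫ q, ker s • (profile E q •
      (ψ (p - dil a q) - ψ (p - dil a q - (0, σ * s)))) := by
    rw [timeFrac_eq]
    refine integral_congr_ae (ae_of_all _ fun s => ?_)
    dsimp only
    rw [integral_smul]
    congr 1
    have : ∀ q, profile E q • (ψ (p - dil a q) - ψ (p - dil a q - (0, σ * s))) =
        profile E q • ψ (p - dil a q) - profile E q • ψ (p - (0, σ * s) - dil a q) := fun q => by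
      rw [smul_sub, sub_right_comm]
    simp only [this]
    rw [integral_sub (hm _) (hm _)]
    rfl
  rw [e1, integral_integral_swap hint]
  simp only [mollify, dilAvg, timeFrac_eq]
  refine integral_congr_ae (ae_of_all _ fun q => ?_)
  dsimp only
  rw [← integral_smul]
  refine integral_congr_ae (ae_of_all _ fun s => ?_)
  exact smul_comm _ _ _

lemma tsupport_mollify_subset {F : Type*} [NormedAddCommGroup F] [NormedSpace ℝ F] [CompleteSpace F]
    {a : ℝ} (ha : 0 ≤ a) (ha1 : a ≤ 1) {f : E × ℝ → F} {p₀ : E × ℝ} {R : ℝ}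
    (hf : tsupport f ⊆ closedBall p₀ R) : tsupport (mollify a f) ⊆ closedBall p₀ (R + a) := by
  refine closure_minimal (fun p hp => ?_) isClosed_closedBall
  by_contra hn
  refine hp (mollify_eq_const ha ha1 fun q hq => image_eq_zero_of_notMem_tsupport fun hB => ?_)
  have hB := hf hB
  rw [mem_closedBall] at hB hq hn
  rw [dist_comm] at hq
  linarith [dist_triangle p q p₀]

/-- Evenness of the profile is what makes mollification its own transpose. -/
lemma profile_neg (q : E × ℝ) : profile E (-q) = profile E q := (profileBump E).normed_neg q

/-- Mollification is symmetric. -/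
lemma integral_mul_mollify {a : ℝ} (ha : 0 < a) {u φ : E × ℝ → ℂ} (hu : AEStronglyMeasurable u)
    (hφ : Continuous φ) {Φ : E × ℝ → ℝ} (hΦ : Integrable fun p => Φ p * ‖u p‖)
    (hb : ∀ p q, ‖q‖ ≤ 1 → ‖φ (p - dil a q)‖ ≤ Φ p) :
    ∫ p, u p * mollify a φ p = ∫ p, mollify a u p * φ p := by
  have hk := (contDiff_profile (E := E)).continuous
  have hd := (dil (E := E) a).continuous
  set K : (E × ℝ) × (E × ℝ) → ℂ := fun x => profile E x.2 • (u x.1 * φ (x.1 - dil a x.2)) with hK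
  have hint : Integrable K (volume.prod volume) := by
    have h1 : Integrable (fun x : (E × ℝ) × (E × ℝ) => (Φ x.1 * ‖u x.1‖) * profile E x.2)
        (volume.prod volume) := hΦ.mul_prod integrable_profile
    refine h1.mono' ?_ (ae_of_all _ fun x => ?_)
    · refine (hk.comp continuous_snd).aestronglyMeasurable.smul ?_
      exact (hu.comp_quasiMeasurePreserving Measure.quasiMeasurePreserving_fst).mul
        (Continuous.aestronglyMeasurable (by fun_prop))
    · rw [norm_smul, norm_mul, Real.norm_of_nonneg (profile_nonneg _)]
      by_cases hx : x.2 ∈ tsupport (profile E)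
      · have := hb x.1 x.2 (mem_closedBall_zero_iff.1 (tsupport_profile.le hx))
        have h2 := mul_le_mul_of_nonneg_left this
          (mul_nonneg (profile_nonneg x.2) (norm_nonneg (u x.1)))
        linarith
      · simp [image_eq_zero_of_notMem_tsupport hx]
  -- This shear carries the integrability of the double integrand over to the translated one, so
  -- Fubini applies a second time.
  have hshear : MeasurePreserving (fun x : (E × ℝ) × (E × ℝ) => (x.1, x.2 + dil a x.1))
      (volume.prod volume) (volume.prod volume) :=
    (MeasurePreserving.id volume).skew_product (g := fun q p => p + dil a q)
      (by fun_prop) (ae_of_all _ fun q => (measurePreserving_add_right volume (dil a q)).map_eq)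
  have hswap : Integrable (fun x : (E × ℝ) × (E × ℝ) => profile E x.1 •
      (u (x.2 + dil a x.1) * φ x.2)) (volume.prod volume) := by
    have := hshear.integrable_comp_of_integrable hint.swap
    refine this.congr (ae_of_all _ fun x => ?_)
    simp only [hK, Function.comp_apply, Prod.swap_prod_mk, add_sub_cancel_right]
  calc ∫ p, u p * mollify a φ p = ∫ p, ∫ q, K (p, q) := by
        refine integral_congr_ae (ae_of_all _ fun p => ?_)
        simp only [mollify, dilAvg, hK]
        rw [← integral_const_mul]
        refine integral_congr_ae (ae_of_all _ fun q => ?_)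
        simp only [Complex.real_smul]; ring
    _ = ∫ q, ∫ p, K (p, q) := integral_integral_swap hint
    _ = ∫ q, ∫ p, profile E q • (u (p + dil a q) * φ p) := by
        refine integral_congr_ae (ae_of_all _ fun q => ?_)
        dsimp only
        rw [← integral_add_right_eq_self (fun p => K (p, q)) (dil a q)]
        simp only [hK, add_sub_cancel_right]
    _ = ∫ p, ∫ q, profile E q • (u (p + dil a q) * φ p) := integral_integral_swap hswap
    _ = _ := by
        refine integral_congr_ae (ae_of_all _ fun p => ?_)
        simp only [mollify, dilAvg]
        rw [← integral_mul_const, ← integral_neg_eq_self]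
        refine integral_congr_ae (ae_of_all _ fun q => ?_)
        simp only [profile_neg, map_neg, ← sub_eq_add_neg, Complex.real_smul]
        ring

end TimeFrac

/-! ### The local estimate for the half-order derivative. -/

section FracSol

variable {E : Type*} [NormedAddCommGroup E] [NormedSpace ℝ E] [FiniteDimensional ℝ E]
  [MeasureSpace E] [BorelSpace E] [(volume : Measure E).IsAddHaarMeasure]
  {ι : Type*} [Fintype ι]

/-- A solution in the cylinder of radius `8`, together with a half-order time derivative `q` given
by the duality with one-sided fractional differences. -/
structure FracSol (e : ι → E) (κ M σ : ℝ) (u : E × ℝ → ℂ) (F G : ι → E × ℝ → ℂ)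
    (q : E × ℝ → ℂ) : Prop extends EllipticSol e {p : E × ℝ | ‖p.1‖ < 8} κ M u F G where
  memL2_frac : MemL2Loc q univ
  decay_lt_top : ∀ᵐ X : E, ‖X‖ < 8 → ∫⁻ t, ‖u (X, t)‖ₑ * ENNReal.ofReal (decay t) < ⊤
  pairing : ∀ᵐ X : E, ‖X‖ < 8 → ∀ ψ : ℝ → ℂ, ContDiff ℝ ∞ ψ → HasCompactSupport ψ →
    ∫ t, q (X, t) * ψ t = ∫ t, u (X, t) * fracDiff σ ψ t

lemma enorm_add_sq_le {F : Type*} [SeminormedAddCommGroup F] (a b : F) :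
    ‖a + b‖ₑ ^ 2 ≤ 2 * (‖a‖ₑ ^ 2 + ‖b‖ₑ ^ 2) := by
  have h : ‖a + b‖ ^ 2 ≤ 2 * (‖a‖ ^ 2 + ‖b‖ ^ 2) := by
    have := norm_add_le a b
    nlinarith [sq_nonneg (‖a‖ - ‖b‖), norm_nonneg (a + b), norm_nonneg a, norm_nonneg b]
  have := ENNReal.ofReal_le_ofReal h
  rwa [ENNReal.ofReal_mul zero_le_two, ENNReal.ofReal_add (sq_nonneg _) (sq_nonneg _),
    ENNReal.ofReal_pow (norm_nonneg _), ENNReal.ofReal_pow (norm_nonneg _),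
    ENNReal.ofReal_pow (norm_nonneg _), ofReal_norm, ofReal_norm, ofReal_norm,
    ENNReal.ofReal_ofNat] at this

lemma enorm_sub_sq_le {F : Type*} [SeminormedAddCommGroup F] (a b : F) :
    ‖a - b‖ₑ ^ 2 ≤ 2 * (‖a‖ₑ ^ 2 + ‖b‖ₑ ^ 2) := by
  rw [sub_eq_add_neg, ← enorm_neg b]
  exact enorm_add_sq_le a (-b)

lemma EllipticSol.sum_enorm_flux_sq_le {e : ι → E} {Ω : Set (E × ℝ)} {κ M : ℝ} {u : E × ℝ → ℂ}
    {F G : ι → E × ℝ → ℂ} (h : EllipticSol e Ω κ M u F G) (p : E × ℝ) :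
    ∑ i, ‖F i p‖ₑ ^ 2 ≤ ENNReal.ofReal (M ^ 2) * ∑ i, ‖G i p‖ₑ ^ 2 := by
  have := ENNReal.ofReal_le_ofReal (h.upper p)
  rw [ENNReal.ofReal_mul (sq_nonneg _), ENNReal.ofReal_sum_of_nonneg fun _ _ => sq_nonneg _,
    ENNReal.ofReal_sum_of_nonneg fun _ _ => sq_nonneg _] at this
  simpa only [ENNReal.ofReal_pow (norm_nonneg _), ofReal_norm] using this

lemma lintegral_sub_mollify_sq_le {a : ℝ} (ha : 0 ≤ a) (ha1 : a ≤ 1) {S S' : Set (E × ℝ)}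
    (h : Nbhd a S S') {f : E × ℝ → ℂ} (hf : AEStronglyMeasurable f) :
    ∫⁻ p in S, ‖f p - mollify a f p‖ₑ ^ 2 ≤ 4 * ∫⁻ p in S', ‖f p‖ₑ ^ 2 := by
  calc ∫⁻ p in S, ‖f p - mollify a f p‖ₑ ^ 2
      ≤ ∫⁻ p in S, 2 * (‖f p‖ₑ ^ 2 + ‖mollify a f p‖ₑ ^ 2) :=
        lintegral_mono fun p => enorm_sub_sq_le _ _
    _ = 2 * ((∫⁻ p in S, ‖f p‖ₑ ^ 2) + ∫⁻ p in S, ‖mollify a f p‖ₑ ^ 2) := by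
        rw [lintegral_const_mul' _ _ (by simp), lintegral_add_left' (hf.restrict.enorm.pow_const 2)]
    _ ≤ 2 * ((∫⁻ p in S', ‖f p‖ₑ ^ 2) + ∫⁻ p in S', ‖f p‖ₑ ^ 2) := by
        exact mul_le_mul_right (add_le_add (lintegral_mono_set (h.subset ha))
          (lintegral_mollify_sq_le ha ha1 h hf)) _
    _ = _ := by ring

/-- The flux, the gradient and the values of `v - v_δ` are controlled by the mean of the gradient,
where `v` is a mollification of a solution and `δ = 1/2`. -/
lemma exists_oscillation_le (e : ι → E) (ℓ : ι → E →L[ℝ] ℝ) (hℓ : ∀ Y, ∑ i, ℓ i Y • e i = Y)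
    {κ M : ℝ} (hκ : 0 < κ) (hM : 0 < M) :
    ∃ C : ℝ≥0∞, C ≠ ⊤ ∧ ∀ {Ω : Set (E × ℝ)} {u : E × ℝ → ℂ} {F G : ι → E × ℝ → ℂ},
      EllipticSol e Ω κ M u F G → ∀ p₀ : E × ℝ, closedBall p₀ 6 ⊆ Ω → ∀ ε : ℝ, 0 < ε → ε ≤ 1 / 4 →
      (∫⁻ p in closedBall p₀ 3, ‖mollify ε u p - mollify (1 / 2) (mollify ε u) p‖ₑ ^ 2) +
        ∑ i, ((∫⁻ p in closedBall p₀ 3,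
            ‖mollify ε (G i) p - mollify (1 / 2) (mollify ε (G i)) p‖ₑ ^ 2) +
          ∫⁻ p in closedBall p₀ 3,
            ‖mollify ε (F i) p - mollify (1 / 2) (mollify ε (F i)) p‖ₑ ^ 2) ≤
      C * (∫⁻ p in closedBall p₀ 6, ∑ i, ‖G i p‖ₑ) ^ 2 := by
  obtain ⟨C₁, hC₁⟩ := exists_gradient_reverse_holder e ℓ hℓ hκ hM
  obtain ⟨C₃, hC₃⟩ := exists_lintegral_sub_mollify_sq_le e ℓ hℓ
  refine ⟨(C₃ * ENNReal.ofReal (1 / 2) ^ 2 + 4) * ((1 + ENNReal.ofReal (M ^ 2)) * C₁), by finiteness,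
    fun {Ω u F G} h p₀ hΩ ε hε hε4 => ?_⟩
  have hε1 : ε ≤ 1 := by linarith
  have hb4 : ball p₀ 4 ⊆ closedBall p₀ 6 :=
    ball_subset_closedBall.trans (closedBall_subset_closedBall (by norm_num))
  -- Radii: 3 + 1/2 = 7/2 for the fixed scale, at most 4 after ε ≤ 1/4, and the gradient estimate
  -- passes from 4 to 6.
  have n1 : Nbhd (1 / 2) (closedBall p₀ 3) (closedBall p₀ (7 / 2)) := fun p hp =>
    closedBall_subset_closedBall' (by linarith [mem_closedBall.1 hp])
  have n2 : Nbhd ε (closedBall p₀ (7 / 2)) (ball p₀ 4) := fun p hp =>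
    closedBall_subset_ball' (by linarith [mem_closedBall.1 hp])
  have hv : SmoothSol e (closedBall p₀ (7 / 2)) _ _ _ := h.toWeakSol.smoothSol hε hε1
    fun p hp => (n2 p hp).trans (hb4.trans hΩ)
  have hGm := fun i => (h.memL2_grad i).aestronglyMeasurable
  have hFm := fun i => (h.memL2_flux i).aestronglyMeasurable
  have hT : ∑ i, ((∫⁻ p in ball p₀ 4, ‖G i p‖ₑ ^ 2) + ∫⁻ p in ball p₀ 4, ‖F i p‖ₑ ^ 2) ≤
      (1 + ENNReal.ofReal (M ^ 2)) * C₁ * (∫⁻ p in closedBall p₀ 6, ∑ i, ‖G i p‖ₑ) ^ 2 := by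
    rw [Finset.sum_add_distrib, ← lintegral_finsetSum' _ fun i _ => (hGm i).restrict.enorm.pow_const 2,
      ← lintegral_finsetSum' _ fun i _ => (hFm i).restrict.enorm.pow_const 2, mul_assoc]
    refine le_trans ?_ (mul_le_mul_right (hC₁ h p₀ hΩ) _)
    rw [add_mul, one_mul, ← lintegral_const_mul' _ _ ENNReal.ofReal_ne_top]
    exact add_le_add le_rfl (lintegral_mono fun p => h.sum_enorm_flux_sq_le p)
  have hz := hC₃ (by norm_num) (by norm_num) isClosed_closedBall.measurableSet n1 hv
  have hz' : ∑ i, ∫⁻ p in closedBall p₀ (7 / 2), (‖mollify ε (G i) p‖ₑ ^ 2 + ‖mollify ε (F i) p‖ₑ ^ 2)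
      ≤ ∑ i, ((∫⁻ p in ball p₀ 4, ‖G i p‖ₑ ^ 2) + ∫⁻ p in ball p₀ 4, ‖F i p‖ₑ ^ 2) := by
    refine Finset.sum_le_sum fun i _ => ?_
    rw [lintegral_add_left ((hv.smooth_grad i).continuous.enorm.measurable.pow_const 2)]
    exact add_le_add (lintegral_mollify_sq_le hε.le hε1 n2 (hGm i))
      (lintegral_mollify_sq_le hε.le hε1 n2 (hFm i))
  have hosc : ∀ {f : E × ℝ → ℂ}, MemL2Loc f univ → ∫⁻ p in closedBall p₀ 3,
      ‖mollify ε f p - mollify (1 / 2) (mollify ε f) p‖ₑ ^ 2 ≤ 4 * ∫⁻ p in ball p₀ 4, ‖f p‖ₑ ^ 2 :=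
    fun hf => (lintegral_sub_mollify_sq_le (by norm_num) (by norm_num) n1
      (hf.mollify hε hε1).aestronglyMeasurable).trans
        (mul_le_mul_right (lintegral_mollify_sq_le hε.le hε1 n2 hf.aestronglyMeasurable) _)
  calc _ ≤ C₃ * ENNReal.ofReal (1 / 2) ^ 2 *
        ∑ i, ((∫⁻ p in ball p₀ 4, ‖G i p‖ₑ ^ 2) + ∫⁻ p in ball p₀ 4, ‖F i p‖ₑ ^ 2) +
        ∑ i, (4 * (∫⁻ p in ball p₀ 4, ‖G i p‖ₑ ^ 2) + 4 * ∫⁻ p in ball p₀ 4, ‖F i p‖ₑ ^ 2) :=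
        add_le_add (hz.trans (mul_le_mul_right hz' _)) (Finset.sum_le_sum fun i _ =>
          add_le_add (hosc (h.memL2_grad i)) (hosc (h.memL2_flux i)))
    _ = (C₃ * ENNReal.ofReal (1 / 2) ^ 2 + 4) *
        ∑ i, ((∫⁻ p in ball p₀ 4, ‖G i p‖ₑ ^ 2) + ∫⁻ p in ball p₀ 4, ‖F i p‖ₑ ^ 2) := by
        simp only [← mul_add, ← Finset.mul_sum]; ring
    _ ≤ _ := by
        rw [mul_assoc]
        exact mul_le_mul_right hT _

/-- The limit ε → 0. The operator f ↦ f - f_{1/2} is bounded from L² on a larger ball, and it is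
applied to u_ε - u, which tends to zero there; the factor 2 comes from the square of a sum. -/
lemma lintegral_sub_mollify_sq_le_of_forall {u : E × ℝ → ℂ} (hu : MemL2Loc u univ) {p₀ : E × ℝ} {R : ℝ}
    {A : ℝ≥0∞} (h : ∀ ε : ℝ, 0 < ε → ε ≤ 1 / 4 → ∫⁻ p in closedBall p₀ R,
      ‖mollify ε u p - mollify (1 / 2) (mollify ε u) p‖ₑ ^ 2 ≤ A) :
    ∫⁻ p in closedBall p₀ R, ‖u p - mollify (1 / 2) u p‖ₑ ^ 2 ≤ 2 * A := by
  have n1 : Nbhd (1 / 2) (closedBall p₀ R) (closedBall p₀ (R + 1)) := fun p hp =>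
    closedBall_subset_closedBall' (by linarith [mem_closedBall.1 hp])
  have hlim := (ENNReal.Tendsto.const_mul (a := 8) (hu.tendsto_mollify
    (S := closedBall p₀ (R + 1)) isBounded_closedBall) (Or.inr (by simp))).const_add (2 * A)
  rw [mul_zero, add_zero] at hlim
  refine ge_of_tendsto hlim ?_
  filter_upwards [Ioc_mem_nhdsGT (by norm_num : (0 : ℝ) < 1 / 4)] with ε ⟨hε, hε4⟩
  have hε1 : ε ≤ 1 := by linarith
  have hv := hu.mollify hε hε1
  have hd : MemL2Loc (fun p => mollify ε u p - u p) univ := fun K hK hKc =>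
    (hv K hK hKc).sub (hu K hK hKc)
  have e : ∀ p, u p - mollify (1 / 2) u p = (mollify ε u p - mollify (1 / 2) (mollify ε u) p)
      - ((mollify ε u p - u p) - mollify (1 / 2) (fun p => mollify ε u p - u p) p) := fun p => by
    have := mollify_sub (a := 1 / 2) (by norm_num) (by norm_num) hv.locallyIntegrable
      hu.locallyIntegrable p
    change mollify (1 / 2) (fun p => mollify ε u p - u p) p = _ at this
    rw [this]; ring
  calc ∫⁻ p in closedBall p₀ R, ‖u p - mollify (1 / 2) u p‖ₑ ^ 2
      ≤ ∫⁻ p in closedBall p₀ R, 2 * (‖mollify ε u p - mollify (1 / 2) (mollify ε u) p‖ₑ ^ 2 +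
        ‖(mollify ε u p - u p) - mollify (1 / 2) (fun p => mollify ε u p - u p) p‖ₑ ^ 2) := by
        refine lintegral_mono fun p => ?_
        rw [e]; exact enorm_sub_sq_le _ _
    _ = 2 * ((∫⁻ p in closedBall p₀ R, ‖mollify ε u p - mollify (1 / 2) (mollify ε u) p‖ₑ ^ 2) +
        ∫⁻ p in closedBall p₀ R,
          ‖(mollify ε u p - u p) - mollify (1 / 2) (fun p => mollify ε u p - u p) p‖ₑ ^ 2) := by
        rw [lintegral_const_mul' _ _ (by simp), lintegral_add_left']
        exact ((hv.aestronglyMeasurable.sub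
          (hv.mollify (by norm_num) (by norm_num)).aestronglyMeasurable).restrict.enorm.pow_const 2)
    _ ≤ 2 * (A + 4 * ∫⁻ p in closedBall p₀ (R + 1), ‖mollify ε u p - u p‖ₑ ^ 2) := by
        gcongr
        · exact h ε hε hε4
        · exact lintegral_sub_mollify_sq_le (by norm_num) (by norm_num) n1 hd.aestronglyMeasurable
    _ = _ := by ring

lemma exists_mem_Ioc_two_mul (t : ℝ) : ∃ j : ℤ, t ∈ Ioc (2 * (j : ℝ) - 1) (2 * j + 1) := by
  refine ⟨⌈(t - 1) / 2⌉, ?_, ?_⟩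
  · have := Int.ceil_lt_add_one ((t - 1) / 2)
    linarith
  · have := Int.le_ceil ((t - 1) / 2)
    linarith

lemma ofReal_decay_le {t s : ℝ} (h : |s - t| ≤ 1) :
    ENNReal.ofReal (decay t) ≤ ENNReal.ofReal (ker (1 / 2)) * ENNReal.ofReal (decay s) := by
  rw [← ENNReal.ofReal_mul (ker_pos (by norm_num)).le]
  refine ENNReal.ofReal_le_ofReal ?_
  have := decay_sub_le h s
  rwa [sub_sub_cancel] at this

/-- The line is cut into intervals of length 2 about the even integers, on each of which the weight
is comparable to its value at the centre. -/
lemma lintegral_mul_decay_le (φ : ℝ → ℝ≥0∞) (b : ℤ → ℝ≥0∞)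
    (h : ∀ (j : ℤ), ∀ t ∈ Ioc (2 * (j : ℝ) - 1) (2 * j + 1), φ t ≤ b j) :
    ∫⁻ t, φ t * ENNReal.ofReal (decay t) ≤
      2 * ENNReal.ofReal (ker (1 / 2)) * ∑' j : ℤ, ENNReal.ofReal (decay (2 * j)) * b j := by
  have hU : (⋃ j : ℤ, Ioc (2 * (j : ℝ) - 1) (2 * j + 1)) = univ :=
    eq_univ_of_forall fun t => mem_iUnion.2 (exists_mem_Ioc_two_mul t)
  rw [← setLIntegral_univ, ← hU, ← ENNReal.tsum_mul_left]
  refine (lintegral_iUnion_le _ _).trans (ENNReal.tsum_le_tsum fun j => ?_)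
  calc ∫⁻ t in Ioc (2 * (j : ℝ) - 1) (2 * j + 1), φ t * ENNReal.ofReal (decay t)
      ≤ ∫⁻ t in Ioc (2 * (j : ℝ) - 1) (2 * j + 1),
        b j * (ENNReal.ofReal (ker (1 / 2)) * ENNReal.ofReal (decay (2 * j))) := by
        refine setLIntegral_mono' measurableSet_Ioc fun t ht => mul_le_mul' (h j t ht) ?_
        exact ofReal_decay_le (abs_le.2 ⟨by linarith [ht.2], by linarith [ht.1]⟩)
    _ = 2 * ENNReal.ofReal (ker (1 / 2)) * (ENNReal.ofReal (decay (2 * j)) * b j) := by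
        rw [lintegral_const, Measure.restrict_apply_univ, Real.volume_Ioc,
          show (2 * (j : ℝ) + 1 - (2 * j - 1)) = 2 by ring, ENNReal.ofReal_ofNat]
        ring

/-- The infinite cylinder is cut into unit-size pieces, each inside a ball centred at (0, 2j), where
local estimates apply. -/
lemma setLIntegral_mul_decay_le (φ : E × ℝ → ℝ≥0∞) :
    ∫⁻ p in closedBall (0 : E) 3 ×ˢ univ, φ p * ENNReal.ofReal (decay p.2) ≤
      ENNReal.ofReal (ker (1 / 2)) * ∑' j : ℤ, ENNReal.ofReal (decay (2 * j)) *
        ∫⁻ p in closedBall ((0 : E), 2 * (j : ℝ)) 3 ∩ univ ×ˢ Ioc (2 * (j : ℝ) - 1) (2 * j + 1), φ p := by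
  have hU : closedBall (0 : E) 3 ×ˢ univ ⊆ (⋃ j : ℤ, closedBall ((0 : E), 2 * (j : ℝ)) 3 ∩
      univ ×ˢ Ioc (2 * (j : ℝ) - 1) (2 * j + 1)) := fun p hp => by
    obtain ⟨j, hj⟩ := exists_mem_Ioc_two_mul p.2
    refine mem_iUnion.2 ⟨j, ?_, mem_univ _, hj⟩
    rw [← closedBall_prod_same]
    refine ⟨hp.1, ?_⟩
    rw [mem_closedBall, Real.dist_eq]
    exact abs_le.2 ⟨by linarith [hj.1], by linarith [hj.2]⟩
  rw [← ENNReal.tsum_mul_left]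
  refine (lintegral_mono_set hU).trans
    ((lintegral_iUnion_le _ _).trans (ENNReal.tsum_le_tsum fun j => ?_))
  rw [← mul_assoc, ← lintegral_const_mul' _ _ (by finiteness)]
  refine setLIntegral_mono' (isClosed_closedBall.measurableSet.inter
    (MeasurableSet.univ.prod measurableSet_Ioc)) fun p hp => ?_
  rw [mul_comm]
  refine mul_le_mul' (ofReal_decay_le ?_) le_rfl
  have := hp.2.2
  exact abs_le.2 ⟨by linarith [this.2], by linarith [this.1]⟩

/-- The weighted sum of the local means of the gradient. -/
def gradTail (G : ι → E × ℝ → ℂ) : ℝ≥0∞ := ∑' j : ℤ, ENNReal.ofReal (decay (2 * j)) *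
  ∫⁻ p in closedBall ((0 : E), 2 * (j : ℝ)) 6, ∑ i, ‖G i p‖ₑ

lemma setLIntegral_le_sqrt {S : Set (E × ℝ)} {f : E × ℝ → ℝ≥0∞} (hf : AEMeasurable f) {A : ℝ≥0∞}
    (h : ∫⁻ p in S, f p ^ 2 ≤ A) : ∫⁻ p in S, f p ≤ (volume S) ^ (1 / 2 : ℝ) * A ^ (1 / 2 : ℝ) := by
  have h1 := lintegral_sq_le (volume.restrict S) hf.restrict
  rw [Measure.restrict_apply_univ] at h1
  rw [← ENNReal.mul_rpow_of_nonneg _ _ (by norm_num)]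
  have h2 := ENNReal.rpow_le_rpow (h1.trans (mul_le_mul_right h _))
    (show (0 : ℝ) ≤ 1 / 2 by norm_num)
  rwa [← ENNReal.rpow_natCast, ← ENNReal.rpow_mul, show ((2 : ℕ) : ℝ) * (1 / 2) = 1 by norm_num,
    ENNReal.rpow_one] at h2

lemma mul_sq_rpow_half (C a : ℝ≥0∞) : (C * a ^ 2) ^ (1 / 2 : ℝ) = C ^ (1 / 2 : ℝ) * a := by
  rw [ENNReal.mul_rpow_of_nonneg _ _ (by norm_num), ← ENNReal.rpow_natCast, ← ENNReal.rpow_mul]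
  norm_num

lemma closedBall_six_subset (j : ℤ) :
    closedBall ((0 : E), 2 * (j : ℝ)) 6 ⊆ {p : E × ℝ | ‖p.1‖ < 8} := fun p hp => by
  rw [← closedBall_prod_same] at hp
  have := mem_closedBall_zero_iff.1 hp.1
  exact this.trans_lt (by norm_num)

/-- The mollification of a solution varies little in the space variables. -/
lemma EllipticSol.enorm_mollify_sub_le {e : ι → E} {ℓ : ι → E →L[ℝ] ℝ}
    (hℓ : ∀ Y, ∑ i, ℓ i Y • e i = Y) {κ M : ℝ} {u : E × ℝ → ℂ} {F G : ι → E × ℝ → ℂ}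
    (h : EllipticSol e {p : E × ℝ | ‖p.1‖ < 8} κ M u F G) :
    ∃ C : ℝ≥0∞, C ≠ ⊤ ∧ ∀ (j : ℤ) (X Y : E) (t : ℝ), ‖X‖ ≤ 3 → ‖Y‖ ≤ 3 →
      t ∈ Ioc (2 * (j : ℝ) - 1) (2 * j + 1) →
      ‖mollify (1 / 2) u (X, t) - mollify (1 / 2) u (Y, t)‖ₑ ≤
        C * ∫⁻ p in closedBall ((0 : E), 2 * (j : ℝ)) 6, ∑ i, ‖G i p‖ₑ := by
  obtain ⟨C, hC0, hC⟩ := exists_enorm_mollify_le E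
  set c := C * ((1 / 2 : ℝ) ^ homDim E)⁻¹ with hc
  have hc0 : 0 ≤ c := by positivity
  have hs0 : 0 ≤ ∑ i, ‖ℓ i‖ := Finset.sum_nonneg fun _ _ => norm_nonneg _
  refine ⟨ENNReal.ofReal ((∑ i, ‖ℓ i‖) * c * 6), ENNReal.ofReal_ne_top, fun j X Y t hX hY ht => ?_⟩
  set a := ∫⁻ p in closedBall ((0 : E), 2 * (j : ℝ)) 6, ∑ i, ‖G i p‖ₑ with ha
  have hatop : a ≠ ⊤ := by
    rw [ha, lintegral_finsetSum' _ fun i _ => (h.memL2_grad i).aestronglyMeasurable.restrict.enorm]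
    exact ENNReal.sum_ne_top.2 fun i _ =>
      ((h.memL2_grad i).integrableOn isBounded_closedBall).2.ne
  have hsm : ContDiff ℝ ∞ (mollify (1 / 2) u) :=
    contDiff_mollify (by norm_num) (by norm_num) h.memL2.locallyIntegrable
  have hG : ∀ Z : E, ‖Z‖ ≤ 3 → ∀ i, ‖mollify (1 / 2) (G i) (Z, t)‖ ≤ c * a.toReal := fun Z hZ i => by
    rw [← ENNReal.ofReal_le_ofReal_iff (by positivity), ofReal_norm, ENNReal.ofReal_mul hc0,
      ENNReal.ofReal_toReal hatop]
    refine (hC (by norm_num) (by norm_num) (G i) (Z, t)).trans (mul_le_mul_right ?_ _)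
    refine (lintegral_mono_set ?_).trans (lintegral_mono fun p =>
      Finset.single_le_sum (f := fun i => ‖G i p‖ₑ) (fun _ _ => zero_le) (Finset.mem_univ i))
    refine closedBall_subset_closedBall' ?_
    have : dist (Z, t) ((0 : E), 2 * (j : ℝ)) ≤ 3 := by
      rw [Prod.dist_eq]
      refine max_le (by simpa using hZ) ?_
      rw [Real.dist_eq]
      exact abs_le.2 ⟨by linarith [ht.1], by linarith [ht.2]⟩
    linarith
  have hd : ∀ Z : E, HasFDerivAt (fun Z => mollify (1 / 2) u (Z, t))
      ((fderiv ℝ (mollify (1 / 2) u) (Z, t)).comp (ContinuousLinearMap.inl ℝ E ℝ)) Z := fun Z =>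
    (hsm.differentiable (by simp) (Z, t)).hasFDerivAt.comp Z (hasFDerivAt_prodMk_left Z t)
  have hbd : ∀ Z ∈ closedBall (0 : E) 3, ‖fderiv ℝ (fun Z => mollify (1 / 2) u (Z, t)) Z‖ ≤
      (∑ i, ‖ℓ i‖) * (c * a.toReal) := fun Z hZ => by
    rw [mem_closedBall_zero_iff] at hZ
    rw [(hd Z).fderiv]
    refine ContinuousLinearMap.opNorm_le_bound _ (by positivity) fun v => ?_
    have h1 : (fderiv ℝ (mollify (1 / 2) u) (Z, t)) (v, 0) =
        ∑ i, ℓ i v • mollify (1 / 2) (G i) (Z, t) := by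
      have h2 : ((v, 0) : E × ℝ) = ∑ i, ℓ i v • (e i, (0 : ℝ)) := by
        refine Prod.ext ?_ ?_
        · simp [Prod.fst_sum, hℓ]
        · simp [Prod.snd_sum]
      rw [h2, map_sum]
      refine Finset.sum_congr rfl fun i _ => ?_
      rw [map_smul, h.toWeakSol.fderiv_mollify_space (by norm_num) (by norm_num)]
      intro p hp
      have h3 : ‖p.1 - Z‖ ≤ 1 / 2 :=
        (norm_fst_le (p - (Z, t))).trans (mem_closedBall_iff_norm.1 hp)
      have h4 : ‖p.1‖ ≤ ‖p.1 - Z‖ + ‖Z‖ := by simpa using norm_add_le (p.1 - Z) Z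
      change ‖p.1‖ < 8
      linarith
    change ‖(fderiv ℝ (mollify (1 / 2) u) (Z, t)) (v, 0)‖ ≤ _
    rw [h1, Finset.sum_mul, Finset.sum_mul]
    refine (norm_sum_le _ _).trans (Finset.sum_le_sum fun i _ => ?_)
    rw [norm_smul, mul_right_comm]
    exact mul_le_mul ((ℓ i).le_opNorm v) (hG Z hZ i) (norm_nonneg _) (by positivity)
  have key := (convex_closedBall (0 : E) 3).norm_image_sub_le_of_norm_fderiv_le (𝕜 := ℝ)
    (fun Z _ => (hd Z).differentiableAt) hbd (mem_closedBall_zero_iff.2 hY)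
    (mem_closedBall_zero_iff.2 hX)
  rw [← ofReal_norm, ← ENNReal.ofReal_toReal hatop, ← ENNReal.ofReal_mul (by positivity)]
  refine ENNReal.ofReal_le_ofReal (key.trans ?_)
  have h6 : ‖X - Y‖ ≤ 6 := (norm_sub_le _ _).trans (by linarith)
  calc _ ≤ (∑ i, ‖ℓ i‖) * (c * a.toReal) * 6 := by gcongr
    _ = _ := by ring

/-- Solutions are integrable against the decaying weight, if the gradient is. -/
lemma FracSol.lintegral_decay_lt_top {e : ι → E} {ℓ : ι → E →L[ℝ] ℝ}
    (hℓ : ∀ Y, ∑ i, ℓ i Y • e i = Y) {κ M σ : ℝ} (hκ : 0 < κ) (hM : 0 < M) {u q : E × ℝ → ℂ}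
    {F G : ι → E × ℝ → ℂ} (h : FracSol e κ M σ u F G q) (hR : gradTail G ≠ ⊤) :
    ∫⁻ p in closedBall (0 : E) 3 ×ˢ univ, ‖u p‖ₑ * ENNReal.ofReal (decay p.2) < ⊤ := by
  obtain ⟨C₁, hC₁, h₁⟩ := exists_oscillation_le e ℓ hℓ hκ hM
  obtain ⟨C₂, hC₂, h₂⟩ := h.toEllipticSol.enorm_mollify_sub_le hℓ
  have hum := h.memL2.aestronglyMeasurable
  have hvm := (h.memL2.mollify (a := 1 / 2) (by norm_num) (by norm_num))
  set v := ParabolicRH.mollify (1 / 2) u with hv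
  have hvc : Continuous v := (contDiff_mollify (by norm_num) (by norm_num)
    h.memL2.locallyIntegrable).continuous
  have hdm : Measurable fun p : E × ℝ => ENNReal.ofReal (decay p.2) :=
    (continuous_decay.measurable.comp measurable_snd).ennreal_ofReal
  -- The oscillating part of u is controlled by the gradient slab by slab.
  have hz : ∫⁻ p in closedBall (0 : E) 3 ×ˢ univ, ‖u p - v p‖ₑ * ENNReal.ofReal (decay p.2) < ⊤ := by
    refine (setLIntegral_mul_decay_le fun p => ‖u p - v p‖ₑ).trans_lt ?_
    have hj : ∀ j : ℤ, ∫⁻ p in closedBall ((0 : E), 2 * (j : ℝ)) 3 ∩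
        univ ×ˢ Ioc (2 * (j : ℝ) - 1) (2 * j + 1), ‖u p - v p‖ₑ ≤
        ((volume (closedBall (0 : E × ℝ) 3)) ^ (1 / 2 : ℝ) * (2 * C₁) ^ (1 / 2 : ℝ)) *
          ∫⁻ p in closedBall ((0 : E), 2 * (j : ℝ)) 6, ∑ i, ‖G i p‖ₑ := fun j => by
      refine (lintegral_mono_set inter_subset_left).trans ?_
      refine (setLIntegral_le_sqrt (hum.sub hvc.aestronglyMeasurable).enorm
        (lintegral_sub_mollify_sq_le_of_forall h.memL2 fun ε hε hε4 =>
          le_self_add.trans (h₁ h.toEllipticSol _ (closedBall_six_subset j) ε hε hε4))).trans ?_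
      rw [← mul_assoc 2, mul_sq_rpow_half, ← mul_assoc,
        Measure.addHaar_closedBall_center (μ := (volume : Measure (E × ℝ)))]
    refine (mul_le_mul_right (ENNReal.tsum_le_tsum fun j => mul_le_mul_right (hj j) _) _).trans_lt ?_
    simp only [mul_left_comm (ENNReal.ofReal (decay _)), ENNReal.tsum_mul_left]
    have hvol : volume (closedBall (0 : E × ℝ) 3) ≠ ⊤ := measure_closedBall_lt_top.ne
    exact ENNReal.mul_lt_top ENNReal.ofReal_lt_top (ENNReal.mul_lt_top
      (ENNReal.mul_lt_top (ENNReal.rpow_lt_top_of_nonneg (by norm_num) hvol)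
        (ENNReal.rpow_lt_top_of_nonneg (by norm_num) (ENNReal.mul_ne_top (by simp) hC₁)))
      hR.lt_top)
  have hres : (volume : Measure (E × ℝ)).restrict (closedBall (0 : E) 3 ×ˢ univ) =
      ((volume : Measure E).restrict (closedBall 0 3)).prod volume := by
    rw [Measure.volume_eq_prod, ← Measure.prod_restrict, Measure.restrict_univ]
  have hzm : AEMeasurable (fun p => ‖u p - v p‖ₑ * ENNReal.ofReal (decay p.2)) :=
    (hum.sub hvc.aestronglyMeasurable).enorm.mul hdm.aemeasurable
  -- Almost every slice of u is integrable against the weight, but with no uniformity. One good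
  -- slice fixes v on a single time line, and the gradient carries the bound to all the others.
  obtain ⟨Y, hY3, hY1, hY2, hYm⟩ : ∃ Y : E, ‖Y‖ ≤ 3 ∧
      ∫⁻ t, ‖u (Y, t)‖ₑ * ENNReal.ofReal (decay t) < ⊤ ∧
      ∫⁻ t, ‖u (Y, t) - v (Y, t)‖ₑ * ENNReal.ofReal (decay t) < ⊤ ∧
      AEStronglyMeasurable fun t => u (Y, t) := by
    have hne : (ae ((volume : Measure E).restrict (closedBall 0 3))).NeBot :=
      ae_restrict_neBot.2 (measure_closedBall_pos _ _ (by norm_num)).ne'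
    have a1 : ∀ᵐ Y ∂(volume : Measure E).restrict (closedBall 0 3),
        ∫⁻ t, ‖u (Y, t) - v (Y, t)‖ₑ * ENNReal.ofReal (decay t) < ⊤ := by
      have hzm' := hzm.restrict (s := closedBall (0 : E) 3 ×ˢ univ)
      rw [hres] at hzm' hz
      rw [lintegral_prod _ hzm'] at hz
      exact ae_lt_top' hzm'.lintegral_prod_right' hz.ne
    have a2 : ∀ᵐ Y : E, AEStronglyMeasurable fun t => u (Y, t) :=
      AEStronglyMeasurable.prodMk_left (by rwa [← Measure.volume_eq_prod])
    obtain ⟨Y, ⟨⟨k1, k2⟩, k3⟩, k4⟩ := (((ae_restrict_mem isClosed_closedBall.measurableSet).and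
      (ae_restrict_of_ae h.decay_lt_top)).and a1 |>.and (ae_restrict_of_ae a2)).exists
    have hY := mem_closedBall_zero_iff.1 k1
    exact ⟨Y, hY, k2 (hY.trans_lt (by norm_num)), k3, k4⟩
  have hdm1 : Measurable fun t : ℝ => ENNReal.ofReal (decay t) :=
    continuous_decay.measurable.ennreal_ofReal
  have hvY : ∫⁻ t, ‖v (Y, t)‖ₑ * ENNReal.ofReal (decay t) < ⊤ := by
    refine lt_of_le_of_lt ?_ (ENNReal.add_lt_top.2 ⟨hY1, hY2⟩)
    have hm : AEMeasurable fun t => ‖u (Y, t)‖ₑ * ENNReal.ofReal (decay t) :=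
      hYm.enorm.mul hdm1.aemeasurable
    rw [← lintegral_add_left' hm]
    refine lintegral_mono fun t => ?_
    rw [← add_mul]
    refine mul_le_mul' ?_ le_rfl
    have := enorm_sub_le (a := u (Y, t)) (b := u (Y, t) - v (Y, t))
    rwa [sub_sub_cancel] at this
  -- The mollification varies in space by at most the local means of the gradient, summed with the
  -- weight.
  have hvX : ∀ X ∈ closedBall (0 : E) 3, ∫⁻ t, ‖v (X, t)‖ₑ * ENNReal.ofReal (decay t) ≤
      (∫⁻ t, ‖v (Y, t)‖ₑ * ENNReal.ofReal (decay t)) +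
        2 * ENNReal.ofReal (ker (1 / 2)) * (C₂ * gradTail G) := fun X hX => by
    have hXY := lintegral_mul_decay_le (fun t => ‖v (X, t) - v (Y, t)‖ₑ)
      (fun j => C₂ * ∫⁻ p in closedBall ((0 : E), 2 * (j : ℝ)) 6, ∑ i, ‖G i p‖ₑ)
      fun j t ht => h₂ j X Y t (mem_closedBall_zero_iff.1 hX) hY3 ht
    simp only [mul_left_comm (ENNReal.ofReal (decay _)), ENNReal.tsum_mul_left] at hXY
    refine le_trans ?_ (add_le_add le_rfl hXY)
    have hm : Measurable fun t => ‖v (Y, t)‖ₑ * ENNReal.ofReal (decay t) :=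
      (hvc.comp (by fun_prop : Continuous fun t : ℝ => (Y, t))).enorm.measurable.mul hdm1
    rw [← lintegral_add_left hm]
    refine lintegral_mono fun t => ?_
    rw [← add_mul]
    refine mul_le_mul' ?_ le_rfl
    have := enorm_add_le (v (Y, t)) (v (X, t) - v (Y, t))
    rwa [add_sub_cancel] at this
  have hvdm : Measurable fun p : E × ℝ => ‖v p‖ₑ * ENNReal.ofReal (decay p.2) :=
    hvc.enorm.measurable.mul hdm
  have hvall : ∫⁻ p in closedBall (0 : E) 3 ×ˢ univ, ‖v p‖ₑ * ENNReal.ofReal (decay p.2) < ⊤ := by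
    rw [hres, lintegral_prod _ hvdm.aemeasurable]
    refine (setLIntegral_mono' isClosed_closedBall.measurableSet hvX).trans_lt ?_
    rw [setLIntegral_const]
    refine ENNReal.mul_lt_top (ENNReal.add_lt_top.2 ⟨hvY, ?_⟩) measure_closedBall_lt_top
    exact ENNReal.mul_lt_top (by finiteness) (ENNReal.mul_lt_top hC₂.lt_top hR.lt_top)
  refine lt_of_le_of_lt ?_ (ENNReal.add_lt_top.2 ⟨hz, hvall⟩)
  rw [← lintegral_add_right _ hvdm]
  refine lintegral_mono fun p => ?_
  rw [← add_mul]
  refine mul_le_mul' ?_ le_rfl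
  have := enorm_add_le (u p - v p) (v p)
  rwa [sub_add_cancel] at this

/-- `u` is integrable over the cylinder of radius `ρ` against the decaying weight. -/
def DecayIntegrable (ρ : ℝ) (u : E × ℝ → ℂ) : Prop :=
  ∫⁻ p in closedBall (0 : E) ρ ×ˢ univ, ‖u p‖ₑ * ENNReal.ofReal (decay p.2) < ⊤

lemma measurableSet_cylinder (ρ : ℝ) : MeasurableSet (closedBall (0 : E) ρ ×ˢ (univ : Set ℝ)) :=
  isClosed_closedBall.measurableSet.prod MeasurableSet.univ

lemma continuous_decay_snd : Continuous fun p : E × ℝ => decay p.2 :=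
  continuous_decay.comp continuous_snd

lemma DecayIntegrable.mono {ρ ρ' : ℝ} {u : E × ℝ → ℂ} (h : DecayIntegrable ρ' u) (hρ : ρ ≤ ρ') :
    DecayIntegrable ρ u :=
  (lintegral_mono_set (prod_mono_left (closedBall_subset_closedBall hρ))).trans_lt h

lemma norm_snd_dil_le {a : ℝ} (ha : 0 ≤ a) (ha1 : a ≤ 1) {q : E × ℝ} (hq : ‖q‖ ≤ 1) :
    |(dil a q).2| ≤ 1 :=
  (norm_snd_le _).trans ((norm_dil_le_of_mem ha ha1 (mem_closedBall_zero_iff.2 hq)).trans ha1)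

lemma decay_le_sub_dil {a : ℝ} (ha : 0 ≤ a) (ha1 : a ≤ 1) {q : E × ℝ} (hq : ‖q‖ ≤ 1) (p : E × ℝ) :
    decay p.2 ≤ ker (1 / 2) * decay (p - dil a q).2 := by
  have h := decay_sub_le (s := -(dil a q).2) (by rw [abs_neg]; exact norm_snd_dil_le ha ha1 hq)
    (p - dil a q).2
  rwa [Prod.snd_sub, sub_neg_eq_add, sub_add_cancel] at h

lemma decay_sub_dil_le {a : ℝ} (ha : 0 ≤ a) (ha1 : a ≤ 1) {q : E × ℝ} (hq : ‖q‖ ≤ 1) (p : E × ℝ) :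
    decay (p - dil a q).2 ≤ ker (1 / 2) * decay p.2 :=
  decay_sub_le (norm_snd_dil_le ha ha1 hq) p.2

/-- Over a time shift of at most 1 the weight changes by a bounded factor, so it can be moved inside
the mollification. -/
lemma DecayIntegrable.mollify {ρ ρ' a : ℝ} {u : E × ℝ → ℂ} (h : DecayIntegrable ρ' u)
    (hu : LocallyIntegrable u) (ha : 0 < a) (ha1 : a ≤ 1) (hρ : ρ + a ≤ ρ') :
    DecayIntegrable ρ (mollify a u) := by
  have hk : 0 ≤ ker (1 / 2) := (ker_pos (by norm_num)).le
  have n : Nbhd a (closedBall (0 : E) ρ ×ˢ (univ : Set ℝ)) (closedBall (0 : E) ρ' ×ˢ univ) :=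
    fun p hp q hq => by
      refine ⟨?_, mem_univ _⟩
      rw [mem_closedBall] at hq ⊢
      have h1 : dist q.1 p.1 ≤ a := (le_max_left _ _).trans hq
      have h2 := mem_closedBall.1 hp.1
      linarith [dist_triangle q.1 p.1 0]
  have hd : Continuous fun p : E × ℝ => decay p.2 := continuous_decay_snd
  have hud : AEStronglyMeasurable fun p => ‖u p‖ * decay p.2 :=
    hu.aestronglyMeasurable.norm.mul hd.aestronglyMeasurable
  have key : ∀ p, ‖ParabolicRH.mollify a u p‖ₑ * ENNReal.ofReal (decay p.2) ≤
      ENNReal.ofReal (ker (1 / 2)) *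
        ‖ParabolicRH.mollify a (fun p => ‖u p‖ * decay p.2) p‖ₑ := fun p => by
    rw [← ofReal_norm, ← ofReal_norm, ← ENNReal.ofReal_mul (norm_nonneg _), ← ENNReal.ofReal_mul hk]
    refine ENNReal.ofReal_le_ofReal ?_
    have hi : Integrable fun q => profile E q • (‖u (p - dil a q)‖ * decay (p - dil a q).2) :=
      integrable_mollify_integrand ha ha1 (f := fun p => ‖u p‖ * decay p.2)
        (hu.mono hud (ae_of_all _ fun p => by
          rw [Real.norm_of_nonneg (mul_nonneg (norm_nonneg _) (decay_pos _).le)]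
          exact mul_le_of_le_one_right (norm_nonneg _) (decay_le_one _))) p
    calc ‖ParabolicRH.mollify a u p‖ * decay p.2
        ≤ (∫ q, ‖profile E q • u (p - dil a q)‖) * decay p.2 :=
          mul_le_mul_of_nonneg_right (norm_integral_le_integral_norm _) (decay_pos _).le
      _ = ∫ q, ‖profile E q • u (p - dil a q)‖ * decay p.2 := (integral_mul_const _ _).symm
      _ ≤ ∫ q, ker (1 / 2) * (profile E q • (‖u (p - dil a q)‖ * decay (p - dil a q).2)) := by
          refine integral_mono_of_nonneg (ae_of_all _ fun q => mul_nonneg (norm_nonneg _)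
            (decay_pos _).le) (hi.const_mul _) (ae_of_all _ fun q => ?_)
          dsimp only
          by_cases hq : q ∈ tsupport (profile E)
          · have := decay_le_sub_dil ha.le ha1 (mem_closedBall_zero_iff.1 (tsupport_profile.le hq)) p
            rw [norm_smul, Real.norm_of_nonneg (profile_nonneg _), smul_eq_mul]
            have h2 := mul_le_mul_of_nonneg_left this (mul_nonneg (profile_nonneg q)
              (norm_nonneg (u (p - dil a q))))
            linarith
          · simp [image_eq_zero_of_notMem_tsupport hq]
      _ = ker (1 / 2) * ParabolicRH.mollify a (fun p => ‖u p‖ * decay p.2) p := by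
          rw [integral_const_mul]; rfl
      _ ≤ _ := mul_le_mul_of_nonneg_left (le_abs_self _) hk
  refine (lintegral_mono key).trans_lt ?_
  rw [lintegral_const_mul' _ _ ENNReal.ofReal_ne_top]
  refine ENNReal.mul_lt_top ENNReal.ofReal_lt_top
    ((lintegral_mollify_le ha.le ha1 n hud).trans_lt (lt_of_le_of_lt (le_of_eq ?_) h))
  refine lintegral_congr fun p => ?_
  rw [← ofReal_norm, Real.norm_of_nonneg (mul_nonneg (norm_nonneg _) (decay_pos _).le),
    ENNReal.ofReal_mul (norm_nonneg _), ofReal_norm]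

lemma DecayIntegrable.integrable {ρ : ℝ} {u : E × ℝ → ℂ} (h : DecayIntegrable ρ u)
    (hu : AEStronglyMeasurable u) (D : ℝ) : Integrable fun p =>
      (closedBall (0 : E) ρ ×ˢ univ).indicator (fun p => D * decay p.2) p * ‖u p‖ := by
  have hd : Continuous fun p : E × ℝ => decay p.2 := continuous_decay_snd
  have h1 : Integrable (fun p => ‖u p‖ * decay p.2)
      (volume.restrict (closedBall (0 : E) ρ ×ˢ univ)) := by
    refine ⟨(hu.norm.mul hd.aestronglyMeasurable).restrict, ?_⟩
    refine lt_of_le_of_lt (lintegral_mono fun p => ?_) h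
    rw [← ofReal_norm, Real.norm_of_nonneg (mul_nonneg (norm_nonneg _) (decay_pos _).le),
      ENNReal.ofReal_mul (norm_nonneg _), ofReal_norm]
  have h2 := (integrable_indicator_iff (measurableSet_cylinder ρ)).2 (h1.const_mul D)
  refine h2.congr (ae_of_all _ fun p => ?_)
  by_cases hp : p ∈ closedBall (0 : E) ρ ×ˢ (univ : Set ℝ)
  · simp only [indicator_of_mem hp]; ring
  · simp only [indicator_of_notMem hp]; ring

lemma exists_timeFrac_le_indicator {σ : ℝ} (hσ : |σ| = 1) {ψ : E × ℝ → ℂ} (hψ : ContDiff ℝ ∞ ψ)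
    {ρ : ℝ} (hs : tsupport ψ ⊆ closedBall 0 ρ) : ∃ D : ℝ, 0 ≤ D ∧ ∀ ρ' p, ρ ≤ ρ' →
      ‖timeFrac σ ψ p‖ ≤ (closedBall (0 : E) ρ' ×ˢ univ).indicator (fun p => D * decay p.2) p := by
  obtain ⟨C, hC, hb⟩ := exists_norm_timeFrac_le hσ (hasCompactSupport_of_tsupport_subset_closedBall hs) hψ
  refine ⟨C, hC, fun ρ' p hρ => ?_⟩
  by_cases hp : p ∈ closedBall (0 : E) ρ' ×ˢ (univ : Set ℝ)
  · rw [indicator_of_mem hp]; exact hb p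
  · rw [indicator_of_notMem hp, timeFrac_eq_zero, norm_zero]
    rintro ⟨x, hx, hxp⟩
    refine hp ⟨?_, mem_univ _⟩
    rw [← hxp, mem_closedBall_zero_iff]
    exact (norm_fst_le x).trans ((mem_closedBall_zero_iff.1 (hs hx)).trans hρ)

lemma DecayIntegrable.integrable_mul_timeFrac {ρ : ℝ} {u : E × ℝ → ℂ} (h : DecayIntegrable ρ u)
    (hu : AEStronglyMeasurable u) {σ : ℝ} (hσ : |σ| = 1) {ψ : E × ℝ → ℂ} (hψ : ContDiff ℝ ∞ ψ)
    (hs : tsupport ψ ⊆ closedBall 0 ρ) : Integrable fun p => u p * timeFrac σ ψ p := by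
  obtain ⟨D, hD, hb⟩ := exists_timeFrac_le_indicator hσ hψ hs
  refine (h.integrable hu D).mono' (hu.mul (continuous_timeFrac hσ
    (hasCompactSupport_of_tsupport_subset_closedBall hs) hψ).aestronglyMeasurable)
    (ae_of_all _ fun p => ?_)
  rw [norm_mul, mul_comm]
  exact mul_le_mul_of_nonneg_right (hb ρ p le_rfl) (norm_nonneg _)

/-- Commutation with the fractional difference followed by symmetry of mollification. The radius
must leave room for a spatial shift by a, while in time the weight does the work of compact support.
-/
lemma DecayIntegrable.integral_mul_timeFrac_mollify {ρ ρ' a : ℝ} {u : E × ℝ → ℂ}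
    (h : DecayIntegrable ρ' u) (hu : AEStronglyMeasurable u) {σ : ℝ} (hσ : |σ| = 1)
    {ψ : E × ℝ → ℂ} (hψ : ContDiff ℝ ∞ ψ) (hs : tsupport ψ ⊆ closedBall 0 ρ) (ha : 0 < a)
    (ha1 : a ≤ 1) (hρ : ρ + a ≤ ρ') :
    ∫ p, u p * timeFrac σ (ParabolicRH.mollify a ψ) p =
      ∫ p, ParabolicRH.mollify a u p * timeFrac σ ψ p := by
  have hc := hasCompactSupport_of_tsupport_subset_closedBall hs
  obtain ⟨D, hD, hb⟩ := exists_timeFrac_le_indicator hσ hψ hs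
  simp only [timeFrac_mollify hσ hc hψ ha ha1]
  refine integral_mul_mollify ha hu (continuous_timeFrac hσ hc hψ)
    (h.integrable hu (D * ker (1 / 2))) fun p q hq => (hb ρ _ le_rfl).trans ?_
  by_cases hp : p - dil a q ∈ closedBall (0 : E) ρ ×ˢ (univ : Set ℝ)
  · have hp' : p ∈ closedBall (0 : E) ρ' ×ˢ (univ : Set ℝ) := by
      refine ⟨?_, mem_univ _⟩
      have h1 := mem_closedBall_zero_iff.1 hp.1
      have h2 := (norm_fst_le _).trans
        (norm_dil_le_of_mem ha.le ha1 (mem_closedBall_zero_iff.2 hq))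
      rw [mem_closedBall_zero_iff]
      have h3 := norm_add_le (p - dil a q).1 (dil a q).1
      rw [Prod.fst_sub, sub_add_cancel] at h3
      rw [Prod.fst_sub] at h1
      linarith
    rw [indicator_of_mem hp, indicator_of_mem hp', mul_assoc]
    exact mul_le_mul_of_nonneg_left (decay_sub_dil_le ha.le ha1 hq p) hD
  · rw [indicator_of_notMem hp]
    exact indicator_nonneg (fun p _ => mul_nonneg (mul_nonneg hD (ker_pos (by norm_num)).le)
      (decay_pos _).le) p

lemma MemL2Loc.integral_mul_mollify {q φ : E × ℝ → ℂ} (hq : MemL2Loc q univ) (hφ : Continuous φ)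
    (hc : HasCompactSupport φ) {a : ℝ} (ha : 0 < a) (ha1 : a ≤ 1) :
    ∫ p, q p * ParabolicRH.mollify a φ p = ∫ p, ParabolicRH.mollify a q p * φ p := by
  obtain ⟨C, hC⟩ := hc.exists_bound_of_continuous hφ
  obtain ⟨R, hR⟩ := hc.isCompact.isBounded.subset_closedBall 0
  have hC0 : 0 ≤ C := (norm_nonneg _).trans (hC 0)
  refine ParabolicRH.integral_mul_mollify ha hq.aestronglyMeasurable hφ
    (Φ := (closedBall 0 (R + 1)).indicator fun _ => C) ?_ fun p x hx => ?_
  · have h1 := (hq.integrableOn (isBounded_closedBall (x := (0 : E × ℝ)) (r := R + 1))).norm.const_mul C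
    refine ((integrable_indicator_iff isClosed_closedBall.measurableSet).2 h1).congr
      (ae_of_all _ fun p => ?_)
    by_cases hp : p ∈ closedBall (0 : E × ℝ) (R + 1)
    · simp only [indicator_of_mem hp]
    · simp only [indicator_of_notMem hp]; ring
  · by_cases hp : p ∈ closedBall (0 : E × ℝ) (R + 1)
    · rw [indicator_of_mem hp]; exact hC _
    · rw [indicator_of_notMem hp, image_eq_zero_of_notMem_tsupport (f := φ) ?_, norm_zero]
      refine fun hn => hp ?_
      have h1 := mem_closedBall_zero_iff.1 (hR hn)
      have h2 := norm_dil_le_of_mem ha.le ha1 (mem_closedBall_zero_iff.2 hx)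
      have h3 := norm_add_le (p - dil a x) (dil a x)
      rw [sub_add_cancel] at h3
      rw [mem_closedBall_zero_iff]
      linarith

/-- The duality on slices integrated over space. Weighted integrability of u over the cylinder is
what permits Fubini for the nonlocal side. -/
lemma FracSol.integral_mul_eq {e : ι → E} {κ M σ : ℝ} (hσ : |σ| = 1) {u q : E × ℝ → ℂ}
    {F G : ι → E × ℝ → ℂ} (h : FracSol e κ M σ u F G q) (hu : DecayIntegrable 3 u)
    {ψ : E × ℝ → ℂ} (hψ : ContDiff ℝ ∞ ψ) (hs : tsupport ψ ⊆ closedBall 0 3) :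
    ∫ p, q p * ψ p = ∫ p, u p * timeFrac σ ψ p := by
  have hc := hasCompactSupport_of_tsupport_subset_closedBall hs
  have h1 : Integrable (fun p => q p * ψ p) (volume.prod volume) := by
    have := h.memL2_frac.locallyIntegrable.integrable_smul_left_of_hasCompactSupport
      hψ.continuous hc
    refine Integrable.congr this (ae_of_all _ fun p => ?_)
    simp [mul_comm]
  have h2 : Integrable (fun p => u p * timeFrac σ ψ p) (volume.prod volume) :=
    hu.integrable_mul_timeFrac h.memL2.aestronglyMeasurable hσ hψ hs
  refine (integral_prod _ h1).trans (Eq.trans ?_ (integral_prod _ h2).symm)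
  refine integral_congr_ae ?_
  filter_upwards [h.pairing] with X hX
  by_cases h8 : ‖X‖ < 8
  · exact hX h8 (fun t => ψ (X, t)) (hψ.comp (contDiff_prodMk_right X))
      (HasCompactSupport.intro (hc.isCompact.image continuous_snd) fun t ht =>
        image_eq_zero_of_notMem_tsupport fun hn => ht ⟨_, hn, rfl⟩)
  · have hX' : X ∉ Prod.fst '' tsupport ψ := by
      rintro ⟨x, hx, rfl⟩
      have := (norm_fst_le x).trans (mem_closedBall_zero_iff.1 (hs hx))
      exact h8 (this.trans_lt (by norm_num))
    have h3 : ∀ t, ψ (X, t) = 0 := fun t => image_eq_zero_of_notMem_tsupport fun hn => hX' ⟨_, hn, rfl⟩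
    have h4 : ∀ t, timeFrac σ ψ (X, t) = 0 := fun t => timeFrac_eq_zero σ hX'
    simp [h3, h4]

/-- The oscillation of the half-order derivative is dual to the oscillation of the solution. -/
lemma FracSol.integral_sub_mollify_mul {e : ι → E} {κ M σ : ℝ} (hσ : |σ| = 1) {u q : E × ℝ → ℂ}
    {F G : ι → E × ℝ → ℂ} (h : FracSol e κ M σ u F G q) (hu : DecayIntegrable 3 u)
    {ε : ℝ} (hε : 0 < ε) (hε4 : ε ≤ 1 / 4)
    {ψ : E × ℝ → ℂ} (hψ : ContDiff ℝ ∞ ψ) (hs : tsupport ψ ⊆ closedBall 0 (3 / 2)) :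
    Integrable (fun p => (ParabolicRH.mollify ε u p - ParabolicRH.mollify (1 / 2)
      (ParabolicRH.mollify ε u) p) * timeFrac σ ψ p) ∧
    ∫ p, (ParabolicRH.mollify ε q p - ParabolicRH.mollify (1 / 2) (ParabolicRH.mollify ε q) p) * ψ p =
      ∫ p, (ParabolicRH.mollify ε u p - ParabolicRH.mollify (1 / 2) (ParabolicRH.mollify ε u) p) *
        timeFrac σ ψ p := by
  have hε1 : ε ≤ 1 := by linarith
  have h12 : (0 : ℝ) < 1 / 2 := by norm_num
  have h12' : (1 / 2 : ℝ) ≤ 1 := by norm_num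
  have hψl : LocallyIntegrable ψ := hψ.continuous.locallyIntegrable
  have hψ₂ : ContDiff ℝ ∞ (ParabolicRH.mollify (1 / 2) ψ) := contDiff_mollify h12 h12' hψl
  -- Support radii: 3/2 + 1/2 = 2, and ε keeps everything within 3, where u is integrable against
  -- the weight.
  have hs₂ : tsupport (ParabolicRH.mollify (1 / 2) ψ) ⊆ closedBall 0 2 := by
    have := tsupport_mollify_subset h12.le h12' hs
    norm_num at this ⊢; exact this
  have hψ₃ : ∀ {φ : E × ℝ → ℂ}, ContDiff ℝ ∞ φ → ContDiff ℝ ∞ (ParabolicRH.mollify ε φ) := fun hφ =>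
    contDiff_mollify hε hε1 hφ.continuous.locallyIntegrable
  have hs₃ : ∀ {φ : E × ℝ → ℂ}, tsupport φ ⊆ closedBall 0 2 →
      tsupport (ParabolicRH.mollify ε φ) ⊆ closedBall 0 3 := fun hφ =>
    (tsupport_mollify_subset hε.le hε1 hφ).trans (closedBall_subset_closedBall (by linarith))
  have hum := h.memL2.aestronglyMeasurable
  have hum' := h.memL2.mollify hε hε1
  have hqm' := h.memL2_frac.mollify hε hε1
  have hu' : DecayIntegrable (9 / 4) (ParabolicRH.mollify ε u) :=
    hu.mollify h.memL2.locallyIntegrable hε hε1 (by linarith)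
  have hu'' : DecayIntegrable (3 / 2) (ParabolicRH.mollify (1 / 2) (ParabolicRH.mollify ε u)) :=
    hu'.mollify hum'.locallyIntegrable h12 h12' (by linarith)
  have step : ∀ {φ : E × ℝ → ℂ}, ContDiff ℝ ∞ φ → tsupport φ ⊆ closedBall 0 2 →
      ∫ p, ParabolicRH.mollify ε q p * φ p = ∫ p, ParabolicRH.mollify ε u p * timeFrac σ φ p :=
    fun hφ hsφ => by
      rw [← h.memL2_frac.integral_mul_mollify hφ.continuous
        (hasCompactSupport_of_tsupport_subset_closedBall hsφ) hε hε1,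
        h.integral_mul_eq hσ hu (hψ₃ hφ) (hs₃ hsφ),
        hu.integral_mul_timeFrac_mollify hum hσ hφ hsφ hε hε1 (by linarith)]
  have hs2 : tsupport ψ ⊆ closedBall 0 2 := hs.trans (closedBall_subset_closedBall (by norm_num))
  have hcc := hasCompactSupport_of_tsupport_subset_closedBall hs
  have i1 := (hu'.mono (by norm_num)).integrable_mul_timeFrac hum'.aestronglyMeasurable hσ hψ hs
  have i2 := hu''.integrable_mul_timeFrac
    (hum'.mollify h12 h12').aestronglyMeasurable hσ hψ hs
  have e2 := step hψ₂ hs₂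
  rw [hqm'.integral_mul_mollify hψ.continuous hcc h12 h12',
    hu'.integral_mul_timeFrac_mollify hum'.aestronglyMeasurable hσ hψ hs h12 h12'
      (by norm_num)] at e2
  have hi : ∀ {v : E × ℝ → ℂ}, MemL2Loc v univ → Integrable fun p => v p * ψ p := fun hv => by
    have := hv.locallyIntegrable.integrable_smul_left_of_hasCompactSupport hψ.continuous hcc
    refine Integrable.congr this (ae_of_all _ fun p => ?_)
    simp [mul_comm]
  simp only [sub_mul]
  refine ⟨i1.sub i2, ?_⟩
  rw [integral_sub (hi hqm') (hi (hqm'.mollify h12 h12')), integral_sub i1 i2, e2, step hψ hs2]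

lemma fderiv_smul_apply {η : E × ℝ → ℝ} {z : E × ℝ → ℂ} (hη : ContDiff ℝ ∞ η)
    (hz : ContDiff ℝ ∞ z) (p v : E × ℝ) : fderiv ℝ (fun p => η p • z p) p v =
      η p • fderiv ℝ z p v + fderiv ℝ η p v • z p := by
  rw [fderiv_fun_smul (hη.differentiable (by simp) p) (hz.differentiable (by simp) p)]
  simp

lemma lintegral_enorm_sq_le_of_subset {S : Set (E × ℝ)} (hS : MeasurableSet S)
    {w : E × ℝ → ℂ} {φ : E × ℝ → ℝ≥0∞} (hw : ∀ p ∉ S, w p = 0) (h : ∀ p, ‖w p‖ₑ ^ 2 ≤ φ p) :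
    ∫⁻ p, ‖w p‖ₑ ^ 2 ≤ ∫⁻ p in S, φ p := by
  rw [← lintegral_indicator hS]
  refine lintegral_mono fun p => ?_
  by_cases hp : p ∈ S
  · rw [indicator_of_mem hp]; exact h p
  · simp [hw p hp]

lemma enorm_smul_sq_le {L c : ℝ} (hc : |c| ≤ L) (z : ℂ) :
    ‖c • z‖ₑ ^ 2 ≤ ENNReal.ofReal (L ^ 2) * ‖z‖ₑ ^ 2 := by
  rw [enorm_smul, mul_pow]
  refine mul_le_mul_left ?_ _
  rw [← ofReal_norm, ← ENNReal.ofReal_pow (norm_nonneg _)]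
  exact ENNReal.ofReal_le_ofReal (pow_le_pow_left₀ (norm_nonneg _) hc 2)

/-- The half-order energy of a localized solution. -/
lemma SmoothSol.enorm_integral_cutoff_mul_timeFrac_sq_le {e : ι → E} {S : Set (E × ℝ)}
    (hS : MeasurableSet S) {z : E × ℝ → ℂ}
    {f g : ι → E × ℝ → ℂ} (h : SmoothSol e S z f g) {η : E × ℝ → ℝ} (hη : ContDiff ℝ ∞ η)
    (hc : HasCompactSupport η) (hs : tsupport η ⊆ S) (hη1 : ∀ p, |η p| ≤ 1) {L : ℝ}
    (hL : ∀ p, |fderiv ℝ η p (0, 1)| ≤ L) (hL' : ∀ p i, |fderiv ℝ η p (e i, 0)| ≤ L)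
    {σ : ℝ} (hσ : |σ| = 1) {ψ : E × ℝ → ℂ} (hψc : HasCompactSupport ψ) (hψ : ContDiff ℝ ∞ ψ) :
    ‖∫ p, (η p • z p) * timeFrac σ ψ p‖ₑ ^ 2 ≤
      ENNReal.ofReal (cosConst ^ 2 + sinConst ^ 2) *
        ((4 + (2 + 4 * Fintype.card ι) * ENNReal.ofReal (L ^ 2)) * ((∫⁻ p in S, ‖z p‖ₑ ^ 2) +
        ∑ i, ((∫⁻ p in S, ‖g i p‖ₑ ^ 2) + ∫⁻ p in S, ‖f i p‖ₑ ^ 2))) * ∫⁻ p, ‖ψ p‖ₑ ^ 2 := by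
  have hout : ∀ p ∉ S, η p = 0 := fun p hp => image_eq_zero_of_notMem_tsupport fun hn => hp (hs hn)
  have hout' : ∀ p ∉ S, fderiv ℝ η p = 0 := fun p hp =>
    image_eq_zero_of_notMem_tsupport fun hn => hp (hs (tsupport_fderiv_subset ℝ hn))
  have hηd : ∀ v, ContDiff ℝ ∞ fun p => fderiv ℝ η p v := fun v =>
    (hη.fderiv_right (m := ∞) (by simp)).clm_apply contDiff_const
  have hηdc : ∀ v, HasCompactSupport fun p => fderiv ℝ η p v := fun v => hc.fderiv_apply (𝕜 := ℝ) v
  have hw : ContDiff ℝ ∞ fun p => η p • z p := hη.smul h.smooth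
  have hwc : HasCompactSupport fun p => η p • z p := hc.smul_right
  -- The commutator with the cutoff: the time derivative of ηz is the divergence of ηf plus this
  -- term, which contains no derivative of z or f.
  obtain ⟨f₀, hf₀⟩ : ∃ f₀ : E × ℝ → ℂ, f₀ = fun p => fderiv ℝ η p (0, 1) • z p +
    -∑ i, fderiv ℝ η p (e i, 0) • f i p := ⟨_, rfl⟩
  have hf : ContDiff ℝ ∞ f₀ := by
    rw [hf₀]
    exact ((hηd _).smul h.smooth).add
      (ContDiff.sum fun i _ => (hηd _).smul (h.smooth_flux i)).neg
  have hf0out : ∀ p ∉ S, f₀ p = 0 := fun p hp => by simp [hf₀, hout' p hp]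
  have hfc : HasCompactSupport f₀ := by
    refine HasCompactSupport.intro hc.isCompact fun p hp => ?_
    have : fderiv ℝ η p = 0 :=
      image_eq_zero_of_notMem_tsupport fun hn => hp (tsupport_fderiv_subset ℝ hn)
    simp [hf₀, this]
  have heq : ∀ p, fderiv ℝ (fun p => η p • z p) p (0, 1) =
      ∑ i, fderiv ℝ (fun p => η p • f i p) p (e i, 0) + f₀ p := fun p => by
    simp only [fderiv_smul_apply hη h.smooth, fderiv_smul_apply hη (h.smooth_flux _), hf₀,
      Finset.sum_add_distrib, ← Finset.smul_sum]
    by_cases hp : p ∈ S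
    · rw [h.eqn p hp]; ring
    · rw [hout p hp]; simp
  have key := lintegral_two_pi_mul_timeFourier_sq_le hwc hw hfc hf
    (fun i => hc.smul_right (f' := f i)) (fun i => hη.smul (h.smooth_flux i)) heq
  have h1 := enorm_integral_mul_timeFrac_sq_le hσ hwc hw hψc hψ
  refine h1.trans (mul_le_mul_left (mul_le_mul_right (key.trans ?_) _) _)
  obtain ⟨Λ, hΛ⟩ : ∃ Λ, Λ = ENNReal.ofReal (L ^ 2) := ⟨_, rfl⟩
  rw [← hΛ]
  have b0 : ∫⁻ p, ‖η p • z p‖ₑ ^ 2 ≤ ∫⁻ p in S, ‖z p‖ₑ ^ 2 :=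
    lintegral_enorm_sq_le_of_subset hS (fun p hp => by simp [hout p hp]) fun p => by
      simpa using enorm_smul_sq_le (hη1 p) (z p)
  have b1 : ∀ i, ∫⁻ p, ‖η p • f i p‖ₑ ^ 2 ≤ ∫⁻ p in S, ‖f i p‖ₑ ^ 2 := fun i =>
    lintegral_enorm_sq_le_of_subset hS (fun p hp => by simp [hout p hp]) fun p => by
      simpa using enorm_smul_sq_le (hη1 p) (f i p)
  have hzm := h.smooth.continuous.enorm.measurable.pow_const 2
  have hgm := fun i => (h.smooth_grad i).continuous.enorm.measurable.pow_const 2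
  have hfm := fun i => (h.smooth_flux i).continuous.enorm.measurable.pow_const 2
  have b2 : ∀ i, ∫⁻ p, ‖fderiv ℝ (fun p => η p • z p) p (e i, 0)‖ₑ ^ 2 ≤
      2 * ((∫⁻ p in S, ‖g i p‖ₑ ^ 2) + Λ * ∫⁻ p in S, ‖z p‖ₑ ^ 2) := fun i => by
    have : ∫⁻ p, ‖fderiv ℝ (fun p => η p • z p) p (e i, 0)‖ₑ ^ 2 ≤
        ∫⁻ p in S, 2 * (‖g i p‖ₑ ^ 2 + Λ * ‖z p‖ₑ ^ 2) := by
      rw [← lintegral_indicator hS]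
      refine lintegral_mono fun p => ?_
      rw [fderiv_smul_apply hη h.smooth]
      by_cases hp : p ∈ S
      · rw [indicator_of_mem hp, h.grad p hp]
        refine (enorm_add_sq_le _ _).trans (mul_le_mul_right (add_le_add ?_ ?_) _)
        · simpa using enorm_smul_sq_le (hη1 p) (g i p)
        · rw [hΛ]; exact enorm_smul_sq_le (hL' p i) (z p)
      · simp [hout p hp, hout' p hp]
    refine this.trans (le_of_eq ?_)
    rw [lintegral_const_mul' _ _ (by simp), lintegral_add_left (hgm i),
      lintegral_const_mul _ hzm]
  have b3 : ∫⁻ p, ‖f₀ p‖ₑ ^ 2 ≤ 2 * (Λ * (∫⁻ p in S, ‖z p‖ₑ ^ 2) +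
      Fintype.card ι * (Λ * ∑ i, ∫⁻ p in S, ‖f i p‖ₑ ^ 2)) := by
    refine (lintegral_enorm_sq_le_of_subset hS (φ := fun p => 2 * (Λ * ‖z p‖ₑ ^ 2 +
      Fintype.card ι * (Λ * ∑ i, ‖f i p‖ₑ ^ 2))) hf0out fun p => ?_).trans (le_of_eq ?_)
    · rw [hf₀]
      refine (enorm_add_sq_le _ _).trans (mul_le_mul_right (add_le_add ?_ ?_) _)
      · rw [hΛ]; exact enorm_smul_sq_le (hL p) (z p)
      · rw [enorm_neg]
        have hsum : ∑ i, ‖fderiv ℝ η p (e i, 0) • f i p‖ₑ ^ 2 ≤ Λ * ∑ i, ‖f i p‖ₑ ^ 2 := by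
          rw [Finset.mul_sum, hΛ]
          exact Finset.sum_le_sum fun i _ => enorm_smul_sq_le (hL' p i) (f i p)
        exact (pow_le_pow_left' (enorm_sum_le Finset.univ fun i => fderiv ℝ η p (e i, 0) • f i p)
          2).trans ((sum_sq_le_card_mul _).trans (mul_le_mul_right hsum _))
    · rw [lintegral_const_mul' _ _ (by simp), lintegral_add_left (hzm.const_mul _),
        lintegral_const_mul _ hzm, lintegral_const_mul' _ _ (by simp), lintegral_const_mul' _ _
        (by simp [hΛ]), lintegral_finsetSum _ fun i _ => hfm i]
  refine (add_le_add (Finset.sum_le_sum fun i _ => add_le_add (b1 i) (b2 i))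
    (add_le_add b3 b0)).trans ?_
  simp only [Finset.sum_add_distrib, ← Finset.mul_sum, Finset.sum_const, Finset.card_univ,
    nsmul_eq_mul]
  generalize (∫⁻ p in S, ‖z p‖ₑ ^ 2) = Z
  generalize (∑ i, ∫⁻ p in S, ‖f i p‖ₑ ^ 2) = A
  generalize (∑ i, ∫⁻ p in S, ‖g i p‖ₑ ^ 2) = B
  generalize (Fintype.card ι : ℝ≥0∞) = N
  calc _ = (1 + (2 + 2 * N) * Λ) * Z + (1 + 2 * N * Λ) * A + 2 * B := by ring
    _ ≤ (4 + (2 + 4 * N) * Λ) * Z + (4 + (2 + 4 * N) * Λ) * A + (4 + (2 + 4 * N) * Λ) * B := by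
        gcongr ?_ * Z + ?_ * A + ?_ * B
        · gcongr <;> norm_num
        · gcongr
          · norm_num
          · exact le_add_left (by gcongr; norm_num)
        · exact le_add_right (by norm_num)
    _ = _ := by ring

/-- The contribution of the tails to the duality. -/
lemma lintegral_mul_tail_le {z ψ : E × ℝ → ℂ} (hz : Continuous z) (hψ : Continuous ψ)
    (hs : tsupport ψ ⊆ closedBall 0 (3 / 2)) {C : ℝ≥0∞} {b : ℤ → ℝ≥0∞}
    (h : ∀ j : ℤ, ∫⁻ p in closedBall ((0 : E), 2 * (j : ℝ)) 3, ‖z p‖ₑ ^ 2 ≤ C * b j ^ 2) :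
    ∫⁻ p in closedBall (0 : E) 3 ×ˢ univ,
        ‖z p‖ₑ * (∫⁻ s, ‖ψ (p.1, s)‖ₑ) * ENNReal.ofReal (decay p.2) ≤
      ENNReal.ofReal (ker (1 / 2)) * ((C * (6 * ∫⁻ p, ‖ψ p‖ₑ ^ 2)) ^ (1 / 2 : ℝ) *
        ∑' j : ℤ, ENNReal.ofReal (decay (2 * j)) * b j) := by
  have hNm : Measurable fun X : E => ∫⁻ s, ‖ψ (X, s)‖ₑ :=
    hψ.enorm.measurable.lintegral_prod_right'
  -- The slices of ψ live on an interval of length 3.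
  have hN : ∀ X : E, (∫⁻ s, ‖ψ (X, s)‖ₑ) ^ 2 ≤ 3 * ∫⁻ s, ‖ψ (X, s)‖ₑ ^ 2 := fun X => by
    have h0 : ∫⁻ s, ‖ψ (X, s)‖ₑ = ∫⁻ s in closedBall (0 : ℝ) (3 / 2), ‖ψ (X, s)‖ₑ := by
      refine (setLIntegral_eq_of_support_subset ?_).symm
      intro s hs'
      have h1 : ψ (X, s) ≠ 0 := fun h0 => hs' (by simp [h0])
      have h2 := mem_closedBall_zero_iff.1 (hs (subset_tsupport _ h1))
      exact mem_closedBall_zero_iff.2 ((norm_snd_le (X, s)).trans h2)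
    rw [h0]
    refine (lintegral_sq_le _ (hψ.comp (by fun_prop : Continuous fun s : ℝ =>
      (X, s))).enorm.measurable.aemeasurable).trans ?_
    rw [Measure.restrict_apply_univ, Real.volume_closedBall]
    norm_num
    exact mul_le_mul_right (setLIntegral_le_lintegral _ _) _
  have hslab : ∀ j : ℤ, ∫⁻ p in closedBall ((0 : E), 2 * (j : ℝ)) 3 ∩
      univ ×ˢ Ioc (2 * (j : ℝ) - 1) (2 * j + 1), ‖z p‖ₑ * (∫⁻ s, ‖ψ (p.1, s)‖ₑ) ≤
        (C * (6 * ∫⁻ p, ‖ψ p‖ₑ ^ 2)) ^ (1 / 2 : ℝ) * b j := fun j => by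
    have hcs := lintegral_mul_sq_le (volume.restrict (closedBall ((0 : E), 2 * (j : ℝ)) 3 ∩
      univ ×ˢ Ioc (2 * (j : ℝ) - 1) (2 * j + 1))) hz.enorm.measurable.aemeasurable
      (hNm.comp measurable_fst).aemeasurable
    -- The integrand does not depend on time, and the slab has length 2, so 3 · 2 = 6.
    have h2 : ∫⁻ p in closedBall ((0 : E), 2 * (j : ℝ)) 3 ∩
        univ ×ˢ Ioc (2 * (j : ℝ) - 1) (2 * j + 1), (∫⁻ s, ‖ψ (p.1, s)‖ₑ) ^ 2 ≤
          6 * ∫⁻ p, ‖ψ p‖ₑ ^ 2 := by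
      refine (lintegral_mono_set inter_subset_right).trans ?_
      have hm : Measurable fun p : E × ℝ => (∫⁻ s, ‖ψ (p.1, s)‖ₑ) ^ 2 :=
        (hNm.comp measurable_fst).pow_const 2
      rw [Measure.volume_eq_prod, ← Measure.prod_restrict, Measure.restrict_univ,
        lintegral_prod _ hm.aemeasurable,
        ← Measure.volume_eq_prod, lintegral_prod_eq (hψ.enorm.measurable.pow_const 2),
        ← lintegral_const_mul' _ _ (by simp)]
      refine lintegral_mono fun X => ?_
      dsimp only
      rw [lintegral_const, Measure.restrict_apply_univ, Real.volume_Ioc,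
        show (2 * (j : ℝ) + 1 - (2 * j - 1)) = 2 by ring, ENNReal.ofReal_ofNat]
      calc _ ≤ 3 * (∫⁻ s, ‖ψ (X, s)‖ₑ ^ 2) * 2 := mul_le_mul_left (hN X) _
        _ = _ := by ring
    have h3 := hcs.trans (mul_le_mul' ((lintegral_mono_set inter_subset_left).trans (h j)) h2)
    have h4 := ENNReal.rpow_le_rpow h3 (show (0 : ℝ) ≤ 1 / 2 by norm_num)
    rw [← ENNReal.rpow_natCast, ← ENNReal.rpow_mul, show ((2 : ℕ) : ℝ) * (1 / 2) = 1 by norm_num,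
      ENNReal.rpow_one, mul_right_comm, mul_sq_rpow_half] at h4
    exact h4
  refine (setLIntegral_mul_decay_le fun p => ‖z p‖ₑ * ∫⁻ s, ‖ψ (p.1, s)‖ₑ).trans ?_
  refine mul_le_mul_right ?_ _
  rw [← ENNReal.tsum_mul_left]
  refine ENNReal.tsum_le_tsum fun j => (mul_le_mul_right (hslab j) _).trans (le_of_eq (by ring))

/-- The term j = 0 of the sum, whose weight is 1. -/
lemma setLIntegral_zero_le_gradTail (G : ι → E × ℝ → ℂ) :
    ∫⁻ p in closedBall (0 : E × ℝ) 6, ∑ i, ‖G i p‖ₑ ≤ gradTail G := by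
  have h := ENNReal.le_tsum (f := fun j : ℤ => ENNReal.ofReal (decay (2 * j)) *
    ∫⁻ p in closedBall ((0 : E), 2 * (j : ℝ)) 6, ∑ i, ‖G i p‖ₑ) 0
  have h0 : decay 0 = 1 := by simp [decay, ker]
  have hz0 : ((0 : E), (0 : ℝ)) = 0 := rfl
  simpa [h0, hz0, gradTail] using h

/-- The function z = u_ε - (u_ε)_{1/2} is split by a cutoff η. The part ηz has a half-order energy
bounded by the equation. On the support of 1 - η one is separated in time from ψ, and the decay of
the fractional difference meets the slabwise bounds for z, which sum to `gradTail`. -/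
lemma exists_enorm_integral_oscillation_sq_le (e : ι → E) (ℓ : ι → E →L[ℝ] ℝ)
    (hℓ : ∀ Y, ∑ i, ℓ i Y • e i = Y) {κ M : ℝ} (hκ : 0 < κ) (hM : 0 < M) :
    ∃ C : ℝ≥0∞, C ≠ ⊤ ∧ ∀ {u : E × ℝ → ℂ} {F G : ι → E × ℝ → ℂ},
      EllipticSol e {p : E × ℝ | ‖p.1‖ < 8} κ M u F G → ∀ ε : ℝ, 0 < ε → ε ≤ 1 / 4 →
      ∀ {σ : ℝ}, |σ| = 1 → ∀ {ψ : E × ℝ → ℂ}, ContDiff ℝ ∞ ψ → tsupport ψ ⊆ closedBall 0 (3 / 2) →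
      Integrable (fun p => (mollify ε u p - mollify (1 / 2) (mollify ε u) p) * timeFrac σ ψ p) →
      ‖∫ p, (mollify ε u p - mollify (1 / 2) (mollify ε u) p) * timeFrac σ ψ p‖ₑ ^ 2 ≤
        C * gradTail G ^ 2 * ∫⁻ p, ‖ψ p‖ₑ ^ 2 := by
  have hz0 : ((0 : E), (0 : ℝ)) = 0 := rfl
  obtain ⟨C₁, hC₁, h₁⟩ := exists_oscillation_le e ℓ hℓ hκ hM
  obtain ⟨C₀, hC₀, hcut⟩ := exists_cutoff E
  obtain ⟨η, hη, hη0, hη1, hηe, hηs, hηd⟩ := hcut 0 2 1 one_pos le_rfl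
  have hηs3 : tsupport η ⊆ closedBall 0 3 :=
    hηs.trans (closedBall_subset_closedBall (by norm_num))
  obtain ⟨L, hL⟩ : ∃ L, L = C₀ * (1 + ∑ i, ‖e i‖) := ⟨_, rfl⟩
  have hLt : ∀ p, |fderiv ℝ η p (0, 1)| ≤ L := fun p => by
    refine (hηd p _).trans ?_
    rw [hL]
    have : (0 : ℝ) ≤ ∑ i, ‖e i‖ := Finset.sum_nonneg fun i _ => norm_nonneg _
    simp only [one_pow, inv_one, mul_one, Prod.norm_mk, norm_zero, norm_one]
    rw [max_eq_right zero_le_one]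
    nlinarith
  have hLx : ∀ p i, |fderiv ℝ η p (e i, 0)| ≤ L := fun p i => by
    refine (hηd p _).trans ?_
    rw [hL]
    have : ‖e i‖ ≤ ∑ i, ‖e i‖ :=
      Finset.single_le_sum (f := fun i => ‖e i‖) (fun i _ => norm_nonneg _) (Finset.mem_univ i)
    simp only [one_pow, inv_one, mul_one, Prod.norm_mk, norm_zero]
    rw [max_eq_left (norm_nonneg _)]
    nlinarith
  obtain ⟨K₁, hK₁⟩ : ∃ K₁, K₁ = ENNReal.ofReal (cosConst ^ 2 + sinConst ^ 2) *
    ((4 + (2 + 4 * Fintype.card ι) * ENNReal.ofReal (L ^ 2)) * C₁) := ⟨_, rfl⟩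
  -- The number 1/6 is 1 / (2R + 3) for the support radius R = 3/2 of ψ; the factor `ker (1 / 2)`
  -- compares the weight within one slab.
  obtain ⟨K₂, hK₂⟩ : ∃ K₂, K₂ = ENNReal.ofReal (ker (1 / 6)) * ENNReal.ofReal (ker (1 / 2)) := ⟨_, rfl⟩
  refine ⟨2 * (K₁ + K₂ ^ 2 * (C₁ * 6)), ?_, fun {u F G} h ε hε hε4 {σ} hσ {ψ} hψ hs hint => ?_⟩
  · rw [hK₁, hK₂]; finiteness
  have hε1 : ε ≤ 1 := by linarith
  have hψc := hasCompactSupport_of_tsupport_subset_closedBall hs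
  have hηc := hasCompactSupport_of_tsupport_subset_closedBall hηs3
  have n2 : Nbhd ε (closedBall (0 : E × ℝ) (7 / 2)) {p | ‖p.1‖ < 8} := fun p hp x hx => by
    have h1 := mem_closedBall_zero_iff.1 hp
    have h2 := mem_closedBall_iff_norm.1 hx
    have h3 := norm_add_le (x - p) p
    rw [sub_add_cancel] at h3
    exact (norm_fst_le x).trans_lt (by linarith)
  have n1 : Nbhd (1 / 2) (closedBall (0 : E × ℝ) 3) (closedBall 0 (7 / 2)) := fun p hp =>
    closedBall_subset_closedBall' (by linarith [mem_closedBall.1 hp])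
  have hv := h.toWeakSol.smoothSol hε hε1 n2
  have hz := (hv.mono (n1.subset (by norm_num))).sub (hv.mollify (by norm_num) (by norm_num) n1)
  obtain ⟨z, hzdef⟩ : ∃ z, z = fun p => mollify ε u p - mollify (1 / 2) (mollify ε u) p := ⟨_, rfl⟩
  rw [← hzdef] at hz
  have hzp : ∀ p, mollify ε u p - mollify (1 / 2) (mollify ε u) p = z p := fun p => by rw [hzdef]
  simp only [hzp] at hint ⊢
  have hosc : ∀ j : ℤ, ∫⁻ p in closedBall ((0 : E), 2 * (j : ℝ)) 3, ‖z p‖ₑ ^ 2 ≤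
      C₁ * (∫⁻ p in closedBall ((0 : E), 2 * (j : ℝ)) 6, ∑ i, ‖G i p‖ₑ) ^ 2 := fun j => by
    rw [hzdef]
    exact le_self_add.trans (h₁ h _ (closedBall_six_subset j) ε hε hε4)
  have hm := continuous_timeFrac hσ hψc hψ
  have i1 : Integrable fun p => (η p • z p) * timeFrac σ ψ p := by
    refine ((hη.continuous.smul hz.smooth.continuous).mul hm).integrable_of_hasCompactSupport ?_
    exact (hηc.smul_right (f' := z)).mul_right
  have b1 : ‖∫ p, (η p • z p) * timeFrac σ ψ p‖ₑ ^ 2 ≤ K₁ * gradTail G ^ 2 * ∫⁻ p, ‖ψ p‖ₑ ^ 2 := by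
    refine (hz.enorm_integral_cutoff_mul_timeFrac_sq_le isClosed_closedBall.measurableSet hη hηc hηs3
      (fun p => by rw [abs_of_nonneg (hη0 p)]; exact hη1 p) hLt hLx hσ hψc hψ).trans ?_
    rw [hK₁]
    have h0 := h₁ h 0 (by simpa [hz0] using closedBall_six_subset (E := E) 0) ε hε hε4
    simp only [hzp] at h0
    have h2 := h0.trans (mul_le_mul_right (pow_le_pow_left' (setLIntegral_zero_le_gradTail G) 2) _)
    refine (mul_le_mul_left (mul_le_mul_right (mul_le_mul_right h2 _) _) _).trans (le_of_eq ?_)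
    ring
  have b2 : ‖∫ p, (z p * timeFrac σ ψ p - (η p • z p) * timeFrac σ ψ p)‖ₑ ≤
      K₂ * ((C₁ * (6 * ∫⁻ p, ‖ψ p‖ₑ ^ 2)) ^ (1 / 2 : ℝ) * gradTail G) := by
    have ht := lintegral_mul_tail_le hz.smooth.continuous hψ.continuous hs hosc
    refine (enorm_integral_le_lintegral_enorm _).trans ?_
    rw [hK₂, mul_assoc]
    refine le_trans ?_ (mul_le_mul_right ht _)
    rw [← lintegral_const_mul' _ _ ENNReal.ofReal_ne_top, ← lintegral_indicator (measurableSet_cylinder 3)]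
    refine lintegral_mono fun p => ?_
    have e1 : z p * timeFrac σ ψ p - (η p • z p) * timeFrac σ ψ p =
        (1 - η p) • (z p * timeFrac σ ψ p) := by
      simp only [Complex.real_smul]; push_cast; ring
    rw [e1]
    by_cases h0 : η p = 1
    · simp [h0]
    by_cases hX : p.1 ∈ Prod.fst '' tsupport ψ
    · have hX1 : ‖p.1‖ ≤ 3 / 2 := by
        obtain ⟨x, hx, hxp⟩ := hX
        rw [← hxp]
        exact (norm_fst_le x).trans (mem_closedBall_zero_iff.1 (hs hx))
      -- On a slice meeting the support of ψ, a point with η ≠ 1 lies at time |t| ≥ 2 = 3/2 + 1/2,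
      -- as the tail bound demands.
      have hp2 : (2 : ℝ) ≤ |p.2| := by
        by_contra hlt
        refine h0 (hηe p (mem_ball_zero_iff.2 ?_))
        rw [Prod.norm_def]
        exact max_lt (by linarith) (not_le.1 hlt)
      have hp : p ∈ closedBall (0 : E) 3 ×ˢ (univ : Set ℝ) :=
        ⟨mem_closedBall_zero_iff.2 (by linarith), mem_univ _⟩
      rw [indicator_of_mem hp]
      have hb := norm_timeFrac_le_of_le hσ hψ.continuous (by norm_num) hs (X := p.1) (t := p.2)
        (by linarith)
      have hint1 : Integrable fun s => ψ (p.1, s) := (hψ.continuous.comp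
        (by fun_prop : Continuous fun s : ℝ => (p.1, s))).integrable_of_hasCompactSupport
        (HasCompactSupport.intro (hψc.isCompact.image continuous_snd) fun t ht =>
          image_eq_zero_of_notMem_tsupport (f := ψ) (x := (p.1, t)) fun hn => ht ⟨(p.1, t), hn, rfl⟩)
      have hb' : ‖timeFrac σ ψ p‖ₑ ≤ ENNReal.ofReal (ker (1 / 6)) * ENNReal.ofReal (decay p.2) *
          ∫⁻ s, ‖ψ (p.1, s)‖ₑ := by
        have := ENNReal.ofReal_le_ofReal hb
        rw [ofReal_norm, ENNReal.ofReal_mul (mul_nonneg (ker_pos (by norm_num)).le (decay_pos _).le),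
          ENNReal.ofReal_mul (ker_pos (by norm_num)).le,
          ofReal_integral_norm_eq_lintegral_enorm hint1] at this
        norm_num at this ⊢
        exact this
      have hη' : ‖1 - η p‖ₑ ≤ 1 := by
        rw [← ofReal_norm, ← ENNReal.ofReal_one]
        refine ENNReal.ofReal_le_ofReal ?_
        rw [Real.norm_of_nonneg (by linarith [hη1 p])]
        linarith [hη0 p]
      rw [enorm_smul, enorm_mul]
      refine (mul_le_mul' hη' (mul_le_mul_right hb' _)).trans (le_of_eq ?_)
      ring
    · rw [timeFrac_eq_zero σ hX]; simp
  have e2 : ∫ p, z p * timeFrac σ ψ p = (∫ p, (η p • z p) * timeFrac σ ψ p) +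
      ∫ p, (z p * timeFrac σ ψ p - (η p • z p) * timeFrac σ ψ p) := by
    rw [integral_sub hint i1]; ring
  rw [e2]
  have b3 := pow_le_pow_left' b2 2
  have hsq : ∀ x : ℝ≥0∞, (x ^ (1 / 2 : ℝ)) ^ 2 = x := fun x => by
    rw [← ENNReal.rpow_natCast, ← ENNReal.rpow_mul]; norm_num
  rw [mul_pow, mul_pow, hsq] at b3
  refine (enorm_add_sq_le _ _).trans ((mul_le_mul_right (add_le_add b1 b3) _).trans (le_of_eq ?_))
  ring

/-- The local estimate for the half-order derivative of a solution. -/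
theorem exists_fractional_reverse_holder (e : ι → E) (ℓ : ι → E →L[ℝ] ℝ)
    (hℓ : ∀ Y, ∑ i, ℓ i Y • e i = Y) {κ M : ℝ} (hκ : 0 < κ) (hM : 0 < M) :
    ∃ C : ℝ≥0∞, C ≠ ⊤ ∧ ∀ {σ : ℝ} {u q : E × ℝ → ℂ} {F G : ι → E × ℝ → ℂ}, |σ| = 1 →
      FracSol e κ M σ u F G q → ∫⁻ p in closedBall 0 1, ‖q p‖ₑ ^ 2 ≤
        C * (gradTail G + ∫⁻ p in closedBall 0 2, ‖q p‖ₑ) ^ 2 := by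
  obtain ⟨C₁, hC₁, h₁⟩ := exists_enorm_integral_oscillation_sq_le e ℓ hℓ hκ hM
  obtain ⟨C₂, hC₂, h₂⟩ := exists_enorm_mollify_le E
  obtain ⟨C₀, hC₀, hcut⟩ := exists_cutoff E
  obtain ⟨η, hη, hη0, hη1, hηe, hηs, -⟩ := hcut 0 (5 / 4) 1 one_pos le_rfl
  obtain ⟨c, hc⟩ : ∃ c, c = ENNReal.ofReal (C₂ * ((1 / 2 : ℝ) ^ homDim E)⁻¹) := ⟨_, rfl⟩
  have hvol : volume (closedBall (0 : E × ℝ) 1) ≠ ⊤ := measure_closedBall_lt_top.ne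
  refine ⟨2 * (2 * C₁ + c ^ 2 * volume (closedBall (0 : E × ℝ) 1)) + 1, by rw [hc]; finiteness,
    fun {σ u q F G} hσ h => ?_⟩
  -- In the infinite case the claim is trivial; the summand 1 in the constant keeps the right side
  -- from being 0 · ∞.
  by_cases hR : gradTail G = ⊤
  · rw [hR, top_add, ENNReal.top_pow (by norm_num), ENNReal.mul_top (by simp)]
    exact le_top
  have hu : DecayIntegrable 3 u := h.lintegral_decay_lt_top hℓ hκ hM hR
  have hηs' : tsupport η ⊆ closedBall 0 (3 / 2) :=
    hηs.trans (closedBall_subset_closedBall (by norm_num))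
  have hηc := hasCompactSupport_of_tsupport_subset_closedBall hηs'
  have hosc : ∀ ε : ℝ, 0 < ε → ε ≤ 1 / 4 → ∫⁻ p in closedBall 0 1,
      ‖mollify ε q p - mollify (1 / 2) (mollify ε q) p‖ₑ ^ 2 ≤ C₁ * gradTail G ^ 2 := by
    intro ε hε hε4
    have hε1 : ε ≤ 1 := by linarith
    have hqm := h.memL2_frac.mollify hε hε1
    obtain ⟨D, hD⟩ : ∃ D, D = fun p => mollify ε q p - mollify (1 / 2) (mollify ε q) p := ⟨_, rfl⟩
    have hDp : ∀ p, mollify ε q p - mollify (1 / 2) (mollify ε q) p = D p := fun p => by rw [hD]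
    have hDs : ContDiff ℝ ∞ D := by
      rw [hD]
      exact (contDiff_mollify hε hε1 h.memL2_frac.locallyIntegrable).sub
        (contDiff_mollify (by norm_num) (by norm_num) hqm.locallyIntegrable)
    -- The test function is the localized conjugate of the oscillation D itself, so that the pairing
    -- becomes the integral of η |D|².
    have hψ : ContDiff ℝ ∞ fun p => η p • conj (D p) :=
      hη.smul (Complex.conjCLE.contDiff.comp hDs)
    have hψs : tsupport (fun p => η p • conj (D p)) ⊆ closedBall 0 (3 / 2) :=
      (closure_mono (Function.support_smul_subset_left _ _)).trans hηs'
    obtain ⟨hi, he⟩ := h.integral_sub_mollify_mul hσ hu hε hε4 hψ hψs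
    have hb := h₁ h.toEllipticSol ε hε hε4 hσ hψ hψs hi
    rw [← he] at hb
    simp only [hDp] at hb ⊢
    have hηD : Continuous fun p => η p * ‖D p‖ ^ 2 :=
      hη.continuous.mul (hDs.continuous.norm.pow 2)
    have hηDi : Integrable fun p => η p * ‖D p‖ ^ 2 :=
      hηD.integrable_of_hasCompactSupport hηc.mul_right
    have e1 : ∀ p, D p * (η p • conj (D p)) = ((η p * ‖D p‖ ^ 2 : ℝ) : ℂ) := fun p => by
      rw [mul_smul_comm, Complex.mul_conj, Complex.normSq_eq_norm_sq, Complex.real_smul]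
      push_cast; ring
    obtain ⟨B, hB⟩ : ∃ B, B = ∫⁻ p, ENNReal.ofReal (η p * ‖D p‖ ^ 2) := ⟨_, rfl⟩
    have hBtop : B ≠ ⊤ := by
      rw [hB]; exact hηDi.lintegral_lt_top.ne
    have e2 : ‖∫ p, D p * (η p • conj (D p))‖ₑ = B := by
      simp only [e1]
      rw [integral_complex_ofReal, ← ofReal_norm, Complex.norm_real, Real.norm_of_nonneg
        (integral_nonneg fun p => mul_nonneg (hη0 p) (sq_nonneg _)),
        ofReal_integral_eq_lintegral_ofReal hηDi
        (ae_of_all _ fun p => mul_nonneg (hη0 p) (sq_nonneg _)), hB]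
    -- From 0 ≤ η ≤ 1 one has η² ≤ η, so the L² norm of the test function is controlled by the
    -- pairing B. The duality bound reads B² ≤ C T² B with T the gradient tail, and B, being finite,
    -- cancels.
    have e3 : ∫⁻ p, ‖η p • conj (D p)‖ₑ ^ 2 ≤ B := by
      rw [hB]
      refine lintegral_mono fun p => ?_
      rw [← ofReal_norm, ← ENNReal.ofReal_pow (norm_nonneg _)]
      refine ENNReal.ofReal_le_ofReal ?_
      rw [norm_smul, Real.norm_of_nonneg (hη0 p), RCLike.norm_conj, mul_pow]
      exact mul_le_mul_of_nonneg_right (by nlinarith [hη0 p, hη1 p]) (sq_nonneg _)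
    rw [e2] at hb
    have hb2 := hb.trans (mul_le_mul_right e3 _)
    have hBle : B ≤ C₁ * gradTail G ^ 2 := by
      by_cases hB0 : B = 0
      · rw [hB0]; exact zero_le
      · rw [sq B] at hb2
        exact (ENNReal.mul_le_mul_iff_left hB0 hBtop).1 hb2
    refine le_trans ?_ hBle
    rw [hB, ← lintegral_indicator isClosed_closedBall.measurableSet]
    refine lintegral_mono fun p => ?_
    by_cases hp : p ∈ closedBall (0 : E × ℝ) 1
    · rw [indicator_of_mem hp, hηe p (closedBall_subset_ball (by norm_num) hp), one_mul,
        ENNReal.ofReal_pow (norm_nonneg _), ofReal_norm]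
    · rw [indicator_of_notMem hp]; exact zero_le
  have hlim := lintegral_sub_mollify_sq_le_of_forall h.memL2_frac hosc
  have hqm := h.memL2_frac.aestronglyMeasurable
  have hq2 := (h.memL2_frac.mollify (a := 1 / 2) (by norm_num) (by norm_num)).aestronglyMeasurable
  have hmean : ∫⁻ p in closedBall 0 1, ‖mollify (1 / 2) q p‖ₑ ^ 2 ≤
      c ^ 2 * volume (closedBall (0 : E × ℝ) 1) * (∫⁻ p in closedBall 0 2, ‖q p‖ₑ) ^ 2 := by
    have : ∀ p ∈ closedBall (0 : E × ℝ) 1, ‖mollify (1 / 2) q p‖ₑ ^ 2 ≤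
        (c * ∫⁻ p in closedBall 0 2, ‖q p‖ₑ) ^ 2 := fun p hp => by
      refine pow_le_pow_left' ((h₂ (by norm_num) (by norm_num) q p).trans ?_) 2
      rw [hc]
      exact mul_le_mul_right (lintegral_mono_set
        (closedBall_subset_closedBall' (by linarith [mem_closedBall.1 hp]))) _
    refine (setLIntegral_mono' isClosed_closedBall.measurableSet this).trans (le_of_eq ?_)
    rw [setLIntegral_const]; ring
  calc ∫⁻ p in closedBall 0 1, ‖q p‖ₑ ^ 2
      ≤ ∫⁻ p in closedBall 0 1, 2 * (‖q p - mollify (1 / 2) q p‖ₑ ^ 2 + ‖mollify (1 / 2) q p‖ₑ ^ 2) := by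
        refine lintegral_mono fun p => ?_
        have := enorm_add_sq_le (q p - mollify (1 / 2) q p) (mollify (1 / 2) q p)
        rwa [sub_add_cancel] at this
    _ = 2 * ((∫⁻ p in closedBall 0 1, ‖q p - mollify (1 / 2) q p‖ₑ ^ 2) +
          ∫⁻ p in closedBall 0 1, ‖mollify (1 / 2) q p‖ₑ ^ 2) := by
        rw [lintegral_const_mul' _ _ (by simp), lintegral_add_left']
        exact ((hqm.sub hq2).restrict.enorm.pow_const 2)
    _ ≤ 2 * (2 * (C₁ * gradTail G ^ 2) + c ^ 2 * volume (closedBall (0 : E × ℝ) 1) *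
          (∫⁻ p in closedBall 0 2, ‖q p‖ₑ) ^ 2) := by gcongr
    _ ≤ 2 * (2 * (C₁ * (gradTail G + ∫⁻ p in closedBall 0 2, ‖q p‖ₑ) ^ 2) +
          c ^ 2 * volume (closedBall (0 : E × ℝ) 1) *
          (gradTail G + ∫⁻ p in closedBall 0 2, ‖q p‖ₑ) ^ 2) := by
        gcongr
        · exact le_self_add
        · exact le_add_self
    _ = 2 * (2 * C₁ + c ^ 2 * volume (closedBall (0 : E × ℝ) 1)) *
          (gradTail G + ∫⁻ p in closedBall 0 2, ‖q p‖ₑ) ^ 2 := by ring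
    _ ≤ _ := mul_le_mul_left le_self_add _

end FracSol

/-! ### Smooth low-frequency averages, uniformly in the scale. -/

section LowPass

/-- A smooth cutoff in frequency. -/
def lowPassBump : ContDiffBump (0 : ℝ) where
  rIn := 1
  rOut := 2
  rIn_pos := one_pos
  rIn_lt_rOut := one_lt_two

lemma contDiff_lowPassBump : ContDiff ℝ ∞ fun ξ : ℝ => ((lowPassBump ξ : ℝ) : ℂ) :=
  Complex.ofRealCLM.contDiff.comp lowPassBump.contDiff

/-- The low frequency cutoff as a Schwartz function. -/
def lowPass : 𝓢(ℝ, ℂ) :=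
  HasCompactSupport.toSchwartzMap (f := fun ξ : ℝ => ((lowPassBump ξ : ℝ) : ℂ))
    (lowPassBump.hasCompactSupport.comp_left (g := fun x : ℝ => (x : ℂ)) Complex.ofReal_zero)
    contDiff_lowPassBump

lemma lowPass_apply (ξ : ℝ) : lowPass ξ = ((lowPassBump ξ : ℝ) : ℂ) := rfl

/-- The convolution kernel of the low frequency cutoff. -/
def lowKernel : 𝓢(ℝ, ℂ) := 𝓕⁻ lowPass

lemma lowKernel_eq : (lowKernel : ℝ → ℂ) = 𝓕⁻ (lowPass : ℝ → ℂ) := SchwartzMap.fourierInv_coe _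

/-- The cutoff equals 1 at frequency zero. This normalization makes the averages converge to f at
small scales. -/
lemma integral_lowKernel : ∫ y, lowKernel y = 1 := by
  have h : 𝓕 lowKernel = lowPass := FourierTransform.fourier_fourierInv_eq _
  have h0 : 𝓕 (lowKernel : ℝ → ℂ) 0 = lowPass 0 := by
    rw [← SchwartzMap.fourier_coe, h]
  have h1 : lowPassBump (0 : ℝ) = 1 := lowPassBump.one_of_mem_closedBall (by simp [lowPassBump])
  rw [Real.fourier_eq', lowPass_apply, h1] at h0
  simpa using h0

/-- The average at scale `s` that cuts off the frequencies above `2 / s`. -/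
def lowAvg (s : ℝ) (f : ℝ → ℂ) (t : ℝ) : ℂ := ∫ y, f (t - s * y) * lowKernel y

lemma lowAvg_eq {s : ℝ} (hs : 0 < s) (f : ℝ → ℂ) (t : ℝ) :
    lowAvg s f t = ∫ y, f y * ((s : ℂ)⁻¹ * lowKernel ((t - y) / s)) := by
  have h1 := integral_sub_left_eq_self (fun y => f y * ((s : ℂ)⁻¹ * lowKernel ((t - y) / s))) volume t
  have h2 := Measure.integral_comp_mul_left
    (fun x => f (t - x) * ((s : ℂ)⁻¹ * lowKernel ((t - (t - x)) / s))) s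
  rw [h1] at h2
  simp only [sub_sub_cancel, mul_div_cancel_left₀ _ hs.ne', mul_left_comm _ ((s : ℂ)⁻¹)] at h2
  rw [integral_const_mul, abs_of_pos (inv_pos.2 hs), Complex.real_smul, Complex.ofReal_inv] at h2
  have h3 := mul_left_cancel₀ (inv_ne_zero (Complex.ofReal_ne_zero.2 hs.ne')) h2
  rw [lowAvg, h3]
  refine integral_congr_ae (ae_of_all _ fun y => ?_)
  dsimp only; ring

/-- The multiplication formula applied to y ↦ f (t - s y) and the cutoff. Neither smoothness of f
nor integrability of 𝓕 f is needed. -/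
lemma fourierInv_lowPass_mul {s : ℝ} (hs : 0 < s) {f : ℝ → ℂ} (hf : Integrable f) (t : ℝ) :
    𝓕⁻ (fun ξ : ℝ => lowPass (s * ξ) * 𝓕 f ξ) t = lowAvg s f t := by
  have hF : Integrable fun y => f (t - s * y) := (hf.comp_sub_left t).comp_mul_left' hs.ne'
  have e1 : ∀ ξ : ℝ, 𝓕 (fun y => f (t - s * y)) (-(s * ξ)) =
      (s : ℂ)⁻¹ * (Complex.exp ((2 * Real.pi * (t * ξ) : ℝ) * Complex.I) * 𝓕 f ξ) := fun ξ => by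
    rw [Real.fourier_real_eq_integral_exp_smul, Real.fourier_real_eq_integral_exp_smul]
    have h2 := Measure.integral_comp_mul_left (fun x => Complex.exp ((2 * Real.pi * (x * ξ) : ℝ) *
      Complex.I) * f (t - x)) s
    have h1 := integral_sub_left_eq_self (fun y => Complex.exp ((2 * Real.pi * ((t - y) * ξ) : ℝ) *
      Complex.I) * f y) volume t
    simp only [sub_sub_cancel] at h1
    rw [h1, abs_of_pos (inv_pos.2 hs), Complex.real_smul, Complex.ofReal_inv] at h2
    refine Eq.trans ?_ (h2.trans ?_)
    · refine integral_congr_ae (ae_of_all _ fun y => ?_)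
      have e : -2 * Real.pi * y * -(s * ξ) = 2 * Real.pi * (s * y * ξ) := by ring
      simp only [smul_eq_mul, e]
    · congr 1
      rw [← integral_const_mul]
      refine integral_congr_ae (ae_of_all _ fun y => ?_)
      have e : Complex.exp ((2 * Real.pi * ((t - y) * ξ) : ℝ) * Complex.I) =
          Complex.exp ((2 * Real.pi * (t * ξ) : ℝ) * Complex.I) *
            Complex.exp ((-2 * Real.pi * y * ξ : ℝ) * Complex.I) := by
        rw [← Complex.exp_add]
        congr 1
        push_cast; ring
      simp only [e, smul_eq_mul]
      rw [mul_assoc]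
  have h1 := Measure.integral_comp_mul_left
    (fun ξ => 𝓕 (fun y => f (t - s * y)) (-ξ) * lowPass ξ) s
  rw [← integral_mul_fourierInv hF lowPass.integrable, ← lowKernel_eq, abs_of_pos (inv_pos.2 hs),
    Complex.real_smul, Complex.ofReal_inv] at h1
  simp only [e1, mul_assoc] at h1
  rw [integral_const_mul] at h1
  have h3 := mul_left_cancel₀ (inv_ne_zero (Complex.ofReal_ne_zero.2 hs.ne')) h1
  rw [lowAvg, ← h3, Real.fourierInv_eq']
  refine integral_congr_ae (ae_of_all _ fun ξ => ?_)
  simp only [smul_eq_mul, RCLike.inner_apply, conj_trivial]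
  ring_nf

lemma exists_lowKernel_bounds : ∃ C : ℝ, 0 < C ∧ (∀ x, ‖lowKernel x‖ ≤ C) ∧
    (∀ x, |x| * ‖lowKernel x‖ ≤ C) ∧ ∀ x, |x| ^ 2 * ‖deriv lowKernel x‖ ≤ C := by
  obtain ⟨C₀, h₀, h₀'⟩ := lowKernel.decay 0 0
  obtain ⟨C₁, h₁, h₁'⟩ := lowKernel.decay 1 0
  obtain ⟨C₂, h₂, h₂'⟩ := lowKernel.decay 2 1
  refine ⟨C₀ + C₁ + C₂, by positivity, fun x => ?_, fun x => ?_, fun x => ?_⟩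
  · have := h₀' x
    simp only [pow_zero, one_mul, norm_iteratedFDeriv_zero] at this
    linarith
  · have := h₁' x
    simp only [pow_one, norm_iteratedFDeriv_zero, Real.norm_eq_abs] at this
    linarith
  · have := h₂' x
    rw [norm_iteratedFDeriv_one, ← norm_deriv_eq_norm_fderiv, Real.norm_eq_abs] at this
    linarith

lemma integrable_lowKernel_scale {s : ℝ} (hs : 0 < s) (t : ℝ) :
    Integrable (fun y => ‖(s : ℂ)⁻¹ * lowKernel ((t - y) / s)‖) ∧
      ∫ y, ‖(s : ℂ)⁻¹ * lowKernel ((t - y) / s)‖ = ∫ y, ‖lowKernel y‖ := by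
  have h0 : Integrable fun x : ℝ => lowKernel (x / s) := lowKernel.integrable.comp_div hs.ne'
  refine ⟨((h0.comp_sub_left t).const_mul _).norm, ?_⟩
  have h1 := integral_sub_left_eq_self (fun y => ‖(s : ℂ)⁻¹ * lowKernel (y / s)‖) volume t
  rw [h1]
  simp only [norm_mul, norm_inv, Complex.norm_real, Real.norm_of_nonneg hs.le]
  rw [integral_const_mul, Measure.integral_comp_div (fun y => ‖lowKernel y‖) s, abs_of_pos hs,
    smul_eq_mul, inv_mul_cancel_left₀ hs.ne']

lemma norm_lowAvg_le {f : ℝ → ℂ} {C : ℝ} (hf : ∀ y, ‖f y‖ ≤ C) (s t : ℝ) :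
    ‖lowAvg s f t‖ ≤ C * ∫ y, ‖lowKernel y‖ := by
  rw [← integral_const_mul]
  refine norm_integral_le_of_norm_le (lowKernel.integrable.norm.const_mul C) (ae_of_all _ fun y => ?_)
  rw [norm_mul]
  exact mul_le_mul_of_nonneg_right (hf _) (norm_nonneg _)

lemma tendsto_lowAvg_zero {f : ℝ → ℂ} (hc : Continuous f) {C : ℝ} (hf : ∀ y, ‖f y‖ ≤ C) (t : ℝ) :
    Tendsto (fun s => lowAvg s f t) (𝓝[>] 0) (𝓝 (f t)) := by
  have h : Tendsto (fun s => lowAvg s f t) (𝓝 0) (𝓝 (lowAvg 0 f t)) := by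
    refine tendsto_integral_filter_of_dominated_convergence (fun y => C * ‖lowKernel y‖)
      (Eventually.of_forall fun s => ?_) (Eventually.of_forall fun s => ae_of_all _ fun y => ?_)
      (lowKernel.integrable.norm.const_mul C) (ae_of_all _ fun y => ?_)
    · have := lowKernel.continuous
      exact Continuous.aestronglyMeasurable (by fun_prop)
    · rw [norm_mul]
      exact mul_le_mul_of_nonneg_right (hf _) (norm_nonneg _)
    · exact ((by fun_prop : Continuous fun s => f (t - s * y) * lowKernel y)).tendsto 0
  have e : lowAvg 0 f t = f t := by
    simp [lowAvg, integral_const_mul, integral_lowKernel]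
  rw [e] at h
  exact h.mono_left nhdsWithin_le_nhds

lemma tendsto_lowAvg_atTop {f : ℝ → ℂ} (hf : Integrable f) (t : ℝ) :
    Tendsto (fun s => lowAvg s f t) atTop (𝓝 0) := by
  obtain ⟨C, hC, h0, -, -⟩ := exists_lowKernel_bounds
  have h : Tendsto (fun s : ℝ => s⁻¹ * (C * ∫ y, ‖f y‖)) atTop (𝓝 0) := by
    have := tendsto_inv_atTop_zero.mul_const (C * ∫ y, ‖f y‖)
    rwa [zero_mul] at this
  refine squeeze_zero_norm' ?_ h
  filter_upwards [eventually_gt_atTop 0] with s hs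
  rw [lowAvg_eq hs, ← integral_const_mul, ← integral_const_mul]
  refine norm_integral_le_of_norm_le ((hf.norm.const_mul C).const_mul s⁻¹) (ae_of_all _ fun y => ?_)
  rw [norm_mul, norm_mul, norm_inv, Complex.norm_real, Real.norm_of_nonneg hs.le]
  have := mul_le_mul_of_nonneg_left (h0 ((t - y) / s)) (mul_nonneg (norm_nonneg (f y)) (inv_pos.2 hs).le)
  linarith

/-- Averages of functions that decay like `1 / |t|` decay in the same way, uniformly in the scale. -/
lemma exists_norm_lowAvg_le_inv {f : ℝ → ℂ} (hf : Integrable f) {C : ℝ}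
    (hb : ∀ y, ‖f y‖ ≤ C * (1 + |y|)⁻¹) :
    ∃ D : ℝ, 0 ≤ D ∧ ∀ s t, 0 < s → ‖lowAvg s f t‖ ≤ D * (1 + |t|)⁻¹ := by
  obtain ⟨C₁, hC₁, -, h1, -⟩ := exists_lowKernel_bounds
  have hC : 0 ≤ C := by have := (norm_nonneg _).trans (hb 0); simpa using this
  have hI : 0 ≤ ∫ y, ‖f y‖ := integral_nonneg fun _ => norm_nonneg _
  have hK : 0 ≤ ∫ y, ‖lowKernel y‖ := integral_nonneg fun _ => norm_nonneg _
  obtain ⟨I, hI'⟩ : ∃ I, I = ∫ y, ‖f y‖ := ⟨_, rfl⟩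
  obtain ⟨N, hN⟩ : ∃ N, N = ∫ y, ‖lowKernel y‖ := ⟨_, rfl⟩
  rw [← hI'] at hI
  rw [← hN] at hK
  refine ⟨4 * (C₁ * I + C * N), by positivity, fun s t hs => ?_⟩
  have ht0 : 0 < 1 + |t| := by positivity
  rcases le_total |t| 1 with ht | ht
  · have h2 : ‖lowAvg s f t‖ ≤ C * N := hN ▸ norm_lowAvg_le (fun y => (hb y).trans
      (mul_le_of_le_one_right hC (inv_le_one_of_one_le₀ (by linarith [abs_nonneg y])))) s t
    refine h2.trans ?_
    rw [← div_eq_mul_inv, le_div_iff₀ ht0]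
    nlinarith [mul_nonneg hC hK, mul_nonneg hC₁.le hI]
  · have htp : 0 < |t| := by linarith
    have h2 : ‖lowAvg s f t‖ ≤ 2 / |t| * (C₁ * I + C * N) := by
      obtain ⟨hki, hke⟩ := integrable_lowKernel_scale hs t
      rw [lowAvg_eq hs, hN, hI', ← hke, ← integral_const_mul, ← integral_const_mul,
        ← integral_add (hf.norm.const_mul _) (hki.const_mul _), ← integral_const_mul]
      refine norm_integral_le_of_norm_le (((hf.norm.const_mul _).add (hki.const_mul _)).const_mul _)
        (ae_of_all _ fun y => ?_)
      rw [norm_mul]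
      obtain ⟨k, hk⟩ : ∃ k, k = ‖(s : ℂ)⁻¹ * lowKernel ((t - y) / s)‖ := ⟨_, rfl⟩
      have hk0 : 0 ≤ k := hk ▸ norm_nonneg _
      rw [← hk, div_mul_eq_mul_div, le_div_iff₀ htp]
      -- For small |y| the scaled kernel is O(1/|t|) whatever the scale, and f is integrable. For
      -- large |y| the function f is O(1/|t|), and the scaled kernel has a fixed L¹ norm.
      rcases le_total |y| (|t| / 2) with hy | hy
      · have h3 : |t - y| * k ≤ C₁ := by
          have := h1 ((t - y) / s)
          rw [hk, norm_mul, norm_inv, Complex.norm_real, Real.norm_of_nonneg hs.le]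
          rw [abs_div, abs_of_pos hs] at this
          refine le_trans (le_of_eq ?_) this
          field_simp
        have h4 : |t| / 2 ≤ |t - y| := by linarith [abs_sub_abs_le_abs_sub t y]
        have h5 : |t| / 2 * k ≤ C₁ := (mul_le_mul_of_nonneg_right h4 hk0).trans h3
        nlinarith [mul_le_mul_of_nonneg_left h5 (norm_nonneg (f y)), mul_nonneg hC hk0]
      · have h3 : ‖f y‖ * (|t| / 2) ≤ C := by
          refine (mul_le_mul_of_nonneg_right (hb y) (by positivity)).trans ?_
          rw [mul_assoc]
          refine mul_le_of_le_one_right hC ?_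
          rw [inv_mul_le_iff₀ (by positivity)]
          linarith
        nlinarith [mul_le_mul_of_nonneg_right h3 hk0, mul_nonneg hC₁.le (norm_nonneg (f y))]
    refine h2.trans ?_
    have h3 : 2 / |t| ≤ 4 * (1 + |t|)⁻¹ := by
      rw [← div_eq_mul_inv, div_le_div_iff₀ htp ht0]
      linarith
    have h4 := mul_le_mul_of_nonneg_right h3 (show 0 ≤ C₁ * I + C * N by positivity)
    linarith

/-- The mean value inequality on a segment that keeps the distance m from the origin. -/
lemma norm_lowKernel_sub_le {C : ℝ} (hC : ∀ x, |x| ^ 2 * ‖deriv lowKernel x‖ ≤ C) {m a b : ℝ}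
    (hm : 0 < m) (h : ∀ x ∈ uIcc a b, m ≤ |x|) :
    ‖lowKernel b - lowKernel a‖ ≤ C / m ^ 2 * |b - a| := by
  refine Convex.norm_image_sub_le_of_norm_deriv_le (s := uIcc a b)
    (fun x _ => lowKernel.differentiableAt) (fun x hx => ?_) (convex_uIcc a b) left_mem_uIcc
    right_mem_uIcc
  rw [le_div_iff₀ (by positivity), mul_comm]
  exact (mul_le_mul_of_nonneg_right (pow_le_pow_left₀ hm.le (h x hx) 2) (norm_nonneg _)).trans (hC x)

lemma integrable_comp_abs {f : ℝ → ℝ} (hf : IntegrableOn f (Ioi 0)) : Integrable (f ∘ abs) := by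
  have h1 : IntegrableOn (f ∘ abs) (Ioi 0) :=
    hf.congr_fun (fun x hx => by rw [Function.comp_apply, abs_of_pos hx]) measurableSet_Ioi
  have h2 : IntegrableOn (f ∘ abs) (Iio 0) := by
    have h3 : IntegrableOn (f ∘ abs) (Ioi (-0)) := by rwa [neg_zero]
    have := h3.comp_neg_Iio
    simpa [Function.comp_def] using this
  rw [← integrableOn_univ, ← Iic_union_Ioi (a := (0 : ℝ))]
  exact (integrableOn_Iic_iff_integrableOn_Iio (by simp) |>.2 h2).union h1

lemma integral_indicator_abs_rpow {T : ℝ} (hT : 0 < T) :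
    Integrable ((Iic T).indicator (fun y : ℝ => y ^ (-(1 / 2) : ℝ)) ∘ abs) ∧
    ∫ y : ℝ, (Iic T).indicator (fun y : ℝ => y ^ (-(1 / 2) : ℝ)) |y| = 4 * T ^ (1 / 2 : ℝ) := by
  have hi : IntegrableOn (fun y : ℝ => y ^ (-(1 / 2) : ℝ)) (Ioc 0 T) :=
    (intervalIntegral.intervalIntegrable_rpow' (by norm_num)).1
  have hi' : IntegrableOn ((Iic T).indicator fun y : ℝ => y ^ (-(1 / 2) : ℝ)) (Ioi 0) := by
    rw [IntegrableOn, integrable_indicator_iff measurableSet_Iic, IntegrableOn,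
      Measure.restrict_restrict measurableSet_Iic, inter_comm, Ioi_inter_Iic]
    exact hi
  refine ⟨integrable_comp_abs hi', ?_⟩
  rw [integral_comp_abs, setIntegral_indicator measurableSet_Iic, Ioi_inter_Iic,
    ← intervalIntegral.integral_of_le hT.le, integral_rpow (Or.inl (by norm_num))]
  norm_num
  ring

lemma integral_indicator_abs_ker {T : ℝ} (hT : 0 < T) :
    Integrable ((Ioi T).indicator ker ∘ abs) ∧
    ∫ y : ℝ, (Ioi T).indicator ker |y| = 4 * T ^ (-(1 / 2) : ℝ) := by
  have hi : IntegrableOn ker (Ioi T) := integrableOn_Ioi_rpow_of_lt (by norm_num) hT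
  have e : Ioi (0 : ℝ) ∩ Ioi T = Ioi T := by
    rw [Ioi_inter_Ioi, sup_eq_right.2 hT.le]
  have hi' : IntegrableOn ((Ioi T).indicator ker) (Ioi 0) := by
    rw [IntegrableOn, integrable_indicator_iff measurableSet_Ioi, IntegrableOn,
      Measure.restrict_restrict measurableSet_Ioi, inter_comm, e]
    exact hi
  refine ⟨integrable_comp_abs hi', ?_⟩
  rw [integral_comp_abs, setIntegral_indicator measurableSet_Ioi, e]
  have := integral_Ioi_rpow_of_lt (a := (-(3 / 2) : ℝ)) (by norm_num) hT
  change 2 * ∫ t : ℝ in Ioi T, t ^ (-(3 / 2) : ℝ) = _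
  rw [this]
  norm_num
  ring

end LowPass

/-! ### Duality for the Hilbert transform beyond Schwartz functions. -/

section HilbertPairing

lemma decay_le_ker_abs {y : ℝ} (hy : y ≠ 0) : decay y ≤ ker |y| :=
  ker_le_ker (abs_pos.2 hy) (by linarith)

/-- Averages of functions of mean zero that decay like `|t| ^ (-3/2)` decay in the same way,
uniformly in the scale. -/
lemma exists_norm_lowAvg_le_decay {f : ℝ → ℂ} (hf : Integrable f) (h0 : ∫ y, f y = 0) {C : ℝ}
    (hb : ∀ y, ‖f y‖ ≤ C * decay y) :
    ∃ D : ℝ, 0 ≤ D ∧ ∀ s t, 0 < s → ‖lowAvg s f t‖ ≤ D * decay t := by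
  obtain ⟨c, hc, -, h1, h2⟩ := exists_lowKernel_bounds
  have hC : 0 ≤ C := by
    have := (norm_nonneg _).trans (hb 0)
    exact nonneg_of_mul_nonneg_left this (decay_pos 0)
  obtain ⟨N, hN⟩ : ∃ N, N = ∫ y, ‖lowKernel y‖ := ⟨_, rfl⟩
  have hN0 : 0 ≤ N := hN ▸ integral_nonneg fun _ => norm_nonneg _
  have hk4 : 0 < ker (1 / 4) := ker_pos (by norm_num)
  have hk2 : 0 < ker 2 := ker_pos two_pos
  refine ⟨C * (6 * c + N) * ker (1 / 4) + C * N * (ker 2)⁻¹, by positivity, fun s t hs => ?_⟩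
  have hd := decay_pos t
  rcases le_total |t| 1 with ht | ht
  · have h3 : ‖lowAvg s f t‖ ≤ C * N := hN ▸ norm_lowAvg_le (fun y => (hb y).trans
      (mul_le_of_le_one_right hC (decay_le_one y))) s t
    have h4 : 1 ≤ (ker 2)⁻¹ * decay t := by
      rw [← div_eq_inv_mul, one_le_div hk2]
      exact ker_le_ker (by positivity) (by linarith)
    have h5 := mul_le_mul_of_nonneg_left h4 (mul_nonneg hC hN0)
    have h6 : 0 ≤ C * (6 * c + N) * ker (1 / 4) * decay t := by positivity
    linarith
  · obtain ⟨T, hT⟩ : ∃ T, T = |t| / 2 := ⟨_, rfl⟩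
    have hT0 : 0 < T := by rw [hT]; linarith
    obtain ⟨i1, e1⟩ := integral_indicator_abs_rpow hT0
    obtain ⟨i2, e2⟩ := integral_indicator_abs_ker hT0
    obtain ⟨i3, e3⟩ := integrable_lowKernel_scale hs t
    have hkt : ‖(s : ℂ)⁻¹ * lowKernel (t / s)‖ ≤ c / (2 * T) := by
      have := h1 (t / s)
      rw [abs_div, abs_of_pos hs] at this
      rw [norm_mul, norm_inv, Complex.norm_real, Real.norm_of_nonneg hs.le,
        le_div_iff₀ (by positivity), hT]
      refine le_trans (le_of_eq ?_) this
      field_simp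
    have hdiff : ∀ y, |y| ≤ T → ‖(s : ℂ)⁻¹ * lowKernel ((t - y) / s) - (s : ℂ)⁻¹ * lowKernel (t / s)‖
        ≤ c / T ^ 2 * |y| := fun y hy => by
      have h3 := norm_lowKernel_sub_le h2 (m := T / s) (a := t / s) (b := (t - y) / s) (by positivity)
        fun x hx => by
          rw [div_le_iff₀ hs]
          have h4 : |t / s - x| ≤ |t / s - (t - y) / s| := by
            rw [abs_sub_comm]
            exact abs_sub_left_of_mem_uIcc hx |>.trans_eq (abs_sub_comm _ _)
          have h5 : |t / s - (t - y) / s| = |y| / s := by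
            rw [← sub_div, sub_sub_cancel, abs_div, abs_of_pos hs]
          have h6 : |t| / s - |x| ≤ |t / s - x| := by
            have := abs_sub_abs_le_abs_sub (t / s) x
            rwa [abs_div, abs_of_pos hs] at this
          have h7 : |t| / s - |x| ≤ T / s := h6.trans (h4.trans (h5.le.trans (by gcongr)))
          have h8 : |t| / s = T / s + T / s := by rw [hT]; ring
          have h9 : T / s ≤ |x| := by linarith
          rwa [div_le_iff₀ hs] at h9
      rw [← mul_sub, norm_mul, norm_inv, Complex.norm_real, Real.norm_of_nonneg hs.le]
      refine (mul_le_mul_of_nonneg_left h3 (inv_pos.2 hs).le).trans (le_of_eq ?_)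
      rw [← sub_div, sub_sub_cancel_left, abs_div, abs_neg, abs_of_pos hs]
      field_simp
    -- Mean zero permits subtracting the kernel at y = 0. Without it the average at scale s ≈ |t|
    -- would decay only like 1/|t|.
    have e0 : lowAvg s f t = ∫ y, f y * ((s : ℂ)⁻¹ * lowKernel ((t - y) / s) -
        (s : ℂ)⁻¹ * lowKernel (t / s)) := by
      obtain ⟨c₀, -, h00, -, -⟩ := exists_lowKernel_bounds
      have hi : Integrable fun y => f y * ((s : ℂ)⁻¹ * lowKernel ((t - y) / s)) := by
        have hK := lowKernel.continuous
        refine hf.mul_bdd (c := s⁻¹ * c₀) (Continuous.aestronglyMeasurable (by fun_prop))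
          (ae_of_all _ fun y => ?_)
        rw [norm_mul, norm_inv, Complex.norm_real, Real.norm_of_nonneg hs.le]
        exact mul_le_mul_of_nonneg_left (h00 _) (inv_pos.2 hs).le
      simp only [mul_sub]
      rw [integral_sub hi (hf.mul_const _), integral_mul_const, h0, zero_mul, sub_zero, lowAvg_eq hs]
    have hmain : ‖lowAvg s f t‖ ≤ C * (6 * c + N) * ker T := by
      -- Split at T = |t|/2. Inside, the difference of kernels is O(|y|/T²). Outside, the two
      -- kernels are estimated separately, against the decay of f. After integration the three terms
      -- give 4c, N and 2c times `C * ker T`.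
      have hbound : ∀ y, ‖f y * ((s : ℂ)⁻¹ * lowKernel ((t - y) / s) - (s : ℂ)⁻¹ * lowKernel (t / s))‖ ≤
          (c * C / T ^ 2) * (Iic T).indicator (fun y : ℝ => y ^ (-(1 / 2) : ℝ)) |y| +
          (C * ker T * ‖(s : ℂ)⁻¹ * lowKernel ((t - y) / s)‖ +
            (c * C / (2 * T)) * (Ioi T).indicator ker |y|) := fun y => by
        have hkT := ker_pos hT0
        rcases le_or_gt |y| T with hy | hy
        · rw [indicator_of_mem (show |y| ∈ Iic T from hy),
            indicator_of_notMem (show |y| ∉ Ioi T from not_lt.2 hy), mul_zero, add_zero]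
          rcases eq_or_ne y 0 with rfl | hy0
          · simp only [sub_zero, sub_self, mul_zero, norm_zero, abs_zero]
            have := Real.rpow_nonneg (le_refl (0 : ℝ)) (-(1 / 2))
            positivity
          have hyk : |y| * ker |y| = |y| ^ (-(1 / 2) : ℝ) := by
            have := Real.rpow_add (abs_pos.2 hy0) 1 (-(3 / 2))
            rw [Real.rpow_one] at this
            rw [ker, ← this]; norm_num
          rw [norm_mul]
          refine le_add_of_le_of_nonneg ?_ (by positivity)
          calc _ ≤ (C * ker |y|) * (c / T ^ 2 * |y|) :=
                mul_le_mul ((hb y).trans (mul_le_mul_of_nonneg_left (decay_le_ker_abs hy0) hC))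
                  (hdiff y hy) (norm_nonneg _) (mul_nonneg hC (ker_pos (abs_pos.2 hy0)).le)
            _ = _ := by rw [← hyk]; ring
        · have hy0 : y ≠ 0 := fun h => by rw [h, abs_zero] at hy; linarith
          rw [indicator_of_notMem (show |y| ∉ Iic T from not_le.2 hy),
            indicator_of_mem (show |y| ∈ Ioi T from hy), mul_zero, zero_add, norm_mul]
          have hfy := (hb y).trans (mul_le_mul_of_nonneg_left (decay_le_ker_abs hy0) hC)
          have hfT := hfy.trans (mul_le_mul_of_nonneg_left (ker_le_ker hT0 hy.le) hC)
          calc _ ≤ ‖f y‖ * (‖(s : ℂ)⁻¹ * lowKernel ((t - y) / s)‖ + ‖(s : ℂ)⁻¹ * lowKernel (t / s)‖) :=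
                mul_le_mul_of_nonneg_left (norm_sub_le _ _) (norm_nonneg _)
            _ = ‖f y‖ * ‖(s : ℂ)⁻¹ * lowKernel ((t - y) / s)‖ +
                ‖f y‖ * ‖(s : ℂ)⁻¹ * lowKernel (t / s)‖ := mul_add _ _ _
            _ ≤ C * ker T * ‖(s : ℂ)⁻¹ * lowKernel ((t - y) / s)‖ + C * ker |y| * (c / (2 * T)) :=
                add_le_add (mul_le_mul_of_nonneg_right hfT (norm_nonneg _))
                  (mul_le_mul hfy hkt (norm_nonneg _) (mul_nonneg hC (ker_pos (abs_pos.2 hy0)).le))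
            _ = _ := by ring
      have j1 : Integrable fun y : ℝ => (c * C / T ^ 2) *
          (Iic T).indicator (fun y : ℝ => y ^ (-(1 / 2) : ℝ)) |y| := i1.const_mul _
      have j2 : Integrable fun y : ℝ => C * ker T * ‖(s : ℂ)⁻¹ * lowKernel ((t - y) / s)‖ :=
        i3.const_mul _
      have j3 : Integrable fun y : ℝ => (c * C / (2 * T)) * (Ioi T).indicator ker |y| := i2.const_mul _
      have j23 : Integrable fun y : ℝ => C * ker T * ‖(s : ℂ)⁻¹ * lowKernel ((t - y) / s)‖ +
        (c * C / (2 * T)) * (Ioi T).indicator ker |y| := j2.add j3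
      rw [e0]
      refine (norm_integral_le_of_norm_le (j1.add j23) (ae_of_all _ hbound)).trans (le_of_eq ?_)
      have k1 : T ^ (1 / 2 : ℝ) = T ^ 2 * ker T := by
        rw [ker, ← Real.rpow_natCast, ← Real.rpow_add hT0]; norm_num
      have k2 : T ^ (-(1 / 2) : ℝ) = T * ker T := by
        have := Real.rpow_add hT0 1 (-(3 / 2))
        rw [Real.rpow_one] at this
        rw [ker, ← this]; norm_num
      have e4 := integral_add j1 j23
      have e5 := integral_add j2 j3
      rw [integral_const_mul, e1, k1] at e4
      rw [integral_const_mul, integral_const_mul, e2, e3, k2, ← hN] at e5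
      refine e4.trans ?_
      rw [e5]
      field_simp
      ring
    have hkT : ker T ≤ ker (1 / 4) * decay t := by
      rw [decay, ← ker_mul (by norm_num) (by positivity)]
      exact ker_le_ker (by positivity) (by rw [hT]; linarith)
    have h6 : 0 ≤ C * N * (ker 2)⁻¹ * decay t := by positivity
    have h7 := mul_le_mul_of_nonneg_left hkT (show 0 ≤ C * (6 * c + N) by positivity)
    linarith

/-- Both cutoffs equal 1 near frequency zero, so their difference removes the singularity of P
there. Both vanish for large frequencies, so the product is a Schwartz function. -/
lemma contDiff_lowPass_sub_mul {s : ℝ} (hs : 0 < s) (hs1 : s < 1) {P : ℝ → ℂ}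
    (hP : ∀ ξ ≠ 0, ContDiffAt ℝ ∞ P ξ) :
    ContDiff ℝ ∞ (fun ξ => (lowPass (s * ξ) - lowPass (s⁻¹ * ξ)) * P ξ) ∧
      HasCompactSupport fun ξ => (lowPass (s * ξ) - lowPass (s⁻¹ * ξ)) * P ξ := by
  have hsi : 1 < s⁻¹ := (one_lt_inv₀ hs).2 hs1
  constructor
  · rw [contDiff_iff_contDiffAt]
    intro ξ
    rcases eq_or_ne ξ 0 with rfl | h
    · refine ContDiffAt.congr_of_eventuallyEq (contDiffAt_const (c := (0 : ℂ))) ?_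
      filter_upwards [ball_mem_nhds (0 : ℝ) hs] with ξ hξ
      have h1 : |ξ| < s := by simpa using hξ
      have a1 : lowPassBump (s * ξ) = 1 := lowPassBump.one_of_mem_closedBall (by
        simp only [lowPassBump, mem_closedBall, dist_zero_right, Real.norm_eq_abs, abs_mul,
          abs_of_pos hs]
        nlinarith [abs_nonneg ξ])
      have a2 : lowPassBump (s⁻¹ * ξ) = 1 := lowPassBump.one_of_mem_closedBall (by
        simp only [lowPassBump, mem_closedBall, dist_zero_right, Real.norm_eq_abs, abs_mul,
          abs_of_pos (inv_pos.2 hs)]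
        rw [inv_mul_le_iff₀ hs]; linarith)
      rw [lowPass_apply, lowPass_apply, a1, a2, sub_self, zero_mul]
    · have h1 : ContDiff ℝ ∞ fun ξ : ℝ => lowPass (s * ξ) :=
        lowPass.smooth'.comp (contDiff_const.mul contDiff_id)
      have h2 : ContDiff ℝ ∞ fun ξ : ℝ => lowPass (s⁻¹ * ξ) :=
        lowPass.smooth'.comp (contDiff_const.mul contDiff_id)
      exact (h1.sub h2).contDiffAt.mul (hP ξ h)
  · refine HasCompactSupport.intro (isCompact_closedBall (0 : ℝ) (2 / s)) fun ξ hξ => ?_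
    have h1 : 2 / s < |ξ| := by simpa using hξ
    rw [div_lt_iff₀ hs] at h1
    have a1 : lowPassBump (s * ξ) = 0 := lowPassBump.zero_of_le_dist (by
      simp only [lowPassBump, dist_zero_right, Real.norm_eq_abs, abs_mul, abs_of_pos hs]
      linarith)
    have a2 : lowPassBump (s⁻¹ * ξ) = 0 := lowPassBump.zero_of_le_dist (by
      simp only [lowPassBump, dist_zero_right, Real.norm_eq_abs, abs_mul, abs_of_pos (inv_pos.2 hs)]
      nlinarith [abs_nonneg ξ])
    rw [lowPass_apply, lowPass_apply, a1, a2]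
    simp

lemma fourierInv_lowPass_sub_mul {s : ℝ} (hs : 0 < s) {f : ℝ → ℂ} (hf : Integrable f) (t : ℝ) :
    𝓕⁻ (fun ξ : ℝ => (lowPass (s * ξ) - lowPass (s⁻¹ * ξ)) * 𝓕 f ξ) t =
      lowAvg s f t - lowAvg s⁻¹ f t := by
  have hi : ∀ {s : ℝ}, 0 < s → Integrable fun ξ : ℝ => lowPass (s * ξ) * 𝓕 f ξ := fun hs => by
    refine (lowPass.integrable.comp_mul_left' hs.ne').mul_bdd (c := ∫ y, ‖f y‖) ?_
      (ae_of_all _ fun ξ => ?_)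
    · exact (VectorFourier.fourierIntegral_continuous Real.continuous_fourierChar
        (by fun_prop) hf).aestronglyMeasurable
    · exact VectorFourier.norm_fourierIntegral_le_integral_norm _ _ _ _ _
  rw [← fourierInv_lowPass_mul hs hf, ← fourierInv_lowPass_mul (inv_pos.2 hs) hf]
  simp only [Real.fourierInv_eq', smul_eq_mul]
  have hexp : ∀ {P : ℝ → ℂ}, Integrable P → Integrable fun ξ : ℝ =>
      Complex.exp ((2 * Real.pi * inner ℝ ξ t : ℝ) * Complex.I) * P ξ := fun hP =>
    hP.bdd_mul (c := 1) (by fun_prop) (ae_of_all _ fun ξ => by rw [Complex.norm_exp_ofReal_mul_I])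
  rw [← integral_sub (hexp (hi hs)) (hexp (hi (inv_pos.2 hs)))]
  refine integral_congr_ae (ae_of_all _ fun ξ => ?_)
  dsimp only; ring

/-- Parseval. The adjoint of the multiplier i sgn ξ is its negative, and φ plays the role of the
adjoint applied to θ, provided that this is again Schwartz. -/
lemma IsHilbertTransform.integral_eq {g h : ℝ → ℂ} (H : IsHilbertTransform g h) {θ φ : 𝓢(ℝ, ℂ)}
    (hφ : ∀ ξ, 𝓕 φ ξ = -(Complex.I * ((SignType.sign ξ : ℝ) : ℂ)) * 𝓕 θ ξ) :
    ∫ t, h t * conj (θ t) = ∫ t, g t * conj (φ t) := by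
  obtain ⟨hg, hh, hH⟩ := H
  have key : ∀ (θ : 𝓢(ℝ, ℂ)) {k : ℝ → ℂ} (hk : MemLp k 2), ∫ t, k t * conj (θ t) =
      ∫ ξ, (𝓕 (hk.toLp k) : Lp ℂ 2 (volume : Measure ℝ)) ξ * conj (𝓕 θ ξ) := fun θ k hk => by
    have h1 := Lp.inner_fourier_eq (θ.toLp 2) (hk.toLp k)
    rw [SchwartzMap.toLp_fourier_eq, L2.inner_def, L2.inner_def] at h1
    refine Eq.trans ?_ (h1.symm.trans ?_)
    · refine integral_congr_ae ?_
      filter_upwards [hk.coeFn_toLp, θ.coeFn_toLp 2 volume] with t h2 h3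
      rw [h2, h3, RCLike.inner_apply]
    · refine integral_congr_ae ?_
      filter_upwards [(𝓕 θ).coeFn_toLp 2 volume] with t h3
      rw [h3, RCLike.inner_apply]
  rw [key θ hh, key φ hg]
  refine integral_congr_ae ?_
  filter_upwards [hH] with ξ h1
  rw [h1, hφ, map_mul, map_neg, map_mul, Complex.conj_I, Complex.conj_ofReal]
  ring

lemma memLp_inv_one_add_abs : MemLp (fun t : ℝ => (1 + |t|)⁻¹) 2 := by
  have hc : Continuous fun t : ℝ => (1 + |t|)⁻¹ :=
    (continuous_const.add continuous_abs).inv₀ fun t =>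
      (add_pos_of_pos_of_nonneg one_pos (abs_nonneg t)).ne'
  rw [memLp_two_iff_integrable_sq hc.aestronglyMeasurable]
  refine integrable_inv_one_add_sq.mono' (hc.pow 2).aestronglyMeasurable (ae_of_all _ fun t => ?_)
  rw [Real.norm_of_nonneg (sq_nonneg _), inv_pow]
  refine inv_anti₀ (by positivity) ?_
  nlinarith [abs_nonneg t, sq_abs t]

lemma MemL2Loc.locallyIntegrable_real {f : ℝ → ℂ} (hf : MemL2Loc f univ) : LocallyIntegrable f := by
  rw [locallyIntegrable_iff]
  intro K hK
  have : IsFiniteMeasure (volume.restrict K) := ⟨by simpa using hK.measure_lt_top⟩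
  exact (hf K (subset_univ _) hK).integrable (by norm_num)

/-- The Hilbert transform of the half-order derivative of `v` is dual to `v`, when tested against
functions with sufficient decay. -/
theorem IsHalfDeriv.integral_hilbert_eq {v g h : ℝ → ℂ} (hv : IsHalfDeriv v g)
    (H : IsHilbertTransform g h) (hvd : Integrable fun t => ‖v t‖ * decay t) {θ B : ℝ → ℂ}
    (hθ : Continuous θ) (hθi : Integrable θ) {c : ℝ} (hθb : ∀ t, ‖θ t‖ ≤ c * (1 + |t|)⁻¹)
    (hB : Continuous B) (hBi : Integrable B) {C : ℝ} (hBb : ∀ t, ‖B t‖ ≤ C * decay t)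
    (hsm : ∀ ξ ≠ 0, ContDiffAt ℝ ∞ (𝓕 θ) ξ)
    (hBθ : ∀ ξ : ℝ, 𝓕 B ξ = (√|2 * Real.pi * ξ| : ℂ) *
      (-(Complex.I * ((SignType.sign ξ : ℝ) : ℂ)) * 𝓕 θ ξ)) :
    ∫ t, h t * conj (θ t) = ∫ t, v t * conj (B t) := by
  have hc : 0 ≤ c := by have := (norm_nonneg _).trans (hθb 0); simpa using this
  have hC : 0 ≤ C := nonneg_of_mul_nonneg_left ((norm_nonneg _).trans (hBb 0)) (decay_pos 0)
  -- The symbol of B vanishes at the origin; the resulting mean zero feeds the uniform decay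
  -- estimate.
  have hB0 : ∫ t, B t = 0 := by
    have h1 := hBθ 0
    rw [Real.fourier_eq'] at h1
    simpa using h1
  obtain ⟨D₁, hD₁, hθs⟩ := exists_norm_lowAvg_le_inv hθi hθb
  obtain ⟨D₂, hD₂, hBs⟩ := exists_norm_lowAvg_le_decay hBi hB0 hBb
  obtain ⟨-, hh, -⟩ := id H
  have hvm := hv.memL2Loc.locallyIntegrable_real.aestronglyMeasurable
  have hsgn : ∀ ξ ≠ 0, ContDiffAt ℝ ∞
      (fun ξ : ℝ => -(Complex.I * ((SignType.sign ξ : ℝ) : ℂ)) * 𝓕 θ ξ) ξ := fun ξ hξ => by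
    refine ContDiffAt.mul ?_ (hsm ξ hξ)
    rcases lt_or_gt_of_ne hξ with h | h
    · refine (contDiffAt_const (c := Complex.I)).congr_of_eventuallyEq ?_
      filter_upwards [Iio_mem_nhds h] with x hx
      rw [sign_neg hx]; simp
    · refine (contDiffAt_const (c := -Complex.I)).congr_of_eventuallyEq ?_
      filter_upwards [Ioi_mem_nhds h] with x hx
      rw [sign_pos hx]; simp
  -- After a band-pass the transforms of θ, and of its image under the sign multiplier, are
  -- compactly supported away from zero. Both functions are then Schwartz, and the definitions of H
  -- and D^{1/2} apply.
  have step : ∀ s : ℝ, 0 < s → s < 1 →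
      AEStronglyMeasurable (fun t => lowAvg s θ t - lowAvg s⁻¹ θ t) ∧
      AEStronglyMeasurable (fun t => lowAvg s B t - lowAvg s⁻¹ B t) ∧
      ∫ t, h t * conj (lowAvg s θ t - lowAvg s⁻¹ θ t) =
        ∫ t, v t * conj (lowAvg s B t - lowAvg s⁻¹ B t) := fun s hs hs1 => by
    obtain ⟨a1, a2⟩ := contDiff_lowPass_sub_mul hs hs1 hsm
    obtain ⟨b1, b2⟩ := contDiff_lowPass_sub_mul hs hs1 hsgn
    obtain ⟨Θ, hΘ⟩ : ∃ Θ : 𝓢(ℝ, ℂ), Θ = a2.toSchwartzMap a1 := ⟨_, rfl⟩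
    obtain ⟨F, hF⟩ : ∃ F : 𝓢(ℝ, ℂ), F = b2.toSchwartzMap b1 := ⟨_, rfl⟩
    have hΘa : (Θ : ℝ → ℂ) = fun ξ => (lowPass (s * ξ) - lowPass (s⁻¹ * ξ)) * 𝓕 θ ξ := by
      rw [hΘ]; rfl
    have hFa : (F : ℝ → ℂ) = fun ξ => (lowPass (s * ξ) - lowPass (s⁻¹ * ξ)) *
      (-(Complex.I * ((SignType.sign ξ : ℝ) : ℂ)) * 𝓕 θ ξ) := by
      rw [hF]; rfl
    have e1 : ∀ t, (𝓕⁻ Θ : 𝓢(ℝ, ℂ)) t = lowAvg s θ t - lowAvg s⁻¹ θ t := fun t => by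
      rw [SchwartzMap.fourierInv_coe, hΘa, fourierInv_lowPass_sub_mul hs hθi]
    have e2 : ∀ t, halfDeriv (𝓕⁻ F : 𝓢(ℝ, ℂ)) t = lowAvg s B t - lowAvg s⁻¹ B t := fun t => by
      rw [halfDeriv, ← SchwartzMap.fourier_coe, FourierTransform.fourier_fourierInv_eq, hFa,
        ← fourierInv_lowPass_sub_mul hs hBi]
      refine congrFun (congrArg _ (funext fun ξ => ?_)) t
      rw [hBθ]; ring
    have e3 := H.integral_eq (θ := 𝓕⁻ Θ) (φ := 𝓕⁻ F) fun ξ => by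
      rw [FourierTransform.fourier_fourierInv_eq, FourierTransform.fourier_fourierInv_eq, hFa, hΘa]
      ring
    rw [← hv.integral_eq] at e3
    simp only [e1, e2] at e3
    refine ⟨?_, ?_, e3⟩
    · simp only [← e1]
      exact (𝓕⁻ Θ : 𝓢(ℝ, ℂ)).continuous.aestronglyMeasurable
    · simp only [← fourierInv_lowPass_sub_mul hs hBi]
      have : Continuous (𝓕⁻ (fun ξ => (lowPass (s * ξ) - lowPass (s⁻¹ * ξ)) * 𝓕 B ξ) : ℝ → ℂ) := by
        have e4 : (fun ξ => (lowPass (s * ξ) - lowPass (s⁻¹ * ξ)) * 𝓕 B ξ) =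
            fun ξ : ℝ => (√|2 * Real.pi * ξ| : ℂ) * F ξ := by
          ext ξ
          rw [hBθ, hFa]; ring
        rw [e4]
        have hi : Integrable fun ξ : ℝ => (√|2 * Real.pi * ξ| : ℂ) * F ξ := by
          refine Continuous.integrable_of_hasCompactSupport ?_ ?_
          · have := F.continuous
            fun_prop
          · rw [hFa]; exact b2.mul_left
        have h5 := VectorFourier.fourierIntegral_continuous (μ := (volume : Measure ℝ))
          Real.continuous_fourierChar (L := -innerₗ ℝ) (by
            simp only [LinearMap.neg_apply]; fun_prop) hi
        exact h5
      exact this.aestronglyMeasurable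
  have hconj : ∀ {a : ℝ → ℂ}, AEStronglyMeasurable a → AEStronglyMeasurable fun t => conj (a t) :=
    fun ha => Complex.continuous_conj.comp_aestronglyMeasurable ha
  have hnear : ∀ᶠ s : ℝ in 𝓝[>] 0, 0 < s ∧ s < 1 := by
    filter_upwards [Ioo_mem_nhdsGT (zero_lt_one' ℝ)] with s hs using hs
  have hlim : ∀ {f : ℝ → ℂ}, Continuous f → Integrable f → ∀ {C : ℝ}, (∀ y, ‖f y‖ ≤ C) → ∀ t,
      Tendsto (fun s => conj (lowAvg s f t - lowAvg s⁻¹ f t)) (𝓝[>] 0) (𝓝 (conj (f t))) := by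
    intro f hf hfi C hfC t
    have h1 := (tendsto_lowAvg_zero hf hfC t).sub
      ((tendsto_lowAvg_atTop hfi t).comp tendsto_inv_nhdsGT_zero)
    rw [sub_zero] at h1
    exact (Complex.continuous_conj.tendsto _).comp h1
  -- As s → 0 the low-pass at scale s tends to θ and the one at scale s⁻¹ to zero. The integrands
  -- are dominated by |h| times a multiple of (1 + |t|)⁻¹, a product of L² functions.
  have L1 : Tendsto (fun s => ∫ t, h t * conj (lowAvg s θ t - lowAvg s⁻¹ θ t)) (𝓝[>] 0)
      (𝓝 (∫ t, h t * conj (θ t))) := by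
    refine tendsto_integral_filter_of_dominated_convergence
      (fun t => ‖h t‖ * (2 * D₁ * (1 + |t|)⁻¹)) ?_ ?_ ?_ ?_
    · filter_upwards [hnear] with s hs
      exact hh.aestronglyMeasurable.mul (hconj (step s hs.1 hs.2).1)
    · filter_upwards [hnear] with s hs
      refine ae_of_all _ fun t => ?_
      rw [norm_mul, RCLike.norm_conj]
      refine mul_le_mul_of_nonneg_left ((norm_sub_le _ _).trans ?_) (norm_nonneg _)
      linarith [hθs s t hs.1, hθs s⁻¹ t (inv_pos.2 hs.1)]
    · exact hh.norm.integrable_mul (memLp_inv_one_add_abs.const_mul (2 * D₁))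
    · exact ae_of_all _ fun t => (hlim hθ hθi (fun y => (hθb y).trans (mul_le_of_le_one_right hc
        (inv_le_one_of_one_le₀ (by linarith [abs_nonneg y])))) t).const_mul _
  -- Here only weighted integrability of v is at hand, so the full decay |t|^(-3/2), uniform in s,
  -- is needed.
  have L2 : Tendsto (fun s => ∫ t, v t * conj (lowAvg s B t - lowAvg s⁻¹ B t)) (𝓝[>] 0)
      (𝓝 (∫ t, v t * conj (B t))) := by
    refine tendsto_integral_filter_of_dominated_convergence
      (fun t => (2 * D₂) * (‖v t‖ * decay t)) ?_ ?_ ?_ ?_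
    · filter_upwards [hnear] with s hs
      exact hvm.mul (hconj (step s hs.1 hs.2).2.1)
    · filter_upwards [hnear] with s hs
      refine ae_of_all _ fun t => ?_
      rw [norm_mul, RCLike.norm_conj, mul_left_comm]
      refine mul_le_mul_of_nonneg_left ((norm_sub_le _ _).trans ?_) (norm_nonneg _)
      linarith [hBs s t hs.1, hBs s⁻¹ t (inv_pos.2 hs.1)]
    · exact hvd.const_mul _
    · exact ae_of_all _ fun t => (hlim hB hBi (fun y => (hBb y).trans (mul_le_of_le_one_right hC
        (decay_le_one y))) t).const_mul _
  refine tendsto_nhds_unique L1 (L2.congr' ?_)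
  filter_upwards [hnear] with s hs
  exact (step s hs.1 hs.2).2.2.symm

end HilbertPairing

/-! ### Half-order derivatives on the line and their dual operators. -/

section HalfDerivative

lemma integrable_decay : Integrable decay := by
  have := integrable_one_add_norm (E := ℝ) (μ := volume) (r := 3 / 2) (by norm_num)
  exact this

lemma decay_le_inv (t : ℝ) : decay t ≤ (1 + |t|)⁻¹ := by
  rw [← Real.rpow_neg_one]
  exact Real.rpow_le_rpow_of_exponent_le (by linarith [abs_nonneg t]) (by norm_num)

lemma exists_norm_le_decay {f : ℝ → ℂ} (hf : Continuous f) (hc : HasCompactSupport f) :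
    ∃ C : ℝ, ∀ t, ‖f t‖ ≤ C * decay t := by
  obtain ⟨C, hC⟩ := (hc.mul_left (f := fun t => ((decay t)⁻¹ : ℂ))).exists_bound_of_continuous
    ((Continuous.inv₀ (by have := continuous_decay; fun_prop)
      fun t => by exact_mod_cast (decay_pos t).ne').mul hf)
  refine ⟨C, fun t => ?_⟩
  have h := hC t
  rw [Pi.mul_apply, norm_mul, norm_inv, Complex.norm_real, Real.norm_of_nonneg (decay_pos t).le, ← div_eq_inv_mul,
    div_le_iff₀ (decay_pos t)] at h
  exact h

/-- The case of a zero-dimensional space in the statements about space-time. -/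
lemma fracDiff_regularity {σ : ℝ} (hσ : |σ| = 1) {ψ : ℝ → ℂ} (hψ : ContDiff ℝ ∞ ψ)
    (hc : HasCompactSupport ψ) :
    Continuous (fracDiff σ ψ) ∧ ∃ C : ℝ, ∀ t, ‖fracDiff σ ψ t‖ ≤ C * decay t := by
  have hc' : HasCompactSupport fun p : EuclideanSpace ℝ (Fin 0) × ℝ => ψ p.2 :=
    HasCompactSupport.intro (subsingleton_univ.isCompact.prod hc.isCompact) fun p hp =>
      image_eq_zero_of_notMem_tsupport fun h => hp ⟨mem_univ _, h⟩
  have hψ' : ContDiff ℝ ∞ fun p : EuclideanSpace ℝ (Fin 0) × ℝ => ψ p.2 := hψ.comp contDiff_snd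
  refine ⟨(continuous_timeFrac hσ hc' hψ').comp
    (by fun_prop : Continuous fun t : ℝ => ((0 : EuclideanSpace ℝ (Fin 0)), t)), ?_⟩
  obtain ⟨C, -, hC⟩ := exists_norm_timeFrac_le hσ hc' hψ'
  exact ⟨C, fun t => hC (0, t)⟩

lemma fourierInv_linear {f g : ℝ → ℂ} (hf : Integrable f) (hg : Integrable g) (a b : ℂ) (t : ℝ) :
    a * 𝓕⁻ f t + b * 𝓕⁻ g t = 𝓕⁻ (fun ξ => a * f ξ + b * g ξ) t := by
  have h := fun {f : ℝ → ℂ} (hf : Integrable f) => (Real.fourierIntegral_convergent_iff (μ := volume)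
    (-t)).2 hf
  have hf' := (h hf).const_mul a
  have hg' := (h hg).const_mul b
  simp only [Real.fourierInv_eq, ← integral_const_mul]
  simp only [inner_neg_right, neg_neg] at hf' hg'
  rw [← integral_add hf' hg']
  simp only [Circle.smul_def, smul_eq_mul]
  congr 1; ext ξ; ring

/-- The even part of the symbol is that of D^{1/2}; the odd part below is that of H D^{1/2}. -/
lemma fracSymbol_add_neg (y : ℝ) : fracSymbol y + fracSymbol (-y) = 2 * cosConst * (√|y| : ℂ) := by
  rcases lt_trichotomy y 0 with hy | rfl | hy
  · rw [fracSymbol_of_neg hy, fracSymbol_of_pos (neg_pos.2 hy), abs_of_neg hy]; ring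
  · simp [fracSymbol_zero]
  · rw [fracSymbol_of_pos hy, fracSymbol_of_neg (neg_neg_iff_pos.2 hy), abs_of_pos hy, neg_neg]; ring

lemma fracSymbol_sub_neg (y : ℝ) : fracSymbol y - fracSymbol (-y) =
    2 * sinConst * (Complex.I * ((SignType.sign y : ℝ) : ℂ) * (√|y| : ℂ)) := by
  rcases lt_trichotomy y 0 with hy | rfl | hy
  · rw [fracSymbol_of_neg hy, fracSymbol_of_pos (neg_pos.2 hy), abs_of_neg hy, sign_neg hy]
    simp; ring
  · simp [fracSymbol_zero]
  · rw [fracSymbol_of_pos hy, fracSymbol_of_neg (neg_neg_iff_pos.2 hy), abs_of_pos hy, neg_neg,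
      sign_pos hy]
    simp; ring

/-- The Hilbert transform of the half-order derivative, up to sign. -/
def dualHalfDeriv (ψ : ℝ → ℂ) (t : ℝ) : ℂ :=
  (-(2 * sinConst : ℂ)⁻¹) * fracDiff 1 ψ t + (2 * sinConst : ℂ)⁻¹ * fracDiff (-1) ψ t

lemma fourierInv_fracSymbol_comb (ψ : 𝓢(ℝ, ℂ)) (a b : ℂ) (t : ℝ) :
    a * fracDiff 1 ψ t + b * fracDiff (-1) ψ t = 𝓕⁻ (fun ξ : ℝ => (a * fracSymbol (2 * Real.pi * ξ) +
      b * fracSymbol (-(2 * Real.pi * ξ))) * 𝓕 (ψ : ℝ → ℂ) ξ) t := by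
  rw [fracDiff_eq_fourierInv, fracDiff_eq_fourierInv, fourierInv_linear
    (integrable_fracSymbol_mul 1 ψ) (integrable_fracSymbol_mul (-1) ψ)]
  refine congrFun (congrArg _ (funext fun ξ => ?_)) t
  rw [mul_one, mul_neg_one, neg_mul]; ring

lemma halfDeriv_eq (ψ : 𝓢(ℝ, ℂ)) (t : ℝ) : halfDeriv ψ t =
    (2 * cosConst : ℂ)⁻¹ * fracDiff 1 ψ t + (2 * cosConst : ℂ)⁻¹ * fracDiff (-1) ψ t := by
  have hc : (cosConst : ℂ) ≠ 0 := by exact_mod_cast cosConst_pos.ne'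
  rw [fourierInv_fracSymbol_comb, halfDeriv]
  refine congrFun (congrArg _ (funext fun ξ => ?_)) t
  rw [← mul_add, fracSymbol_add_neg]
  field_simp

/-- The kernel representation supplies continuity and the decay |t|^(-3/2), hence integrability.
With the integrability of the transform this justifies Fourier inversion although the symbol is not
smooth at zero. -/
lemma fourier_fracDiff_comb {ψ : ℝ → ℂ} (hψ : ContDiff ℝ ∞ ψ) (hc : HasCompactSupport ψ) (a b : ℂ) :
    Continuous (fun t => a * fracDiff 1 ψ t + b * fracDiff (-1) ψ t) ∧
    Integrable (fun t => a * fracDiff 1 ψ t + b * fracDiff (-1) ψ t) ∧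
    (∃ C : ℝ, ∀ t, ‖a * fracDiff 1 ψ t + b * fracDiff (-1) ψ t‖ ≤ C * decay t) ∧
    𝓕 (fun t => a * fracDiff 1 ψ t + b * fracDiff (-1) ψ t) = fun ξ : ℝ =>
      (a * fracSymbol (2 * Real.pi * ξ) + b * fracSymbol (-(2 * Real.pi * ξ))) * 𝓕 ψ ξ := by
  obtain ⟨c1, C1, h1⟩ := fracDiff_regularity (σ := 1) (by simp) hψ hc
  obtain ⟨c2, C2, h2⟩ := fracDiff_regularity (σ := -1) (by simp) hψ hc
  have hcont : Continuous fun t => a * fracDiff 1 ψ t + b * fracDiff (-1) ψ t := by fun_prop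
  have hb : ∀ t, ‖a * fracDiff 1 ψ t + b * fracDiff (-1) ψ t‖ ≤ (‖a‖ * C1 + ‖b‖ * C2) * decay t := by
    intro t
    refine (norm_add_le _ _).trans ?_
    rw [norm_mul, norm_mul, add_mul, mul_assoc, mul_assoc]
    exact add_le_add (mul_le_mul_of_nonneg_left (h1 t) (norm_nonneg _))
      (mul_le_mul_of_nonneg_left (h2 t) (norm_nonneg _))
  have hi : Integrable fun t => a * fracDiff 1 ψ t + b * fracDiff (-1) ψ t :=
    (integrable_decay.const_mul _).mono' hcont.aestronglyMeasurable (ae_of_all _ hb)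
  refine ⟨hcont, hi, ⟨_, hb⟩, ?_⟩
  obtain ⟨Ψ, hΨ⟩ : ∃ Ψ : 𝓢(ℝ, ℂ), (Ψ : ℝ → ℂ) = ψ := ⟨hc.toSchwartzMap hψ, rfl⟩
  rw [← hΨ] at hi ⊢
  have e : (fun t => a * fracDiff 1 Ψ t + b * fracDiff (-1) Ψ t) = 𝓕⁻ (fun ξ : ℝ =>
    (a * fracSymbol (2 * Real.pi * ξ) + b * fracSymbol (-(2 * Real.pi * ξ))) * 𝓕 (Ψ : ℝ → ℂ) ξ) :=
    funext fun t => fourierInv_fracSymbol_comb Ψ a b t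
  rw [e]
  have i1 := (integrable_fracSymbol_mul 1 Ψ).const_mul a
  have i2 := (integrable_fracSymbol_mul (-1) Ψ).const_mul b
  have e3 : (fun ξ : ℝ => (a * fracSymbol (2 * Real.pi * ξ) + b * fracSymbol (-(2 * Real.pi * ξ))) *
      𝓕 (Ψ : ℝ → ℂ) ξ) = fun ξ : ℝ => a * (fracSymbol (2 * Real.pi * 1 * ξ) * 𝓕 (Ψ : ℝ → ℂ) ξ) +
        b * (fracSymbol (2 * Real.pi * (-1) * ξ) * 𝓕 (Ψ : ℝ → ℂ) ξ) := by
    ext ξ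
    rw [mul_one, mul_neg_one, neg_mul]; ring
  refine Continuous.fourier_fourierInv_eq ?_ ?_ ?_
  · have h3 := continuous_fracSymbol
    have h4 : Continuous (𝓕 (Ψ : ℝ → ℂ)) := by
      rw [← SchwartzMap.fourier_coe]; exact (𝓕 Ψ).continuous
    fun_prop
  · rw [e3]; exact i1.add i2
  · have e4 : 𝓕 (fun ξ : ℝ =>
      (a * fracSymbol (2 * Real.pi * ξ) + b * fracSymbol (-(2 * Real.pi * ξ))) * 𝓕 (Ψ : ℝ → ℂ) ξ) =
        fun t => a * fracDiff 1 Ψ (-t) + b * fracDiff (-1) Ψ (-t) := by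
      ext t
      rw [fourierInv_fracSymbol_comb, Real.fourierInv_eq_fourier_neg, neg_neg]
    rw [e4]
    exact hi.comp_neg

/-- Off its support, a fractional difference of a nonnegative bump has a fixed sign, so the two
directions cannot cancel. The direction that looks from t towards the origin meets the whole bump at
steps s < 1 + |t|, which bounds the kernel below. -/
lemma neg_fracDiff_bump {σ : ℝ} (hσ : |σ| = 1) {t : ℝ} (ht : 2 ≤ |t|) (φ : ContDiffBump (0 : ℝ))
    (hφ : φ.rOut = 1) :
    ∃ x : ℝ, fracDiff σ (fun t => (φ t : ℂ)) t = -(x : ℂ) ∧ 0 ≤ x ∧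
      (σ * t = |t| → decay t * ∫ s, φ s ≤ x) := by
  have hz : ∀ {y : ℝ}, 1 ≤ |y| → φ y = 0 := fun {y} hy => φ.zero_of_le_dist (by simpa [hφ] using hy)
  have hb : ∀ s, 0 < s → ‖φ (t - σ * s)‖ ≤ 1 * min 1 s := fun s hs => by
    rw [Real.norm_of_nonneg φ.nonneg, one_mul]
    rcases le_total 1 s with h | h
    · rw [min_eq_left h]; exact φ.le_one
    · rw [hz]
      · exact le_min zero_le_one hs.le
      · have := abs_sub_abs_le_abs_sub t (σ * s)
        rw [abs_mul, hσ, abs_of_pos hs] at this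
        linarith
  have hcont : Continuous fun s : ℝ => φ (t - σ * s) := φ.continuous.comp (by fun_prop)
  have hint : IntegrableOn (fun s => ker s • φ (t - σ * s)) (Ioi 0) :=
    integrableOn_ker_smul hcont.aestronglyMeasurable hb
  refine ⟨∫ s in Ioi (0 : ℝ), ker s • φ (t - σ * s), ?_, ?_, fun hσt => ?_⟩
  · rw [fracDiff, ← integral_complex_ofReal, ← integral_neg]
    refine integral_congr_ae (ae_of_all _ fun s => ?_)
    simp [hz (by linarith : 1 ≤ |t|)]
  · exact setIntegral_nonneg measurableSet_Ioi fun s hs =>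
      smul_nonneg (ker_pos hs).le φ.nonneg
  · have hσ0 : σ ≠ 0 := by rintro rfl; simp at hσ
    have e1 : ∫ s, φ s = ∫ s in Ioi (0 : ℝ), φ (t - σ * s) := by
      rw [setIntegral_eq_integral_of_forall_compl_eq_zero]
      · have h1 := Measure.integral_comp_mul_left (fun s => φ (t - s)) σ
        rw [abs_inv, hσ, inv_one, one_smul] at h1
        rw [h1, integral_sub_left_eq_self (fun s => φ s)]
      · intro s hs
        refine hz ?_
        have hs' : s ≤ 0 := not_lt.1 hs
        have h2 : |t - σ * s| = |σ| * |t - σ * s| := by rw [hσ, one_mul]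
        have h3 : σ * σ = 1 := by rw [← abs_mul_abs_self, hσ, one_mul]
        rw [h2, ← abs_mul, mul_sub, hσt, ← mul_assoc, h3, one_mul]
        exact le_abs.2 (Or.inl (by linarith))
    rw [e1, ← integral_const_mul]
    have hi : IntegrableOn (fun s => φ (t - σ * s)) (Ioi 0) := by
      refine (Continuous.integrable_of_hasCompactSupport hcont ?_).integrableOn
      refine HasCompactSupport.intro (isCompact_closedBall (0 : ℝ) (|t| + 1)) fun s hs => hz ?_
      have := abs_sub_abs_le_abs_sub (σ * s) t
      rw [abs_mul, hσ, abs_sub_comm] at this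
      rw [mem_closedBall_zero_iff, Real.norm_eq_abs, not_le] at hs
      linarith
    refine setIntegral_mono_on (hi.const_mul _) hint measurableSet_Ioi fun s hs => ?_
    rw [smul_eq_mul]
    by_cases h0 : |t - σ * s| < 1
    · refine mul_le_mul_of_nonneg_right (ker_le_ker hs ?_) φ.nonneg
      have h2 : |t - σ * s| = |σ| * |t - σ * s| := by rw [hσ, one_mul]
      have h3 : σ * σ = 1 := by rw [← abs_mul_abs_self, hσ, one_mul]
      rw [h2, ← abs_mul, mul_sub, hσt, ← mul_assoc, h3, one_mul, abs_lt] at h0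
      linarith
    · rw [hz (not_lt.1 h0), mul_zero, mul_zero]

/-- Functions with a half-order derivative satisfy a weighted integrability condition. -/
theorem IsHalfDeriv.integrable_mul_decay {v g : ℝ → ℂ} (hv : IsHalfDeriv v g) :
    Integrable fun t => ‖v t‖ * decay t := by
  obtain ⟨φ, hφ⟩ : ∃ φ : ContDiffBump (0 : ℝ), φ.rOut = 1 :=
    ⟨⟨1 / 2, 1, by norm_num, by norm_num⟩, rfl⟩
  have hI : 0 < ∫ s, φ s := φ.integral_pos
  have hc0 := cosConst_pos
  obtain ⟨Ψ, hΨ⟩ : ∃ Ψ : 𝓢(ℝ, ℂ), (Ψ : ℝ → ℂ) = fun t => (φ t : ℂ) :=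
    ⟨(φ.hasCompactSupport.comp_left (g := ((↑) : ℝ → ℂ)) Complex.ofReal_zero).toSchwartzMap
      (Complex.ofRealCLM.contDiff.comp φ.contDiff), rfl⟩
  -- The half-order derivative of one bump is as large as the weight, so the integrability required
  -- by the definition, for this single test function, already gives the weighted integrability.
  have hlow : ∀ t, 2 ≤ |t| → decay t * (∫ s, φ s) ≤ (2 * cosConst) * ‖halfDeriv Ψ t‖ := by
    intro t ht
    obtain ⟨x, h1, h2, h3⟩ := neg_fracDiff_bump (σ := 1) (by simp) ht φ hφ
    obtain ⟨y, h4, h5, h6⟩ := neg_fracDiff_bump (σ := -1) (by simp) ht φ hφ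
    have e : halfDeriv Ψ t = ((-((2 * cosConst)⁻¹ * (x + y)) : ℝ) : ℂ) := by
      rw [halfDeriv_eq, hΨ, h1, h4]; push_cast; ring
    rw [e, Complex.norm_real, norm_neg, Real.norm_of_nonneg (by positivity), ← mul_assoc,
      mul_inv_cancel₀ (by positivity), one_mul]
    rcases abs_cases t with ⟨h, -⟩ | ⟨h, -⟩
    · linarith [h3 (by rw [h, one_mul])]
    · linarith [h6 (by rw [h]; ring)]
  have hloc := hv.memL2Loc.locallyIntegrable_real
  have h1 := (hv.integrable Ψ).norm.const_mul ((2 * cosConst) / ∫ s, φ s)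
  have h2 : Integrable ((Icc (-2 : ℝ) 2).indicator fun t => ‖v t‖) :=
    (integrable_indicator_iff measurableSet_Icc).2 (hloc.integrableOn_isCompact isCompact_Icc).norm
  refine (h1.add h2).mono' (hloc.aestronglyMeasurable.norm.mul
    continuous_decay.aestronglyMeasurable) (ae_of_all _ fun t => ?_)
  rw [Real.norm_of_nonneg (mul_nonneg (norm_nonneg _) (decay_pos t).le), Pi.add_apply, norm_mul]
  by_cases ht : t ∈ Icc (-2 : ℝ) 2
  · rw [indicator_of_mem ht]
    have : ‖v t‖ * decay t ≤ ‖v t‖ := mul_le_of_le_one_right (norm_nonneg _) (decay_le_one t)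
    have : 0 ≤ 2 * cosConst / (∫ s, φ s) * (‖v t‖ * ‖halfDeriv Ψ t‖) := by positivity
    linarith
  · rw [indicator_of_notMem ht, add_zero]
    have ht' : 2 ≤ |t| := by
      by_contra! h
      exact ht (abs_le.1 h.le)
    rw [div_mul_eq_mul_div, le_div_iff₀ hI]
    nlinarith [mul_le_mul_of_nonneg_left (hlow t ht') (norm_nonneg (v t))]

lemma fracDiff_conj (σ : ℝ) (ψ : ℝ → ℂ) (t : ℝ) :
    fracDiff σ (fun t => conj (ψ t)) t = conj (fracDiff σ ψ t) := by
  rw [fracDiff, fracDiff, ← integral_conj]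
  simp

/-- The general duality with θ = ψ and B = `dualHalfDeriv ψ`, whose symbol is -i sgn ξ |2πξ|^(1/2).
-/
lemma IsHalfDeriv.integral_conj_dualHalfDeriv {v g h : ℝ → ℂ} (hv : IsHalfDeriv v g)
    (H : IsHilbertTransform g h) {ψ : ℝ → ℂ} (hψ : ContDiff ℝ ∞ ψ) (hc : HasCompactSupport ψ) :
    ∫ t, h t * conj (ψ t) = ∫ t, v t * conj (dualHalfDeriv ψ t) := by
  have hs : (sinConst : ℂ) ≠ 0 := by exact_mod_cast sinConst_pos.ne'
  obtain ⟨h1, h2, ⟨C, h3⟩, h4⟩ := fourier_fracDiff_comb hψ hc (-(2 * sinConst : ℂ)⁻¹)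
    (2 * sinConst : ℂ)⁻¹
  obtain ⟨c, hc'⟩ := exists_norm_le_decay hψ.continuous hc
  have hc0 : 0 ≤ c := nonneg_of_mul_nonneg_left ((norm_nonneg _).trans (hc' 0)) (decay_pos 0)
  refine hv.integral_hilbert_eq H hv.integrable_mul_decay hψ.continuous
    (hψ.continuous.integrable_of_hasCompactSupport hc) (c := c)
    (fun t => (hc' t).trans (mul_le_mul_of_nonneg_left (decay_le_inv t) hc0)) h1 h2 h3
    (fun ξ _ => ?_) fun ξ => ?_
  · have := (𝓕 (hc.toSchwartzMap hψ)).smooth ⊤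
    rw [SchwartzMap.fourier_coe] at this
    exact this.contDiffAt
  · have := congrFun h4 ξ
    refine this.trans ?_
    have e := fracSymbol_sub_neg (2 * Real.pi * ξ)
    have e2 : SignType.sign (2 * Real.pi * ξ) = SignType.sign ξ := by
      rw [sign_mul, sign_pos Real.two_pi_pos, one_mul]
    rw [e2, sub_eq_iff_eq_add] at e
    rw [e]
    field_simp
    ring

/-- The combinations of the half-order derivative and of its Hilbert transform that are dual to the
one-sided fractional difference operators. -/
theorem IsHalfDeriv.integral_mul_fracDiff {v g h : ℝ → ℂ} (hv : IsHalfDeriv v g)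
    (H : IsHilbertTransform g h) {ψ : ℝ → ℂ} (hψ : ContDiff ℝ ∞ ψ) (hc : HasCompactSupport ψ)
    {σ : ℝ} (hσ : σ = 1 ∨ σ = -1) :
    ∫ t, (cosConst * g t - σ * sinConst * h t) * ψ t = ∫ t, v t * fracDiff σ ψ t := by
  obtain ⟨θ, hθ⟩ : ∃ θ : ℝ → ℂ, θ = fun t => conj (ψ t) := ⟨_, rfl⟩
  have hψθ : ψ = fun t => conj (θ t) := by ext t; rw [hθ]; simp
  have hθs : ContDiff ℝ ∞ θ := by rw [hθ]; exact Complex.conjCLE.contDiff.comp hψ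
  have hθc : HasCompactSupport θ := by rw [hθ]; exact hc.comp_left (g := conj) (map_zero _)
  have hcc : (cosConst : ℂ) ≠ 0 := by exact_mod_cast cosConst_pos.ne'
  have hsc : (sinConst : ℂ) ≠ 0 := by exact_mod_cast sinConst_pos.ne'
  obtain ⟨Θ, hΘ⟩ : ∃ Θ : 𝓢(ℝ, ℂ), (Θ : ℝ → ℂ) = θ := ⟨hθc.toSchwartzMap hθs, rfl⟩
  have e1 := hv.integral_eq Θ
  have e2 := hv.integral_conj_dualHalfDeriv H hθs hθc
  obtain ⟨-, hh, -⟩ := id H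
  have hθ2 : MemLp (fun t => conj (θ t)) 2 := by
    rw [← hψθ]; exact hψ.continuous.memLp_of_hasCompactSupport hc
  have i1 : Integrable fun t => g t * conj (θ t) := hv.memL2.integrable_mul hθ2
  have i2 : Integrable fun t => h t * conj (θ t) := hh.integrable_mul hθ2
  have hvd := hv.integrable_mul_decay
  have hvm := hv.memL2Loc.locallyIntegrable_real.aestronglyMeasurable
  have key : ∀ {f : ℝ → ℂ}, Continuous f → (∃ C : ℝ, ∀ t, ‖f t‖ ≤ C * decay t) →
      Integrable fun t => v t * conj (f t) := by
    rintro f hf ⟨C, hC⟩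
    refine (hvd.const_mul C).mono' (hvm.mul
      (Complex.continuous_conj.comp hf).aestronglyMeasurable) (ae_of_all _ fun t => ?_)
    rw [norm_mul, RCLike.norm_conj, mul_left_comm]
    exact mul_le_mul_of_nonneg_left (hC t) (norm_nonneg _)
  have hD : halfDeriv Θ = fun t => (2 * cosConst : ℂ)⁻¹ * fracDiff 1 θ t +
      (2 * cosConst : ℂ)⁻¹ * fracDiff (-1) θ t := by
    ext t; rw [halfDeriv_eq, hΘ]
  obtain ⟨a1, -, a2, -⟩ := fourier_fracDiff_comb hθs hθc (2 * cosConst : ℂ)⁻¹ (2 * cosConst : ℂ)⁻¹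
  obtain ⟨b1, -, b2, -⟩ := fourier_fracDiff_comb hθs hθc (-(2 * sinConst : ℂ)⁻¹)
    (2 * sinConst : ℂ)⁻¹
  have j1 := key a1 a2
  have j2 := key b1 b2
  rw [hD, hΘ] at e1
  have l1 : ∫ t, (cosConst * g t - σ * sinConst * h t) * ψ t =
      cosConst * (∫ t, g t * conj (θ t)) - σ * sinConst * ∫ t, h t * conj (θ t) := by
    rw [← integral_const_mul, ← integral_const_mul, ← integral_sub (i1.const_mul _) (i2.const_mul _),
      hψθ]
    congr 1; ext t; ring
  rw [l1, e2, ← e1, ← integral_const_mul, ← integral_const_mul]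
  simp only [dualHalfDeriv]
  rw [← integral_sub (j1.const_mul _) (j2.const_mul _), hψθ]
  congr 1; ext t
  rw [fracDiff_conj]
  simp only [map_add, map_mul, map_neg, map_inv₀, Complex.conj_ofReal, map_ofNat]
  -- The constants cancel: half the sum of the two differences, plus or minus half their difference,
  -- is the single difference in the direction σ.
  rcases hσ with rfl | rfl
  · push_cast; field_simp; ring
  · push_cast; field_simp; ring

/-- The half-order derivative composed with the Hilbert transform and the half-order derivative is
the derivative. -/
theorem IsHalfDeriv.integral_hilbert_mul_halfDeriv {v g h : ℝ → ℂ} (hv : IsHalfDeriv v g)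
    (H : IsHilbertTransform g h) {φ : ℝ → ℂ} (hφ : ContDiff ℝ ∞ φ) (hc : HasCompactSupport φ) :
    ∫ t, h t * conj (halfDeriv φ t) = -∫ t, v t * conj (deriv φ t) := by
  have hcc : (cosConst : ℂ) ≠ 0 := by exact_mod_cast cosConst_pos.ne'
  obtain ⟨Φ, hΦ⟩ : ∃ Φ : 𝓢(ℝ, ℂ), (Φ : ℝ → ℂ) = φ := ⟨hc.toSchwartzMap hφ, rfl⟩
  obtain ⟨a1, a2, ⟨C, a3⟩, a4⟩ := fourier_fracDiff_comb hφ hc (2 * cosConst : ℂ)⁻¹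
    (2 * cosConst : ℂ)⁻¹
  have hD : (fun t => (2 * cosConst : ℂ)⁻¹ * fracDiff 1 φ t + (2 * cosConst : ℂ)⁻¹ *
      fracDiff (-1) φ t) = halfDeriv φ := by
    ext t; rw [← hΦ, halfDeriv_eq]
  have hC : 0 ≤ C := nonneg_of_mul_nonneg_left ((norm_nonneg _).trans (a3 0)) (decay_pos 0)
  have a3' : ∀ t, ‖halfDeriv φ t‖ ≤ C * (1 + |t|)⁻¹ := fun t => by
    rw [← hD]
    exact (a3 t).trans (mul_le_mul_of_nonneg_left (decay_le_inv t) hC)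
  rw [hD] at a1 a2 a4
  have hF : ∀ ξ : ℝ, 𝓕 (halfDeriv φ) ξ = (√|2 * Real.pi * ξ| : ℂ) * 𝓕 φ ξ := fun ξ => by
    have h1 := congrFun a4 ξ
    rw [← mul_add, fracSymbol_add_neg] at h1
    rw [h1]
    field_simp
  have hd : Continuous (deriv φ) := hφ.continuous_deriv (by simp)
  have hdc : HasCompactSupport (deriv φ) := hc.deriv
  have hdi : Integrable (deriv φ) := hd.integrable_of_hasCompactSupport hdc
  obtain ⟨c, hcb⟩ := exists_norm_le_decay hd.neg hdc.neg
  have hFs : ContDiff ℝ ∞ (𝓕 φ) := by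
    have := (𝓕 Φ).smooth ⊤
    rwa [SchwartzMap.fourier_coe, hΦ] at this
  have hFd : ∀ ξ : ℝ, 𝓕 (fun t => -deriv φ t) ξ = -((2 * Real.pi * Complex.I * ξ) * 𝓕 φ ξ) := by
    intro ξ
    have h1 := congrFun (Real.fourier_deriv (hφ.continuous.integrable_of_hasCompactSupport hc)
      (hφ.differentiable (by simp)) hdi) ξ
    rw [smul_eq_mul] at h1
    rw [← h1, Real.fourier_eq', Real.fourier_eq', ← integral_neg]
    simp
  -- The duality with θ = D^{1/2}φ and B = -φ'. The symbols match since |τ|^(1/2) · (-i sgn τ) ·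
  -- |τ|^(1/2) = -iτ. The transform of θ is not smooth at zero, which the duality tolerates.
  have key := hv.integral_hilbert_eq H hv.integrable_mul_decay a1 a2 a3' hd.neg hdi.neg hcb
    (fun ξ hξ => ?_) fun ξ => ?_
  · rw [key, ← integral_neg]
    simp
  · rw [funext hF]
    have : (2 * Real.pi * ξ) ≠ 0 := mul_ne_zero Real.two_pi_pos.ne' hξ
    have h1 : ContDiffAt ℝ ∞ (fun ξ : ℝ => √|2 * Real.pi * ξ|) ξ := by
      refine ContDiffAt.sqrt ?_ (abs_ne_zero.2 this)
      exact (contDiffAt_abs this).comp ξ (by fun_prop : ContDiffAt ℝ ∞ (fun ξ : ℝ => 2 * Real.pi * ξ) ξ)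
    exact (Complex.ofRealCLM.contDiff.contDiffAt.comp ξ h1).mul hFs.contDiffAt
  · have h1 : (√|2 * Real.pi * ξ| : ℂ) * (√|2 * Real.pi * ξ| : ℂ) = |2 * Real.pi * ξ| := by
      rw [← Complex.ofReal_mul, Real.mul_self_sqrt (abs_nonneg _)]
    have h2 : ((|2 * Real.pi * ξ| : ℝ) : ℂ) * ((SignType.sign ξ : ℝ) : ℂ) = 2 * Real.pi * ξ := by
      rw [← Complex.ofReal_mul, abs_mul, abs_of_pos Real.two_pi_pos, mul_assoc, abs_mul_sign]
      push_cast; ring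
    rw [hF]
    refine (hFd ξ).trans ?_
    linear_combination (Complex.I * ((SignType.sign ξ : ℝ) : ℂ) * 𝓕 φ ξ) * h1 +
      (Complex.I * 𝓕 φ ξ) * h2

end HalfDerivative

/-! ### The time derivative in the weak formulation on the half-space. -/

section HalfSpace

/-- The space of all `(lam, x)`. -/
abbrev Space (n : ℕ) : Type := ℝ × EuclideanSpace ℝ (Fin n)

variable {n : ℕ}

instance isAddHaarMeasure_volume_space (n : ℕ) :
    (volume : Measure (Space n)).IsAddHaarMeasure :=
  Measure.prod.instIsAddHaarMeasure volume volume

instance isAddHaarMeasure_volume_pt (n : ℕ) :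
    (volume : Measure (Pt n)).IsAddHaarMeasure :=
  haveI : (volume : Measure (EuclideanSpace ℝ (Fin n) × ℝ)).IsAddHaarMeasure :=
    Measure.prod.instIsAddHaarMeasure volume volume
  Measure.prod.instIsAddHaarMeasure volume volume

/-- Plancherel, the multiplier being bounded by 1. -/
lemma IsHilbertTransform.lintegral_sq_le {g h : ℝ → ℂ} (H : IsHilbertTransform g h) :
    ∫⁻ t, ‖h t‖ₑ ^ 2 ≤ ∫⁻ t, ‖g t‖ₑ ^ 2 := by
  obtain ⟨hg, hh, hH⟩ := H
  have h1 : ‖(𝓕 (hh.toLp h) : Lp ℂ 2 (volume : Measure ℝ))‖ ≤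
      ‖(𝓕 (hg.toLp g) : Lp ℂ 2 (volume : Measure ℝ))‖ := by
    refine Lp.norm_le_norm_of_ae_le ?_
    filter_upwards [hH] with ξ h2
    rw [h2, norm_mul]
    refine mul_le_of_le_one_left (norm_nonneg _) ?_
    rcases lt_trichotomy ξ 0 with h | rfl | h
    · simp [sign_neg h]
    · simp
    · simp [sign_pos h]
  rw [Lp.norm_fourier_eq, Lp.norm_fourier_eq, Lp.norm_toLp, Lp.norm_toLp,
    ENNReal.toReal_le_toReal hh.eLpNorm_ne_top hg.eLpNorm_ne_top] at h1
  rw [← eLpNorm_two_sq, ← eLpNorm_two_sq]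
  exact pow_le_pow_left' h1 2

lemma measurePreserving_slab {K : Set (Space n)} (hK : MeasurableSet K) :
    MeasurePreserving (MeasurableEquiv.prodAssoc : Space n × ℝ ≃ᵐ Pt n)
      ((volume.restrict K).prod volume) (volume.restrict {p : Pt n | (p.1, p.2.1) ∈ K}) := by
  have hm : MeasurableSet {p : Pt n | (p.1, p.2.1) ∈ K} :=
    (by fun_prop : Measurable fun p : Pt n => (p.1, p.2.1)) hK
  have h := (volume_preserving_prodAssoc (α₁ := ℝ) (β₁ := EuclideanSpace ℝ (Fin n))
    (γ₁ := ℝ)).restrict_preimage hm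
  have e : (volume.restrict K).prod (volume : Measure ℝ) = volume.restrict
      ((MeasurableEquiv.prodAssoc : Space n × ℝ ≃ᵐ Pt n) ⁻¹'
        {p : Pt n | (p.1, p.2.1) ∈ K}) := by
    have h1 := Measure.prod_restrict (μ := (volume : Measure (Space n)))
      (ν := (volume : Measure ℝ)) K univ
    rw [Measure.restrict_univ] at h1
    rw [h1, Measure.volume_eq_prod (Space n)]
    congr 1
    ext p
    simp [MeasurableEquiv.prodAssoc]
  rw [e]
  exact h

/-- The L² bound on time slices, integrated over K by Tonelli. -/
lemma IsTimeHilbertTransform.memLp {u g h : Pt n → ℂ} (hh : IsTimeHilbertTransform g h)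
    (hg : IsTimeHalfDeriv u g) {K : Set (Space n)}
    (hK : K ⊆ spatialHalfSpace n) (hKc : IsCompact K) :
    MemLp h 2 (volume.restrict {p : Pt n | (p.1, p.2.1) ∈ K}) := by
  have mp := measurePreserving_slab hKc.measurableSet
  have hsub : {p : Pt n | (p.1, p.2.1) ∈ K} ⊆ halfSpace n := fun p hp => hK hp
  have hm : AEStronglyMeasurable h (volume.restrict {p : Pt n | (p.1, p.2.1) ∈ K}) :=
    hh.measurable.mono_measure (Measure.restrict_mono hsub le_rfl)
  have hg2 := hg.memL2 K hK hKc
  have key : ∀ {f : Pt n → ℂ}, AEStronglyMeasurable f (volume.restrict {p : Pt n | (p.1, p.2.1) ∈ K}) →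
      eLpNorm f 2 (volume.restrict {p : Pt n | (p.1, p.2.1) ∈ K}) ^ 2 =
        ∫⁻ X in K, ∫⁻ t, ‖f (X.1, X.2, t)‖ₑ ^ 2 := fun {f} hf => by
    rw [← eLpNorm_comp_measurePreserving hf mp, eLpNorm_two_sq, lintegral_prod]
    · rfl
    · exact ((hf.comp_measurePreserving mp).enorm.pow_const 2)
  refine ⟨hm, ?_⟩
  refine (ENNReal.pow_lt_top_iff.1 (?_ : eLpNorm h 2 _ ^ 2 < ⊤)).resolve_right two_ne_zero
  rw [key hm]
  refine lt_of_le_of_lt (lintegral_mono_ae ?_) ((key hg2.1).symm.trans_lt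
    (ENNReal.pow_lt_top hg2.2))
  filter_upwards [ae_restrict_of_ae_restrict_of_subset hK hh.slices] with X hX
  exact hX.lintegral_sq_le

lemma integrable_mul_of_memL2Loc {f ψ : Pt n → ℂ} (hf : MemL2Loc f (halfSpace n))
    (hψ : Continuous ψ) (hc : HasCompactSupport ψ) (hs : tsupport ψ ⊆ halfSpace n) :
    Integrable fun p => f p * ψ p := by
  have h1 : MemLp ψ 2 (volume.restrict (tsupport ψ)) :=
    (hψ.memLp_of_hasCompactSupport hc).restrict _
  have h2 : IntegrableOn (fun p => f p * ψ p) (tsupport ψ) := (hf _ hs hc.isCompact).integrable_mul h1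
  refine (integrableOn_iff_integrable_of_support_subset fun p hp => ?_).1 h2
  exact subset_tsupport ψ fun h => hp (by simp [h])

/-- The term of the weak formulation with the half-order derivatives is the time derivative. -/
theorem IsTimeHalfDeriv.integral_hilbert_mul_timeHalfDeriv {u g h φ : Pt n → ℂ}
    (hg : IsTimeHalfDeriv u g) (hh : IsTimeHilbertTransform g h) (hφ : IsTestFunction φ) :
    IntegrableOn (fun p => h p * conj (timeHalfDeriv φ p)) (halfSpace n) ∧
    ∫ p in halfSpace n, h p * conj (timeHalfDeriv φ p) =
      -∫ p in halfSpace n, u p * conj (fderiv ℝ φ p (0, 0, 1)) := by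
  obtain ⟨a, ha⟩ : ∃ a : (Space n × ℝ) ≃L[ℝ] Pt n,
    a = ContinuousLinearEquiv.prodAssoc ℝ ℝ (EuclideanSpace ℝ (Fin n)) ℝ := ⟨_, rfl⟩
  have hap : ∀ p, a p = (p.1.1, p.1.2, p.2) := fun p => by rw [ha]; rfl
  obtain ⟨w, hw⟩ : ∃ w : Space n × ℝ → ℂ, w = φ ∘ a := ⟨_, rfl⟩
  have hws : ContDiff ℝ ∞ w := by rw [hw]; exact hφ.smooth.comp a.contDiff
  have hwc : HasCompactSupport w := by
    rw [hw]; exact hφ.compactSupport.comp_homeomorph a.toHomeomorph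
  have hslice : ∀ X : Space n, ContDiff ℝ ∞ (fun s => φ (X.1, X.2, s)) ∧
      HasCompactSupport (fun s => φ (X.1, X.2, s)) := fun X => by
    refine ⟨hφ.smooth.comp (by fun_prop), ?_⟩
    exact HasCompactSupport.intro (hφ.compactSupport.isCompact.image
      (by fun_prop : Continuous fun p : Pt n => p.2.2)) fun s hs =>
        image_eq_zero_of_notMem_tsupport fun h => hs ⟨_, h, rfl⟩
  obtain ⟨K, hK⟩ : ∃ K : Set (Space n),
    K = (fun p : Pt n => (p.1, p.2.1)) '' tsupport φ := ⟨_, rfl⟩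
  have hKc : IsCompact K := by rw [hK]; exact hφ.compactSupport.isCompact.image (by fun_prop)
  have hKs : K ⊆ spatialHalfSpace n := by
    rw [hK]; rintro _ ⟨p, hp, rfl⟩; exact hφ.support_subset hp
  have hz : ∀ p : Pt n, (p.1, p.2.1) ∉ K → ∀ s, φ (p.1, p.2.1, s) = 0 := fun p hp s => by
    refine image_eq_zero_of_notMem_tsupport fun h => hp ?_
    rw [hK]; exact ⟨_, h, rfl⟩
  have hhalf : ∀ p : Space n × ℝ, timeHalfDeriv φ (a p) =
      (2 * cosConst : ℂ)⁻¹ * timeFrac 1 w p + (2 * cosConst : ℂ)⁻¹ * timeFrac (-1) w p := fun p => by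
    have := halfDeriv_eq ((hslice p.1).2.toSchwartzMap (hslice p.1).1) p.2
    rw [hap, timeHalfDeriv]
    refine this.trans ?_
    simp only [timeFrac, hw, Function.comp_def, hap]
    rfl
  have mp := measurePreserving_slab hKc.measurableSet
  have hme : MeasurableEmbedding
      (MeasurableEquiv.prodAssoc : Space n × ℝ ≃ᵐ Pt n) :=
    MeasurableEquiv.measurableEmbedding _
  have hfin : IsFiniteMeasure (volume.restrict K) := ⟨by simpa using hKc.measure_lt_top⟩
  have hma : ∀ p, (MeasurableEquiv.prodAssoc : Space n × ℝ ≃ᵐ Pt n) p = a p :=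
    fun p => by rw [hap]; rfl
  -- The half-order derivative of a test function is not compactly supported in time, but the decay
  -- |t|^(-3/2) puts it in L² of K × ℝ, where it can be paired with h and Fubini is available.
  have hD : MemLp (fun p => timeHalfDeriv φ (a p)) 2 ((volume.restrict K).prod volume) := by
    obtain ⟨C₁, -, h1⟩ := exists_norm_timeFrac_le (σ := 1) (by simp) hwc hws
    obtain ⟨C₂, -, h2⟩ := exists_norm_timeFrac_le (σ := -1) (by simp) hwc hws
    have c1 := continuous_timeFrac (σ := 1) (by simp) hwc hws
    have c2 := continuous_timeFrac (σ := -1) (by simp) hwc hws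
    have hdec : MemLp (fun p : Space n × ℝ => decay p.2) 2
        ((volume.restrict K).prod volume) := by
      refine (memLp_two_iff_integrable_sq
        (continuous_decay.comp continuous_snd).aestronglyMeasurable).2 ?_
      refine Integrable.comp_snd (f := fun t => decay t ^ 2) ?_ _
      refine integrable_decay.mono' (continuous_decay.pow 2).aestronglyMeasurable
        (ae_of_all _ fun t => ?_)
      rw [Real.norm_of_nonneg (sq_nonneg _), sq]
      exact mul_le_of_le_one_left (decay_pos t).le (decay_le_one t)
    simp only [hhalf]
    have hb : ∀ {C : ℝ} {f : Space n × ℝ → ℂ}, Continuous f →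
        (∀ p, ‖f p‖ ≤ C * decay p.2) → MemLp f 2 ((volume.restrict K).prod volume) :=
      fun hf hC => hdec.of_le_mul hf.aestronglyMeasurable (ae_of_all _ fun p => by
        rw [Real.norm_of_nonneg (decay_pos _).le]; exact hC p)
    exact ((hb c1 h1).const_mul _).add ((hb c2 h2).const_mul _)
  have hh2 := (hh.memLp hg hKs hKc).comp_measurePreserving mp
  have hint : Integrable (fun p => h (a p) * conj (timeHalfDeriv φ (a p)))
      ((volume.restrict K).prod volume) := by
    have : MemLp (fun p => conj (timeHalfDeriv φ (a p))) 2 ((volume.restrict K).prod volume) :=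
      hD.star
    have h3 := hh2.integrable_mul this
    simp only [Function.comp_def, hma] at h3
    exact h3
  have hzero : ∀ p : Pt n, (p.1, p.2.1) ∉ K → timeHalfDeriv φ p = 0 := fun p hp => by
    have : (fun s => φ (p.1, p.2.1, s)) = fun _ => 0 := funext fun s => hz p hp s
    simp [timeHalfDeriv, this, halfDeriv, Real.fourier_eq', Real.fourierInv_eq']
  have hdz : ∀ p : Pt n, (p.1, p.2.1) ∉ K → fderiv ℝ φ p (0, 0, 1) = 0 := fun p hp => by
    have : p ∉ tsupport (fderiv ℝ φ) := fun h => hp (by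
      rw [hK]; exact ⟨p, tsupport_fderiv_subset ℝ h, rfl⟩)
    rw [image_eq_zero_of_notMem_tsupport this]; rfl
  have hmS : MeasurableSet {p : Pt n | (p.1, p.2.1) ∈ K} :=
    (by fun_prop : Measurable fun p : Pt n => (p.1, p.2.1)) hKc.measurableSet
  have hmH : MeasurableSet (halfSpace n) := measurableSet_lt measurable_const measurable_fst
  have hred : ∀ f : Pt n → ℂ, (∀ p : Pt n, (p.1, p.2.1) ∉ K → f p = 0) →
      ∫ p in halfSpace n, f p = ∫ p, f (a p) ∂((volume.restrict K).prod volume) := fun f hf => by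
    rw [setIntegral_eq_of_subset_of_forall_sdiff_eq_zero hmH
      (s := {p : Pt n | (p.1, p.2.1) ∈ K}) (fun p hp => hKs hp) fun p hp => hf p hp.2,
      ← mp.integral_comp hme]
    simp only [hma]
  have hintu : Integrable (fun p => u (a p) * conj (fderiv ℝ φ (a p) (0, 0, 1)))
      ((volume.restrict K).prod volume) := by
    have hcc : Continuous fun p => conj (fderiv ℝ φ p (0, 0, 1)) :=
      Complex.continuous_conj.comp ((hφ.smooth.continuous_fderiv (by simp)).clm_apply continuous_const)
    have hcs : HasCompactSupport fun p => fderiv ℝ φ p (0, 0, 1) :=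
      hφ.compactSupport.fderiv_apply (𝕜 := ℝ) _
    have hcs' : HasCompactSupport fun p => conj (fderiv ℝ φ p (0, 0, 1)) :=
      hcs.comp_left (g := conj) (map_zero _)
    have h4 := integrable_mul_of_memL2Loc hg.memL2Loc hcc hcs' (by
      refine (closure_mono fun p hp => ?_).trans
        ((tsupport_fderiv_apply_subset ℝ (0, 0, 1)).trans hφ.support_subset)
      exact fun h0 => hp (by simp [h0]))
    have h5 := (mp.integrable_comp_emb hme).2 (h4.integrableOn (s := {p : Pt n | (p.1, p.2.1) ∈ K}))
    simpa only [Function.comp_def, hma] using h5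
  refine ⟨?_, ?_⟩
  · have h5 : IntegrableOn (fun p => h p * conj (timeHalfDeriv φ p))
        {p : Pt n | (p.1, p.2.1) ∈ K} := by
      refine (mp.integrable_comp_emb hme).1 ?_
      simpa only [Function.comp_def, hma] using hint
    refine IntegrableOn.of_forall_sdiff_eq_zero h5 hmH fun p hp => ?_
    rw [hzero p hp.2, map_zero, mul_zero]
  · rw [hred _ fun p hp => by rw [hzero p hp, map_zero, mul_zero],
      hred _ fun p hp => by rw [hdz p hp, map_zero, mul_zero], integral_prod _ hint,
      integral_prod _ hintu, ← integral_neg]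
    refine integral_congr_ae ?_
    filter_upwards [ae_restrict_of_ae_restrict_of_subset hKs hg.slices,
      ae_restrict_of_ae_restrict_of_subset hKs hh.slices] with X h6 h7
    have h8 := h6.integral_hilbert_mul_halfDeriv h7 (hslice X).1 (hslice X).2
    simp only [hap, timeHalfDeriv]
    refine h8.trans (congrArg _ (integral_congr_ae (ae_of_all _ fun t => ?_)))
    have h9 : HasDerivAt (fun s : ℝ => ((X.1, X.2, s) : Pt n)) (0, 0, 1) t :=
      (hasDerivAt_const t X.1).prodMk ((hasDerivAt_const t X.2).prodMk (hasDerivAt_id t))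
    have h10 := ((hφ.smooth.differentiable (by simp) (X.1, X.2, t)).hasFDerivAt.comp_hasDerivAt t h9)
    dsimp only
    congr 2
    exact h10.deriv

end HalfSpace

/-! ### Parabolic rescaling to the unit cylinder. -/

section Rescale

variable {n : ℕ}

/-- The parabolic dilation by `r`, followed by the translation to `(lam, x, t)`. -/
def paraScale (lam : ℝ) (x : EuclideanSpace ℝ (Fin n)) (t : ℝ) {r : ℝ} (hr : 0 < r) :
    Space n × ℝ ≃ₜ Pt n where
  toFun p := (lam + r * p.1.1, x + r • p.1.2, t + r ^ 2 * p.2)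
  invFun q := ((r⁻¹ * (q.1 - lam), r⁻¹ • (q.2.1 - x)), (r ^ 2)⁻¹ * (q.2.2 - t))
  left_inv p := by
    have := hr.ne'
    ext <;> simp [this]
  right_inv q := by
    have := hr.ne'
    ext <;> simp [this]
  continuous_toFun := by fun_prop
  continuous_invFun := by fun_prop

/-- The linear part of `paraScale`. -/
def paraScaleLinear (n : ℕ) (r : ℝ) : (Space n × ℝ) →L[ℝ] Pt n :=
  (r • (ContinuousLinearMap.fst ℝ ℝ (EuclideanSpace ℝ (Fin n))).comp
    (ContinuousLinearMap.fst ℝ _ ℝ)).prod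
  ((r • (ContinuousLinearMap.snd ℝ ℝ (EuclideanSpace ℝ (Fin n))).comp
    (ContinuousLinearMap.fst ℝ _ ℝ)).prod (r ^ 2 • ContinuousLinearMap.snd ℝ _ ℝ))

lemma paraScaleLinear_apply (r : ℝ) (p : Space n × ℝ) :
    paraScaleLinear n r p = (r * p.1.1, r • p.1.2, r ^ 2 * p.2) := rfl

/-- The coordinate directions of space. -/
def coordDir (i : Fin (n + 1)) : Space n :=
  Fin.cases (1, 0) (fun j => (0, EuclideanSpace.single j 1)) i

lemma paraScaleLinear_coordDir (r : ℝ) (i : Fin (n + 1)) :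
    paraScaleLinear n r (coordDir i, 0) = r • spaceDir i := by
  rw [paraScaleLinear_apply]
  induction i using Fin.cases with
  | zero => simp [coordDir, spaceDir]
  | succ j => simp [coordDir, spaceDir]

/-- The coordinate functionals of space. -/
def coordFun (i : Fin (n + 1)) : Space n →L[ℝ] ℝ :=
  Fin.cases (ContinuousLinearMap.fst ℝ _ _)
    (fun j => (EuclideanSpace.proj j).comp (ContinuousLinearMap.snd ℝ _ _)) i

lemma sum_coordFun_smul_coordDir (Y : Space n) :
    ∑ i, coordFun i Y • coordDir i = Y := by
  rw [Fin.sum_univ_succ]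
  refine Prod.ext ?_ ?_
  · simp [coordFun, coordDir, Prod.fst_sum]
  · ext j
    simp [coordFun, coordDir, Prod.snd_sum, Finset.sum_apply, Pi.single_apply]

variable (lam : ℝ) (x : EuclideanSpace ℝ (Fin n)) (t : ℝ) {r : ℝ} (hr : 0 < r)

lemma paraScale_apply (p : Space n × ℝ) : paraScale lam x t hr p =
    (lam + r * p.1.1, x + r • p.1.2, t + r ^ 2 * p.2) := rfl

lemma paraScale_eq (p : Space n × ℝ) :
    paraScale lam x t hr p = (lam, x, t) + paraScaleLinear n r p := rfl

lemma contDiff_paraScale_symm : ContDiff ℝ ∞ (paraScale lam x t hr).symm := by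
  change ContDiff ℝ ∞ fun q : Pt n =>
    ((r⁻¹ * (q.1 - lam), r⁻¹ • (q.2.1 - x)), (r ^ 2)⁻¹ * (q.2.2 - t))
  fun_prop

/-- Only equalities of integrals and mean values are transported, so the value of the Jacobian is
irrelevant. -/
lemma exists_map_paraScale : ∃ c : ℝ≥0, c ≠ 0 ∧
    Measure.map (paraScale lam x t hr) volume = c • (volume : Measure (Pt n)) := by
  obtain ⟨a, ha⟩ : ∃ a : (Space n × ℝ) ≃L[ℝ] Pt n,
      ∀ p, a p = paraScaleLinear n r p := by
    refine ⟨ContinuousLinearEquiv.equivOfInverse (paraScaleLinear n r)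
      ((((r⁻¹ • ContinuousLinearMap.fst ℝ _ _).prod (r⁻¹ • (ContinuousLinearMap.fst ℝ _ _).comp
        (ContinuousLinearMap.snd ℝ _ _)))).prod ((r ^ 2)⁻¹ • (ContinuousLinearMap.snd ℝ _ _).comp
        (ContinuousLinearMap.snd ℝ _ _))) (fun p => ?_) fun q => ?_, fun p => rfl⟩
    · have := hr.ne'
      ext <;> simp [paraScaleLinear_apply, this]
    · have := hr.ne'
      ext <;> simp [paraScaleLinear_apply, this]
  have h1 : (Measure.map a volume).IsAddHaarMeasure := a.isAddHaarMeasure_map volume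
  refine ⟨(Measure.map a volume).addHaarScalarFactor volume,
    (Measure.addHaarScalarFactor_pos_of_isAddHaarMeasure _ _).ne', ?_⟩
  have h2 : (paraScale lam x t hr : _ → Pt n) = (fun q => (lam, x, t) + q) ∘ a := by
    ext1 p; rw [Function.comp_apply, ha, paraScale_eq]
  rw [h2, ← Measure.map_map (by fun_prop) a.continuous.measurable,
    ← Measure.isAddLeftInvariant_eq_smul (Measure.map a volume) volume, map_add_left_eq_self]

lemma integral_comp_paraScale_eq {f g : Pt n → ℂ} (h : ∫ q, f q = ∫ q, g q) :
    ∫ p, f (paraScale lam x t hr p) = ∫ p, g (paraScale lam x t hr p) := by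
  obtain ⟨c, -, h1⟩ := exists_map_paraScale lam x t hr
  have h2 := (paraScale lam x t hr).measurableEmbedding
  rw [← h2.integral_map f, ← h2.integral_map g, h1, integral_smul_nnreal_measure,
    integral_smul_nnreal_measure, h]

lemma setLAverage_paraScale (f : Pt n → ℝ≥0∞) {S : Set (Pt n)} (hS : MeasurableSet S) :
    ⨍⁻ q in S, f q ∂volume = (∫⁻ p in paraScale lam x t hr ⁻¹' S, f (paraScale lam x t hr p)) /
      volume (paraScale lam x t hr ⁻¹' S) := by
  obtain ⟨c, hc, h1⟩ := exists_map_paraScale lam x t hr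
  have h2 := (paraScale lam x t hr).measurableEmbedding
  have h3 : volume (paraScale lam x t hr ⁻¹' S) = c * volume S := by
    rw [← h2.map_apply, h1]; rfl
  have h4 : ∫⁻ p in paraScale lam x t hr ⁻¹' S, f (paraScale lam x t hr p) = c * ∫⁻ q in S, f q := by
    rw [← h2.lintegral_map f, ← h2.restrict_map, h1, Measure.restrict_smul, lintegral_smul_measure]
    rfl
  rw [setLAverage_eq, h3, h4, ENNReal.mul_div_mul_left _ _ (by exact_mod_cast hc) (by simp)]

variable {lam}

/-- The condition r < λ/8 acts here: it keeps the rescaled cylinder of radius 8, boundary included,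
inside the half-space. -/
lemma paraScale_mem_halfSpace (hlam : 8 * r < lam) {p : Space n × ℝ} (hp : ‖p.1‖ ≤ 8) :
    paraScale lam x t hr p ∈ halfSpace n := by
  have h1 : |p.1.1| ≤ 8 := (norm_fst_le p.1).trans hp
  have h2 := (abs_le.1 h1).1
  change 0 < lam + r * p.1.1
  nlinarith

/-- Extension by zero outside the cylinder makes the rescaled functions locally square integrable on
the whole space. The closed cylinder maps into the half-space, so there is no trouble at its
boundary. -/
lemma MemL2Loc.comp_paraScale (hlam : 8 * r < lam) {F : Type*} [NormedAddCommGroup F] {f : Pt n → F}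
    (hf : MemL2Loc f (halfSpace n)) :
    MemL2Loc ({p : Space n × ℝ | ‖p.1‖ < 8}.indicator
      (f ∘ paraScale lam x t hr)) univ := by
  intro K _ hK
  obtain ⟨c, hc, h1⟩ := exists_map_paraScale lam x t hr
  have hme := (paraScale lam x t hr).measurableEmbedding
  have hK' : IsCompact (closedBall (0 : Space n) 8 ×ˢ (Prod.snd '' K)) :=
    (isCompact_closedBall _ _).prod (hK.image continuous_snd)
  have h2 := (hf _ (image_subset_iff.2 fun p hp => paraScale_mem_halfSpace x t hr hlam
    (by simpa using hp.1)) (hK'.image (paraScale lam x t hr).continuous)).smul_measure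
    (c := (c : ℝ≥0∞)) (by simp)
  have h3 : (c : ℝ≥0∞) • (volume : Measure (Pt n)).restrict (paraScale lam x t hr ''
      (closedBall (0 : Space n) 8 ×ˢ (Prod.snd '' K))) =
      Measure.map (paraScale lam x t hr)
        (volume.restrict (closedBall (0 : Space n) 8 ×ˢ (Prod.snd '' K))) := by
    have h4 := hme.restrict_map volume (paraScale lam x t hr ''
      (closedBall (0 : Space n) 8 ×ˢ (Prod.snd '' K)))
    rw [preimage_image_eq _ (paraScale lam x t hr).injective, h1] at h4
    rw [← h4, Measure.restrict_smul]
    rfl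
  rw [h3, hme.memLp_map_measure_iff] at h2
  have hD : MeasurableSet {p : Space n × ℝ | ‖p.1‖ < 8} :=
    measurableSet_lt (by fun_prop) measurable_const
  rw [memLp_indicator_iff_restrict hD, Measure.restrict_restrict hD]
  refine h2.mono_measure (Measure.restrict_mono_set _ fun p hp =>
    mem_prod.2 ⟨?_, mem_image_of_mem _ hp.2⟩)
  rw [mem_closedBall_zero_iff]
  exact le_of_lt hp.1

lemma ae_comp_paraScale (hr : 0 < r) (hlam : 8 * r < lam) {P : Space n → Prop}
    (h : ∀ᵐ X ∂(volume.restrict (spatialHalfSpace n)), P X) :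
    ∀ᵐ X : Space n, ‖X‖ < 8 → P (lam + r * X.1, x + r • X.2) := by
  have hm : MeasurableSet (spatialHalfSpace n) := measurableSet_lt measurable_const measurable_fst
  rw [ae_restrict_iff' hm] at h
  have h1 : Measure.QuasiMeasurePreserving (fun X : Space n => r • X) :=
    ⟨by fun_prop, by
      rw [Measure.map_addHaar_smul volume hr.ne']
      exact Measure.smul_absolutelyContinuous⟩
  have h2 := (measurePreserving_add_left volume (lam, x)).quasiMeasurePreserving.comp h1
  filter_upwards [h2.ae h] with X h3 hX
  refine h3 ?_
  have h4 : |X.1| ≤ 8 := (norm_fst_le X).trans hX.le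
  have h5 := (abs_le.1 h4).1
  change 0 < lam + r * X.1
  nlinarith

end Rescale

/-! ### Fractional differences under time scaling. -/

section TimeRescale

/-- An operator of order 1/2 in time scales like r under t ↦ r² t, because r² (r²)^(-3/2) = r⁻¹. -/
lemma fracDiff_comp_paraScale (σ : ℝ) (ψ : ℝ → ℂ) (t : ℝ) {r : ℝ} (hr : 0 < r) (s : ℝ) :
    (r : ℂ) * fracDiff σ (fun τ => ψ ((r ^ 2)⁻¹ * (τ - t))) (t + r ^ 2 * s) = fracDiff σ ψ s := by
  have hr2 : 0 < r ^ 2 := by positivity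
  have hk : r ^ 2 * ker (r ^ 2) = r⁻¹ := by
    rw [ker, ← Real.rpow_natCast, ← Real.rpow_mul hr.le, ← Real.rpow_add hr, ← Real.rpow_neg_one]
    norm_num
  have h1 := integral_comp_mul_left_Ioi (fun z => ker z • (ψ ((r ^ 2)⁻¹ * (t + r ^ 2 * s - t)) -
    ψ ((r ^ 2)⁻¹ * (t + r ^ 2 * s - σ * z - t)))) 0 hr2
  rw [mul_zero, eq_inv_smul_iff₀ hr2.ne'] at h1
  rw [fracDiff, ← h1, fracDiff, ← integral_smul, ← integral_const_mul]
  refine setIntegral_congr_fun measurableSet_Ioi fun z hz => ?_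
  rw [ker_mul hr2 hz, add_sub_cancel_left, inv_mul_cancel_left₀ hr2.ne']
  have h2 : (r ^ 2)⁻¹ * (t + r ^ 2 * s - σ * (r ^ 2 * z) - t) = s - σ * z := by
    field_simp; ring
  rw [h2, smul_smul, ← mul_assoc, hk, mul_smul, Complex.real_smul (x := r⁻¹), ← mul_assoc,
    ← Complex.ofReal_mul, mul_inv_cancel₀ hr.ne', Complex.ofReal_one, one_mul]

lemma integral_comp_affine_eq {f g : ℝ → ℂ} (h : ∫ τ, f τ = ∫ τ, g τ) (t c : ℝ) :
    ∫ s, f (t + c * s) = ∫ s, g (t + c * s) := by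
  rw [Measure.integral_comp_mul_left (fun s => f (t + s)), Measure.integral_comp_mul_left
    (fun s => g (t + s)), integral_add_left_eq_self f, integral_add_left_eq_self g, h]

/-- The weight changes under the affine map by a factor depending on t and r only, by 1 + |t + r² s|
≤ (1 + |t| + r²)(1 + |s|). Only finiteness is claimed, so this dependence does no harm. -/
lemma IsHalfDeriv.lintegral_comp_lt_top {v g : ℝ → ℂ} (hv : IsHalfDeriv v g) (t : ℝ) {r : ℝ}
    (hr : 0 < r) : ∫⁻ s, ‖v (t + r ^ 2 * s)‖ₑ * ENNReal.ofReal (decay s) < ⊤ := by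
  have h1 := (hv.integrable_mul_decay.comp_add_left t).comp_mul_left' (R := r ^ 2) (by positivity)
  have hc : 0 < 1 + |t| + r ^ 2 := by positivity
  refine lt_of_le_of_lt (lintegral_mono (g := fun s => ENNReal.ofReal (ker (1 + |t| + r ^ 2))⁻¹ *
    ‖‖v (t + r ^ 2 * s)‖ * decay (t + r ^ 2 * s)‖ₑ) fun s => ?_) ?_
  · dsimp only
    rw [enorm_mul, enorm_norm, mul_left_comm, Real.enorm_of_nonneg (decay_pos _).le,
      ← ENNReal.ofReal_mul (inv_pos.2 (ker_pos hc)).le]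
    refine mul_le_mul_right (ENNReal.ofReal_le_ofReal ?_) _
    rw [← div_eq_inv_mul, le_div_iff₀ (ker_pos hc), decay, decay, mul_comm,
      ← ker_mul hc (by positivity)]
    refine ker_le_ker (by positivity) ?_
    have h3 := abs_add_le t (r ^ 2 * s)
    rw [abs_mul, abs_of_pos (by positivity : 0 < r ^ 2)] at h3
    nlinarith [abs_nonneg t, abs_nonneg s, mul_nonneg (abs_nonneg t) (abs_nonneg s), sq_nonneg r]
  · rw [lintegral_const_mul' _ _ ENNReal.ofReal_ne_top]
    exact ENNReal.mul_lt_top ENNReal.ofReal_lt_top h1.hasFiniteIntegral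

lemma IsHalfDeriv.integral_comp_mul_fracDiff {v g h : ℝ → ℂ} (hv : IsHalfDeriv v g)
    (H : IsHilbertTransform g h) {ψ : ℝ → ℂ} (hψ : ContDiff ℝ ∞ ψ) (hc : HasCompactSupport ψ)
    {σ : ℝ} (hσ : σ = 1 ∨ σ = -1) (t : ℝ) {r : ℝ} (hr : 0 < r) :
    ∫ s, (r : ℂ) * (cosConst * g (t + r ^ 2 * s) - σ * sinConst * h (t + r ^ 2 * s)) * ψ s =
      ∫ s, v (t + r ^ 2 * s) * fracDiff σ ψ s := by
  have hr2 : 0 < r ^ 2 := by positivity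
  have hψs : ContDiff ℝ ∞ fun τ => ψ ((r ^ 2)⁻¹ * (τ - t)) := hψ.comp (by fun_prop)
  have hψc : HasCompactSupport fun τ => ψ ((r ^ 2)⁻¹ * (τ - t)) := by
    refine HasCompactSupport.intro (hc.isCompact.image
      (by fun_prop : Continuous fun s : ℝ => t + r ^ 2 * s)) fun τ hτ =>
        image_eq_zero_of_notMem_tsupport fun h => hτ ⟨_, h, ?_⟩
    field_simp; ring
  have h1 := integral_comp_affine_eq (hv.integral_mul_fracDiff H hψs hψc hσ) t (r ^ 2)
  simp only [add_sub_cancel_left, inv_mul_cancel_left₀ hr2.ne'] at h1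
  simp only [mul_assoc]
  simp only [mul_assoc] at h1
  rw [integral_const_mul, h1, ← integral_const_mul]
  refine integral_congr_ae (ae_of_all _ fun s => ?_)
  dsimp only
  rw [← fracDiff_comp_paraScale σ ψ t hr s]
  ring

end TimeRescale

/-! ### From reinforced weak solutions to the normalized problem. -/

section Reduction

variable {n : ℕ} {A : Pt n → Matrix (Fin (n + 1)) (Fin (n + 1)) ℂ} {κ M : ℝ} {u g h : Pt n → ℂ}
  {G : Pt n → EuclideanSpace ℂ (Fin (n + 1))}

/-- The bilinear bound tested with the conjugate of Aξ. -/
lemma IsElliptic.norm_mulVec_le (hA : IsElliptic A κ M) {p : Pt n} (hp : p ∈ halfSpace n)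
    (ξ : EuclideanSpace ℂ (Fin (n + 1))) :
    ‖(WithLp.toLp 2 (A p *ᵥ ξ.ofLp) : EuclideanSpace ℂ (Fin (n + 1)))‖ ≤ M * ‖ξ‖ := by
  obtain ⟨η, hη⟩ : ∃ η : EuclideanSpace ℂ (Fin (n + 1)), η = WithLp.toLp 2 (A p *ᵥ ξ.ofLp) :=
    ⟨_, rfl⟩
  have h1 := hA.upper p hp ξ (WithLp.toLp 2 (star η.ofLp))
  have h2 : ‖(WithLp.toLp 2 (star η.ofLp) : EuclideanSpace ℂ (Fin (n + 1)))‖ = ‖η‖ := by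
    simp [EuclideanSpace.norm_eq]
  have h3 : (A p *ᵥ ξ.ofLp) ⬝ᵥ star η.ofLp = ((‖η‖ ^ 2 : ℝ) : ℂ) := by
    rw [EuclideanSpace.norm_sq_eq, hη, dotProduct, Complex.ofReal_sum]
    refine Finset.sum_congr rfl fun i _ => ?_
    rw [Pi.star_apply, Complex.star_def, Complex.mul_conj']
    push_cast; rfl
  rw [← hη]
  rw [h2, h3, Complex.norm_real, Real.norm_of_nonneg (sq_nonneg _), sq] at h1
  rcases (norm_nonneg η).eq_or_lt with h0 | h0
  -- When Aξ = 0 one needs M ‖ξ‖ ≥ 0. No sign of M is assumed, but the bound itself forces it when ξ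
  -- ≠ 0.
  · have h4 := hA.upper p hp ξ ξ
    rw [← h0]
    by_contra! h5
    have h6 : 0 ≤ M * ‖ξ‖ * ‖ξ‖ := (norm_nonneg _).trans h4
    have h7 : 0 < ‖ξ‖ := (norm_nonneg ξ).lt_of_ne fun h => by rw [← h] at h5; simp at h5
    exact absurd h6 (not_le.2 (mul_neg_of_neg_of_pos h5 h7))
  · exact le_of_mul_le_mul_right h1 h0

lemma IsElliptic.memL2Loc_mulVec (hA : IsElliptic A κ M) (hG : MemL2Loc G (halfSpace n))
    (i : Fin (n + 1)) : MemL2Loc (fun p => (A p *ᵥ (G p).ofLp) i) (halfSpace n) := by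
  intro K hK hKc
  have h1 := hG K hK hKc
  have hm : AEStronglyMeasurable (fun p => (A p *ᵥ (G p).ofLp) i) (volume.restrict K) := by
    simp only [Matrix.mulVec, dotProduct]
    refine AEMeasurable.aestronglyMeasurable ?_
    refine Finset.aemeasurable_fun_sum _ fun j _ => ?_
    refine ((hA.measurable i j).mono_measure (Measure.restrict_mono hK le_rfl)).mul ?_
    exact (by fun_prop : Measurable fun z : EuclideanSpace ℂ (Fin (n + 1)) => z j).comp_aemeasurable
      h1.aestronglyMeasurable.aemeasurable
  refine h1.of_le_mul (c := M) hm ((ae_restrict_iff' hKc.measurableSet).2 (ae_of_all _ fun p hp => ?_))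
  exact (PiLp.norm_apply_le (WithLp.toLp 2 (A p *ᵥ (G p).ofLp) : EuclideanSpace ℂ (Fin (n + 1)))
    i).trans (hA.norm_mulVec_le (hK hp) _)

lemma MemL2Loc.apply (hG : MemL2Loc G (halfSpace n)) (i : Fin (n + 1)) :
    MemL2Loc (fun p => G p i) (halfSpace n) := fun K hK hKc =>
  (hG K hK hKc).of_le ((by fun_prop : Measurable fun z : EuclideanSpace ℂ (Fin (n + 1)) => z i
    ).comp_aemeasurable (hG K hK hKc).aestronglyMeasurable.aemeasurable).aestronglyMeasurable
    (ae_of_all _ fun p => PiLp.norm_apply_le _ i)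

lemma IsTestFunction.eq_zero {φ : Pt n → ℂ} (hφ : IsTestFunction φ) {p : Pt n}
    (hp : p ∉ halfSpace n) : φ p = 0 ∧ fderiv ℝ φ p = 0 := by
  have h1 : p ∉ tsupport φ := fun h => hp (hφ.support_subset h)
  exact ⟨image_eq_zero_of_notMem_tsupport h1,
    image_eq_zero_of_notMem_tsupport fun h => h1 (tsupport_fderiv_subset ℝ h)⟩

lemma IsTestFunction.setIntegral_eq {φ : Pt n → ℂ} (hφ : IsTestFunction φ) (f : Pt n → ℂ) (v : Pt n) :
    ∫ p in halfSpace n, f p * fderiv ℝ φ p v = ∫ p, f p * fderiv ℝ φ p v :=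
  setIntegral_eq_integral_of_forall_compl_eq_zero fun p hp => by simp [(hφ.eq_zero hp).2]

/-- The weak formulation of the equation with the time derivative. -/
lemma IsReinforcedWeakSolution.integral_eq (hA : IsElliptic A κ M)
    (hu : IsReinforcedWeakSolution A u G g h) {φ : Pt n → ℂ} (hφ : IsTestFunction φ)
    (hreal : ∀ p v, conj (fderiv ℝ φ p v) = fderiv ℝ φ p v) :
    ∑ i, ∫ p, (A p *ᵥ (G p).ofLp) i * fderiv ℝ φ p (spaceDir i) = ∫ p, u p * fderiv ℝ φ p (0, 0, 1) := by
  obtain ⟨h1, h2⟩ := hu.half.integral_hilbert_mul_timeHalfDeriv hu.hilbert hφ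
  have h3 : ∀ p, (A p *ᵥ (G p).ofLp) ⬝ᵥ star (spaceGrad φ p).ofLp =
      ∑ i, (A p *ᵥ (G p).ofLp) i * fderiv ℝ φ p (spaceDir i) := fun p => by
    rw [dotProduct]
    refine Finset.sum_congr rfl fun i _ => ?_
    rw [Pi.star_apply, Complex.star_def, spaceGrad, hreal]
  have h4 : ∀ i, Integrable fun p => (A p *ᵥ (G p).ofLp) i * fderiv ℝ φ p (spaceDir i) := fun i =>
    integrable_mul_of_memL2Loc (hA.memL2Loc_mulVec hu.grad.memL2Loc_grad i)
      ((hφ.smooth.continuous_fderiv (by simp)).clm_apply continuous_const)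
      (hφ.compactSupport.fderiv_apply (𝕜 := ℝ) _)
      ((tsupport_fderiv_apply_subset ℝ _).trans hφ.support_subset)
  have h5 := hu.equation φ hφ
  simp only [h3] at h5
  rw [integral_add (integrable_finsetSum _ fun i _ => (h4 i).integrableOn) h1, h2,
    integral_finsetSum _ fun i _ => (h4 i).integrableOn] at h5
  simp only [hreal, hφ.setIntegral_eq] at h5
  linear_combination h5

variable (lam : ℝ) (x : EuclideanSpace ℝ (Fin n)) (t : ℝ) {r : ℝ} (hr : 0 < r)

/-- The normalized weak formulation uses real test functions. Their transports have real
derivatives, so the conjugations in the sesquilinear form disappear. -/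
lemma isTestFunction_paraScale (hlam : 8 * r < lam) {φ : Space n × ℝ → ℝ}
    (hφ : ContDiff ℝ ∞ φ) (hc : HasCompactSupport φ)
    (hs : tsupport φ ⊆ {p : Space n × ℝ | ‖p.1‖ < 8}) :
    ∃ Ψ : Pt n → ℂ, IsTestFunction Ψ ∧ (∀ q v, conj (fderiv ℝ Ψ q v) = fderiv ℝ Ψ q v) ∧
      (∀ p, Ψ (paraScale lam x t hr p) = φ p) ∧
      ∀ p v, fderiv ℝ Ψ (paraScale lam x t hr p) (paraScaleLinear n r v) =
        ((fderiv ℝ φ p v : ℝ) : ℂ) := by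
  obtain ⟨Θ, hΘ⟩ : ∃ Θ : Pt n → ℝ, Θ = φ ∘ (paraScale lam x t hr).symm := ⟨_, rfl⟩
  have hΘs : ContDiff ℝ ∞ Θ := by rw [hΘ]; exact hφ.comp (contDiff_paraScale_symm lam x t hr)
  have hΘc : HasCompactSupport Θ := by
    rw [hΘ]; exact hc.comp_homeomorph (paraScale lam x t hr).symm
  have hΘd : ∀ q, HasFDerivAt (fun q => (Θ q : ℂ)) (Complex.ofRealCLM.comp (fderiv ℝ Θ q)) q :=
    fun q => Complex.ofRealCLM.hasFDerivAt.comp q (hΘs.differentiable (by simp) q).hasFDerivAt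
  refine ⟨fun q => (Θ q : ℂ), ⟨Complex.ofRealCLM.contDiff.comp hΘs,
    hΘc.comp_left Complex.ofReal_zero, ?_⟩, fun q v => ?_, fun p => by simp [hΘ], fun p v => ?_⟩
  · have h1 : tsupport (fun q => (Θ q : ℂ)) ⊆ paraScale lam x t hr '' tsupport φ := by
      refine closure_minimal (fun q hq => ⟨(paraScale lam x t hr).symm q,
        subset_tsupport φ fun h0 => hq (by simp [hΘ, h0]), by simp⟩)
        ((paraScale lam x t hr).isClosedMap _ (isClosed_tsupport φ))
    rintro q hq
    obtain ⟨p, hp, rfl⟩ := h1 hq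
    exact paraScale_mem_halfSpace x t hr hlam (le_of_lt (hs hp))
  · rw [(hΘd q).fderiv]
    exact Complex.conj_ofReal _
  · rw [(hΘd _).fderiv]
    have h2 : HasFDerivAt (paraScale lam x t hr) (paraScaleLinear n r) p :=
      ((paraScaleLinear n r).hasFDerivAt).const_add (lam, x, t)
    have h3 := (hΘs.differentiable (by simp) (paraScale lam x t hr p)).hasFDerivAt.comp p h2
    have h4 : Θ ∘ paraScale lam x t hr = φ := by ext; simp [hΘ]
    rw [h4] at h3
    rw [h3.fderiv]
    rfl

/-- After rescaling, a reinforced weak solution solves the normalized problem. -/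
theorem IsReinforcedWeakSolution.fracSol (hA : IsElliptic A κ M)
    (hu : IsReinforcedWeakSolution A u G g h) (hr : 0 < r) (hlam : 8 * r < lam) {σ : ℝ}
    (hσ : σ = 1 ∨ σ = -1) :
    FracSol coordDir κ M σ
      ({p : Space n × ℝ | ‖p.1‖ < 8}.indicator (u ∘ paraScale lam x t hr))
      (fun i => {p : Space n × ℝ | ‖p.1‖ < 8}.indicator
        ((fun q => (r : ℂ) * (A q *ᵥ (G q).ofLp) i) ∘ paraScale lam x t hr))
      (fun i => {p : Space n × ℝ | ‖p.1‖ < 8}.indicator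
        ((fun q => (r : ℂ) * G q i) ∘ paraScale lam x t hr))
      ({p : Space n × ℝ | ‖p.1‖ < 8}.indicator
        ((fun q => (r : ℂ) * (cosConst * g q - σ * sinConst * h q)) ∘ paraScale lam x t hr)) where
  memL2 := hu.grad.memL2Loc.comp_paraScale x t hr hlam
  memL2_flux i := MemL2Loc.comp_paraScale x t hr hlam fun K hK hKc =>
    ((hA.memL2Loc_mulVec hu.grad.memL2Loc_grad i) K hK hKc).const_mul _
  memL2_grad i := MemL2Loc.comp_paraScale x t hr hlam fun K hK hKc =>
    ((hu.grad.memL2Loc_grad.apply i) K hK hKc).const_mul _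
  grad φ hφ hc hs i := by
    obtain ⟨Ψ, h1, -, h3, h4⟩ := isTestFunction_paraScale lam x t hr hlam hφ hc hs
    have h5 := hu.grad.integral_eq Ψ h1 i
    rw [h1.setIntegral_eq, setIntegral_eq_integral_of_forall_compl_eq_zero fun p hp => by
      simp [(h1.eq_zero hp).1], ← integral_neg] at h5
    have h6 := congrArg (fun z => (r : ℂ) * z) (integral_comp_paraScale_eq lam x t hr h5)
    simp only [← integral_const_mul] at h6
    rw [← integral_neg]
    refine Eq.trans (integral_congr_ae (ae_of_all _ fun p => ?_))
      (h6.trans (integral_congr_ae (ae_of_all _ fun p => ?_)))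
    · have h7 := h4 p (coordDir i, 0)
      rw [paraScaleLinear_coordDir, map_smul, Complex.real_smul] at h7
      dsimp only
      by_cases hp : ‖p.1‖ < 8
      · rw [indicator_of_mem (s := {p : Space n × ℝ | ‖p.1‖ < 8}) hp,
          Complex.real_smul, ← h7, Function.comp_apply]
        ring
      · have h8 : fderiv ℝ φ p = 0 := image_eq_zero_of_notMem_tsupport fun h => hp
          (hs (tsupport_fderiv_subset ℝ h))
        rw [h8, _root_.zero_apply, Complex.ofReal_zero] at h7
        rw [h8, _root_.zero_apply, zero_smul, mul_left_comm, h7, mul_zero]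
    · dsimp only
      by_cases hp : ‖p.1‖ < 8
      · rw [indicator_of_mem (s := {p : Space n × ℝ | ‖p.1‖ < 8}) hp,
          Complex.real_smul, h3, Function.comp_apply]
        ring
      · rw [h3, image_eq_zero_of_notMem_tsupport (f := φ) (x := p) fun h => hp (hs h)]
        simp
  eqn φ hφ hc hs := by
    obtain ⟨Ψ, h1, h2, -, h4⟩ := isTestFunction_paraScale lam x t hr hlam hφ hc hs
    have h5 := hu.integral_eq hA h1 h2
    obtain ⟨c, hc0, hmap⟩ := exists_map_paraScale lam x t hr
    have hme := (paraScale lam x t hr).measurableEmbedding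
    have hint : ∀ f : Pt n → ℂ, ∫ p, f (paraScale lam x t hr p) = (c : ℂ) * ∫ q, f q := fun f => by
      rw [← hme.integral_map f, hmap, integral_smul_nnreal_measure, NNReal.smul_def,
        Complex.real_smul]
    have h6 : ∀ p v, p ∉ {p : Space n × ℝ | ‖p.1‖ < 8} →
        fderiv ℝ φ p v = 0 := fun p v hp => by
      have h8 : fderiv ℝ φ p = 0 := image_eq_zero_of_notMem_tsupport fun h => hp
        (hs (tsupport_fderiv_subset ℝ h))
      rw [h8, _root_.zero_apply]
    have h7 : ∀ (f : Pt n → ℂ) (v : Space n × ℝ),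
        ∫ p, fderiv ℝ φ p v • {p : Space n × ℝ | ‖p.1‖ < 8}.indicator
          (f ∘ paraScale lam x t hr) p = (c : ℂ) * ∫ q, f q * fderiv ℝ Ψ q (paraScaleLinear n r v) :=
      fun f v => by
        rw [← hint]
        refine integral_congr_ae (ae_of_all _ fun p => ?_)
        dsimp only
        rw [h4]
        by_cases hp : p ∈ {p : Space n × ℝ | ‖p.1‖ < 8}
        · rw [indicator_of_mem hp, Complex.real_smul, Function.comp_apply, mul_comm]
        · rw [h6 p v hp]; simp
    -- The time direction scales by r², a space direction by r. The factor r built into the rescaled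
    -- flux restores the balance.
    have h8 : paraScaleLinear n r (0, 1) = (r ^ 2 : ℝ) • ((0, 0, 1) : Pt n) := by
      rw [paraScaleLinear_apply]; simp
    simp only [h7]
    simp only [paraScaleLinear_coordDir, h8, map_smul, Complex.real_smul]
    have h9 : ∀ (f : Pt n → ℂ) (a : ℂ) (v : Pt n), ∫ q, f q * (a * fderiv ℝ Ψ q v) =
        a * ∫ q, f q * fderiv ℝ Ψ q v := fun f a v => by
      rw [← integral_const_mul]; congr 1; ext q; ring
    simp only [h9]
    rw [← h5, Finset.mul_sum, Finset.mul_sum]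
    refine Finset.sum_congr rfl fun i _ => ?_
    have h10 : ∫ q, (r : ℂ) * (A q *ᵥ (G q).ofLp) i * fderiv ℝ Ψ q (spaceDir i) =
        (r : ℂ) * ∫ q, (A q *ᵥ (G q).ofLp) i * fderiv ℝ Ψ q (spaceDir i) := by
      rw [← integral_const_mul]; congr 1; ext q; ring
    rw [h10]
    push_cast; ring
  lower p := by
    by_cases hp : p ∈ {p : Space n × ℝ | ‖p.1‖ < 8}
    · simp only [indicator_of_mem hp, Function.comp_apply]
      obtain ⟨q, hq⟩ : ∃ q, q = paraScale lam x t hr p := ⟨_, rfl⟩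
      have h1 := hA.lower q (hq ▸ paraScale_mem_halfSpace x t hr hlam (le_of_lt hp)) (G q)
      rw [← hq]
      have h2 : ∑ i, ‖(r : ℂ) * G q i‖ ^ 2 = r ^ 2 * ‖G q‖ ^ 2 := by
        rw [EuclideanSpace.norm_sq_eq, Finset.mul_sum]
        refine Finset.sum_congr rfl fun i _ => ?_
        rw [norm_mul, mul_pow, Complex.norm_real, Real.norm_eq_abs, sq_abs]
      have h3 : ∑ i, inner ℝ ((r : ℂ) * G q i) ((r : ℂ) * (A q *ᵥ (G q).ofLp) i) =
          r ^ 2 * ((A q *ᵥ (G q).ofLp) ⬝ᵥ star (G q).ofLp).re := by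
        rw [dotProduct, Complex.re_sum, Finset.mul_sum]
        refine Finset.sum_congr rfl fun i _ => ?_
        rw [Complex.inner, Pi.star_apply, Complex.star_def]
        simp only [map_mul, Complex.conj_ofReal, Complex.mul_re, Complex.mul_im, Complex.ofReal_re,
          Complex.ofReal_im, Complex.conj_re, Complex.conj_im]
        ring
      rw [h2, h3]
      nlinarith [sq_nonneg r, mul_le_mul_of_nonneg_left h1 (sq_nonneg r)]
    · simp only [indicator_of_notMem hp]; simp
  upper p := by
    by_cases hp : p ∈ {p : Space n × ℝ | ‖p.1‖ < 8}
    · simp only [indicator_of_mem hp, Function.comp_apply]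
      obtain ⟨q, hq⟩ : ∃ q, q = paraScale lam x t hr p := ⟨_, rfl⟩
      have h1 := hA.norm_mulVec_le (hq ▸ paraScale_mem_halfSpace x t hr hlam (le_of_lt hp)) (G q)
      rw [← hq]
      have h2 := pow_le_pow_left₀ (norm_nonneg _) h1 2
      rw [mul_pow, EuclideanSpace.norm_sq_eq, EuclideanSpace.norm_sq_eq] at h2
      simp only [norm_mul, mul_pow, ← Finset.mul_sum]
      refine (mul_le_mul_of_nonneg_left h2 (sq_nonneg _)).trans (le_of_eq ?_)
      ring
    · simp only [indicator_of_notMem hp]; simp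
  memL2_frac := MemL2Loc.comp_paraScale x t hr hlam fun K hK hKc => by
    have hK' : IsCompact ((fun p : Pt n => (p.1, p.2.1)) '' K) := hKc.image (by fun_prop)
    have hsub : (fun p : Pt n => (p.1, p.2.1)) '' K ⊆ spatialHalfSpace n := by
      rintro _ ⟨p, hp, rfl⟩; exact hK hp
    have hle := Measure.restrict_mono (μ := (volume : Measure (Pt n)))
      (fun p hp => ⟨p, hp, rfl⟩ : K ⊆ {p : Pt n | (p.1, p.2.1) ∈
        (fun p : Pt n => (p.1, p.2.1)) '' K}) le_rfl
    have h1 := (hu.half.memL2 _ hsub hK').mono_measure hle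
    have h2 := (hu.hilbert.memLp hu.half hsub hK').mono_measure hle
    exact ((h1.const_mul _).sub (h2.const_mul _)).const_mul _
  decay_lt_top := by
    filter_upwards [ae_comp_paraScale x hr hlam hu.half.slices] with X hX hX8
    refine lt_of_le_of_lt (lintegral_mono fun s => ?_) ((hX hX8).lintegral_comp_lt_top t hr)
    refine mul_le_mul_left ?_ _
    rw [indicator_of_mem (s := {p : Space n × ℝ | ‖p.1‖ < 8}) hX8]
    rfl
  pairing := by
    filter_upwards [ae_comp_paraScale x hr hlam hu.half.slices,
      ae_comp_paraScale x hr hlam hu.hilbert.slices] with X hX hX' hX8 ψ hψ hc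
    have h1 := (hX hX8).integral_comp_mul_fracDiff (hX' hX8) hψ hc hσ t hr
    have h2 : ∀ s, (X, s) ∈ {p : Space n × ℝ | ‖p.1‖ < 8} := fun s => hX8
    simp only [indicator_of_mem (h2 _)]
    exact h1

end Reduction

/-! ### Comparison of the weighted sums and elementary algebra. -/

section Averages

variable {E : Type*} [NormedAddCommGroup E] [NormedSpace ℝ E] [FiniteDimensional ℝ E]
  [MeasureSpace E] [BorelSpace E] [(volume : Measure E).IsAddHaarMeasure]

/-- An index shift by at most 4 costs a constant, since 1 + |k| ≤ 5 (1 + 2 |k - m|). -/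
lemma decay_two_mul_sub_le (k : ℤ) {m : ℝ} (hm : |m| ≤ 4) :
    decay (2 * (k - m)) ≤ 2 * ker (1 / 5) * (1 / (1 + |(k : ℝ)| ^ (3 / 2 : ℝ))) := by
  have h1 : decay (2 * (k - m)) ≤ ker (1 / 5) * ker (1 + |(k : ℝ)|) := by
    rw [decay, ← ker_mul (by norm_num) (by positivity)]
    refine ker_le_ker (by positivity) ?_
    rw [abs_mul, abs_two]
    have := abs_sub_abs_le_abs_sub (k : ℝ) m
    linarith [abs_nonneg ((k : ℝ) - m)]
  have h2 : ker (1 + |(k : ℝ)|) ≤ 2 * (1 / (1 + |(k : ℝ)| ^ (3 / 2 : ℝ))) := by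
    rw [ker, Real.rpow_neg (by positivity), ← div_eq_mul_one_div, inv_eq_one_div,
      div_le_div_iff₀ (by positivity) (by positivity)]
    have h3 : |(k : ℝ)| ^ (3 / 2 : ℝ) ≤ (1 + |(k : ℝ)|) ^ (3 / 2 : ℝ) :=
      Real.rpow_le_rpow (abs_nonneg _) (by linarith) (by norm_num)
    have h4 : 1 ≤ (1 + |(k : ℝ)|) ^ (3 / 2 : ℝ) :=
      Real.one_le_rpow (by linarith [abs_nonneg (k : ℝ)]) (by norm_num)
    linarith
  refine h1.trans ((mul_le_mul_of_nonneg_left h2 (ker_pos (by norm_num)).le).trans (le_of_eq ?_))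
  ring

/-- The ball extends 6 in time, so the slabs of length 2 with index between j - 4 and j + 4 cover
it. -/
lemma closedBall_subset_iUnion_slab (j : ℤ) : closedBall ((0 : E), 2 * (j : ℝ)) 6 ⊆
    ⋃ i : Fin 9, ball (0 : E) 8 ×ˢ Ioc (2 * ((j + ((i : ℤ) - 4) : ℤ) : ℝ) - 1)
      (2 * ((j + ((i : ℤ) - 4) : ℤ) : ℝ) + 1) := by
  rintro ⟨X, s⟩ hp
  rw [mem_closedBall, Prod.dist_eq, max_le_iff, dist_zero_right, Real.dist_eq, abs_le] at hp
  obtain ⟨h1, h2, h3⟩ := hp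
  dsimp only at h1 h2 h3
  have h4 := Int.le_ceil ((s - 1) / 2)
  have h5 := Int.ceil_lt_add_one ((s - 1) / 2)
  obtain ⟨k, hk⟩ : ∃ k, k = ⌈(s - 1) / 2⌉ := ⟨_, rfl⟩
  rw [← hk] at h4 h5
  have h6 : j - 4 ≤ k := by
    have : (j : ℝ) - 5 < k := by linarith
    have : ((j - 5 : ℤ) : ℝ) < k := by push_cast; linarith
    have := Int.cast_lt.1 this
    omega
  have h7 : k ≤ j + 4 := by
    have : (k : ℝ) < ((j + 5 : ℤ) : ℝ) := by push_cast; linarith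
    have := Int.cast_lt.1 this
    omega
  refine mem_iUnion.2 ⟨⟨(k - j + 4).toNat, by omega⟩, ?_⟩
  have h8 : j + (((k - j + 4).toNat : ℤ) - 4) = k := by omega
  dsimp only
  rw [h8]
  exact ⟨by rw [mem_ball_zero_iff]; linarith, by constructor <;> dsimp only <;> linarith⟩

/-- Overlapping balls are exchanged for disjoint slabs: each ball is covered by nine, and a shift of
the summation index changes the weights by a bounded factor. -/
lemma tsum_decay_mul_le (f : E × ℝ → ℝ≥0∞) :
    ∑' j : ℤ, ENNReal.ofReal (decay (2 * j)) * ∫⁻ p in closedBall ((0 : E), 2 * (j : ℝ)) 6, f p ≤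
      9 * ENNReal.ofReal (2 * ker (1 / 5)) * ∑' k : ℤ,
        ENNReal.ofReal (1 / (1 + |(k : ℝ)| ^ (3 / 2 : ℝ))) *
        ∫⁻ p in ball (0 : E) 8 ×ˢ Ioc (2 * (k : ℝ) - 1) (2 * k + 1), f p := by
  obtain ⟨b, hb⟩ : ∃ b : ℤ → ℝ≥0∞, b = fun k : ℤ =>
    ∫⁻ p in ball (0 : E) 8 ×ˢ Ioc (2 * (k : ℝ) - 1) (2 * k + 1), f p := ⟨_, rfl⟩
  have h1 : ∀ j : ℤ, ∫⁻ p in closedBall ((0 : E), 2 * (j : ℝ)) 6, f p ≤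
      ∑ i : Fin 9, b (j + ((i : ℤ) - 4)) := fun j => by
    refine (lintegral_mono_set (closedBall_subset_iUnion_slab j)).trans
      ((lintegral_iUnion_le _ _).trans (le_of_eq ?_))
    rw [tsum_fintype, hb]
  have h2 : ∀ i : Fin 9, ∑' j : ℤ, ENNReal.ofReal (decay (2 * j)) * b (j + ((i : ℤ) - 4)) ≤
      ENNReal.ofReal (2 * ker (1 / 5)) * ∑' k : ℤ,
        ENNReal.ofReal (1 / (1 + |(k : ℝ)| ^ (3 / 2 : ℝ))) * b k := fun i => by
    rw [← (Equiv.subRight ((i : ℤ) - 4)).tsum_eq, ← ENNReal.tsum_mul_left]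
    refine ENNReal.tsum_le_tsum fun k => ?_
    rw [Equiv.subRight_apply, sub_add_cancel, ← mul_assoc, ← ENNReal.ofReal_mul
      (mul_pos two_pos (ker_pos (by norm_num))).le]
    refine mul_le_mul_left (ENNReal.ofReal_le_ofReal ?_) _
    have h3 := decay_two_mul_sub_le k (m := ((i : ℤ) - 4 : ℤ)) (by
      rw [← Int.cast_abs]
      have : |(i : ℤ) - 4| ≤ 4 := by
        have := i.2
        rw [abs_le]; omega
      exact_mod_cast this)
    rwa [← Int.cast_sub] at h3
  calc _ ≤ ∑' j : ℤ, ∑ i : Fin 9, ENNReal.ofReal (decay (2 * j)) * b (j + ((i : ℤ) - 4)) :=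
        ENNReal.tsum_le_tsum fun j => by
          rw [← Finset.mul_sum]
          exact mul_le_mul_right (h1 j) _
    _ = ∑ i : Fin 9, ∑' j : ℤ, ENNReal.ofReal (decay (2 * j)) * b (j + ((i : ℤ) - 4)) :=
        Summable.tsum_finsetSum fun _ _ => ENNReal.summable
    _ ≤ ∑ _i : Fin 9, ENNReal.ofReal (2 * ker (1 / 5)) * ∑' k : ℤ,
        ENNReal.ofReal (1 / (1 + |(k : ℝ)| ^ (3 / 2 : ℝ))) * b k :=
        Finset.sum_le_sum fun i _ => h2 i
    _ = _ := by
      rw [Finset.sum_const, Finset.card_univ, Fintype.card_fin, nsmul_eq_mul, hb, mul_assoc]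
      norm_num

lemma enorm_sq_eq_sum {ι : Type*} [Fintype ι] (ξ : EuclideanSpace ℂ ι) :
    ‖ξ‖ₑ ^ 2 = ∑ i, ‖ξ i‖ₑ ^ 2 := by
  simp only [← ofReal_norm, ← ENNReal.ofReal_pow (norm_nonneg _)]
  rw [EuclideanSpace.norm_sq_eq, ENNReal.ofReal_sum_of_nonneg fun _ _ => sq_nonneg _]

/-- The half-sum of the two combinations isolates c a. Used once for the half-order derivative and
once for its Hilbert transform. -/
lemma enorm_sq_le_of_comb {c a b : ℂ} (hc : c ≠ 0) :
    ‖a‖ₑ ^ 2 ≤ ‖(2 * c)⁻¹‖ₑ ^ 2 * 2 * (‖c * a + b‖ₑ ^ 2 + ‖c * a - b‖ₑ ^ 2) := by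
  have h1 : a = (2 * c)⁻¹ * ((c * a + b) + (c * a - b)) := by field_simp; ring
  calc ‖a‖ₑ ^ 2 = ‖(2 * c)⁻¹‖ₑ ^ 2 * ‖(c * a + b) + (c * a - b)‖ₑ ^ 2 := by
        rw [← mul_pow, ← enorm_mul, ← h1]
    _ ≤ _ := by
      rw [mul_assoc]
      exact mul_le_mul_right (enorm_add_sq_le _ _) _

end Averages

/-! ### The estimate in normalized coordinates. -/

section Conclusion

variable {n : ℕ} {A : Pt n → Matrix (Fin (n + 1)) (Fin (n + 1)) ℂ} {u g h : Pt n → ℂ}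
  {G : Pt n → EuclideanSpace ℂ (Fin (n + 1))}

/-- The estimate in normalized coordinates. -/
theorem exists_normalized_reverse_holder (n : ℕ) {κ M : ℝ} (hκ : 0 < κ) (hM : 0 < M) :
    ∃ C : ℝ≥0∞, C ≠ ⊤ ∧ ∀ {A : Pt n → Matrix (Fin (n + 1)) (Fin (n + 1)) ℂ}, IsElliptic A κ M →
      ∀ {u : Pt n → ℂ} {G : Pt n → EuclideanSpace ℂ (Fin (n + 1))} {g h : Pt n → ℂ},
        IsReinforcedWeakSolution A u G g h →
        ∀ {lam : ℝ} (x : EuclideanSpace ℝ (Fin n)) (t : ℝ) {r : ℝ} (hr : 0 < r), 8 * r < lam →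
          ∫⁻ p in closedBall 0 1, (‖G (paraScale lam x t hr p)‖ₑ ^ 2 +
            (‖h (paraScale lam x t hr p)‖ₑ ^ 2 + ‖g (paraScale lam x t hr p)‖ₑ ^ 2)) ≤
          C * (∑' j : ℤ, ENNReal.ofReal (decay (2 * j)) *
            ∫⁻ p in closedBall ((0 : Space n), 2 * (j : ℝ)) 6,
              (‖G (paraScale lam x t hr p)‖ₑ + ‖h (paraScale lam x t hr p)‖ₑ +
                ‖g (paraScale lam x t hr p)‖ₑ)) ^ 2 := by
  obtain ⟨C₁, hC₁⟩ := exists_gradient_reverse_holder (coordDir (n := n)) coordFun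
    sum_coordFun_smul_coordDir hκ hM
  obtain ⟨C₂, hC₂t, hC₂⟩ := exists_fractional_reverse_holder (coordDir (n := n)) coordFun
    sum_coordFun_smul_coordDir hκ hM
  have hcc : (cosConst : ℂ) ≠ 0 := by exact_mod_cast cosConst_pos.ne'
  have hsc : (sinConst : ℂ) ≠ 0 := by exact_mod_cast sinConst_pos.ne'
  obtain ⟨N, hN⟩ : ∃ N : ℝ≥0∞, N = (n + 1 : ℕ) := ⟨_, rfl⟩
  have hNt : N ≠ ⊤ := by rw [hN]; exact ENNReal.natCast_ne_top _
  obtain ⟨B, hB⟩ : ∃ B : ℝ≥0∞, B = ‖(cosConst : ℂ)‖ₑ + ‖(sinConst : ℂ)‖ₑ := ⟨_, rfl⟩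
  have hBt : B ≠ ⊤ := by rw [hB]; simp
  obtain ⟨B', hB'⟩ : ∃ B' : ℝ≥0∞, B' = ‖(2 * (sinConst : ℂ))⁻¹‖ₑ ^ 2 * 2 +
    ‖(2 * (cosConst : ℂ))⁻¹‖ₑ ^ 2 * 2 := ⟨_, rfl⟩
  have hBt' : B' ≠ ⊤ := by
    rw [hB']
    exact ENNReal.add_ne_top.2 ⟨ENNReal.mul_ne_top (ENNReal.pow_ne_top enorm_ne_top) (by simp),
      ENNReal.mul_ne_top (ENNReal.pow_ne_top enorm_ne_top) (by simp)⟩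
  refine ⟨C₁ * N ^ 2 + B' * (2 * (C₂ * (N + B) ^ 2)), by finiteness, ?_⟩
  intro A hA u G g h hu lam x t r hr hlam
  obtain ⟨Φ, hΦ⟩ : ∃ Φ : Space n × ℝ ≃ₜ Pt n, Φ = paraScale lam x t hr :=
    ⟨_, rfl⟩
  obtain ⟨D, hD⟩ : ∃ D : Set (Space n × ℝ), D = {p | ‖p.1‖ < 8} := ⟨_, rfl⟩
  have sol := fun {σ : ℝ} (hσ : σ = 1 ∨ σ = -1) => hu.fracSol lam x t hA hr hlam hσ
  rw [← hΦ, ← hD] at sol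
  rw [← hΦ]
  obtain ⟨f, hf⟩ : ∃ f : Space n × ℝ → ℝ≥0∞,
    f = fun p => ‖G (Φ p)‖ₑ + ‖h (Φ p)‖ₑ + ‖g (Φ p)‖ₑ := ⟨_, rfl⟩
  obtain ⟨T, hT⟩ : ∃ T : ℝ≥0∞, T = ∑' j : ℤ, ENNReal.ofReal (decay (2 * j)) *
    ∫⁻ p in closedBall ((0 : Space n), 2 * (j : ℝ)) 6, f p := ⟨_, rfl⟩
  obtain ⟨R, hR⟩ : ∃ R : ℝ≥0∞, R = ‖(r : ℂ)‖ₑ := ⟨_, rfl⟩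
  have hRt : R ≠ ⊤ := by rw [hR]; exact enorm_ne_top
  have hR0 : R ≠ 0 := by
    rw [hR, enorm_ne_zero]; exact_mod_cast hr.ne'
  obtain ⟨G', hG'⟩ : ∃ G' : Fin (n + 1) → Space n × ℝ → ℂ,
    G' = fun i => D.indicator ((fun q => (r : ℂ) * G q i) ∘ Φ) := ⟨_, rfl⟩
  obtain ⟨q, hq⟩ : ∃ q : ℝ → Space n × ℝ → ℂ, q = fun σ : ℝ =>
    D.indicator ((fun q => (r : ℂ) * (cosConst * g q - σ * sinConst * h q)) ∘ Φ) := ⟨_, rfl⟩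
  have hG'le : ∀ p, ∑ i, ‖G' i p‖ₑ ≤ N * R * f p := fun p => by
    have h1 : ∀ i, ‖G' i p‖ₑ ≤ R * f p := fun i => by
      rw [hG']
      refine (enorm_indicator_le_enorm_self _ _).trans ?_
      rw [Function.comp_apply, enorm_mul, ← hR, hf]
      refine mul_le_mul_right (le_trans ?_ (le_self_add.trans le_self_add)) _
      exact enorm_le_iff_norm_le.2 (PiLp.norm_apply_le _ i)
    refine (Finset.sum_le_sum fun i _ => h1 i).trans (le_of_eq ?_)
    rw [Finset.sum_const, Finset.card_univ, Fintype.card_fin, nsmul_eq_mul, hN, mul_assoc]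
  have hqle : ∀ {σ : ℝ}, σ = 1 ∨ σ = -1 → ∀ p, ‖q σ p‖ₑ ≤ B * R * f p := fun {σ} hσ p => by
    rw [hq]
    refine (enorm_indicator_le_enorm_self _ _).trans ?_
    have hσ' : ‖(σ : ℂ)‖ₑ = 1 := by rcases hσ with rfl | rfl <;> simp
    have h1 : ‖(cosConst : ℂ) * g (Φ p) - σ * sinConst * h (Φ p)‖ₑ ≤ B * f p := by
      refine enorm_sub_le.trans ?_
      rw [enorm_mul, enorm_mul, enorm_mul, hσ', one_mul, hB, add_mul, hf]
      exact add_le_add (mul_le_mul_right le_add_self _)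
        (mul_le_mul_right ((le_add_self).trans le_self_add) _)
    rw [Function.comp_apply, enorm_mul, ← hR, mul_comm B, mul_assoc R B]
    exact mul_le_mul_right h1 _
  have hTG : gradTail G' ≤ N * R * T := by
    rw [hT, ← ENNReal.tsum_mul_left]
    refine ENNReal.tsum_le_tsum fun j => ?_
    rw [mul_left_comm, ← lintegral_const_mul' _ _ (ENNReal.mul_ne_top hNt hRt)]
    exact mul_le_mul_right (lintegral_mono hG'le) _
  have hT0 : ∫⁻ p in closedBall 0 6, f p ≤ T := by
    have h1 := ENNReal.le_tsum (f := fun j : ℤ => ENNReal.ofReal (decay (2 * j)) *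
      ∫⁻ p in closedBall ((0 : Space n), 2 * (j : ℝ)) 6, f p) 0
    have h0 : decay 0 = 1 := by simp [decay, ker]
    rw [hT]
    simpa [h0, ← Prod.zero_eq_mk] using h1
  have hTq : ∀ {σ : ℝ}, σ = 1 ∨ σ = -1 → ∫⁻ p in closedBall 0 2, ‖q σ p‖ₑ ≤ B * R * T :=
    fun {σ} hσ => by
      refine (lintegral_mono (hqle hσ)).trans ?_
      rw [lintegral_const_mul' _ _ (ENNReal.mul_ne_top hBt hRt)]
      exact mul_le_mul_right ((lintegral_mono_set (closedBall_subset_closedBall (by norm_num))).trans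
        hT0) _
  have hq2 : ∀ {σ : ℝ}, σ = 1 ∨ σ = -1 → ∫⁻ p in closedBall 0 1, ‖q σ p‖ₑ ^ 2 ≤
      R ^ 2 * (C₂ * (N + B) ^ 2 * T ^ 2) := fun {σ} hσ => by
    have h1 := sol hσ
    rw [hq]
    refine (hC₂ (by rcases hσ with rfl | rfl <;> simp) h1).trans ?_
    have h2 := hTG
    have h3 := hTq hσ
    rw [hG'] at h2
    rw [hq] at h3
    refine (mul_le_mul_right (pow_le_pow_left' (add_le_add h2 h3) 2) _).trans (le_of_eq ?_)
    ring
  have hG2 : ∫⁻ p in closedBall 0 1, ∑ i, ‖G' i p‖ₑ ^ 2 ≤ R ^ 2 * (C₁ * N ^ 2 * T ^ 2) := by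
    have h1 := (sol (Or.inl rfl)).toEllipticSol
    have h2 := hC₁ h1 0 (by
      intro p hp
      rw [mem_closedBall_zero_iff] at hp
      exact lt_of_le_of_lt ((norm_fst_le p).trans hp) (by norm_num))
    have h3 := (setLIntegral_zero_le_gradTail G').trans hTG
    rw [hG'] at h3 ⊢
    refine (lintegral_mono_set (closedBall_subset_ball (by norm_num))).trans (h2.trans
      ((mul_le_mul_right (pow_le_pow_left' h3 2) _).trans (le_of_eq ?_)))
    ring
  -- Both directions σ = 1 and σ = -1 are needed to recover g and h from the combinations q.
  have hpt : ∀ p ∈ closedBall (0 : Space n × ℝ) 1,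
      R ^ 2 * (‖G (Φ p)‖ₑ ^ 2 + (‖h (Φ p)‖ₑ ^ 2 + ‖g (Φ p)‖ₑ ^ 2)) ≤
        ∑ i, ‖G' i p‖ₑ ^ 2 + B' * (‖q 1 p‖ₑ ^ 2 + ‖q (-1) p‖ₑ ^ 2) := fun p hp => by
    have hpD : p ∈ D := by
      rw [mem_closedBall_zero_iff] at hp
      rw [hD]
      exact lt_of_le_of_lt ((norm_fst_le p).trans hp) (by norm_num)
    rw [hG', hq]
    simp only [indicator_of_mem hpD, Function.comp_apply, enorm_mul, mul_pow, ← hR]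
    rw [← Finset.mul_sum, ← enorm_sq_eq_sum, ← mul_add, mul_left_comm B', ← mul_add]
    refine mul_le_mul_right (add_le_add_right ?_ _) _
    have h1 := enorm_sq_le_of_comb (a := g (Φ p)) (b := sinConst * h (Φ p)) hcc
    have h2 := enorm_sq_le_of_comb (a := h (Φ p)) (b := cosConst * g (Φ p)) hsc
    refine (add_le_add h2 h1).trans (le_of_eq ?_)
    rw [hB', add_mul]
    have e1 : ‖(sinConst : ℂ) * h (Φ p) - cosConst * g (Φ p)‖ₑ =
        ‖(cosConst : ℂ) * g (Φ p) - ((1 : ℝ) : ℂ) * sinConst * h (Φ p)‖ₑ := by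
      rw [← enorm_neg]; congr 1; push_cast; ring
    have e2 : (sinConst : ℂ) * h (Φ p) + cosConst * g (Φ p) =
        cosConst * g (Φ p) - ((-1 : ℝ) : ℂ) * sinConst * h (Φ p) := by
      push_cast; ring
    have e3 : (cosConst : ℂ) * g (Φ p) + sinConst * h (Φ p) =
        cosConst * g (Φ p) - ((-1 : ℝ) : ℂ) * sinConst * h (Φ p) := by
      push_cast; ring
    have e4 : (cosConst : ℂ) * g (Φ p) - sinConst * h (Φ p) =
        cosConst * g (Φ p) - ((1 : ℝ) : ℂ) * sinConst * h (Φ p) := by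
      push_cast; ring
    rw [e1, e2, e3, e4]
    ring
  have hqm : ∀ {σ : ℝ}, σ = 1 ∨ σ = -1 → AEMeasurable (fun p => ‖q σ p‖ₑ ^ 2)
      (volume.restrict (closedBall 0 1)) := fun {σ} hσ => by
    have h1 := (sol hσ).memL2_frac.aestronglyMeasurable
    rw [hq]
    exact (h1.enorm.pow_const 2).restrict
  have hmain : R ^ 2 * ∫⁻ p in closedBall 0 1,
      (‖G (Φ p)‖ₑ ^ 2 + (‖h (Φ p)‖ₑ ^ 2 + ‖g (Φ p)‖ₑ ^ 2)) ≤
      R ^ 2 * ((C₁ * N ^ 2 + B' * (2 * (C₂ * (N + B) ^ 2))) * T ^ 2) := by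
    rw [← lintegral_const_mul' _ _ (ENNReal.pow_ne_top hRt)]
    refine (setLIntegral_mono' measurableSet_closedBall hpt).trans ?_
    have i1 := (hqm (Or.inl rfl)).add (hqm (Or.inr rfl))
    have i2 : AEMeasurable (fun p => B' * (‖q 1 p‖ₑ ^ 2 + ‖q (-1) p‖ₑ ^ 2))
      (volume.restrict (closedBall 0 1)) := i1.const_mul B'
    rw [lintegral_add_right' _ i2, lintegral_const_mul' _ _ hBt',
      lintegral_add_left' (hqm (Or.inl rfl))]
    refine (add_le_add hG2 (mul_le_mul_right (add_le_add (hq2 (Or.inl rfl)) (hq2 (Or.inr rfl)))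
      _)).trans (le_of_eq ?_)
    ring
  rw [hf] at hT
  rw [← hT]
  -- Every rescaled derivative carries one factor r, so both sides are homogeneous of degree two in
  -- r and the constant is independent of it.
  exact (ENNReal.mul_le_mul_iff_right (pow_ne_zero 2 hR0) (ENNReal.pow_ne_top hRt)).1 hmain

lemma paraScale_preimage_cylinder (lam : ℝ) (x : EuclideanSpace ℝ (Fin n)) (t : ℝ) {r : ℝ} (hr : 0 < r)
    (ρ : ℝ) (k : ℤ) : paraScale lam x t hr ⁻¹' parabolicCylinder lam x (ρ * r) (timeInterval t r k) =
      ball (0 : Space n) ρ ×ˢ Ioc (2 * (k : ℝ) - 1) (2 * k + 1) := by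
  ext ⟨⟨a, y⟩, s⟩
  have hr2 : 0 < r ^ 2 := by positivity
  rw [mem_preimage, paraScale_apply, parabolicCylinder, mem_prod, mem_prod, mem_prod, mem_ball_zero_iff,
    Prod.norm_mk, max_lt_iff, mem_ball, dist_eq_norm, add_sub_cancel_left, norm_smul,
    Real.norm_of_nonneg hr.le, mul_comm r ‖y‖, mul_lt_mul_iff_left₀ hr, and_assoc, Real.norm_eq_abs,
    abs_lt, timeInterval, mem_Ioc, mem_Ioc, mem_Ioo]
  refine and_congr ?_ (and_congr Iff.rfl ?_)
  · constructor <;> rintro ⟨h1, h2⟩ <;> constructor <;> nlinarith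
  · constructor <;> rintro ⟨h1, h2⟩ <;> constructor <;> nlinarith

lemma measurableSet_parabolicCylinder (lam : ℝ) (x : EuclideanSpace ℝ (Fin n)) (ρ t r : ℝ) (k : ℤ) :
    MeasurableSet (parabolicCylinder lam x ρ (timeInterval t r k)) :=
  measurableSet_Ioo.prod (measurableSet_ball.prod measurableSet_Ioc)

end Conclusion

end ParabolicRH

end

/-! ### The main theorem: return to the original cylinders. -/

open ParabolicRH
theorem theorem2p12 (n : ℕ) (hn : 1 ≤ n) (κ M : ℝ) (hκ : 0 < κ) (hM : 0 < M) :
    ∃ C : ℝ≥0, ∀ (A : Pt n → Matrix (Fin (n + 1)) (Fin (n + 1)) ℂ), IsElliptic A κ M →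
      ∀ (u : Pt n → ℂ) (G : Pt n → EuclideanSpace ℂ (Fin (n + 1))) (g h : Pt n → ℂ),
        IsReinforcedWeakSolution A u G g h →
        ∀ (lam : ℝ) (x : EuclideanSpace ℝ (Fin n)) (t r : ℝ), 0 < r → r < lam / 8 →
          (⨍⁻ p in parabolicCylinder lam x r (Ioc (t - r ^ 2) (t + r ^ 2)),
              (‖G p‖ₑ ^ 2 + ‖h p‖ₑ ^ 2 + ‖g p‖ₑ ^ 2) ∂volume) ^ (1 / 2 : ℝ) ≤
            C * ∑' k : ℤ, ENNReal.ofReal (1 / (1 + |(k : ℝ)| ^ (3 / 2 : ℝ))) *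
              ⨍⁻ p in parabolicCylinder lam x (8 * r) (timeInterval t r k),
                (‖G p‖ₑ + ‖h p‖ₑ + ‖g p‖ₑ) ∂volume := by
  obtain ⟨C, hC, hmain⟩ := exists_normalized_reverse_holder n hκ hM
  -- The volume of the rescaled cylinder of radius ρ over one time interval, whose length becomes 2.
  obtain ⟨V, hV⟩ : ∃ V : ℝ → ℝ≥0∞, V = fun ρ =>
    volume (Metric.ball (0 : Space n) ρ) * 2 := ⟨_, rfl⟩
  have hV0 : ∀ ρ, 0 < ρ → V ρ ≠ 0 := fun ρ hρ => by
    rw [hV]; exact mul_ne_zero (Metric.measure_ball_pos _ _ hρ).ne' two_ne_zero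
  have hVt : ∀ ρ, V ρ ≠ ⊤ := fun ρ => by
    rw [hV]; exact ENNReal.mul_ne_top measure_ball_lt_top.ne (by simp)
  obtain ⟨W, hW⟩ : ∃ W : ℝ≥0∞, W = 9 * ENNReal.ofReal (2 * ker (1 / 5)) := ⟨_, rfl⟩
  have hWt : W ≠ ⊤ := by rw [hW]; exact ENNReal.mul_ne_top (by simp) ENNReal.ofReal_ne_top
  have hCV : (C / V 1) ^ (1 / 2 : ℝ) ≠ ⊤ :=
    ENNReal.rpow_ne_top_of_nonneg (by norm_num) (ENNReal.div_ne_top hC (hV0 1 one_pos))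
  refine ⟨((C / V 1) ^ (1 / 2 : ℝ) * (W * V 8)).toNNReal,
    fun A hA u G g h hu lam x t r hr hlam => ?_⟩
  rw [ENNReal.coe_toNNReal (ENNReal.mul_ne_top hCV (ENNReal.mul_ne_top hWt (hVt 8)))]
  have hm := hmain hA hu x t hr (by linarith)
  have havg : ∀ (f : Pt n → ℝ≥0∞) (ρ : ℝ) (k : ℤ),
      ⨍⁻ p in parabolicCylinder lam x (ρ * r) (timeInterval t r k), f p ∂volume =
        (∫⁻ p in Metric.ball (0 : Space n) ρ ×ˢ
          Ioc (2 * (k : ℝ) - 1) (2 * k + 1), f (paraScale lam x t hr p)) / V ρ := fun f ρ k => by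
    rw [setLAverage_paraScale lam x t hr f (measurableSet_parabolicCylinder lam x (ρ * r) t r k),
      paraScale_preimage_cylinder, hV, Measure.volume_eq_prod, Measure.prod_prod, Real.volume_Ioc]
    congr 2
    rw [show 2 * (k : ℝ) + 1 - (2 * k - 1) = 2 by ring, ENNReal.ofReal_ofNat]
  obtain ⟨T, hT⟩ : ∃ T : ℝ≥0∞, T = ∑' j : ℤ, ENNReal.ofReal (decay (2 * j)) *
    ∫⁻ p in Metric.closedBall ((0 : Space n), 2 * (j : ℝ)) 6,
      (‖G (paraScale lam x t hr p)‖ₑ + ‖h (paraScale lam x t hr p)‖ₑ +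
        ‖g (paraScale lam x t hr p)‖ₑ) := ⟨_, rfl⟩
  have hI : Ioc (t - r ^ 2) (t + r ^ 2) = timeInterval t r 0 := by simp [timeInterval]
  have hleft : (⨍⁻ p in parabolicCylinder lam x r (Ioc (t - r ^ 2) (t + r ^ 2)),
      (‖G p‖ₑ ^ 2 + ‖h p‖ₑ ^ 2 + ‖g p‖ₑ ^ 2) ∂volume) ≤ C / V 1 * T ^ 2 := by
    have h1 := havg (fun p => ‖G p‖ₑ ^ 2 + ‖h p‖ₑ ^ 2 + ‖g p‖ₑ ^ 2) 1 0
    rw [one_mul, ← hI] at h1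
    rw [h1, ENNReal.mul_div_right_comm.symm, hT]
    refine ENNReal.div_le_div_right (le_trans ?_ hm) _
    simp only [add_assoc]
    refine lintegral_mono_set fun p hp => ?_
    -- The rescaled cylinder over (-1, 1] lies in the closed unit ball of the product norm.
    rw [mem_closedBall_zero_iff, Prod.norm_def, max_le_iff]
    refine ⟨(mem_ball_zero_iff.1 hp.1).le, abs_le.2 ?_⟩
    have h2 := hp.2
    simp only [Int.cast_zero, mul_zero, zero_sub, zero_add] at h2
    exact ⟨h2.1.le, h2.2⟩
  have hright : T ≤ W * V 8 * ∑' k : ℤ, ENNReal.ofReal (1 / (1 + |(k : ℝ)| ^ (3 / 2 : ℝ))) *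
      ⨍⁻ p in parabolicCylinder lam x (8 * r) (timeInterval t r k),
        (‖G p‖ₑ + ‖h p‖ₑ + ‖g p‖ₑ) ∂volume := by
    rw [hT, hW]
    refine (tsum_decay_mul_le _).trans (le_of_eq ?_)
    rw [mul_assoc _ (V 8), ← ENNReal.tsum_mul_left (a := V 8)]
    congr 1
    refine tsum_congr fun k => ?_
    rw [havg, mul_left_comm, ENNReal.mul_div_cancel (hV0 8 (by norm_num)) (hVt 8)]
  refine (ENNReal.rpow_le_rpow hleft (by norm_num)).trans ?_
  rw [ENNReal.mul_rpow_of_nonneg _ _ (by norm_num), ← ENNReal.rpow_natCast, ← ENNReal.rpow_mul,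
    show ((2 : ℕ) : ℝ) * (1 / 2) = 1 by norm_num, ENNReal.rpow_one, mul_assoc]
  exact mul_le_mul_right hright _
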